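/- **Notation.** Let $n\ge 1$, $\mathcal F f(\xi)=\int_{\mathbb R^n}e^{-2\pi i x\cdot\xi}f(x)\,dx$. Write $(-\Delta)^{r/2}$ for the operator with symbol $(2\pi|\xi|)^r$ ($r>-n$; for $-n<r<0$ it is the Riesz potential $I^{-r}$, where $I^\sigma f(x)=c_{n,\sigma}\int|x-y|^{\sigma-n}f(y)\,dy$), and $\mathcal R=(\mathcal R_1,\dots,\mathcal R_n)$ for the Riesz transforms, with symbols $i\xi_j/|\xi|$; on $L^p(\mathbb R^n,\mathbb R^n)$, $1<p<\infty$, $\mathcal R\otimes\mathcal R=(\mathcal R_i\mathcal R_j)_{ij}$ and $(-\Delta)^{r/2}$ are understood in the sense of tempered distributions. Let $H^{r,p}$ be the space of $u\in L^p(\mathbb R^n,\mathbb R^n)$ with $(-\Delta)^{r/2}u\in L^p$. For $\alpha,\Lambda>0$ let $\mathcal A(\alpha,\Lambda)$ be the class of symmetric $A:\mathbb R^n\times\mathbb R^n\to\mathbb R$ with $|A|\le\Lambda$ and $|A(z,x)-A(z,y)|\le\Lambda|x-y|^\alpha$ for all $x,y,z$, and put $A_D(z)=A(z,z)$ and $[T,b]f=T(bf)-b\,Tf$.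 For $u\in H^{s_1,p}$ and $\varphi\in C_c^\infty(\mathbb R^n,\mathbb R^n)$ put $U=(-\Delta)^{s_1/2}u$, $V=(-\Delta)^{s_2/2}\varphi$ and $$\mathcal D_2(u,\varphi)=\int_{\mathbb R^n}\big\langle[\mathcal R\otimes\mathcal R,A_D]U(z),V(z)\big\rangle\,dz .$$ With $e=\frac{x-y}{|x-y|}$, and for $s_1,s_2<1$, put $$\langle\mathcal L^s_Au,\varphi\rangle=\iint\frac{A(x,y)}{|x-y|^{n+2s}}\big((u(x)-u(y))\cdot e\big)\big((\varphi(x)-\varphi(y))\cdot e\big)\,dx\,dy,$$ $$\langle A_D\mathcal L^s_1u,\varphi\rangle=\iint\frac{1}{|x-y|^{n+2s}}\big((I^{s_1}[A_DU](x)-I^{s_1}[A_DU](y))\cdot e\big)\big((I^{s_2}V(x)-I^{s_2}V(y))\cdot e\big)\,dx\,dy$$ (differences of Riesz potentials being formed with the difference of the kernels), $\mathcal D_1(u,\varphi)=\langle\mathcal L^s_Au,\varphi\rangle-\langle A_D\mathcal L^s_1u,\varphi\rangle$, and $$\langle\bar{\mathfrak L}_{A_D}u,\varphi\rangle=\int_{\mathbb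 R^n}A_D\big\langle(c_1\mathbb I+c_2\,\mathcal R\otimes\mathcal R)U,V\big\rangle\,dz .$$ **Proposition 2.2.** Let $n\ge1$ and $s\in(0,1)$. There are real constants $c_1$ and $c_2\neq0$ (depending only on $n,s$) such that the following holds for all $s_1,s_2>0$ with $s_1+s_2=2s$ and all $\alpha,\Lambda>0$. (i) For all $1<p<\infty$, $A\in\mathcal A(\alpha,\Lambda)$, $u\in H^{s_1,p}$ and $\varphi\in C_c^\infty(\mathbb R^n,\mathbb R^n)$, the fields $\mathcal R\otimes\mathcal R\,U$ and $\mathcal R\otimes\mathcal R(A_DU)$ exist in $L^p$ and the integral $\mathcal D_2(u,\varphi)$ converges absolutely. If moreover $s_1,s_2<1$, then the integrals defining $\langle\mathcal L^s_Au,\varphi\rangle$, $\langle A_D\mathcal L^s_1u,\varphi\rangle$ and $\langle\bar{\mathfrak L}_{A_D}u,\varphi\rangle$ converge absolutely and $$\langle\mathcal L^s_Au,\varphi\rangle=\langle\bar{\mathfrak L}_{A_D}u,\varphi\rangle+\mathcal D_1(u,\varphi)+c_2\,\mathcal D_2(u,\varphi).$$ (ii) For every $\varepsilon\in(0,\alpha)$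 there is a constant $C>0$, depending only on $n,s_1,s_2,\alpha,\Lambda,\varepsilon$, such that for all $1<p<\infty$, $A\in\mathcal A(\alpha,\Lambda)$, $u\in H^{s_1,p}$ and $\varphi\in C_c^\infty(\mathbb R^n,\mathbb R^n)$ $$|\mathcal D_2(u,\varphi)|\le C\int_{\mathbb R^n}I^{\alpha-\varepsilon}\big|(-\Delta)^{\frac{s_1-\varepsilon}2}u\big|(z)\,\big|(-\Delta)^{\frac{s_2}2}\varphi\big|(z)\,dz$$ whenever $(-\Delta)^{(s_1-\varepsilon)/2}u$ exists (which is the case if $\varepsilon-s_1<n/p$, in particular if $\varepsilon\le s_1$), and $$|\mathcal D_2(u,\varphi)|\le C\int_{\mathbb R^n}I^{\alpha-\varepsilon}\big|(-\Delta)^{\frac{s_1}2}u\big|(z)\,\big|(-\Delta)^{\frac{s_2-\varepsilon}2}\varphi\big|(z)\,dz .$$ The right-hand sides may be infinite. (For $\alpha>1$ the class $\mathcal A(\alpha,\Lambda)$ contains only constants and $\mathcal D_2=0$.) -/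

import Mathlib

open MeasureTheory
open scoped ENNReal SchwartzMap FourierTransform

noncomputable section

namespace NonlocalCommutator

/-- Points of `ℝⁿ`, and also values of vector fields on `ℝⁿ`. -/
abbrev Vec (n : ℕ) := EuclideanSpace ℝ (Fin n)

/-! ### Fourier multipliers: fractional Laplacian and Riesz transforms -/

/-- The Fourier multiplier `f ↦ 𝓕⁻¹ (m · 𝓕 f)`, with `𝓕 f ξ = ∫ exp (-2πi x·ξ) f x`, acting on a
real-valued function `f`. All symbols used below satisfy `m (-ξ) = conj (m ξ)`, so that
`𝓕⁻¹ (m · 𝓕 f)` is real-valued and taking the real part only changes the type. -/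
def multiplierOp {n : ℕ} (m : Vec n → ℂ) (f : Vec n → ℝ) (x : Vec n) : ℝ :=
  (𝓕⁻ (fun ξ : Vec n => m ξ * 𝓕 (fun y : Vec n => (f y : ℂ)) ξ) x).re

/-- `(-Δ)^{r/2} f`, the multiplier with symbol `(2π|ξ|)^r`, for a rapidly decreasing `f` and
`r > -n`. For `-n < r < 0` this is the Riesz potential `I^{-r} f`. -/
def fracLap {n : ℕ} (r : ℝ) (f : Vec n → ℝ) : Vec n → ℝ :=
  multiplierOp (fun ξ => (((2 * Real.pi * ‖ξ‖) ^ r : ℝ) : ℂ)) f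

/-- `(-Δ)^{r/2} φ` for a vector field `φ`, component by component. -/
def fracLapVec {n : ℕ} (r : ℝ) (φ : Vec n → Vec n) (x : Vec n) : Vec n :=
  WithLp.toLp 2 (fun i => fracLap r (fun y => φ y i) x)

/-- The symbol `i ξⱼ / |ξ|` of the `j`-th Riesz transform `Rⱼ = ∂ⱼ (-Δ)^{-1/2}`. -/
def rieszSymbol {n : ℕ} (j : Fin n) (ξ : Vec n) : ℂ :=
  Complex.I * ((ξ j / ‖ξ‖ : ℝ) : ℂ)

/-- The second order Riesz transform `Rᵢ Rⱼ f` of a rapidly decreasing function. -/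
def rieszRiesz {n : ℕ} (i j : Fin n) (f : Vec n → ℝ) : Vec n → ℝ :=
  multiplierOp (fun ξ => rieszSymbol i ξ * rieszSymbol j ξ) f

/-- `g = (-Δ)^{r/2} u` in the sense of tempered distributions: every component satisfies
`∫ gᵢ ψ = ∫ uᵢ (-Δ)^{r/2} ψ` for all Schwartz functions `ψ`, all these integrals being
absolutely convergent. -/
def IsFracLap {n : ℕ} (r : ℝ) (u g : Vec n → Vec n) : Prop :=
  ∀ (ψ : 𝓢(Vec n, ℝ)) (i : Fin n),
    Integrable (fun x => u x i * fracLap r ψ x) ∧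
    Integrable (fun x => g x i * ψ x) ∧
    ∫ x, g x i * ψ x = ∫ x, u x i * fracLap r ψ x

/-- `g = (R ⊗ R) f` on `L^p` vector fields: `g ∈ L^p` and
`∫ gᵢ ψ = ∑ⱼ ∫ fⱼ Rᵢ Rⱼ ψ` for all Schwartz functions `ψ` (`Rᵢ Rⱼ` is its own transpose). -/
def IsRieszRiesz {n : ℕ} (p : ℝ≥0∞) (f g : Vec n → Vec n) : Prop :=
  MemLp g p volume ∧
  ∀ (ψ : 𝓢(Vec n, ℝ)) (i : Fin n),
    ∫ x, g x i * ψ x = ∑ j, ∫ x, f x j * rieszRiesz i j ψ x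

/-- `u ∈ H^{r,p}(ℝⁿ, ℝⁿ)` with `(-Δ)^{r/2} u = U`: both `u` and `U` are in `L^p`. -/
structure IsSobolevPair {n : ℕ} (r : ℝ) (p : ℝ≥0∞) (u U : Vec n → Vec n) : Prop where
  memLp : MemLp u p volume
  memLp_fracLap : MemLp U p volume
  isFracLap : IsFracLap r u U

/-! ### Riesz potentials -/

/-- The constant `c` for which `c |x|^{σ-n}` is the kernel of `I^σ = (-Δ)^{-σ/2}`, `0 < σ < n`. -/
def rieszConst (n : ℕ) (σ : ℝ) : ℝ :=
  Real.Gamma (((n : ℝ) - σ) / 2) /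
    (Real.pi ^ ((n : ℝ) / 2) * 2 ^ σ * Real.Gamma (σ / 2))

/-- `I^σ |f| (x)`, with values in `[0, ∞]`. -/
def rieszPotential {n : ℕ} (σ : ℝ) (f : Vec n → Vec n) (x : Vec n) : ℝ≥0∞ :=
  ENNReal.ofReal (rieszConst n σ) *
    ∫⁻ y, ‖f y‖ₑ * ENNReal.ofReal (‖x - y‖ ^ (σ - (n : ℝ)))

/-- `I^σ F (x) - I^σ F (y)`, written with the difference of the kernels (it converges for more
fields `F` than the two potentials do separately). -/
def rieszPotentialDiff {n : ℕ} (σ : ℝ) (F : Vec n → Vec n) (x y : Vec n) : Vec n :=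
  rieszConst n σ • ∫ z, (‖x - z‖ ^ (σ - (n : ℝ)) - ‖y - z‖ ^ (σ - (n : ℝ))) • F z

/-! ### The coefficients and the bilinear forms -/

/-- Symmetric coefficients bounded by `Λ` and uniformly `α`-Hölder with constant `Λ`. -/
structure IsCoefficient {n : ℕ} (α Λ : ℝ) (A : Vec n → Vec n → ℝ) : Prop where
  symm : ∀ x y, A x y = A y x
  bound : ∀ x y, |A x y| ≤ Λ
  holder : ∀ z x y, |A z x - A z y| ≤ Λ * ‖x - y‖ ^ α

/-- The integrand
`B(x,y) / |x-y|^{n+2s} ⟨e ⊗ e (δu(x,y)), δφ(x,y)⟩` with `e = (x-y)/|x-y|`. -/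
def bondIntegrand {n : ℕ} (s : ℝ) (B : Vec n → Vec n → ℝ) (δu δφ : Vec n → Vec n → Vec n)
    (q : Vec n × Vec n) : ℝ :=
  B q.1 q.2 / ‖q.1 - q.2‖ ^ ((n : ℝ) + 2 * s) *
    (inner ℝ (δu q.1 q.2) (‖q.1 - q.2‖⁻¹ • (q.1 - q.2)) *
      inner ℝ (δφ q.1 q.2) (‖q.1 - q.2‖⁻¹ • (q.1 - q.2)))

/-- The integrand of `⟨𝓛^s_A u, φ⟩`. -/
def integrandLA {n : ℕ} (s : ℝ) (A : Vec n → Vec n → ℝ) (u φ : Vec n → Vec n) :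
    Vec n × Vec n → ℝ :=
  bondIntegrand s A (fun x y => u x - u y) (fun x y => φ x - φ y)

/-- The integrand of `⟨A_D 𝓛^s_1 u, φ⟩`, where `U = (-Δ)^{s₁/2} u`, `V = (-Δ)^{s₂/2} φ`: here the
coefficient `A_D` multiplies `U` and the differences of `u` and `φ` are expressed through
`I^{s₁}` and `I^{s₂}`. -/
def integrandADL1 {n : ℕ} (s s₁ s₂ : ℝ) (A : Vec n → Vec n → ℝ) (U V : Vec n → Vec n) :
    Vec n × Vec n → ℝ :=
  bondIntegrand s (fun _ _ => 1) (rieszPotentialDiff s₁ (fun z => A z z • U z))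
    (rieszPotentialDiff s₂ V)

/-- `𝓓₁(u, φ) = ⟨𝓛^s_A u, φ⟩ - ⟨A_D 𝓛^s_1 u, φ⟩`. -/
def formD1 {n : ℕ} (s s₁ s₂ : ℝ) (A : Vec n → Vec n → ℝ) (u U φ V : Vec n → Vec n) : ℝ :=
  (∫ q, integrandLA s A u φ q) - ∫ q, integrandADL1 s s₁ s₂ A U V q

/-- The integrand of the weighted fractional Lamé form,
`A_D ⟨(c₁ 𝕀 + c₂ R ⊗ R) U, V⟩`, where `G = (R ⊗ R) U`. -/
def integrandLame {n : ℕ} (c₁ c₂ : ℝ) (A : Vec n → Vec n → ℝ) (U G V : Vec n → Vec n)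
    (z : Vec n) : ℝ :=
  A z z * inner ℝ (c₁ • U z + c₂ • G z) (V z)

/-- The integrand of `𝓓₂(u, φ)`, that is `⟨[R ⊗ R, A_D] U, V⟩`, where `H = (R ⊗ R) (A_D U)` and
`G = (R ⊗ R) U`. -/
def integrandD2 {n : ℕ} (A : Vec n → Vec n → ℝ) (H G V : Vec n → Vec n) (z : Vec n) : ℝ :=
  inner ℝ (H z - A z z • G z) (V z)

end NonlocalCommutator

end

open NonlocalCommutator

/-!
Everything rests on the heat kernel `p_t = heat t`, through which multipliers are written as
convolutions: `(2π|ξ|)^{-σ}` is `Γ(σ/2)⁻¹ ∫ t^{σ/2-1} e^{-4π²t|ξ|²} dt`, and `Rᵢ Rⱼ` is convolution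
with `∫ ∂ᵢ∂ⱼ p_t dt`, both integrals being over all scales `t > 0`.

**Second order Riesz transforms on `L^p`.** The truncated kernels `∫_b^c ∂ᵢ∂ⱼ p_t dt`
(`hessKernel`) are bounded on `L^p` uniformly in `b, c`. By the semigroup law the pairing of their
convolution with `g` is a space-time integral of products of gradients of heat extensions. Such an
integral is bounded by the decrease, along the heat flow of the pair `(f, g)`, of the integral of
a convex Bellman function (`integral_gradients_le`, `abs_convPairing_le`,
`eLpNorm_conv_hessKernel_le`). No singular integral theory is needed: the truncations converge in
`L^p` (`exists_tendsto_rieszTrunc`), and the limit is `R ⊗ R` (`exists_isRieszRiesz`).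

**The commutator estimates.** By the same truncation `[R ⊗ R, A_D] U` is a limit of integrals
against `∂ᵢ∂ⱼ p_t (x - y) (a y - a x)` with `a = A_D`. The field carrying the derivative of order
`s` is recovered from `w = (-Δ)^{(s-ε)/2} u` by
`e^{δΔ} (-Δ)^{s/2} u = Γ(1-ε/2)⁻¹ ∫ τ^{-ε/2} (-Δ) e^{(δ+τ)Δ} w dτ`, so one has to bound the kernel
`∫ ∂ᵢ∂ⱼ p_t (x - y) (a y - a x) Δp_σ (y - z) dy`. Hölder continuity of `a` gains a factor
`min(t, σ)^{α/2}`, directly if `t ≤ σ`, and after replacing `a x` by `a z` if `σ < t`. This is the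
bound by `commMajorant` (`exists_abs_commKernel_le`), whose integral over both scales is a multiple
of `|x - z|^{α-ε-n}`, the kernel of `I^{α-ε}` (`exists_lintegral_lintegral_commMajorant_le`). This
yields `exists_enorm_integral_commConv_le` and, as `R ⊗ R` is symmetric, both estimates in
`exists_formD2_le`. If `α > 1` the diagonal of `A` is constant and the commutator vanishes.

**The decomposition.** The bond form has the Fourier symbol
`∫ hᵢhⱼ |h|^{-n-2s-2} |1 - e^{2πih·ξ}|² dh = (a δᵢⱼ + b ξᵢξⱼ/|ξ|²) (2π|ξ|)^{2s}` with explicit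
`a = symbolConst` and `b = symbolConst' > 0` (`integral_bondWeight_mul_gap`). Differences of Riesz
potentials are convolutions with the integrable kernels `rieszDiff`; applying the symbol to `A_D U`
turns `⟨A_D 𝓛₁ u, φ⟩` into `a ∫ A_D U·V - b ∫ A_D U·(R ⊗ R V)`, as `Rᵢ Rⱼ` has the symbol
`-ξᵢξⱼ/|ξ|²`. Moving `R ⊗ R` onto `A_D U` (`IsRieszRiesz.sum_integral_mul_fracLap`) and writing
`R ⊗ R (A_D U) = A_D (R ⊗ R U) + [R ⊗ R, A_D] U` gives the decomposition with `c₁ = a` and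
`c₂ = -b` (`nonlocal_decomposition`).
-/

open MeasureTheory
open scoped ENNReal SchwartzMap FourierTransform
open NonlocalCommutator

noncomputable section

namespace NonlocalCommutator

open Filter Topology
open ENNReal (ofReal ofReal_mul HolderConjugate ofReal_le_ofReal ofReal_ne_top mul_lt_top toReal_one
  conjExponent one_ne_top toReal_lt_toReal rpow_one)
open Set (Ioi Ioc)
open EuclideanSpace (single)
open Real (norm_of_nonneg Gamma rpow_add norm_eq_abs mul_rpow rpow_neg rpow_mul exp)
open Finset (sum_congr mul_sum sum_mul)
open intervalIntegral (integral_of_le)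
open scoped Real

variable {n : ℕ} {k f g : Vec n → ℝ} {P Q p q : ℝ≥0∞} {a b r s t σ Λ C : ℝ} {ξ : Vec n}
  {u U V G H : Vec n → Vec n} {A : Vec n → Vec n → ℝ} {m : Vec n → ℂ}

section

/-! ### The heat kernel -/

/-- The heat kernel `p_t` on `ℝⁿ`, the kernel of `e^{tΔ}`. -/
def heat (t : ℝ) (x : Vec n) : ℝ := (4 * π * t) ^ (-(n : ℝ) / 2) * exp (-(‖x‖ ^ 2 / (4 * t)))

/-- The partial derivative `∂ᵢ p_t`. -/
def heatGrad (i : Fin n) (t : ℝ) (x : Vec n) : ℝ := -(x i / (2 * t)) * heat t x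

/-- The second derivative `∂ᵢ∂ⱼ p_t`, the kernel of `∂ᵢ∂ⱼ e^{tΔ}`. -/
def heatHess (i j : Fin n) (t : ℝ) (x : Vec n) : ℝ :=
  (x i * x j / (4 * t ^ 2) - (if i = j then 1 else 0) / (2 * t)) * heat t x

/-- The Laplacian `Δ p_t = ∂_t p_t`. -/
def heatLap (t : ℝ) (x : Vec n) : ℝ := ∑ k, heatHess k k t x

lemma integral_congr_all {α E : Type*} [MeasurableSpace α] {μ : Measure α} [NormedAddCommGroup E]
    [NormedSpace ℝ E] {f g : α → E} (h : ∀ x, f x = g x) : ∫ x, f x ∂μ = ∫ x, g x ∂μ :=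
  integral_congr_ae (ae_of_all _ h)

lemma heat_pos (ht : 0 < t) (x : Vec n) : 0 < heat t x := by unfold heat; positivity

lemma heat_neg (t : ℝ) (x : Vec n) : heat t (-x) = heat t x := by simp [heat]

lemma heat_sub_comm (t : ℝ) (x y : Vec n) : heat t (x - y) = heat t (y - x) := by
  rw [← heat_neg, neg_sub]

lemma heatGrad_neg (i : Fin n) (t : ℝ) (x : Vec n) : heatGrad i t (-x) = -heatGrad i t x := by
  simp [heatGrad, heat_neg, neg_div]

lemma heatHess_neg (i j : Fin n) (t : ℝ) (x : Vec n) : heatHess i j t (-x) = heatHess i j t x := by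
  simp [heatHess, heat_neg]

@[fun_prop]
lemma continuous_heat (t : ℝ) : Continuous (heat t : Vec n → ℝ) := by unfold heat; fun_prop

@[fun_prop]
lemma measurable_heat_uncurry : Measurable (fun q : ℝ × Vec n => heat q.1 q.2) := by
  unfold heat; fun_prop

@[fun_prop]
lemma measurable_heatGrad_uncurry (i : Fin n) :
    Measurable (fun q : ℝ × Vec n => heatGrad i q.1 q.2) := by
  unfold heatGrad; fun_prop

@[fun_prop]
lemma measurable_heatHess_uncurry (i j : Fin n) :
    Measurable (fun q : ℝ × Vec n => heatHess i j q.1 q.2) := by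
  unfold heatHess; fun_prop

@[fun_prop]
lemma measurable_heatLap_uncurry : Measurable (fun q : ℝ × Vec n => heatLap q.1 q.2) := by
  unfold heatLap; fun_prop

@[fun_prop]
lemma continuous_heatGrad (i : Fin n) (t : ℝ) : Continuous (heatGrad i t : Vec n → ℝ) := by
  unfold heatGrad; fun_prop

@[fun_prop]
lemma continuous_heatHess (i j : Fin n) (t : ℝ) : Continuous (heatHess i j t : Vec n → ℝ) := by
  unfold heatHess; fun_prop

@[fun_prop]
lemma continuous_heatLap (t : ℝ) : Continuous (heatLap t : Vec n → ℝ) := by unfold heatLap; fun_prop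

lemma integrable_exp_neg_mul_sq (hb : 0 < b) :
    Integrable (fun x : Vec n => exp (-b * ‖x‖ ^ 2)) := by
  have h := GaussianFourier.integrable_cexp_neg_mul_sq_norm_add (V := Vec n)
    (b := (b : ℂ)) (by simpa using hb) 0 0
  refine (h.re).congr (ae_of_all _ fun x => ?_)
  simp only [zero_mul, add_zero]
  rw [show (-(b : ℂ) * (‖x‖ : ℂ) ^ 2) = ((-b * ‖x‖ ^ 2 : ℝ) : ℂ) by push_cast; ring]
  exact Complex.exp_ofReal_re (-b * ‖x‖ ^ 2)

lemma heat_eq : (heat t : Vec n → ℝ) = fun x =>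
    (4 * π * t) ^ (-(n : ℝ) / 2) * exp (-(1 / (4 * t)) * ‖x‖ ^ 2) := by
  funext x; unfold heat; congr 2; ring

lemma integrable_heat (ht : 0 < t) : Integrable (heat t : Vec n → ℝ) := by
  rw [heat_eq]
  exact (integrable_exp_neg_mul_sq (by positivity)).const_mul _

lemma integral_heat (ht : 0 < t) : ∫ x : Vec n, heat t x = 1 := by
  rw [heat_eq, integral_const_mul, GaussianFourier.integral_rexp_neg_mul_sq_norm (by positivity)]
  rw [finrank_euclideanSpace_fin, neg_div, rpow_neg (by positivity)]
  rw [show π / (1 / (4 * t)) = 4 * π * t by field_simp]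
  exact inv_mul_cancel₀ (by positivity)

lemma heat_le_const (ht : 0 < t) (x : Vec n) : heat t x ≤ (4 * π * t) ^ (-(n : ℝ) / 2) := by
  have : exp (-(‖x‖ ^ 2 / (4 * t))) ≤ 1 := Real.exp_le_one_iff.2 (by
    have : 0 ≤ ‖x‖ ^ 2 / (4 * t) := by positivity
    linarith)
  exact mul_le_of_le_one_right (by positivity) this

lemma heat_le_mul {c : ℝ} (hs : 0 < s) (hst : s ≤ t) (htc : t ≤ c * s) (x : Vec n) :
    heat s x ≤ c ^ ((n : ℝ) / 2) * heat t x := by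
  have ht : 0 < t := hs.trans_le hst
  have hc : 0 < c := by
    by_contra h
    push Not at h
    nlinarith
  unfold heat
  have h1 : exp (-(‖x‖ ^ 2 / (4 * s))) ≤ exp (-(‖x‖ ^ 2 / (4 * t))) := by
    apply Real.exp_le_exp.2
    gcongr
  have h2 : (4 * π * s) ^ (-(n : ℝ) / 2) ≤ c ^ ((n : ℝ) / 2) * (4 * π * t) ^ (-(n : ℝ) / 2) := by
    rw [neg_div, rpow_neg (by positivity), rpow_neg (by positivity), ← div_eq_mul_inv,
      le_div_iff₀ (by positivity), inv_mul_le_iff₀ (by positivity), ← mul_rpow (by positivity)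
      (by positivity)]
    apply Real.rpow_le_rpow (by positivity) _ (by positivity)
    calc 4 * π * t ≤ 4 * π * (c * s) := by gcongr
      _ = _ := by ring
  calc _ ≤ (c ^ ((n : ℝ) / 2) * (4 * π * t) ^ (-(n : ℝ) / 2)) *
        exp (-(‖x‖ ^ 2 / (4 * t))) := by gcongr
    _ = _ := by ring

lemma rpow_le_mul_exp (ha : 0 ≤ a) : ∃ C : ℝ, 0 < C ∧ ∀ y : ℝ, 0 ≤ y → y ^ a ≤ C * exp (y / 8) := by
  rcases ha.eq_or_lt with rfl | ha
  · refine ⟨1, one_pos, fun y hy => ?_⟩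
    simpa using div_nonneg hy (by norm_num : (0 : ℝ) ≤ 8)
  · refine ⟨(8 * a) ^ a, by positivity, fun y hy => ?_⟩
    have h1 : y / (8 * a) ≤ exp (y / (8 * a)) := by linarith [Real.add_one_le_exp (y / (8 * a))]
    calc y ^ a = (8 * a) ^ a * (y / (8 * a)) ^ a := by
          rw [← mul_rpow (by positivity) (by positivity)]
          congr 1; field_simp
      _ ≤ (8 * a) ^ a * (exp (y / (8 * a))) ^ a := by gcongr
      _ = _ := by
          rw [← Real.exp_mul]
          congr 2; field_simp

/-- Powers of `|x|` cost powers of `√t` and a doubling of the time. -/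
lemma rpow_norm_mul_heat_le (n : ℕ) {m : ℝ} (hm : 0 ≤ m) :
    ∃ C : ℝ, 0 < C ∧ ∀ t : ℝ, 0 < t → ∀ x : Vec n,
      ‖x‖ ^ m * heat t x ≤ C * t ^ (m / 2) * heat (2 * t) x := by
  obtain ⟨C, hC, h⟩ := rpow_le_mul_exp (a := m / 2) (by positivity)
  refine ⟨C * 2 ^ ((n : ℝ) / 2), by positivity, fun t ht x => ?_⟩
  have h1 := h (‖x‖ ^ 2 / t) (by positivity)
  have h2 : heat t x = 2 ^ ((n : ℝ) / 2) * heat (2 * t) x * exp (-(‖x‖ ^ 2 / t / 8)) := by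
    unfold heat
    rw [show 4 * π * (2 * t) = 2 * (4 * π * t) by ring,
      mul_rpow (x := 2) (by positivity) (by positivity), neg_div,
      rpow_neg (x := 2) (by positivity)]
    have e : exp (-(‖x‖ ^ 2 / (4 * t))) = exp (-(‖x‖ ^ 2 / (4 * (2 * t)))) *
        exp (-(‖x‖ ^ 2 / t / 8)) := by
      rw [← Real.exp_add]; congr 1; field_simp; ring
    rw [e]; field_simp
  have h3 : ‖x‖ ^ m = t ^ (m / 2) * (‖x‖ ^ 2 / t) ^ (m / 2) := by
    rw [← mul_rpow (by positivity) (by positivity), mul_div_cancel₀ _ ht.ne',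
      ← Real.rpow_natCast, ← rpow_mul (by positivity)]
    congr 1; push_cast; ring
  have hpos := heat_pos (t := 2 * t) (by positivity) x
  calc ‖x‖ ^ m * heat t x = t ^ (m / 2) * (‖x‖ ^ 2 / t) ^ (m / 2) *
        (2 ^ ((n : ℝ) / 2) * heat (2 * t) x * exp (-(‖x‖ ^ 2 / t / 8))) := by rw [h3, h2]
    _ ≤ t ^ (m / 2) * (C * exp (‖x‖ ^ 2 / t / 8)) *
        (2 ^ ((n : ℝ) / 2) * heat (2 * t) x * exp (-(‖x‖ ^ 2 / t / 8))) := by gcongr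
    _ = C * 2 ^ ((n : ℝ) / 2) * t ^ (m / 2) * heat (2 * t) x *
        (exp (‖x‖ ^ 2 / t / 8) * exp (-(‖x‖ ^ 2 / t / 8))) := by ring
    _ = _ := by rw [← Real.exp_add]; simp

lemma abs_coord_le_norm (x : Vec n) (i : Fin n) : |x i| ≤ ‖x‖ := by
  simpa using PiLp.norm_apply_le x i

lemma abs_heatHess_le_sq (ht : 0 < t) (i j : Fin n) (x : Vec n) :
    |heatHess i j t x| ≤ (‖x‖ ^ 2 / (4 * t ^ 2) + 1 / (2 * t)) * heat t x := by
  unfold heatHess; rw [abs_mul, abs_of_pos (heat_pos ht x)]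
  apply mul_le_mul_of_nonneg_right _ (heat_pos ht x).le
  have h1 : |x i * x j| ≤ ‖x‖ ^ 2 := by
    rw [abs_mul, sq]
    exact mul_le_mul (abs_coord_le_norm x i) (abs_coord_le_norm x j) (abs_nonneg _) (norm_nonneg _)
  calc _ ≤ |x i * x j / (4 * t ^ 2)| + |(if i = j then 1 else 0) / (2 * t)| := abs_sub _ _
    _ ≤ _ := by
      rw [abs_div, abs_div, abs_of_pos (by positivity : 0 < 4 * t ^ 2),
        abs_of_pos (by positivity : 0 < 2 * t)]
      gcongr
      split_ifs <;> simp

lemma rpow_norm_mul_heatHess_le (n : ℕ) {m : ℝ} (hm : 0 ≤ m) :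
    ∃ C : ℝ, 0 < C ∧ ∀ t : ℝ, 0 < t → ∀ (i j : Fin n) (x : Vec n),
      ‖x‖ ^ m * |heatHess i j t x| ≤ C * t ^ (m / 2 - 1) * heat (2 * t) x := by
  obtain ⟨C₁, hC₁, h₁⟩ := rpow_norm_mul_heat_le n hm
  obtain ⟨C₂, hC₂, h₂⟩ := rpow_norm_mul_heat_le n (m := m + 2) (by positivity)
  refine ⟨C₁ + C₂, by positivity, fun t ht i j x => ?_⟩
  have hp := heat_pos (t := 2 * t) (by positivity) x
  have e1 : t ^ (m / 2) = t ^ (m / 2 - 1) * t := by rw [Real.rpow_sub_one ht.ne']; field_simp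
  have e2 : t ^ ((m + 2) / 2) = t ^ (m / 2 - 1) * t ^ 2 := by
    rw [show (m + 2) / 2 = (m / 2 - 1) + (2 : ℕ) by push_cast; ring, Real.rpow_add_natCast ht.ne']
  have e3 : ‖x‖ ^ (m + 2) = ‖x‖ ^ m * ‖x‖ ^ 2 := by
    rw [Real.rpow_add_of_nonneg (norm_nonneg _) hm (by norm_num)]; norm_cast
  have a1 := h₁ t ht x
  have a2 := h₂ t ht x
  rw [e1] at a1; rw [e2, e3] at a2
  calc ‖x‖ ^ m * |heatHess i j t x|
      ≤ ‖x‖ ^ m * ((‖x‖ ^ 2 / (4 * t ^ 2) + 1 / (2 * t)) * heat t x) := by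
        gcongr; exact abs_heatHess_le_sq ht i j x
    _ = (‖x‖ ^ m * ‖x‖ ^ 2 * heat t x) / (4 * t ^ 2) + (‖x‖ ^ m * heat t x) / (2 * t) := by ring
    _ ≤ (C₂ * (t ^ (m / 2 - 1) * t ^ 2) * heat (2 * t) x) / (4 * t ^ 2) +
        (C₁ * (t ^ (m / 2 - 1) * t) * heat (2 * t) x) / (2 * t) := by gcongr
    _ = (C₂ / 4 + C₁ / 2) * (t ^ (m / 2 - 1) * heat (2 * t) x) := by field_simp
    _ ≤ (C₁ + C₂) * (t ^ (m / 2 - 1) * heat (2 * t) x) := by gcongr ?_ * _; linarith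
    _ = _ := by ring

lemma abs_heatHess_le (n : ℕ) : ∃ C : ℝ, 0 < C ∧ ∀ t : ℝ, 0 < t → ∀ (i j : Fin n) (x : Vec n),
    |heatHess i j t x| ≤ C * t⁻¹ * heat (2 * t) x := by
  obtain ⟨C, hC, h⟩ := rpow_norm_mul_heatHess_le n le_rfl
  refine ⟨C, hC, fun t ht i j x => ?_⟩
  simpa [Real.rpow_neg_one] using h t ht i j x

lemma rpow_norm_mul_heatLap_le (n : ℕ) {m : ℝ} (hm : 0 ≤ m) :
    ∃ C : ℝ, 0 < C ∧ ∀ t : ℝ, 0 < t → ∀ x : Vec n,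
      ‖x‖ ^ m * |heatLap t x| ≤ C * t ^ (m / 2 - 1) * heat (2 * t) x := by
  obtain ⟨C, hC, h⟩ := rpow_norm_mul_heatHess_le n hm
  refine ⟨(n + 1) * C, by positivity, fun t ht x => ?_⟩
  have hp := heat_pos (t := 2 * t) (by positivity) x
  calc ‖x‖ ^ m * |heatLap t x| ≤ ‖x‖ ^ m * ∑ k, |heatHess k k t x| := by
        gcongr; exact Finset.abs_sum_le_sum_abs _ _
    _ = ∑ k, ‖x‖ ^ m * |heatHess k k t x| := by rw [mul_sum]
    _ ≤ ∑ _k : Fin n, C * t ^ (m / 2 - 1) * heat (2 * t) x :=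
        Finset.sum_le_sum fun k _ => h t ht k k x
    _ = n * C * t ^ (m / 2 - 1) * heat (2 * t) x := by
        simp only [Finset.sum_const, Finset.card_univ, Fintype.card_fin]; ring
    _ ≤ _ := by gcongr; linarith

lemma abs_heatLap_le (n : ℕ) : ∃ C : ℝ, 0 < C ∧ ∀ t : ℝ, 0 < t → ∀ x : Vec n,
    |heatLap t x| ≤ C * t⁻¹ * heat (2 * t) x := by
  obtain ⟨C, hC, h⟩ := rpow_norm_mul_heatLap_le n le_rfl
  refine ⟨C, hC, fun t ht x => ?_⟩
  simpa [Real.rpow_neg_one] using h t ht x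

lemma abs_heatGrad_le (n : ℕ) : ∃ C : ℝ, 0 < C ∧ ∀ t : ℝ, 0 < t → ∀ (i : Fin n) (x : Vec n),
    |heatGrad i t x| ≤ C * t ^ (-(1 / 2) : ℝ) * heat (2 * t) x := by
  obtain ⟨C, hC, h⟩ := rpow_norm_mul_heat_le n zero_le_one
  refine ⟨C, hC, fun t ht i x => ?_⟩
  have hp := heat_pos (t := 2 * t) (by positivity) x
  have h1 := h t ht x
  rw [Real.rpow_one] at h1
  have e : t ^ (-(1 / 2) : ℝ) = t ^ (1 / 2 : ℝ) / t := by
    rw [eq_div_iff ht.ne', ← Real.rpow_add_one ht.ne']; norm_num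
  unfold heatGrad
  rw [abs_mul, abs_neg, abs_div, abs_of_pos (heat_pos ht x), abs_of_pos (by positivity : 0 < 2 * t)]
  calc |x i| / (2 * t) * heat t x ≤ ‖x‖ / (2 * t) * heat t x := by
        gcongr
        · exact (heat_pos ht x).le
        · exact abs_coord_le_norm x i
    _ = (‖x‖ * heat t x) / (2 * t) := by ring
    _ ≤ (C * t ^ (1 / 2 : ℝ) * heat (2 * t) x) / (2 * t) := by gcongr
    _ = (C * t ^ (-(1 / 2) : ℝ) * heat (2 * t) x) / 2 := by rw [e]; field_simp
    _ ≤ _ := half_le_self (by positivity)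

lemma integrable_heatGrad (ht : 0 < t) (i : Fin n) : Integrable (heatGrad i t : Vec n → ℝ) := by
  obtain ⟨C, hC, h⟩ := abs_heatGrad_le n
  exact ((integrable_heat (n := n) (t := 2 * t) (by positivity)).const_mul _).mono'
    (by fun_prop) (ae_of_all _ fun x => h t ht i x)

lemma integrable_heatHess (ht : 0 < t) (i j : Fin n) : Integrable (heatHess i j t : Vec n → ℝ) := by
  obtain ⟨C, hC, h⟩ := abs_heatHess_le n
  exact ((integrable_heat (n := n) (t := 2 * t) (by positivity)).const_mul _).mono'
    (by fun_prop) (ae_of_all _ fun x => h t ht i j x)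

lemma integrable_heatLap (ht : 0 < t) : Integrable (heatLap t : Vec n → ℝ) :=
  integrable_finsetSum _ fun k _ => integrable_heatHess ht k k

lemma integral_abs_heatHess_le (n : ℕ) : ∃ C : ℝ, 0 < C ∧ ∀ t : ℝ, 0 < t → ∀ (i j : Fin n),
    ∫ x : Vec n, |heatHess i j t x| ≤ C * t⁻¹ := by
  obtain ⟨C, hC, h⟩ := abs_heatHess_le n
  refine ⟨C, hC, fun t ht i j => ?_⟩
  calc _ ≤ ∫ x : Vec n, C * t⁻¹ * heat (2 * t) x := by
        refine integral_mono (integrable_heatHess ht i j).abs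
          ((integrable_heat (by positivity)).const_mul _) fun x => h t ht i j x
    _ = _ := by rw [integral_const_mul, integral_heat (by positivity), mul_one]

/-- The Chapman-Kolmogorov identity `p_s * p_t = p_{s+t}`, by completing the square. -/
lemma integral_heat_mul_heat (hs : 0 < s) (ht : 0 < t) (x : Vec n) :
    ∫ y, heat s (x - y) * heat t y = heat (s + t) x := by
  have key : ∀ y : Vec n, heat s (x - y) * heat t y = heat (s + t) x *
      heat (s * t / (s + t)) (y - (t / (s + t)) • x) := by
    intro y; unfold heat
    have hst : (0 : ℝ) < s + t := by positivity
    have e1 : -(‖x - y‖ ^ 2 / (4 * s)) + -(‖y‖ ^ 2 / (4 * t)) = -(‖x‖ ^ 2 / (4 * (s + t))) +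
        -(‖y - (t / (s + t)) • x‖ ^ 2 / (4 * (s * t / (s + t)))) := by
      rw [norm_sub_sq_real, norm_sub_sq_real, inner_smul_right, norm_smul, mul_pow,
        norm_eq_abs, sq_abs, real_inner_comm]
      field_simp; ring
    have e2 : (4 * π * s) ^ (-(n : ℝ) / 2) * (4 * π * t) ^ (-(n : ℝ) / 2) =
        (4 * π * (s + t)) ^ (-(n : ℝ) / 2) * (4 * π * (s * t / (s + t))) ^ (-(n : ℝ) / 2) := by
      rw [← mul_rpow (by positivity) (by positivity), ← mul_rpow (by positivity) (by positivity)]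
      congr 1; field_simp
    calc _ = ((4 * π * s) ^ (-(n : ℝ) / 2) * (4 * π * t) ^ (-(n : ℝ) / 2)) *
          exp (-(‖x - y‖ ^ 2 / (4 * s)) + -(‖y‖ ^ 2 / (4 * t))) := by rw [Real.exp_add]; ring
      _ = _ := by rw [e1, e2, Real.exp_add]; ring
  simp_rw [key]
  rw [integral_const_mul, integral_sub_right_eq_self (fun y => heat (s * t / (s + t)) y),
    integral_heat (by positivity), mul_one]

lemma hasDerivAt_heat_line (k : Fin n) (x : Vec n) (s : ℝ) :
    HasDerivAt (fun s : ℝ => heat t (x + s • single k (1 : ℝ)))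
      (heatGrad k t (x + s • single k (1 : ℝ))) s := by
  unfold heatGrad heat
  have h1 : HasDerivAt (fun s : ℝ => x + s • single k (1 : ℝ)) (single k (1 : ℝ)) s := by
    simpa using ((hasDerivAt_id s).smul_const (single k (1 : ℝ))).const_add x
  have h2 := h1.norm_sq
  have h3 := ((h2.div_const (4 * t)).neg.exp).const_mul ((4 * π * t) ^ (-(n : ℝ) / 2))
  refine h3.congr_deriv ?_
  rw [EuclideanSpace.inner_single_right]; simp; ring

lemma hasDerivAt_coord_line (i k : Fin n) (x : Vec n) (s : ℝ) :
    HasDerivAt (fun s : ℝ => (x + s • single k (1 : ℝ)) i) (if i = k then 1 else 0) s := by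
  simp only [PiLp.add_apply, PiLp.smul_apply, PiLp.single_apply, smul_eq_mul]
  simpa using ((hasDerivAt_id s).mul_const (if i = k then (1 : ℝ) else 0)).const_add (x i)

lemma hasDerivAt_heatGrad_line (i k : Fin n) (x : Vec n) (s : ℝ) :
    HasDerivAt (fun s : ℝ => heatGrad i t (x + s • single k (1 : ℝ)))
      (heatHess i k t (x + s • single k (1 : ℝ))) s := by
  unfold heatHess
  have h := ((hasDerivAt_coord_line i k x s).div_const (2 * t)).neg.mul
    (hasDerivAt_heat_line (t := t) k x s)
  refine h.congr_deriv ?_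
  simp only [Pi.neg_apply, heatGrad]
  rcases eq_or_ne t 0 with rfl | ht
  · simp
  · field_simp; ring

/-- The heat equation `∂_t p_t = Δ p_t`. -/
lemma hasDerivAt_heat_time (ht : 0 < t) (x : Vec n) :
    HasDerivAt (fun t : ℝ => heat t x) (heatLap t x) t := by
  unfold heat
  have h1 : HasDerivAt (fun t : ℝ => 4 * π * t) (4 * π) t := by
    simpa using (hasDerivAt_id t).const_mul (4 * π)
  have h2 := h1.rpow_const (p := -(n : ℝ) / 2) (Or.inl (by positivity))
  have h3 : HasDerivAt (fun t : ℝ => -(‖x‖ ^ 2 / (4 * t))) (‖x‖ ^ 2 / (4 * t ^ 2)) t := by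
    have := ((hasDerivAt_inv ht.ne').const_mul (-(‖x‖ ^ 2 / 4)))
    refine (this.congr_deriv (by field_simp)).congr_of_eventuallyEq (.of_forall fun s => ?_)
    simp only [mul_inv, div_eq_mul_inv]; ring
  have h4 := h2.mul h3.exp
  refine h4.congr_deriv ?_
  have e : ∑ k : Fin n, x k * x k = ‖x‖ ^ 2 := by rw [EuclideanSpace.norm_sq_eq]; simp [sq]
  simp only [heatLap, heatHess, ← sum_mul]; rw [Finset.sum_sub_distrib, ← Finset.sum_div, e]
  simp only [if_true, Finset.sum_const, Finset.card_univ, Fintype.card_fin, nsmul_eq_mul]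
  rw [Real.rpow_sub_one (by positivity)]; unfold heat; field_simp
  ring

end

section

/-! ### Convolutions on Lebesgue spaces -/

/-- Convolution `(k * f)(x) = ∫ k (x - y) f y dy`. -/
def conv (k f : Vec n → ℝ) (x : Vec n) : ℝ := ∫ y, k (x - y) * f y

lemma aestronglyMeasurable_comp_sub (hk : AEStronglyMeasurable k) :
    AEStronglyMeasurable (fun q : Vec n × Vec n => k (q.1 - q.2)) :=
  hk.comp_quasiMeasurePreserving (quasiMeasurePreserving_sub volume volume)

lemma aestronglyMeasurable_kernel (hk : AEStronglyMeasurable k) (hf : AEStronglyMeasurable f) :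
    AEStronglyMeasurable (fun q : Vec n × Vec n => k (q.1 - q.2) * f q.2) :=
  (aestronglyMeasurable_comp_sub hk).mul hf.comp_snd

lemma integrable_comp_sub_left (hk : Integrable k) (x : Vec n) :
    Integrable (fun y => k (x - y)) := hk.comp_sub_left x

lemma one_le_toReal (hp : 1 ≤ p) (hpt : p ≠ ∞) : 1 ≤ p.toReal := by
  simpa using ENNReal.toReal_mono hpt hp

lemma one_lt_toReal (hp : 1 < p) (hpt : p ≠ ∞) : 1 < p.toReal := by
  simpa using (toReal_lt_toReal one_ne_top hpt).2 hp

lemma aestronglyMeasurable_sub_left (hk : AEStronglyMeasurable k) (x : Vec n) :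
    AEStronglyMeasurable fun y => k (x - y) :=
  hk.comp_quasiMeasurePreserving (quasiMeasurePreserving_sub_left volume x)

/-- Jensen's inequality for the measure `k dμ`. -/
lemma lintegral_mul_rpow_le {α : Type*} [MeasurableSpace α] {μ : Measure α} {k f : α → ℝ≥0∞}
    (hk : AEMeasurable k μ) (hf : AEMeasurable f μ) (hr : 1 ≤ r) :
    (∫⁻ y, k y * f y ∂μ) ^ r ≤ (∫⁻ y, k y ∂μ) ^ (r - 1) * ∫⁻ y, k y * f y ^ r ∂μ := by
  have hr0 := zero_lt_one.trans_le hr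
  have h := eLpNorm'_le_eLpNorm'_mul_rpow_measure_univ one_pos hr
    (hf.mono_ac (withDensity_absolutelyContinuous μ k)).aestronglyMeasurable
  simp only [eLpNorm', enorm_eq_self, rpow_one, div_one, withDensity_apply _ .univ,
    setLIntegral_univ, lintegral_withDensity_eq_lintegral_mul₀ hk hf,
    lintegral_withDensity_eq_lintegral_mul₀ hk (hf.pow_const r), Pi.mul_apply] at h
  refine (ENNReal.rpow_le_rpow h hr0.le).trans_eq ?_
  rw [ENNReal.mul_rpow_of_nonneg _ _ hr0.le, ← ENNReal.rpow_mul, ← ENNReal.rpow_mul, sub_mul,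
    one_div_mul_cancel hr0.ne', one_mul, rpow_one, mul_comm]

lemma lintegral_young (hk : AEStronglyMeasurable k) (hf : AEStronglyMeasurable f) (hr : 1 ≤ r) :
    ∫⁻ x, (∫⁻ y, ‖k (x - y)‖ₑ * ‖f y‖ₑ) ^ r ≤ (∫⁻ y, ‖k y‖ₑ) ^ r * ∫⁻ y, ‖f y‖ₑ ^ r := by
  have h0 : ∀ x, ∫⁻ y, ‖k (x - y)‖ₑ = ∫⁻ y, ‖k y‖ₑ := fun x =>
    lintegral_sub_left_eq_self (fun y => ‖k y‖ₑ) x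
  have h0' : ∀ y, ∫⁻ x, ‖k (x - y)‖ₑ = ∫⁻ y, ‖k y‖ₑ := fun y =>
    lintegral_sub_right_eq_self (fun y => ‖k y‖ₑ) y
  have hkx : ∀ x, AEMeasurable (fun y => ‖k (x - y)‖ₑ) := fun x =>
    (aestronglyMeasurable_sub_left hk x).enorm
  have hm : AEMeasurable (fun q => ‖k (q.1 - q.2)‖ₑ * ‖f q.2‖ₑ ^ r)
      (volume.prod volume) :=
    ((aestronglyMeasurable_comp_sub hk).enorm).mul (hf.comp_snd.enorm.pow_const r)
  calc _ ≤ ∫⁻ x, (∫⁻ y, ‖k y‖ₑ) ^ (r - 1) * ∫⁻ y, ‖k (x - y)‖ₑ * ‖f y‖ₑ ^ r := by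
        refine lintegral_mono fun x => ?_
        have := lintegral_mul_rpow_le (hkx x) hf.enorm hr
        rwa [h0 x] at this
    _ = (∫⁻ y, ‖k y‖ₑ) ^ (r - 1) * ∫⁻ x, ∫⁻ y, ‖k (x - y)‖ₑ * ‖f y‖ₑ ^ r := by
        rw [lintegral_const_mul'' _ hm.lintegral_prod_right']
    _ = (∫⁻ y, ‖k y‖ₑ) ^ (r - 1) * ∫⁻ y, ∫⁻ x, ‖k (x - y)‖ₑ * ‖f y‖ₑ ^ r := by
        rw [lintegral_lintegral_swap hm]
    _ = (∫⁻ y, ‖k y‖ₑ) ^ (r - 1) * ((∫⁻ y, ‖k y‖ₑ) * ∫⁻ y, ‖f y‖ₑ ^ r) := by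
        congr 1; rw [← lintegral_const_mul'' _ (hf.enorm.pow_const r)]
        refine lintegral_congr fun y => ?_
        have hky : AEMeasurable (fun x => ‖k (x - y)‖ₑ) := (hk.comp_quasiMeasurePreserving
          (measurePreserving_sub_right volume y).quasiMeasurePreserving).enorm
        rw [lintegral_mul_const'' _ hky, h0']
    _ = _ := by
        rw [← mul_assoc]
        nth_rewrite 2 [← rpow_one (∫⁻ y, ‖k y‖ₑ)]
        rw [← ENNReal.rpow_add_of_nonneg _ _ (by linarith) zero_le_one, sub_add_cancel]

lemma ae_integrable_conv (hk : Integrable k) (hp : 1 ≤ p)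
    (hpt : p ≠ ∞) (hf : MemLp f p) : ∀ᵐ x, Integrable (fun y => k (x - y) * f y) := by
  have hr := one_le_toReal hp hpt
  have h1 := lintegral_young hk.1 hf.1 hr
  have h2 : ∫⁻ x, (∫⁻ y, ‖k (x - y)‖ₑ * ‖f y‖ₑ) ^ p.toReal ≠ ∞ := by
    refine ne_top_of_le_ne_top (ENNReal.mul_ne_top ?_ ?_) h1
    · exact ENNReal.rpow_ne_top_of_nonneg (by positivity) hk.2.ne
    · have := lintegral_rpow_enorm_lt_top_of_eLpNorm_lt_top (zero_lt_one.trans_le hp).ne' hpt hf.2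
      exact this.ne
  have hm : AEMeasurable (fun x => (∫⁻ y, ‖k (x - y)‖ₑ * ‖f y‖ₑ) ^ p.toReal) :=
    (((aestronglyMeasurable_comp_sub hk.1).enorm).mul
      (hf.1.comp_snd.enorm)).lintegral_prod_right'.pow_const _
  filter_upwards [ae_lt_top' hm h2] with x hx
  refine ⟨?_, ?_⟩
  · exact (aestronglyMeasurable_sub_left hk.1 x).mul hf.1
  · rw [hasFiniteIntegral_iff_enorm]; simp only [enorm_mul]
    exact (ENNReal.rpow_lt_top_iff_of_pos (by linarith)).1 hx

lemma aestronglyMeasurable_conv (hk : AEStronglyMeasurable k)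
    (hf : AEStronglyMeasurable f) : AEStronglyMeasurable (conv k f) :=
  (aestronglyMeasurable_kernel hk hf).integral_prod_right'

lemma eLpNorm_conv_le (hk : AEStronglyMeasurable k)
    (hf : AEStronglyMeasurable f) (hp : 1 ≤ p) (hpt : p ≠ ∞) :
    eLpNorm (conv k f) p ≤ eLpNorm k 1 * eLpNorm f p := by
  have hr := one_le_toReal hp hpt
  have hp0 : p ≠ 0 := (zero_lt_one.trans_le hp).ne'
  rw [eLpNorm_eq_lintegral_rpow_enorm_toReal hp0 hpt,
    eLpNorm_eq_lintegral_rpow_enorm_toReal hp0 hpt, eLpNorm_one_eq_lintegral_enorm]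
  calc _ ≤ ((∫⁻ y, ‖k y‖ₑ) ^ p.toReal * ∫⁻ y, ‖f y‖ₑ ^ p.toReal) ^ (1 / p.toReal) := by
        refine ENNReal.rpow_le_rpow (le_trans ?_ (lintegral_young hk hf hr)) (by positivity)
        refine lintegral_mono fun x => ENNReal.rpow_le_rpow ?_ (by positivity)
        refine (enorm_integral_le_lintegral_enorm _).trans (le_of_eq ?_)
        simp only [enorm_mul]
    _ = _ := by
        rw [ENNReal.mul_rpow_of_nonneg _ _ (by positivity), ← ENNReal.rpow_mul,
          mul_one_div_cancel (by linarith), rpow_one]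

lemma MemLp.conv (hk : Integrable k) (hp : 1 ≤ p)
    (hpt : p ≠ ∞) (hf : MemLp f p) : MemLp (conv k f) p :=
  ⟨aestronglyMeasurable_conv hk.1 hf.1, (eLpNorm_conv_le hk.1 hf.1 hp hpt).trans_lt
    (mul_lt_top (memLp_one_iff_integrable.2 hk).2 hf.2)⟩

lemma lintegral_mul_le_eLpNorm {α : Type*} [MeasurableSpace α] {μ : Measure α} {f g : α → ℝ}
    (hf : AEStronglyMeasurable f μ) (hg : AEStronglyMeasurable g μ) (p q : ℝ≥0∞)
    [HolderConjugate p q] :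
    ∫⁻ x, ‖f x‖ₑ * ‖g x‖ₑ ∂μ ≤ eLpNorm f p μ * eLpNorm g q μ := by
  have h := eLpNorm_smul_le_mul_eLpNorm (p := p) (q := q) (r := 1) hg hf
  rw [eLpNorm_one_eq_lintegral_enorm] at h
  simpa only [Pi.smul_apply', smul_eq_mul, enorm_mul] using h

/-- The trilinear form `∫∫ k (x - y) f y g x` is bounded by `‖k‖₁ ‖f‖_p ‖g‖_q`. -/
lemma lintegral_kernel_le (hk : AEStronglyMeasurable k)
    (hf : AEStronglyMeasurable f) (hg : AEStronglyMeasurable g) (p q : ℝ≥0∞)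
    [HolderConjugate p q] :
    ∫⁻ x, ∫⁻ y, ‖k (x - y)‖ₑ * ‖f y‖ₑ * ‖g x‖ₑ ≤ eLpNorm k 1 * eLpNorm f p * eLpNorm g q := by
  have hs := measurePreserving_sub_right (volume : Measure (Vec n))
  have e1 : ∀ x, ∫⁻ y, ‖k (x - y)‖ₑ * ‖f y‖ₑ * ‖g x‖ₑ = ∫⁻ h, ‖k h‖ₑ * (‖f (x - h)‖ₑ * ‖g x‖ₑ) := by
    intro x; rw [← lintegral_sub_left_eq_self _ x]; simp [mul_assoc]
  simp_rw [e1]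
  rw [lintegral_lintegral_swap (hk.comp_snd.enorm.mul
    ((aestronglyMeasurable_comp_sub hf).enorm.mul hg.comp_fst.enorm)),
    eLpNorm_one_eq_lintegral_enorm, mul_assoc, ← lintegral_mul_const'' _ hk.enorm]
  refine lintegral_mono fun h => ?_
  have hfh : AEStronglyMeasurable (fun x => f (x - h)) :=
    hf.comp_quasiMeasurePreserving (hs h).quasiMeasurePreserving
  rw [lintegral_const_mul' _ _ enorm_ne_top, ← eLpNorm_comp_measurePreserving hf (hs h)]; gcongr
  exact lintegral_mul_le_eLpNorm hfh hg p q

lemma lintegral_enorm_kernel (hk : AEStronglyMeasurable k)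
    (hf : AEStronglyMeasurable f) (hg : AEStronglyMeasurable g) :
    ∫⁻ z : Vec n × Vec n, ‖k (z.1 - z.2) * f z.2 * g z.1‖ₑ =
      ∫⁻ x, ∫⁻ y, ‖k (x - y)‖ₑ * ‖f y‖ₑ * ‖g x‖ₑ := by
  simp only [← enorm_mul]
  exact lintegral_prod _ ((aestronglyMeasurable_kernel hk hf).mul hg.comp_fst).enorm

lemma integrable_kernel (hk : Integrable k)
    [HolderConjugate p q] (hf : MemLp f p) (hg : MemLp g q) :
    Integrable (fun z : Vec n × Vec n => k (z.1 - z.2) * f z.2 * g z.1) := by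
  refine ⟨(aestronglyMeasurable_kernel hk.1 hf.1).mul hg.1.comp_fst, ?_⟩
  rw [hasFiniteIntegral_iff_enorm, lintegral_enorm_kernel hk.1 hf.1 hg.1]
  exact (lintegral_kernel_le hk.1 hf.1 hg.1 p q).trans_lt
    (mul_lt_top (mul_lt_top (memLp_one_iff_integrable.2 hk).2 hf.2) hg.2)

lemma integral_conv_mul_eq (hk : Integrable k)
    [HolderConjugate p q] (hf : MemLp f p) (hg : MemLp g q) :
    ∫ x, conv k f x * g x = ∫ z : Vec n × Vec n, k (z.1 - z.2) * f z.2 * g z.1 := by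
  rw [Measure.volume_eq_prod, integral_prod _ (integrable_kernel hk hf hg)]
  refine integral_congr_all fun x => ?_
  simp only [conv]; rw [← integral_mul_const]

lemma integral_conv_mul (hk : Integrable k)
    [HolderConjugate p q] (hf : MemLp f p) (hg : MemLp g q) :
    ∫ x, conv k f x * g x = ∫ y, f y * conv (fun x => k (-x)) g y := by
  rw [integral_conv_mul_eq hk hf hg, Measure.volume_eq_prod,
    integral_prod_symm _ (integrable_kernel hk hf hg)]
  refine integral_congr_all fun y => ?_
  simp only [conv]; rw [← integral_const_mul]
  refine integral_congr_all fun x => ?_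
  simp only [neg_sub]; ring

lemma integrable_mul_of_memLp {α : Type*} [MeasurableSpace α] {μ : Measure α} {f g : α → ℝ}
    [HolderConjugate p q] (hf : MemLp f p μ) (hg : MemLp g q μ) :
    Integrable (fun x => f x * g x) μ := by
  refine ⟨hf.1.mul hg.1, ?_⟩
  rw [hasFiniteIntegral_iff_enorm]; simp only [enorm_mul]
  exact (lintegral_mul_le_eLpNorm hf.1 hg.1 p q).trans_lt (mul_lt_top hf.2 hg.2)

lemma enorm_integral_mul_le {α : Type*} [MeasurableSpace α] {μ : Measure α} {f g : α → ℝ}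
    (hf : AEStronglyMeasurable f μ) (hg : AEStronglyMeasurable g μ) (p q : ℝ≥0∞)
    [HolderConjugate p q] :
    ‖∫ x, f x * g x ∂μ‖ₑ ≤ eLpNorm f p μ * eLpNorm g q μ := by
  refine (enorm_integral_le_lintegral_enorm _).trans ?_
  simp only [enorm_mul]
  exact lintegral_mul_le_eLpNorm hf hg p q

/-- Convergence in `L^p` implies convergence of the pairings with a fixed element of `L^q`. -/
lemma tendsto_integral_mul_of_eLpNorm {ι : Type*} {l : Filter ι} {F : ι → Vec n → ℝ}
    [HolderConjugate p q] (hF : ∀ i, MemLp (F i) p)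
    (hf : MemLp f p) (hg : MemLp g q)
    (h : Tendsto (fun i => eLpNorm (F i - f) p volume) l (𝓝 0)) :
    Tendsto (fun i => ∫ x, F i x * g x) l (𝓝 (∫ x, f x * g x)) := by
  rw [tendsto_iff_edist_tendsto_0]
  have h2 : Tendsto (fun i => eLpNorm (F i - f) p volume * eLpNorm g q volume) l (𝓝 0) := by
    have := ENNReal.Tendsto.mul_const (b := eLpNorm g q volume) h (Or.inr hg.2.ne)
    simpa using this
  refine tendsto_of_tendsto_of_tendsto_of_le_of_le tendsto_const_nhds h2 (fun _ => zero_le)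
    fun i => ?_
  simp only
  rw [edist_eq_enorm_sub, ← integral_sub (integrable_mul_of_memLp (hF i) hg)
    (integrable_mul_of_memLp hf hg)]
  simp_rw [← sub_mul]
  exact enorm_integral_mul_le ((hF i).sub hf).1 hg.1 p q

/-- Associativity of convolution, almost everywhere, on `L¹ × L¹ × L^p`. -/
lemma conv_conv {l : Vec n → ℝ} (hk : Integrable k) (hl : Integrable l)
    (hp : 1 ≤ p) (hpt : p ≠ ∞) (hf : MemLp f p) :
    conv k (conv l f) =ᵐ[volume] conv (conv k l) f := by
  have hK := ae_integrable_conv hk.abs hp hpt (MemLp.conv hl.abs hp hpt hf.abs)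
  filter_upwards [hK, ae_integrable_conv hk hp hpt (MemLp.conv hl hp hpt hf)] with x hx hx'
  have hae := ae_integrable_conv hl.abs hp hpt hf.abs
  have hkx := aestronglyMeasurable_sub_left hk.1 x
  have hm : AEStronglyMeasurable (fun q : Vec n × Vec n => k (x - q.1) * (l (q.1 - q.2) * f q.2))
      (volume.prod volume) := hkx.comp_fst.mul (aestronglyMeasurable_kernel hl.1 hf.1)
  have hint : Integrable (fun q : Vec n × Vec n => k (x - q.1) * (l (q.1 - q.2) * f q.2))
      (volume.prod volume) := by
    rw [integrable_prod_iff hm]; constructor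
    · filter_upwards [hae] with y hy
      refine Integrable.const_mul (hy.mono ?_ ?_) _
      · exact (aestronglyMeasurable_sub_left hl.1 y).mul hf.1
      · exact ae_of_all _ fun z => by simp
    · refine hx.congr (ae_of_all _ fun y => ?_)
      simp only [conv, norm_mul, norm_eq_abs]; rw [integral_const_mul]; rfl
  calc conv k (conv l f) x = ∫ y, ∫ z, k (x - y) * (l (y - z) * f z) := by
        simp only [conv, integral_const_mul]
    _ = ∫ z, ∫ y, k (x - y) * (l (y - z) * f z) := integral_integral_swap hint
    _ = _ := by
        simp only [conv]
        refine integral_congr_all fun z => ?_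
        rw [← integral_add_right_eq_self _ z, ← integral_mul_const]
        refine integral_congr_all fun y => ?_
        simp only [add_sub_cancel_right]; rw [show x - (y + z) = x - z - y by abel]
        ring

lemma integrable_conv {l : Vec n → ℝ} (hk : Integrable k) (hl : Integrable l) :
    Integrable (conv k l) :=
  memLp_one_iff_integrable.1 (MemLp.conv hk le_rfl one_ne_top (memLp_one_iff_integrable.2 hl))

lemma conv_comm (k f : Vec n → ℝ) : conv k f = conv f k := by
  funext x; simp only [conv]; rw [← integral_sub_left_eq_self _ volume x]
  simp [mul_comm]

lemma conv_congr_right (h : f =ᵐ[volume] g) : conv k f = conv k g := by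
  funext x
  refine integral_congr_ae ?_
  filter_upwards [h] with y hy
  rw [hy]

lemma conv_sub_right (hk : Integrable k) (hp : 1 ≤ p)
    (hpt : p ≠ ∞) (hf : MemLp f p) (hg : MemLp g p) :
    conv k (f - g) =ᵐ[volume] conv k f - conv k g := by
  filter_upwards [ae_integrable_conv hk hp hpt hf, ae_integrable_conv hk hp hpt hg] with x h1 h2
  simp only [conv, Pi.sub_apply, mul_sub]
  exact integral_sub h1 h2

/-- The norm of `h ∈ L^p` is controlled by its pairings with `L^q`. -/
lemma eLpNorm_le_of_pairing [hpq : HolderConjugate p q] (hp : 1 < p)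
    (hpt : p ≠ ∞) {h : Vec n → ℝ} (hh : MemLp h p) {C : ℝ≥0∞}
    (H : ∀ g : Vec n → ℝ, MemLp g q → ‖∫ x, h x * g x‖ₑ ≤ C * eLpNorm g q volume) :
    eLpNorm h p volume ≤ C := by
  have hp0 : p ≠ 0 := (zero_lt_one.trans hp).ne'
  have hq : 1 < q := (HolderConjugate.lt_top_iff_one_lt p q).1 hpt.lt_top
  have hqt : q ≠ ∞ := ((HolderConjugate.lt_top_iff_one_lt q p).2 hp).ne
  have hq0 : q ≠ 0 := (zero_lt_one.trans hq).ne'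
  have hr := one_lt_toReal hp hpt
  have hc : p.toReal.HolderConjugate q.toReal := HolderConjugate.toReal hr
  set r := p.toReal
  set r' := q.toReal
  have hr0 : 0 < r := by linarith
  have hr'0 : 0 < r' := hc.symm.pos
  have hI := lintegral_rpow_enorm_lt_top_of_eLpNorm_lt_top hp0 hpt hh.2
  set I := ∫⁻ x, ‖h x‖ₑ ^ r with hIdef
  have hg1 : ∀ x, ‖h x * |h x| ^ (r - 2)‖ₑ = ‖h x‖ₑ ^ (r - 1) := by
    intro x
    rcases eq_or_ne (h x) 0 with h0 | h0
    · simp [h0, ENNReal.zero_rpow_of_pos (by linarith : 0 < r - 1)]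
    · have hpos : 0 < |h x| := abs_pos.2 h0
      rw [← ofReal_norm, ← ofReal_norm, norm_eq_abs, norm_eq_abs,
        ENNReal.ofReal_rpow_of_pos hpos, abs_mul, abs_of_nonneg (Real.rpow_nonneg hpos.le _)]
      congr 1; rw [show r - 1 = 1 + (r - 2) by ring, rpow_add hpos, Real.rpow_one]
  have hgm : AEStronglyMeasurable (fun x => h x * |h x| ^ (r - 2)) := by
    have := hh.1.aemeasurable
    exact (this.mul ((this.abs).pow_const (r - 2))).aestronglyMeasurable
  have hgn : eLpNorm (fun x => h x * |h x| ^ (r - 2)) q volume = I ^ (1 / r') := by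
    rw [eLpNorm_eq_lintegral_rpow_enorm_toReal hq0 hqt]
    simp_rw [hg1, ← ENNReal.rpow_mul]
    rw [show (r - 1) * q.toReal = r from hc.sub_one_mul_conj]
  have hgL : MemLp (fun x => h x * |h x| ^ (r - 2)) q := by
    refine ⟨hgm, ?_⟩
    rw [hgn]
    exact ENNReal.rpow_lt_top_of_nonneg (by positivity) hI.ne
  have hprod : ∀ x, h x * (h x * |h x| ^ (r - 2)) = ‖h x‖ ^ r := by
    intro x
    rcases eq_or_ne (h x) 0 with h0 | h0
    · simp [h0, Real.zero_rpow hr0.ne']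
    · have hpos : 0 < |h x| := abs_pos.2 h0
      rw [norm_eq_abs, show r = (2 : ℕ) + (r - 2) by push_cast; ring, rpow_add hpos,
        Real.rpow_natCast, sq_abs]
      ring_nf
  have key := H _ hgL
  rw [hgn] at key
  have e : ‖∫ x, h x * (h x * |h x| ^ (r - 2))‖ₑ = I := by
    simp_rw [hprod]
    have hint : Integrable (fun x => ‖h x‖ ^ r) := hh.integrable_norm_rpow hp0 hpt
    rw [← ofReal_norm, norm_of_nonneg (integral_nonneg fun x => by positivity),
      ofReal_integral_eq_lintegral_ofReal hint (ae_of_all _ fun x => by positivity)]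
    refine lintegral_congr fun x => ?_
    rw [← ofReal_norm, ENNReal.ofReal_rpow_of_nonneg (norm_nonneg _) hr0.le]
  rw [e] at key; rw [eLpNorm_eq_lintegral_rpow_enorm_toReal hp0 hpt]
  change I ^ (1 / r) ≤ C
  rcases eq_or_ne I 0 with h0 | h0
  · rw [h0, ENNReal.zero_rpow_of_pos (by positivity)]; exact zero_le
  · have h1 : 1 / r + 1 / r' = 1 := by simpa using hc.inv_add_inv_eq_one
    have h2 : I = I ^ (1 / r) * I ^ (1 / r') := by
      rw [← ENNReal.rpow_add _ _ h0 hI.ne, h1, rpow_one]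
    refine (ENNReal.mul_le_mul_iff_left ?_ ?_).1 (h2.symm.le.trans key)
    · exact (ENNReal.rpow_pos (pos_iff_ne_zero.2 h0) hI.ne).ne'
    · exact ENNReal.rpow_ne_top_of_nonneg (by positivity) hI.ne

end

section

/-! ### The heat semigroup -/

/-- The elementary interpolation `‖f‖_q ≤ ‖f‖_∞^{1-1/q} ‖f‖_1^{1/q}`. -/
lemma eLpNorm_le_of_bound (hC : ∀ x, |f x| ≤ C) (hq : 1 ≤ q) (hqt : q ≠ ∞) :
    eLpNorm f q volume ≤ ofReal C ^ (1 - 1 / q.toReal) * eLpNorm f 1 volume ^ (1 / q.toReal) := by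
  have hr := one_le_toReal hq hqt
  rw [eLpNorm_eq_lintegral_rpow_enorm_toReal (zero_lt_one.trans_le hq).ne' hqt,
    eLpNorm_one_eq_lintegral_enorm]
  have h1 : ∀ x, ‖f x‖ₑ ^ q.toReal ≤ ofReal C ^ (q.toReal - 1) * ‖f x‖ₑ := by
    intro x
    have : ‖f x‖ₑ ≤ ofReal C := by rw [← ofReal_norm, norm_eq_abs]; exact ofReal_le_ofReal (hC x)
    calc ‖f x‖ₑ ^ q.toReal = ‖f x‖ₑ ^ (q.toReal - 1) * ‖f x‖ₑ := by
          nth_rewrite 3 [← rpow_one ‖f x‖ₑ]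
          rw [← ENNReal.rpow_add_of_nonneg _ _ (by linarith) zero_le_one, sub_add_cancel]
      _ ≤ _ := by gcongr
  calc _ ≤ (ofReal C ^ (q.toReal - 1) * ∫⁻ x, ‖f x‖ₑ) ^ (1 / q.toReal) := by
        refine ENNReal.rpow_le_rpow ?_ (by positivity)
        rw [← lintegral_const_mul' _ _ (ENNReal.rpow_ne_top_of_nonneg (by linarith) ofReal_ne_top)]
        exact lintegral_mono h1
    _ = _ := by
        rw [ENNReal.mul_rpow_of_nonneg _ _ (by positivity), ← ENNReal.rpow_mul]; field_simp

lemma memLp_of_integrable_of_bound (hf : Integrable f)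
    (hC : ∀ x, |f x| ≤ C) (hq : 1 ≤ q) : MemLp f q := by
  rcases eq_or_ne q ∞ with rfl | hqt
  · exact memLp_top_of_bound hf.1 C (ae_of_all _ hC)
  refine ⟨hf.1, (eLpNorm_le_of_bound hC hq hqt).trans_lt ?_⟩
  have hr := one_le_toReal hq hqt
  refine mul_lt_top ?_ ?_
  · refine ENNReal.rpow_lt_top_of_nonneg ?_ ofReal_ne_top
    rw [sub_nonneg, div_le_one (by linarith)]; exact hr
  · exact ENNReal.rpow_lt_top_of_nonneg (by positivity) (memLp_one_iff_integrable.2 hf).2.ne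

lemma memLp_heat (ht : 0 < t) (hq : 1 ≤ q) : MemLp (heat t : Vec n → ℝ) q :=
  memLp_of_integrable_of_bound (integrable_heat ht) (fun x => by
    rw [abs_of_pos (heat_pos ht x)]; exact heat_le_const ht x) hq

lemma eLpNorm_one_heat (ht : 0 < t) : eLpNorm (heat t : Vec n → ℝ) 1 volume = 1 := by
  rw [eLpNorm_one_eq_lintegral_enorm]
  have : ∀ x : Vec n, ‖heat t x‖ₑ = ofReal (heat t x) := fun x => by
    rw [← ofReal_norm, norm_of_nonneg (heat_pos ht x).le]
  simp_rw [this]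
  rw [← ofReal_integral_eq_lintegral_ofReal (integrable_heat ht)
    (ae_of_all _ fun x => (heat_pos ht x).le), integral_heat ht, ENNReal.ofReal_one]

lemma eLpNorm_conv_heat_le (ht : 0 < t) (hf : AEStronglyMeasurable f) (hp : 1 ≤ p) (hpt : p ≠ ∞) :
    eLpNorm (conv (heat t) f) p volume ≤ eLpNorm f p volume := by
  have := eLpNorm_conv_le (integrable_heat ht).1 hf hp hpt
  rwa [eLpNorm_one_heat ht, one_mul] at this

lemma conv_heat_heat (hs : 0 < s) (ht : 0 < t) :
    conv (heat s) (heat t) = (heat (s + t) : Vec n → ℝ) :=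
  funext fun x => integral_heat_mul_heat hs ht x

lemma tendsto_conv_heat_apply (hf : Integrable f) {x : Vec n}
    (hx : ContinuousAt f x) : Tendsto (fun δ => conv (heat δ) f x) (𝓝[>] 0) (𝓝 (f x)) := by
  have h1 := Real.tendsto_integral_gaussian_smul' (f := fun x => (f x : ℂ)) hf.ofReal
    (Complex.continuous_ofReal.continuousAt.comp hx)
  have h2 : Tendsto (fun δ => (4 * π ^ 2)⁻¹ * δ⁻¹) (𝓝[>] 0) atTop :=
    tendsto_inv_nhdsGT_zero.const_mul_atTop (by positivity)
  have h3 := (Complex.continuous_re.tendsto _).comp (h1.comp h2)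
  refine h3.congr' ?_
  filter_upwards [self_mem_nhdsWithin] with δ hδ
  have hδ : 0 < δ := hδ
  simp only [Function.comp]
  have e : ∀ w : Vec n, ((π * (((4 * π ^ 2)⁻¹ * δ⁻¹ : ℝ) : ℂ)) ^
      (Module.finrank ℝ (Vec n) / 2 : ℂ) *
      Complex.exp (-π ^ 2 * (((4 * π ^ 2)⁻¹ * δ⁻¹ : ℝ) : ℂ) * ‖x - w‖ ^ 2)) • (f w : ℂ)
      = ((heat δ (x - w) * f w : ℝ) : ℂ) := by
    intro w
    have a1 : (π * (((4 * π ^ 2)⁻¹ * δ⁻¹ : ℝ) : ℂ)) ^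
        (Module.finrank ℝ (Vec n) / 2 : ℂ) = (((4 * π * δ) ^ (-(n : ℝ) / 2) : ℝ) : ℂ) := by
      rw [finrank_euclideanSpace_fin, neg_div, rpow_neg (by positivity),
        ← Real.inv_rpow (by positivity), Complex.ofReal_cpow (by positivity)]
      congr 1
      · push_cast; field_simp
      · push_cast; rfl
    rw [a1]; unfold heat; push_cast
    congr 3
    field_simp
  simp_rw [e]
  rw [integral_complex_ofReal, Complex.ofReal_re]; rfl

lemma tendsto_eLpNorm_zero_of_dominated {ι : Type*} {l : Filter ι} [l.IsCountablyGenerated]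
    {F : ι → Vec n → ℝ} {b : Vec n → ℝ} (hp : 1 ≤ p) (hpt : p ≠ ∞) (hb : MemLp b p)
    (hF : ∀ᶠ i in l, AEStronglyMeasurable (F i)) (hFb : ∀ᶠ i in l, ∀ x, |F i x| ≤ b x)
    (h0 : ∀ᵐ x, Tendsto (fun i => F i x) l (𝓝 0)) :
    Tendsto (fun i => eLpNorm (F i) p volume) l (𝓝 0) := by
  have hp0 : p ≠ 0 := (zero_lt_one.trans_le hp).ne'
  have hr : 0 < p.toReal := ENNReal.toReal_pos hp0 hpt
  have hI := lintegral_rpow_enorm_lt_top_of_eLpNorm_lt_top hp0 hpt hb.2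
  simp_rw [eLpNorm_eq_lintegral_rpow_enorm_toReal hp0 hpt]
  have h1 : Tendsto (fun i => ∫⁻ x, ‖F i x‖ₑ ^ p.toReal) l (𝓝 (∫⁻ _x : Vec n, 0)) := by
    refine tendsto_lintegral_filter_of_dominated_convergence' (fun x => ‖b x‖ₑ ^ p.toReal)
      ?_ ?_ hI.ne ?_
    · filter_upwards [hF] with i hi using hi.enorm.pow_const _
    · filter_upwards [hFb] with i hi
      refine ae_of_all _ fun x => ENNReal.rpow_le_rpow ?_ hr.le
      rw [← ofReal_norm, ← ofReal_norm]
      exact ofReal_le_ofReal ((hi x).trans (le_abs_self _))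
    · filter_upwards [h0] with x hx
      have := (ENNReal.continuous_rpow_const (y := p.toReal)).tendsto 0 |>.comp
        (hx.enorm.trans (by simp))
      simpa [ENNReal.zero_rpow_of_pos hr, Function.comp_def] using this
  rw [lintegral_zero] at h1
  have h2 := (ENNReal.continuous_rpow_const (y := 1 / p.toReal)).tendsto 0 |>.comp h1
  simpa [ENNReal.zero_rpow_of_pos (by positivity : 0 < p.toReal⁻¹), Function.comp_def] using h2

lemma abs_integral_le_of_abs_le {α : Type*} [MeasurableSpace α] {μ : Measure α} {f g : α → ℝ}
    (hg : Integrable g μ) (h : ∀ x, |f x| ≤ g x) : |∫ x, f x ∂μ| ≤ ∫ x, g x ∂μ := by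
  rw [← norm_eq_abs]
  exact norm_integral_le_of_norm_le hg (ae_of_all _ h)

lemma exists_le_mul_heat (hg : Continuous g) (hc : HasCompactSupport g) :
    ∃ C : ℝ, 0 < C ∧ ∀ x, |g x| ≤ C * heat 1 x := by
  obtain ⟨C, hC⟩ := (hg.norm.mul ((continuous_heat 1).inv₀ fun x =>
    (heat_pos one_pos x).ne')).bounded_above_of_compact_support (hc.norm.mul_right)
  refine ⟨|C| + 1, by positivity, fun x => ?_⟩
  have h := hC x
  have hp := heat_pos one_pos x
  simp only [Pi.mul_apply, Pi.inv_apply, norm_mul, norm_inv, norm_eq_abs, abs_abs,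
    abs_of_pos hp] at h
  rw [← div_eq_mul_inv, div_le_iff₀ hp] at h
  refine h.trans ?_
  gcongr
  linarith [le_abs_self C]

lemma abs_conv_le_of_le_heat (ht : 0 < t) (hs : 0 < s)
    (hC : ∀ x, |g x| ≤ C * heat s x) (x : Vec n) :
    |conv (heat t) g x| ≤ C * heat (t + s) x := by
  rw [← conv_heat_heat ht hs]; simp only [conv]; rw [← integral_const_mul]
  have hi : Integrable fun y => heat t (x - y) * heat s y :=
    ((integrable_heat ht).comp_sub_left x).mul_bdd (by fun_prop)
      (ae_of_all _ fun y => by rw [norm_of_nonneg (heat_pos hs y).le]; exact heat_le_const hs y)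
  refine abs_integral_le_of_abs_le (hi.const_mul C) fun y => ?_
  rw [abs_mul, abs_of_pos (heat_pos ht _)]
  calc _ ≤ heat t (x - y) * (C * heat s y) :=
        mul_le_mul_of_nonneg_left (hC y) (heat_pos ht _).le
    _ = _ := by ring

lemma tendsto_conv_heat_of_continuous (hg : Continuous g)
    (hc : HasCompactSupport g) (hp : 1 ≤ p) (hpt : p ≠ ∞) :
    Tendsto (fun δ => eLpNorm (conv (heat δ) g - g) p volume) (𝓝[>] 0) (𝓝 0) := by
  obtain ⟨C, hC, h⟩ := exists_le_mul_heat hg hc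
  have hgi : Integrable g := hg.integrable_of_hasCompactSupport hc
  refine tendsto_eLpNorm_zero_of_dominated hp hpt
    (b := fun x => (2 * C * 2 ^ ((n : ℝ) / 2)) * heat 2 x)
    ((memLp_heat two_pos hp).const_mul _) ?_ ?_ ?_
  · filter_upwards [self_mem_nhdsWithin] with δ hδ
    exact (aestronglyMeasurable_conv (integrable_heat hδ).1 hgi.1).sub hgi.1
  · filter_upwards [Ioc_mem_nhdsGT one_pos] with δ hδ x
    have h1 := abs_conv_le_of_le_heat hδ.1 one_pos h x
    have h2 := heat_le_mul (s := δ + 1) (t := 2) (c := 2) (by linarith [hδ.1]) (by linarith [hδ.2])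
      (by linarith [hδ.1]) x
    have h3 := heat_le_mul (s := 1) (t := 2) (c := 2) one_pos (by norm_num) (by norm_num) x
    calc _ ≤ |conv (heat δ) g x| + |g x| := abs_sub _ _
      _ ≤ C * heat (δ + 1) x + C * heat 1 x := add_le_add h1 (h x)
      _ ≤ C * (2 ^ ((n : ℝ) / 2) * heat 2 x) + C * (2 ^ ((n : ℝ) / 2) * heat 2 x) := by gcongr
      _ = _ := by ring
  · refine ae_of_all _ fun x => ?_
    have := (tendsto_conv_heat_apply hgi hg.continuousAt (x := x)).sub_const (g x)
    simpa using this

/-- The heat semigroup is strongly continuous at `0` on `L^p`, `1 ≤ p < ∞`. -/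
lemma tendsto_conv_heat (hp : 1 ≤ p) (hpt : p ≠ ∞) (hf : MemLp f p) :
    Tendsto (fun δ => eLpNorm (conv (heat δ) f - f) p volume) (𝓝[>] 0) (𝓝 0) := by
  rw [ENNReal.tendsto_nhds_zero]; intro ε hε
  have hε3 : ε / 3 ≠ 0 := (ENNReal.div_pos hε.ne' (by norm_num)).ne'
  obtain ⟨g, hgc, hfg, hg, hgL⟩ := hf.exists_hasCompactSupport_eLpNorm_sub_le hpt hε3
  have h1 := ENNReal.tendsto_nhds_zero.1 (tendsto_conv_heat_of_continuous hg hgc hp hpt) (ε / 3)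
    (pos_iff_ne_zero.2 hε3)
  filter_upwards [h1, self_mem_nhdsWithin] with δ h hδ
  have hδ : 0 < δ := hδ
  have e : conv (heat δ) f - f =ᵐ[volume]
      (conv (heat δ) (f - g) + (conv (heat δ) g - g)) + (g - f) := by
    filter_upwards [conv_sub_right (integrable_heat hδ) hp hpt hf hgL] with x hx
    simp only [Pi.add_apply, Pi.sub_apply] at hx ⊢
    rw [hx]; ring
  have hm := hf.1.sub hgL.1
  have hm1 := aestronglyMeasurable_conv (integrable_heat (n := n) hδ).1 hm
  have hm2 := (aestronglyMeasurable_conv (integrable_heat (n := n) hδ).1 hgL.1).sub hgL.1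
  rw [eLpNorm_congr_ae e]
  calc _ ≤ eLpNorm (conv (heat δ) (f - g)) p volume + eLpNorm (conv (heat δ) g - g) p volume
        + eLpNorm (g - f) p volume :=
        (eLpNorm_add_le (hm1.add hm2) (hgL.1.sub hf.1) hp).trans
          (by gcongr; exact eLpNorm_add_le hm1 hm2 hp)
    _ ≤ ε / 3 + ε / 3 + ε / 3 := by
        gcongr
        · exact (eLpNorm_conv_heat_le hδ hm hp hpt).trans hfg
        · rw [eLpNorm_sub_comm]; exact hfg
    _ = ε := ENNReal.add_thirds ε

/-- For `1 < p < ∞` the heat semigroup tends strongly to `0` on `L^p` at infinite time. -/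
lemma tendsto_conv_heat_atTop (hn : 0 < n) (hp : 1 < p) (hpt : p ≠ ∞)
    (hf : MemLp f p) : Tendsto (fun t => eLpNorm (conv (heat t) f) p volume) atTop (𝓝 0) := by
  have hr := one_lt_toReal hp hpt
  have hexp : 0 < 1 - 1 / p.toReal := by rw [sub_pos, div_lt_one (by linarith)]; exact hr
  rw [ENNReal.tendsto_nhds_zero]; intro ε hε
  have hε2 : ε / 2 ≠ 0 := (ENNReal.div_pos hε.ne' (by norm_num)).ne'
  obtain ⟨g, hgc, hfg, hg, hgL⟩ := hf.exists_hasCompactSupport_eLpNorm_sub_le hpt hε2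
  have hgi : Integrable g := hg.integrable_of_hasCompactSupport hgc
  have hb : Tendsto (fun t : ℝ => (4 * π * t) ^ (-(n : ℝ) / 2) * ∫ y, |g y|) atTop (𝓝 0) := by
    have h1 : Tendsto (fun t : ℝ => 4 * π * t) atTop atTop :=
      tendsto_id.const_mul_atTop (by positivity)
    have h2 := (tendsto_rpow_neg_atTop (y := (n : ℝ) / 2) (by positivity)).comp h1
    have h3 := h2.mul_const (∫ y, |g y|)
    simpa [neg_div, Function.comp_def] using h3
  have hb2 : Tendsto (fun t : ℝ => ofReal ((4 * π * t) ^ (-(n : ℝ) / 2) * ∫ y, |g y|) ^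
      (1 - 1 / p.toReal) * eLpNorm g 1 volume ^ (1 / p.toReal)) atTop (𝓝 0) := by
    have h4 := (ENNReal.continuous_rpow_const (y := 1 - 1 / p.toReal)).tendsto 0 |>.comp
      ((ENNReal.tendsto_ofReal hb).trans (by simp))
    rw [ENNReal.zero_rpow_of_pos hexp] at h4
    have h5 := ENNReal.Tendsto.mul_const (b := eLpNorm g 1 volume ^ (1 / p.toReal)) h4
      (Or.inr (ENNReal.rpow_ne_top_of_nonneg (by positivity) (memLp_one_iff_integrable.2 hgi).2.ne))
    simpa using h5
  filter_upwards [ENNReal.tendsto_nhds_zero.1 hb2 (ε / 2) (pos_iff_ne_zero.2 hε2),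
    eventually_gt_atTop 0] with t ht ht0
  have hm := hf.1.sub hgL.1
  have e : conv (heat t) f =ᵐ[volume] conv (heat t) (f - g) + conv (heat t) g := by
    filter_upwards [conv_sub_right (integrable_heat ht0) hp.le hpt hf hgL] with x hx
    simp only [Pi.add_apply, Pi.sub_apply] at hx ⊢
    rw [hx]; ring
  rw [eLpNorm_congr_ae e]
  have hK := integrable_heat (n := n) ht0
  have hbd : ∀ x, |conv (heat t) g x| ≤ (4 * π * t) ^ (-(n : ℝ) / 2) * ∫ y, |g y| := by
    intro x; rw [← integral_const_mul]
    refine abs_integral_le_of_abs_le (hgi.abs.const_mul _) fun y => ?_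
    rw [abs_mul, abs_of_pos (heat_pos ht0 _)]; gcongr
    exact heat_le_const ht0 _
  calc _ ≤ eLpNorm (conv (heat t) (f - g)) p volume + eLpNorm (conv (heat t) g) p volume :=
        eLpNorm_add_le (aestronglyMeasurable_conv hK.1 hm) (aestronglyMeasurable_conv hK.1 hgL.1)
          hp.le
    _ ≤ ε / 2 + ε / 2 := by
        gcongr
        · exact (eLpNorm_conv_heat_le ht0 hm hp.le hpt).trans hfg
        · refine (eLpNorm_le_of_bound hbd hp.le hpt).trans (le_trans ?_ ht)
          gcongr
          exact eLpNorm_conv_heat_le ht0 hgL.1 le_rfl one_ne_top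
    _ = ε := ENNReal.add_halves ε

end

section

/-! ### The Bellman function -/

/-- `u^p + v^q`. -/
def bellN (p q u v : ℝ) : ℝ := u ^ p + v ^ q

/-- The differential of `u^p + v^q` in the direction `(a, b)`. -/
def bellD (p q u v a b : ℝ) : ℝ := p * u ^ (p - 1) * a + q * v ^ (q - 1) * b

/-- The second differential of `u^p + v^q` in the direction `(a, b)`. -/
def bellE (p q u v a b : ℝ) : ℝ :=
  p * (p - 1) * u ^ (p - 2) * a ^ 2 + q * (q - 1) * v ^ (q - 2) * b ^ 2

/-- The Bellman function `v² (u^p + v^q)^{2/p-1} + (16 q + 1) (u^p + v^q)` on the open quadrant,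
for `1 < p ≤ 2` and `1/p + 1/q = 1`. -/
def bell (p q u v : ℝ) : ℝ := v ^ 2 * bellN p q u v ^ (2 / p - 1) + (16 * q + 1) * bellN p q u v

/-- The differential of the Bellman function in the direction `(a, b)`. -/
def bellDeriv (p q u v a b : ℝ) : ℝ := 2 * v * b * bellN p q u v ^ (2 / p - 1) +
    v ^ 2 * ((2 / p - 1) * bellN p q u v ^ (2 / p - 2) * bellD p q u v a b) +
    (16 * q + 1) * bellD p q u v a b

/-- The second differential of the Bellman function in the direction `(a, b)`. -/
def bellHess (p q u v a b : ℝ) : ℝ := 2 * b ^ 2 * bellN p q u v ^ (2 / p - 1) +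
    4 * (2 / p - 1) * v * b * bellN p q u v ^ (2 / p - 2) * bellD p q u v a b +
    (2 / p - 1) * (2 / p - 2) * v ^ 2 * bellN p q u v ^ (2 / p - 3) * bellD p q u v a b ^ 2 +
    (2 / p - 1) * v ^ 2 * bellN p q u v ^ (2 / p - 2) * bellE p q u v a b +
    (16 * q + 1) * bellE p q u v a b

lemma bellN_pos {p q u v : ℝ} (hu : 0 < u) (hv : 0 < v) : 0 < bellN p q u v := by
  unfold bellN; positivity

lemma hasDerivAt_bellN {p q : ℝ} {f g : ℝ → ℝ} (hf : HasDerivAt f a s)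
    (hg : HasDerivAt g b s) (hu : 0 < f s) (hv : 0 < g s) :
    HasDerivAt (fun s => bellN p q (f s) (g s)) (bellD p q (f s) (g s) a b) s := by
  have h := (hf.rpow_const (p := p) (Or.inl hu.ne')).add (hg.rpow_const (p := q) (Or.inl hv.ne'))
  refine h.congr_deriv ?_
  unfold bellD; ring

lemma hasDerivAt_bellD {p q : ℝ} {f g f' g' : ℝ → ℝ} (hf : HasDerivAt f (f' s) s)
    (hg : HasDerivAt g (g' s) s) (hf' : HasDerivAt f' a s) (hg' : HasDerivAt g' b s)
    (hu : 0 < f s) (hv : 0 < g s) :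
    HasDerivAt (fun s => bellD p q (f s) (g s) (f' s) (g' s))
      (bellD p q (f s) (g s) a b + bellE p q (f s) (g s) (f' s) (g' s)) s := by
  have h := (((hf.rpow_const (p := p - 1) (Or.inl hu.ne')).const_mul p).mul hf').add
    (((hg.rpow_const (p := q - 1) (Or.inl hv.ne')).const_mul q).mul hg')
  refine h.congr_deriv ?_
  unfold bellD bellE; rw [show p - 1 - 1 = p - 2 by ring, show q - 1 - 1 = q - 2 by ring]
  ring

lemma hasDerivAt_bell {p q : ℝ} {f g : ℝ → ℝ} (hf : HasDerivAt f a s)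
    (hg : HasDerivAt g b s) (hu : 0 < f s) (hv : 0 < g s) :
    HasDerivAt (fun s => bell p q (f s) (g s)) (bellDeriv p q (f s) (g s) a b) s := by
  have hN := hasDerivAt_bellN (p := p) (q := q) hf hg hu hv
  have h := ((hg.pow 2).mul (hN.rpow_const (p := 2 / p - 1)
    (Or.inl (bellN_pos hu hv).ne'))).add (hN.const_mul (16 * q + 1))
  refine h.congr_deriv ?_
  unfold bellDeriv; rw [show 2 / p - 1 - 1 = 2 / p - 2 by ring]
  simp only [Pi.pow_apply]; ring

lemma hasDerivAt_bellDeriv {p q : ℝ} {f g f' g' : ℝ → ℝ}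
    (hf : HasDerivAt f (f' s) s) (hg : HasDerivAt g (g' s) s) (hf' : HasDerivAt f' a s)
    (hg' : HasDerivAt g' b s) (hu : 0 < f s) (hv : 0 < g s) :
    HasDerivAt (fun s => bellDeriv p q (f s) (g s) (f' s) (g' s))
      (bellDeriv p q (f s) (g s) a b + bellHess p q (f s) (g s) (f' s) (g' s)) s := by
  have hN := hasDerivAt_bellN (p := p) (q := q) hf hg hu hv
  have hD := hasDerivAt_bellD (p := p) (q := q) hf hg hf' hg' hu hv
  have hne := Or.inl (b := (1 : ℝ) ≤ 2 / p - 1) (bellN_pos (p := p) (q := q) hu hv).ne'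
  have hne' := Or.inl (b := (1 : ℝ) ≤ 2 / p - 2) (bellN_pos (p := p) (q := q) hu hv).ne'
  have h := ((((hg.const_mul 2).mul hg').mul (hN.rpow_const (p := 2 / p - 1) hne)).add
    ((hg.pow 2).mul (((hN.rpow_const (p := 2 / p - 2) hne').const_mul (2 / p - 1)).mul hD))).add
    (hD.const_mul (16 * q + 1))
  refine h.congr_deriv ?_
  unfold bellDeriv bellHess
  rw [show 2 / p - 1 - 1 = 2 / p - 2 by ring, show 2 / p - 2 - 1 = 2 / p - 3 by ring]
  simp only [Pi.pow_apply, Pi.mul_apply]; ring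

section Bounds

variable {p q u v ρ : ℝ} (hpq : p.HolderConjugate q) (hp : p ≤ 2) (hu : 0 < u) (hv : 0 < v)

include hu hv

lemma bellN_rpow_sub_two :
    bellN p q u v ^ (2 / p - 2) = bellN p q u v ^ (2 / p - 1) / bellN p q u v := by
  rw [← Real.rpow_sub_one (bellN_pos hu hv).ne']; congr 1; ring

lemma bellN_rpow_sub_three : bellN p q u v ^ (2 / p - 3) =
      bellN p q u v ^ (2 / p - 1) / bellN p q u v / bellN p q u v := by
  rw [← Real.rpow_sub_one (bellN_pos hu hv).ne', ← Real.rpow_sub_one (bellN_pos hu hv).ne']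
  congr 1; ring

include hpq

lemma bellE_nonneg (a b : ℝ) :
    0 ≤ bellE p q u v a b := by
  have := hpq.sub_one_pos
  have := hpq.symm.sub_one_pos
  have := hpq.pos
  have := hpq.symm.pos
  unfold bellE; positivity

lemma bell_nonneg : 0 ≤ bell p q u v := by
  have hN := bellN_pos (p := p) (q := q) hu hv
  have := hpq.symm.pos
  unfold bell; positivity

omit hu hv

include hp

lemma conj_bounds : 2 ≤ q ∧ 0 ≤ 2 / p - 1 ∧ 2 / p - 1 ≤ 1 ∧ 2 / p + 2 / q = 2 := by
  have h2 := hpq.inv_add_inv_eq_one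
  have hp2 : (2 : ℝ)⁻¹ ≤ p⁻¹ := inv_anti₀ hpq.pos hp
  have hp1 : p⁻¹ ≤ 1 := inv_le_one_of_one_le₀ hpq.lt.le
  simp only [div_eq_mul_inv]
  exact ⟨(inv_le_inv₀ hpq.symm.pos two_pos).1 (by linarith), by linarith, by linarith, by linarith⟩

include hu hv

lemma sq_le_bellN : v ^ 2 * bellN p q u v ^ (2 / p - 1) ≤ bellN p q u v := by
  obtain ⟨hq, -, -, h⟩ := conj_bounds hpq hp
  have hN := bellN_pos (p := p) (q := q) hu hv
  have hv2 : v ^ 2 ≤ bellN p q u v ^ (2 / q) := by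
    calc v ^ 2 = (v ^ q) ^ (2 / q) := by
          rw [← rpow_mul hv.le, mul_div_cancel₀ _ (by linarith : q ≠ 0)]; norm_cast
      _ ≤ _ := by
          apply Real.rpow_le_rpow (by positivity) _ (by positivity)
          unfold bellN; linarith [Real.rpow_nonneg hu.le p]
  calc _ ≤ bellN p q u v ^ (2 / q) * bellN p q u v ^ (2 / p - 1) := by gcongr
    _ = bellN p q u v := by
        rw [← rpow_add hN, show 2 / q + (2 / p - 1) = 1 by linarith, Real.rpow_one]

lemma bellD_sq_le (a b : ℝ) :
    bellD p q u v a b ^ 2 ≤ 2 * q * bellN p q u v * bellE p q u v a b := by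
  obtain ⟨hq, -, -, -⟩ := conj_bounds hpq hp
  have h1 := hpq.lt
  have e (p : ℝ) {u : ℝ} (hu : 0 < u) : u ^ (p - 1) * u ^ (p - 1) = u ^ p * u ^ (p - 2) := by
    rw [← rpow_add hu, ← rpow_add hu]; congr 1; ring
  have hpq' : p * q = p + q := hpq.mul_eq_add
  have hp1 : 0 < p - 1 := by linarith
  have hq1 : 0 < q - 1 := by linarith
  have hX : (p * u ^ (p - 1) * a) ^ 2 = q * (u ^ p * (p * (p - 1) * u ^ (p - 2) * a ^ 2)) := by
    linear_combination p ^ 2 * a ^ 2 * e p hu - p * u ^ p * u ^ (p - 2) * a ^ 2 * hpq'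
  have hY : (q * v ^ (q - 1) * b) ^ 2 = p * (v ^ q * (q * (q - 1) * v ^ (q - 2) * b ^ 2)) := by
    linear_combination q ^ 2 * b ^ 2 * e q hv - q * v ^ q * v ^ (q - 2) * b ^ 2 * hpq'
  unfold bellD bellN bellE
  set X := p * u ^ (p - 1) * a
  set Y := q * v ^ (q - 1) * b
  have hE1 : 0 ≤ p * (p - 1) * u ^ (p - 2) * a ^ 2 := by positivity
  have hE2 : 0 ≤ q * (q - 1) * v ^ (q - 2) * b ^ 2 := by positivity
  set E1 := p * (p - 1) * u ^ (p - 2) * a ^ 2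
  set E2 := q * (q - 1) * v ^ (q - 2) * b ^ 2
  have h4 : p * (v ^ q * E2) ≤ q * (v ^ q * E2) := by gcongr; linarith
  have h5 : 0 ≤ q * (u ^ p * E2) := by positivity
  have h6 : 0 ≤ q * (v ^ q * E1) := by positivity
  nlinarith [sq_nonneg (X - Y)]

/-- Convexity of the Bellman function. -/
lemma bellHess_ge (a b : ℝ) :
    bellN p q u v ^ (2 / p - 1) * b ^ 2 + bellE p q u v a b ≤ bellHess p q u v a b := by
  obtain ⟨hq, hθ0, hθ1, -⟩ := conj_bounds hpq hp
  have hN := bellN_pos (p := p) (q := q) hu hv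
  have hX := sq_le_bellN hpq hp hu hv
  have hD := bellD_sq_le hpq hp hu hv a b
  have hE := bellE_nonneg hpq hu hv a b
  unfold bellHess
  rw [show (2 / p - 1) * (2 / p - 2) = (2 / p - 1) * (2 / p - 1 - 1) by ring,
    bellN_rpow_sub_three hu hv, bellN_rpow_sub_two hu hv]
  have hM := Real.rpow_pos_of_pos hN (2 / p - 1)
  set N := bellN p q u v
  set M := N ^ (2 / p - 1)
  set D := bellD p q u v a b
  set E := bellE p q u v a b
  set θ := 2 / p - 1
  have hsq : 0 ≤ M * (b + 2 * θ * v * D / N) ^ 2 := by positivity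
  have hY1 : v ^ 2 * M / N ≤ 1 := (div_le_one hN).2 hX
  have hZ1 : D ^ 2 / N ≤ 2 * q * E := by rw [div_le_iff₀ hN]; linarith
  have hYZ : (v ^ 2 * M / N) * (D ^ 2 / N) ≤ 2 * q * E :=
    (mul_le_of_le_one_left (by positivity) hY1).trans hZ1
  have hYZ0 : 0 ≤ (v ^ 2 * M / N) * (D ^ 2 / N) := by positivity
  have e3 : θ * (θ - 1) * v ^ 2 * (M / N / N) * D ^ 2 =
      θ * (θ - 1) * ((v ^ 2 * M / N) * (D ^ 2 / N)) := by field_simp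
  have h4 : 0 ≤ θ * v ^ 2 * (M / N) * E := by positivity
  have e5 : M * (b + 2 * θ * v * D / N) ^ 2 = M * b ^ 2 + 4 * θ * v * b * (M / N) * D +
      4 * θ ^ 2 * ((v ^ 2 * M / N) * (D ^ 2 / N)) := by field_simp; ring
  rw [e3]; rw [e5] at hsq
  set W := (v ^ 2 * M / N) * (D ^ 2 / N)
  have h6 : (4 * θ ^ 2 + θ * (1 - θ)) * W ≤ 8 * W := by gcongr; nlinarith
  nlinarith

/-- The form of convexity that controls products of gradients. -/
lemma two_mul_le_bellHess_add (a b b' : ℝ) :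
    2 * (p - 1) * (|a| * |b'|) ≤ bellN p q u v ^ (2 / p - 1) * b' ^ 2 + bellE p q u v a b := by
  obtain ⟨hq, hθ0, hθ1, -⟩ := conj_bounds hpq hp
  have hp1 := hpq.sub_one_pos
  have := hpq.symm.sub_one_pos
  have := hpq.symm.pos
  have hM : u ^ (2 - p) ≤ bellN p q u v ^ (2 / p - 1) := by
    calc u ^ (2 - p) = (u ^ p) ^ (2 / p - 1) := by
          rw [← rpow_mul hu.le]; have := hpq.pos; congr 1; field_simp
      _ ≤ _ := by
          apply Real.rpow_le_rpow (by positivity) _ hθ0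
          unfold bellN; linarith [Real.rpow_nonneg hv.le q]
  have hU := Real.rpow_pos_of_pos hu (2 - p)
  have hE : (p - 1) * (u ^ (2 - p))⁻¹ * a ^ 2 ≤ bellE p q u v a b := by
    rw [← rpow_neg hu.le, neg_sub, mul_assoc]
    have h2 : 0 ≤ q * (q - 1) * v ^ (q - 2) * b ^ 2 := by positivity
    have h3 : 0 ≤ (p - 1) * (u ^ (p - 2) * a ^ 2) := by positivity
    unfold bellE; nlinarith
  have hb : (p - 1) * u ^ (2 - p) * b' ^ 2 ≤ bellN p q u v ^ (2 / p - 1) * b' ^ 2 := by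
    gcongr
    exact (mul_le_of_le_one_left hU.le (by linarith)).trans hM
  set U := u ^ (2 - p)
  have key : 2 * (|a| * |b'|) ≤ U⁻¹ * a ^ 2 + U * b' ^ 2 := by
    have h1 : 0 ≤ U⁻¹ * (|a| - U * |b'|) ^ 2 := by positivity
    have h2 : U⁻¹ * (|a| - U * |b'|) ^ 2 = U⁻¹ * |a| ^ 2 + U * |b'| ^ 2 - 2 * (|a| * |b'|) := by
      field_simp; ring
    rw [sq_abs, sq_abs] at h2; linarith
  nlinarith

lemma bell_le : bell p q u v ≤ (16 * q + 2) * bellN p q u v := by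
  have := sq_le_bellN hpq hp hu hv
  unfold bell; linarith

variable (ha : |a| ≤ ρ * u) (hb : |b| ≤ ρ * v)

include ha hb

lemma bellE_le : bellE p q u v a b ≤ ρ ^ 2 * q ^ 2 * bellN p q u v := by
  obtain ⟨hq, -, -, -⟩ := conj_bounds hpq hp
  have hp1 := hpq.sub_one_pos
  have hq1 := hpq.symm.sub_one_pos
  have e1 : u ^ (p - 2) * u ^ 2 = u ^ p := by rw [← Real.rpow_add_natCast hu.ne']; simp
  have e2 : v ^ (q - 2) * v ^ 2 = v ^ q := by rw [← Real.rpow_add_natCast hv.ne']; simp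
  have ha2 : a ^ 2 ≤ ρ ^ 2 * u ^ 2 := by rw [← sq_abs, ← mul_pow]; gcongr
  have hb2 : b ^ 2 ≤ ρ ^ 2 * v ^ 2 := by rw [← sq_abs, ← mul_pow]; gcongr
  have hp0 := hpq.pos
  unfold bellE bellN
  calc _ ≤ p * (p - 1) * u ^ (p - 2) * (ρ ^ 2 * u ^ 2) +
        q * (q - 1) * v ^ (q - 2) * (ρ ^ 2 * v ^ 2) := by gcongr
    _ = ρ ^ 2 * (p * (p - 1) * u ^ p + q * (q - 1) * v ^ q) := by rw [← e1, ← e2]; ring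
    _ ≤ ρ ^ 2 * (q ^ 2 * u ^ p + q ^ 2 * v ^ q) := by gcongr <;> nlinarith
    _ = _ := by ring

variable (hρ : 0 ≤ ρ)

include hρ

lemma abs_bellD_le : |bellD p q u v a b| ≤ ρ * q * bellN p q u v := by
  obtain ⟨hq, -, -, -⟩ := conj_bounds hpq hp
  have hp0 := hpq.pos
  have e1 : u ^ (p - 1) * u = u ^ p := by rw [← Real.rpow_add_one hu.ne']; simp
  have e2 : v ^ (q - 1) * v = v ^ q := by rw [← Real.rpow_add_one hv.ne']; simp
  unfold bellD bellN
  calc _ ≤ |p * u ^ (p - 1) * a| + |q * v ^ (q - 1) * b| := abs_add_le _ _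
    _ = p * u ^ (p - 1) * |a| + q * v ^ (q - 1) * |b| := by
        rw [abs_mul, abs_mul (q * _), abs_of_nonneg (a := p * _) (by positivity),
          abs_of_nonneg (a := q * _) (by positivity)]
    _ ≤ p * u ^ (p - 1) * (ρ * u) + q * v ^ (q - 1) * (ρ * v) := by gcongr
    _ = ρ * (p * u ^ p + q * v ^ q) := by rw [← e1, ← e2]; ring
    _ ≤ ρ * (q * u ^ p + q * v ^ q) := by gcongr; linarith
    _ = _ := by ring

lemma abs_bellDeriv_le :
    |bellDeriv p q u v a b| ≤ 20 * q ^ 3 * ρ * bellN p q u v := by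
  obtain ⟨hq, hθ0, hθ1, -⟩ := conj_bounds hpq hp
  have hN := bellN_pos (p := p) (q := q) hu hv
  have hX := sq_le_bellN hpq hp hu hv
  have hD := abs_bellD_le hpq hp hu hv ha hb hρ
  unfold bellDeriv; rw [bellN_rpow_sub_two hu hv]
  set N := bellN p q u v
  set M := N ^ (2 / p - 1)
  set D := bellD p q u v a b
  set θ := 2 / p - 1
  have hY1 : v ^ 2 * M / N ≤ 1 := (div_le_one hN).2 hX
  have t1 : |2 * v * b * M| ≤ 2 * ρ * N := by
    rw [abs_mul, abs_mul, abs_of_pos (by positivity : 0 < 2 * v), abs_of_pos (by positivity : 0 < M)]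
    calc 2 * v * |b| * M ≤ 2 * v * (ρ * v) * M := by gcongr
      _ = 2 * ρ * (v ^ 2 * M) := by ring
      _ ≤ _ := by gcongr
  have t2 : |v ^ 2 * (θ * (M / N) * D)| ≤ 1 * 1 * |D| := by
    rw [show v ^ 2 * (θ * (M / N) * D) = θ * (v ^ 2 * M / N) * D by ring, abs_mul,
      abs_of_nonneg (by positivity)]
    gcongr
  have t3 : |(16 * q + 1) * D| ≤ (16 * q + 1) * (ρ * q * N) := by
    rw [abs_mul, abs_of_pos (by linarith)]; gcongr
  calc _ ≤ |2 * v * b * M| + |v ^ 2 * (θ * (M / N) * D)| + |(16 * q + 1) * D| := abs_add_three _ _ _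
    _ ≤ (2 + 2 * q + 16 * q ^ 2) * ρ * N := by linarith
    _ ≤ _ := by gcongr; nlinarith

lemma abs_bellHess_le :
    |bellHess p q u v a b| ≤ 20 * q ^ 3 * ρ ^ 2 * bellN p q u v := by
  obtain ⟨hq, hθ0, hθ1, -⟩ := conj_bounds hpq hp
  have hN := bellN_pos (p := p) (q := q) hu hv
  have hX := sq_le_bellN hpq hp hu hv
  have hD := abs_bellD_le hpq hp hu hv ha hb hρ
  have hE := bellE_le hpq hp hu hv ha hb
  have hE0 := bellE_nonneg hpq hu hv a b
  unfold bellHess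
  rw [show (2 / p - 1) * (2 / p - 2) = (2 / p - 1) * (2 / p - 1 - 1) by ring,
    bellN_rpow_sub_three hu hv, bellN_rpow_sub_two hu hv]
  set N := bellN p q u v
  set M := N ^ (2 / p - 1)
  set D := bellD p q u v a b
  set E := bellE p q u v a b
  set θ := 2 / p - 1
  have hY1 : v ^ 2 * M / N ≤ 1 := (div_le_one hN).2 hX
  have hD2 : D ^ 2 ≤ (ρ * q * N) ^ 2 := by rw [← sq_abs]; gcongr
  have t1 : |2 * b ^ 2 * M| ≤ 2 * ρ ^ 2 * N := by
    rw [abs_of_nonneg (by positivity), ← sq_abs]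
    calc 2 * |b| ^ 2 * M ≤ 2 * (ρ * v) ^ 2 * M := by gcongr
      _ = 2 * ρ ^ 2 * (v ^ 2 * M) := by ring
      _ ≤ _ := by gcongr
  have t2 : |4 * θ * v * b * (M / N) * D| ≤ 4 * q * ρ ^ 2 * N := by
    rw [abs_mul, abs_mul, abs_mul, abs_of_nonneg (by positivity : 0 ≤ 4 * θ * v),
      abs_of_pos (by positivity : 0 < M / N)]
    calc _ ≤ 4 * 1 * v * (ρ * v) * (M / N) * (ρ * q * N) := by gcongr
      _ = 4 * q * ρ ^ 2 * N * (v ^ 2 * M / N) := by ring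
      _ ≤ _ := mul_le_of_le_one_right (by positivity) hY1
  have t3 : |θ * (θ - 1) * v ^ 2 * (M / N / N) * D ^ 2| ≤ q ^ 2 * ρ ^ 2 * N := by
    have h1θ : 0 ≤ 1 - θ := by linarith
    rw [show θ * (θ - 1) * v ^ 2 * (M / N / N) * D ^ 2 =
      -((θ * (1 - θ)) * ((v ^ 2 * M / N) * (D ^ 2 / N))) by field_simp; ring, abs_neg,
      abs_of_nonneg (by positivity)]
    have : D ^ 2 / N ≤ q ^ 2 * ρ ^ 2 * N := by rw [div_le_iff₀ hN]; linarith
    calc _ ≤ 1 * (1 * (q ^ 2 * ρ ^ 2 * N)) := by gcongr; nlinarith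
      _ = _ := by ring
  have t4 : |θ * v ^ 2 * (M / N) * E| ≤ 1 * 1 * E := by
    rw [show θ * v ^ 2 * (M / N) * E = θ * (v ^ 2 * M / N) * E by ring,
      abs_of_nonneg (by positivity)]
    gcongr
  have t5 : |(16 * q + 1) * E| ≤ (16 * q + 1) * (ρ ^ 2 * q ^ 2 * N) := by
    rw [abs_of_nonneg (by positivity)]; gcongr
  refine le_trans ?_ (show (2 + 4 * q + 3 * q ^ 2 + 16 * q ^ 3) * ρ ^ 2 * N ≤ _ by
    gcongr; nlinarith [mul_nonneg (sub_nonneg.2 hq) (sq_nonneg q)])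
  rw [abs_le] at *
  constructor <;> linarith

end Bounds

end

section

/-! ### Derivatives of heat convolutions -/

lemma hasDerivAt_integral_kernel (hf : Integrable f) {κ κ' : ℝ → Vec n → ℝ}
    {s₀ : ℝ} {S : Set ℝ} (hS : S ∈ 𝓝 s₀) (hκ : ∀ s, Continuous (κ s)) (hκC : ∀ y, |κ s₀ y| ≤ C)
    (hκ' : Continuous (κ' s₀)) (hd : ∀ s ∈ S, ∀ y, HasDerivAt (fun s => κ s y) (κ' s y) s)
    (hC : ∀ s ∈ S, ∀ y, |κ' s y| ≤ C) :
    HasDerivAt (fun s => ∫ y, κ s y * f y) (∫ y, κ' s₀ y * f y) s₀ := by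
  refine (hasDerivAt_integral_of_dominated_loc_of_deriv_le (F := fun s y => κ s y * f y)
    (F' := fun s y => κ' s y * f y) (bound := fun y => C * |f y|) hS ?_ ?_ ?_ ?_ ?_ ?_).2
  · exact .of_forall fun s => (hκ s).aestronglyMeasurable.mul hf.1
  · exact hf.bdd_mul (hκ s₀).aestronglyMeasurable (ae_of_all _ hκC)
  · exact hκ'.aestronglyMeasurable.mul hf.1
  · refine ae_of_all _ fun y s hs => ?_
    rw [norm_mul, norm_eq_abs, norm_eq_abs]; gcongr
    exact hC s hs y
  · exact hf.abs.const_mul C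
  · exact ae_of_all _ fun y s hs => (hd s hs y).mul_const (f y)

lemma exists_bound_heat (n : ℕ) (ha : 0 < a) : ∃ C : ℝ, ∀ t, a ≤ t → ∀ x : Vec n,
    |heat t x| ≤ C ∧ (∀ i, |heatGrad i t x| ≤ C) ∧ (∀ i j, |heatHess i j t x| ≤ C) ∧
      |heatLap t x| ≤ C := by
  obtain ⟨C₁, hC₁, h₁⟩ := abs_heatGrad_le n
  obtain ⟨C₂, hC₂, h₂⟩ := abs_heatHess_le n
  obtain ⟨C₃, hC₃, h₃⟩ := abs_heatLap_le n
  have hb : ∀ t, a ≤ t → ∀ x : Vec n, heat t x ≤ (4 * π * a) ^ (-(n : ℝ) / 2) := by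
    intro t ht x
    refine (heat_le_const (ha.trans_le ht) x).trans ?_
    apply Real.rpow_le_rpow_of_nonpos (by positivity) (by gcongr)
    rw [neg_div, neg_nonpos]; positivity
  set D := (4 * π * a) ^ (-(n : ℝ) / 2)
  have hD : 0 < D := by positivity
  refine ⟨D + C₁ * a ^ (-(1 / 2) : ℝ) * D + C₂ * a⁻¹ * D + C₃ * a⁻¹ * D, fun t ht x => ?_⟩
  have ht0 := ha.trans_le ht
  have k1 : 0 ≤ C₁ * a ^ (-(1 / 2) : ℝ) * D := by positivity
  have k2 : 0 ≤ C₂ * a⁻¹ * D := by positivity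
  have k3 : 0 ≤ C₃ * a⁻¹ * D := by positivity
  have hp := heat_pos (n := n) (t := 2 * t) (by positivity) x
  have h2 := hb (2 * t) (by linarith) x
  have hinv : t⁻¹ ≤ a⁻¹ := inv_anti₀ ha ht
  refine ⟨?_, fun i => ?_, fun i j => ?_, ?_⟩
  · rw [abs_of_pos (heat_pos ht0 x)]; linarith [hb t ht x]
  · refine (h₁ t ht0 i x).trans ?_
    have : t ^ (-(1 / 2) : ℝ) ≤ a ^ (-(1 / 2) : ℝ) :=
      Real.rpow_le_rpow_of_nonpos ha ht (by norm_num)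
    have : C₁ * t ^ (-(1 / 2) : ℝ) * heat (2 * t) x ≤ C₁ * a ^ (-(1 / 2) : ℝ) * D := by gcongr
    linarith
  · refine (h₂ t ht0 i j x).trans ?_
    have : C₂ * t⁻¹ * heat (2 * t) x ≤ C₂ * a⁻¹ * D := by gcongr
    linarith
  · refine (h₃ t ht0 x).trans ?_
    have : C₃ * t⁻¹ * heat (2 * t) x ≤ C₃ * a⁻¹ * D := by gcongr
    linarith

lemma hasDerivAt_conv_heat_line (hf : Integrable f) (ht : 0 < t) (k : Fin n) (x : Vec n) (s : ℝ) :
    HasDerivAt (fun s : ℝ => conv (heat t) f (x + s • single k (1 : ℝ)))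
      (conv (heatGrad k t) f (x + s • single k (1 : ℝ))) s := by
  obtain ⟨C, hC⟩ := exists_bound_heat n ht
  refine hasDerivAt_integral_kernel hf (κ := fun s y => heat t (x + s • single k (1 : ℝ) - y))
    (κ' := fun s y => heatGrad k t (x + s • single k (1 : ℝ) - y)) (C := C)
    univ_mem (fun s => by fun_prop) (fun y => (hC t le_rfl _).1) (by fun_prop) ?_
    (fun s _ y => (hC t le_rfl _).2.1 k)
  intro s _ y
  have := hasDerivAt_heat_line (t := t) k (x - y) s
  simpa only [add_sub_right_comm] using this

lemma hasDerivAt_conv_heatGrad_line (hf : Integrable f) (ht : 0 < t)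
    (i k : Fin n) (x : Vec n) (s : ℝ) :
    HasDerivAt (fun s : ℝ => conv (heatGrad i t) f (x + s • single k (1 : ℝ)))
      (conv (heatHess i k t) f (x + s • single k (1 : ℝ))) s := by
  obtain ⟨C, hC⟩ := exists_bound_heat n ht
  refine hasDerivAt_integral_kernel hf (κ := fun s y => heatGrad i t (x + s • single k (1 : ℝ) - y))
    (κ' := fun s y => heatHess i k t (x + s • single k (1 : ℝ) - y)) (C := C)
    univ_mem (fun s => by fun_prop) (fun y => (hC t le_rfl _).2.1 i) (by fun_prop) ?_
    (fun s _ y => (hC t le_rfl _).2.2.1 i k)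
  intro s _ y
  have := hasDerivAt_heatGrad_line (t := t) i k (x - y) s
  simpa only [add_sub_right_comm] using this

lemma hasDerivAt_conv_heat_time (hf : Integrable f) (ht : 0 < t) (x : Vec n) :
    HasDerivAt (fun t : ℝ => conv (heat t) f x) (conv (heatLap t) f x) t := by
  obtain ⟨C, hC⟩ := exists_bound_heat n (half_pos ht)
  refine hasDerivAt_integral_kernel hf
    (κ := fun t y => heat t (x - y)) (κ' := fun t y => heatLap t (x - y)) (C := C)
    (S := Ioi (t / 2)) (Ioi_mem_nhds (by linarith)) (fun s => by fun_prop)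
    (fun y => (hC t (by linarith) _).1) (by fun_prop) ?_
    (fun s hs y => (hC s (le_of_lt hs) _).2.2.2)
  intro s hs y
  exact hasDerivAt_heat_time ((half_pos ht).trans hs) (x - y)

lemma conv_heatHess_integrable (hf : Integrable f) (ht : 0 < t)
    (i j : Fin n) (x : Vec n) : Integrable (fun y => heatHess i j t (x - y) * f y) := by
  obtain ⟨C, hC⟩ := exists_bound_heat n ht
  exact hf.bdd_mul (by fun_prop) (ae_of_all _ fun y => (hC t le_rfl _).2.2.1 i j)

lemma conv_heatLap_eq_sum (hf : Integrable f) (ht : 0 < t) (x : Vec n) :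
    conv (heatLap t) f x = ∑ k, conv (heatHess k k t) f x := by
  simp only [conv, heatLap, sum_mul]
  exact integral_finsetSum _ fun k _ => conv_heatHess_integrable hf ht k k x

/-- If the shifted function of `s` is differentiable at `0`, for all base points, then the
conclusions of the one-dimensional lemmas hold as line derivatives. -/
lemma hasLineDerivAt_of_line {g' : Vec n → ℝ} {k : Fin n}
    (h : ∀ x, HasDerivAt (fun s : ℝ => g (x + s • single k (1 : ℝ))) (g' x) 0)
    (x : Vec n) : HasLineDerivAt ℝ g (g' x) x (single k (1 : ℝ)) := h x

lemma integral_lineDeriv_eq_zero {g' : Vec n → ℝ} {v : Vec n} (hg : Integrable g)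
    (hg' : Integrable g') (h : ∀ x, HasLineDerivAt ℝ g (g' x) x v) : ∫ x, g' x = 0 := by
  have := integral_bilinear_hasLineDerivAt_right_eq_neg_left_of_integrable (μ := volume)
    (f := fun _ : Vec n => (1 : ℝ)) (f' := fun _ => (0 : ℝ)) (g := g) (g' := g') (v := v)
    (B := ContinuousLinearMap.mul ℝ ℝ) (by simp) (by simpa using hg') (by simpa using hg)
    (fun x _ => hasDerivAt_const (0 : ℝ) (1 : ℝ))
    (fun x _ => h x)
  simpa using this

lemma integral_heatHess (ht : 0 < t) (i j : Fin n) : ∫ x : Vec n, heatHess i j t x = 0 := by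
  refine integral_lineDeriv_eq_zero (g := heatGrad i t) (v := single j (1 : ℝ))
    (integrable_heatGrad ht i) (integrable_heatHess ht i j) fun x => ?_
  refine hasLineDerivAt_of_line (fun x => ?_) x
  simpa using hasDerivAt_heatGrad_line (t := t) i j x 0

/-- `∂ᵢ p_s * p_t = ∂ᵢ p_{s+t}`. -/
lemma conv_heatGrad_heat (hs : 0 < s) (ht : 0 < t) (i : Fin n) :
    conv (heatGrad i s) (heat t) = (heatGrad i (s + t) : Vec n → ℝ) := by
  funext x
  have h1 := hasDerivAt_conv_heat_line (integrable_heat (n := n) ht) hs i x 0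
  rw [conv_heat_heat hs ht] at h1
  have h2 := hasDerivAt_heat_line (t := s + t) i x 0
  simpa using h1.unique h2

/-- `∂ᵢ∂ⱼ p_s * p_t = ∂ᵢ∂ⱼ p_{s+t}`. -/
lemma conv_heatHess_heat (hs : 0 < s) (ht : 0 < t) (i j : Fin n) :
    conv (heatHess i j s) (heat t) = (heatHess i j (s + t) : Vec n → ℝ) := by
  funext x
  have h1 := hasDerivAt_conv_heatGrad_line (integrable_heat (n := n) ht) hs i j x 0
  rw [conv_heatGrad_heat hs ht] at h1
  have h2 := hasDerivAt_heatGrad_line (t := s + t) i j x 0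
  simpa using h1.unique h2

/-- `∂ᵢ p_s * ∂ⱼ p_t = ∂ᵢ∂ⱼ p_{s+t}`. -/
lemma conv_heatGrad_heatGrad (hs : 0 < s) (ht : 0 < t) (i j : Fin n) :
    conv (heatGrad i s) (heatGrad j t) = (heatHess i j (s + t) : Vec n → ℝ) := by
  funext x
  have h1 := hasDerivAt_conv_heat_line (integrable_heatGrad (n := n) hs i) ht j x 0
  rw [conv_comm (heat t), conv_heatGrad_heat hs ht, conv_comm (heatGrad j t)] at h1
  have h2 := hasDerivAt_heatGrad_line (t := s + t) i j x 0
  simpa using h1.unique h2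

end

section

/-! ### The Bellman function along the heat flow -/

/-- Nonnegative, bounded and boundedly supported functions that do not vanish almost everywhere. -/
structure IsBump (M R : ℝ) (f : Vec n → ℝ) : Prop where
  meas : Measurable f
  nonneg : ∀ x, 0 ≤ f x
  le : ∀ x, f x ≤ M
  supp : ∀ x, R < ‖x‖ → f x = 0
  R_nonneg : 0 ≤ R
  integral_pos : 0 < ∫ x, f x

namespace IsBump

variable {M R : ℝ}

lemma exists_le_heat (hf : IsBump M R f) : ∃ C : ℝ, 0 < C ∧ ∀ x, |f x| ≤ C * heat 1 x := by
  set D := (4 * π * 1) ^ (-(n : ℝ) / 2) * exp (-(R ^ 2 / (4 * 1)))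
  have hD : 0 < D := by positivity
  refine ⟨(|M| + 1) / D, by positivity, fun x => ?_⟩
  rw [abs_of_nonneg (hf.nonneg x)]
  rcases lt_or_ge R ‖x‖ with h | h
  · rw [hf.supp x h]
    have := heat_pos one_pos x
    positivity
  · have h1 : D ≤ heat 1 x := by
      unfold heat; simp only [D]; gcongr
    calc f x ≤ |M| + 1 := by linarith [hf.le x, le_abs_self M]
      _ = (|M| + 1) / D * D := by field_simp
      _ ≤ _ := by gcongr

lemma integrable (hf : IsBump M R f) : Integrable f := by
  obtain ⟨C, hC, h⟩ := hf.exists_le_heat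
  exact ((integrable_heat one_pos).const_mul C).mono' hf.meas.aestronglyMeasurable (ae_of_all _ h)

lemma integrable_heat_mul (hf : IsBump M R f) (ht : 0 < t) (x : Vec n) :
    Integrable (fun y => heat t (x - y) * f y) := by
  obtain ⟨C, hC⟩ := exists_bound_heat n ht
  exact hf.integrable.bdd_mul (by fun_prop) (ae_of_all _ fun y => (hC t le_rfl _).1)

lemma conv_heat_pos (hf : IsBump M R f) (ht : 0 < t) (x : Vec n) : 0 < conv (heat t) f x := by
  have h := (integral_pos_iff_support_of_nonneg hf.nonneg hf.integrable).1 hf.integral_pos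
  refine (integral_pos_iff_support_of_nonneg (fun y => mul_nonneg (heat_pos ht _).le (hf.nonneg y))
    (hf.integrable_heat_mul ht x)).2 ?_
  have e : (Function.support fun y => heat t (x - y) * f y) = Function.support f := by
    ext y; simp [(heat_pos ht (x - y)).ne']
  rwa [e]

lemma norm_sub_le (hf : IsBump M R f) (x y : Vec n) (h : f y ≠ 0) : ‖x - y‖ ≤ ‖x‖ + R := by
  have : ‖y‖ ≤ R := by by_contra h'; exact h (hf.supp y (not_le.1 h'))
  linarith [_root_.norm_sub_le x y]

lemma abs_conv_le (hf : IsBump M R f) (ht : 0 < t) {x : Vec n} {c : ℝ}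
    (hk : ∀ z, ‖z‖ ≤ ‖x‖ + R → |k z| ≤ c * heat t z) :
    |conv k f x| ≤ c * conv (heat t) f x := by
  simp only [conv]; rw [← integral_const_mul]
  refine abs_integral_le_of_abs_le ((hf.integrable_heat_mul ht x).const_mul c) fun y => ?_
  rcases eq_or_ne (f y) 0 with h | h
  · simp [h]
  · rw [abs_mul, abs_of_nonneg (hf.nonneg y), ← mul_assoc]
    exact mul_le_mul_of_nonneg_right (hk _ (hf.norm_sub_le x y h)) (hf.nonneg y)

lemma exists_deriv_bounds (hf : IsBump M R f) (ha : 0 < a) : ∀ᶠ ρ in atTop, ∀ t, a ≤ t → ∀ x,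
      (∀ i, |conv (heatGrad i t) f x| ≤ ρ * (1 + ‖x‖) * conv (heat t) f x) ∧
      (∀ i j, |conv (heatHess i j t) f x| ≤ (ρ * (1 + ‖x‖)) ^ 2 * conv (heat t) f x) := by
  have hR := hf.R_nonneg
  filter_upwards [eventually_ge_atTop ((1 + R) / (2 * a) + (1 / (2 * a) + 1))] with ρ hρ t ht x
  have ht0 := ha.trans_le ht
  have hx := norm_nonneg x
  have h0 : 0 < 1 / (2 * a) := by positivity
  have h1 {z : Vec n} (hz : ‖z‖ ≤ ‖x‖ + R) : ‖z‖ / (2 * t) ≤ (1 + R) / (2 * a) * (1 + ‖x‖) := by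
    calc ‖z‖ / (2 * t) ≤ (‖x‖ + R) / (2 * a) := by gcongr
      _ ≤ _ := by rw [div_mul_eq_mul_div]; gcongr; nlinarith
  refine ⟨fun i => hf.abs_conv_le ht0 fun z hz => ?_, fun i j => hf.abs_conv_le ht0 fun z hz =>
    (abs_heatHess_le_sq ht0 i j z).trans ?_⟩
  · unfold heatGrad
    rw [abs_mul, abs_of_pos (heat_pos ht0 z), abs_neg, abs_div, abs_of_pos (by positivity : 0 < 2 * t)]
    gcongr
    · exact (heat_pos ht0 z).le
    · calc |z i| / (2 * t) ≤ ‖z‖ / (2 * t) := by gcongr; exact abs_coord_le_norm z i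
        _ ≤ _ := (h1 hz).trans (by gcongr; linarith)
  · gcongr
    · exact (heat_pos ht0 z).le
    · have h2 : ‖z‖ ^ 2 / (4 * t ^ 2) ≤ ((1 + R) / (2 * a) * (1 + ‖x‖)) ^ 2 :=
        calc _ = (‖z‖ / (2 * t)) ^ 2 := by rw [div_pow]; ring
          _ ≤ _ := by gcongr; exact h1 hz
      have h3 : 1 / (2 * t) ≤ 1 / (2 * a) := by gcongr
      have h4 : 0 ≤ (1 + R) / (2 * a) := by positivity
      set A := (1 + R) / (2 * a)
      set B := 1 / (2 * a)
      have h5 : A ^ 2 + B ≤ ρ ^ 2 := by nlinarith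
      rw [mul_pow] at h2 ⊢
      nlinarith [sq_nonneg ‖x‖]

lemma exists_rpow_bound (hf : IsBump M R f) {p : ℝ} (hp : 1 ≤ p) :
    ∀ᶠ C in atTop, ∀ t, 0 < t → t ≤ b → ∀ x, conv (heat t) f x ^ p ≤ C * heat (1 + b) x := by
  obtain ⟨C, hC, h⟩ := hf.exists_le_heat
  rcases le_or_gt b 0 with hb | hb
  · exact .of_forall fun C t ht htb => by linarith
  set D := C * (1 + b) ^ ((n : ℝ) / 2)
  set E := D * (4 * π * (1 + b)) ^ (-(n : ℝ) / 2)
  filter_upwards [eventually_ge_atTop (E ^ (p - 1) * D)] with K hK t ht htb x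
  have hpos := hf.conv_heat_pos ht x
  have h1 : conv (heat t) f x ≤ D * heat (1 + b) x := by
    calc _ ≤ |conv (heat t) f x| := le_abs_self _
      _ ≤ C * heat (t + 1) x := abs_conv_le_of_le_heat ht one_pos h x
      _ ≤ C * ((1 + b) ^ ((n : ℝ) / 2) * heat (1 + b) x) := by
          gcongr
          exact heat_le_mul (by linarith) (by linarith) (by nlinarith) x
      _ = _ := by ring
  have h2 : conv (heat t) f x ≤ E := h1.trans (by
    simp only [E]; gcongr; exact heat_le_const (by linarith) x)
  calc conv (heat t) f x ^ p = conv (heat t) f x ^ (p - 1) * conv (heat t) f x := by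
        rw [← Real.rpow_add_one hpos.ne', sub_add_cancel]
    _ ≤ E ^ (p - 1) * (D * heat (1 + b) x) := by gcongr
    _ ≤ _ := by rw [← mul_assoc]; gcongr; exact (heat_pos (by linarith) x).le

end IsBump

lemma measurable_conv_param {k : ℝ → Vec n → ℝ} (hk : Measurable fun q : ℝ × Vec n => k q.1 q.2)
    (hf : Measurable f) :
    Measurable (fun q : ℝ × Vec n => conv (k q.1) f q.2) := by
  have h1 : Measurable (fun q : (ℝ × Vec n) × Vec n => k q.1.1 (q.1.2 - q.2) * f q.2) := by
    have h2 : Measurable (fun q : (ℝ × Vec n) × Vec n => (q.1.1, q.1.2 - q.2)) := by fun_prop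
    exact (hk.comp h2).mul (hf.comp measurable_snd)
  exact (h1.stronglyMeasurable.integral_prod_right' (ν := volume)).measurable

lemma integrable_sq_mul_heat (ht : 0 < t) :
    Integrable (fun x : Vec n => (1 + ‖x‖) ^ 2 * heat t x) := by
  obtain ⟨C, hC, h⟩ := rpow_norm_mul_heat_le n (m := 2) zero_le_two
  refine (((integrable_heat (n := n) (t := 2 * t) (by positivity)).const_mul (2 * (C * t))).add
    ((integrable_heat ht).const_mul 2)).mono' (by fun_prop) (ae_of_all _ fun x => ?_)
  have hp := heat_pos ht x
  have h1 := h t ht x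
  simp only [Real.rpow_ofNat, div_self (two_ne_zero' ℝ), Real.rpow_one] at h1
  rw [norm_of_nonneg (by positivity)]
  have h2 : (1 + ‖x‖) ^ 2 ≤ 2 * ‖x‖ ^ 2 + 2 := by nlinarith [sq_nonneg (1 - ‖x‖)]
  calc _ ≤ (2 * ‖x‖ ^ 2 + 2) * heat t x := by gcongr
    _ ≤ _ := by simp only [Pi.add_apply]; linarith

section Flow

variable {p q M R M' R' : ℝ}

/-- Along the heat flow the integral of the Bellman function decreases, and its decrease bounds the
space-time integral of the product of the gradients. -/
theorem integral_gradients_le (hpq : p.HolderConjugate q) (hp : p ≤ 2) (hf : IsBump M R f)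
    (hg : IsBump M' R' g) (ha : 0 < a) (hab : a ≤ b) (i j : Fin n) :
    IntegrableOn (fun z : ℝ × Vec n => |conv (heatGrad i z.1) f z.2| * |conv (heatGrad j z.1) g z.2|)
      (Ioc a b ×ˢ Set.univ) ∧
    2 * (p - 1) * ∫ t in Ioc a b, ∫ x, |conv (heatGrad i t) f x| * |conv (heatGrad j t) g x| ≤
    (16 * q + 2) * ∫ x, bellN p q (conv (heat a) f x) (conv (heat a) g x) := by
  obtain ⟨hq, -, -, -⟩ := conj_bounds hpq hp
  have hp1 := hpq.sub_one_pos
  have hb : 0 < b := ha.trans_le hab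
  obtain ⟨ρ, h₁, h₂, k₁, k₂, hρ⟩ := ((hf.exists_deriv_bounds ha).and <|
    (hg.exists_deriv_bounds ha).and <| (hf.exists_rpow_bound (b := b) hpq.lt.le).and <|
    (hg.exists_rpow_bound (b := b) hpq.symm.lt.le).and (eventually_ge_atTop 1)).exists
  set F : ℝ → Vec n → ℝ := fun t => conv (heat t) f
  set G : ℝ → Vec n → ℝ := fun t => conv (heat t) g
  set F1 : Fin n → ℝ → Vec n → ℝ := fun k t => conv (heatGrad k t) f
  set G1 : Fin n → ℝ → Vec n → ℝ := fun k t => conv (heatGrad k t) g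
  set F2 : Fin n → ℝ → Vec n → ℝ := fun k t => conv (heatHess k k t) f
  set G2 : Fin n → ℝ → Vec n → ℝ := fun k t => conv (heatHess k k t) g
  have Fpos {t} (ht : t ∈ Set.Icc a b) (x) : 0 < F t x := hf.conv_heat_pos (ha.trans_le ht.1) x
  have Gpos {t} (ht : t ∈ Set.Icc a b) (x) : 0 < G t x := hg.conv_heat_pos (ha.trans_le ht.1) x
  set N : ℝ → Vec n → ℝ := fun t x => bellN p q (F t x) (G t x)
  have Npos {t} (ht : t ∈ Set.Icc a b) (x) : 0 < N t x := bellN_pos (Fpos ht x) (Gpos ht x)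
  -- the Bellman function along the flow, and its first and second order terms
  set β : ℝ → Vec n → ℝ := fun t x => bell p q (F t x) (G t x)
  set P : Fin n → ℝ → Vec n → ℝ := fun k t x => bellDeriv p q (F t x) (G t x) (F1 k t x) (G1 k t x)
  set Q : Fin n → ℝ → Vec n → ℝ := fun k t x => bellDeriv p q (F t x) (G t x) (F2 k t x) (G2 k t x)
  set H : Fin n → ℝ → Vec n → ℝ := fun k t x => bellHess p q (F t x) (G t x) (F1 k t x) (G1 k t x)
  -- all of them are measurable and dominated by an integrable function of `x`
  set Φ : Vec n → ℝ := fun x =>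
    20 * q ^ 3 * (ρ ^ 2 * ((ρ + ρ) * ((1 + ‖x‖) ^ 2 * heat (1 + b) x)))
  have hΦ : Integrable Φ :=
    (((integrable_sq_mul_heat (by linarith)).const_mul _).const_mul _).const_mul _
  let adm (u : ℝ → Vec n → ℝ) : Prop := (Measurable fun z : ℝ × Vec n => u z.1 z.2) ∧
    ∀ t ∈ Set.Icc a b, ∀ x, |u t x| ≤ 20 * q ^ 3 * (ρ * (1 + ‖x‖)) ^ 2 * N t x
  have dom {u} (hu : adm u) {t} (ht : t ∈ Set.Icc a b) (x) : |u t x| ≤ Φ x := by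
    have e : N t x ≤ (ρ + ρ) * heat (1 + b) x := by
      rw [add_mul]; exact add_le_add (k₁ t (ha.trans_le ht.1) ht.2 x) (k₂ t (ha.trans_le ht.1) ht.2 x)
    calc _ ≤ 20 * q ^ 3 * (ρ * (1 + ‖x‖)) ^ 2 * ((ρ + ρ) * heat (1 + b) x) :=
          (hu.2 t ht x).trans (by gcongr)
      _ = _ := by simp only [Φ]; ring
  have intx {u} (hu : adm u) {t} (ht : t ∈ Set.Icc a b) : Integrable (u t) :=
    hΦ.mono' (hu.1.comp measurable_prodMk_left).aestronglyMeasurable (ae_of_all _ (dom hu ht))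
  set μ := (volume : Measure ℝ).restrict (Ioc a b)
  have aeμ : ∀ᵐ t ∂μ, t ∈ Set.Icc a b :=
    (ae_restrict_mem measurableSet_Ioc).mono fun t ht => Set.Ioc_subset_Icc_self ht
  have aez : ∀ᵐ z ∂(μ.prod (volume : Measure (Vec n))), z.1 ∈ Set.Icc a b :=
    Measure.quasiMeasurePreserving_fst.ae aeμ
  have intz {u} (hu : adm u) : Integrable (fun z : ℝ × Vec n => u z.1 z.2) (μ.prod volume) := by
    refine ((integrable_const (1 : ℝ)).mul_prod hΦ).mono' hu.1.aestronglyMeasurable ?_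
    filter_upwards [aez] with z hz
    rw [one_mul]
    exact dom hu hz z.2
  have mF : Measurable fun z : ℝ × Vec n => F z.1 z.2 := measurable_conv_param (by fun_prop) hf.meas
  have mG : Measurable fun z : ℝ × Vec n => G z.1 z.2 := measurable_conv_param (by fun_prop) hg.meas
  have mF1 (k) : Measurable fun z : ℝ × Vec n => F1 k z.1 z.2 :=
    measurable_conv_param (by fun_prop) hf.meas
  have mG1 (k) : Measurable fun z : ℝ × Vec n => G1 k z.1 z.2 :=
    measurable_conv_param (by fun_prop) hg.meas
  have mF2 (k) : Measurable fun z : ℝ × Vec n => F2 k z.1 z.2 :=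
    measurable_conv_param (by fun_prop) hf.meas
  have mG2 (k) : Measurable fun z : ℝ × Vec n => G2 k z.1 z.2 :=
    measurable_conv_param (by fun_prop) hg.meas
  have aP (k) : adm (P k) := by
    have := mF1 k; have := mG1 k
    refine ⟨by simp only [P, bellDeriv, bellN, bellD]; fun_prop, fun t ht x => ?_⟩
    have := (Npos ht x).le
    refine (abs_bellDeriv_le hpq hp (Fpos ht x) (Gpos ht x)
      ((h₁ t ht.1 x).1 k) ((h₂ t ht.1 x).1 k) (by positivity)).trans ?_
    gcongr
    exact le_self_pow₀ (one_le_mul_of_one_le_of_one_le hρ (by simp)) two_ne_zero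
  have aQ (k) : adm (Q k) := by
    have := mF2 k; have := mG2 k
    exact ⟨by simp only [Q, bellDeriv, bellN, bellD]; fun_prop, fun t ht x =>
      abs_bellDeriv_le hpq hp (Fpos ht x) (Gpos ht x)
        ((h₁ t ht.1 x).2 k k) ((h₂ t ht.1 x).2 k k) (by positivity)⟩
  have aH (k) : adm (H k) := by
    have := mF1 k; have := mG1 k
    exact ⟨by simp only [H, bellHess, bellN, bellD, bellE]; fun_prop, fun t ht x =>
      abs_bellHess_le hpq hp (Fpos ht x) (Gpos ht x)
        ((h₁ t ht.1 x).1 k) ((h₂ t ht.1 x).1 k) (by positivity)⟩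
  have hβN {t} (ht : t ∈ Set.Icc a b) (x) : β t x ≤ (16 * q + 2) * N t x :=
    bell_le hpq hp (Fpos ht x) (Gpos ht x)
  have hβ0 {t} (ht : t ∈ Set.Icc a b) (x) : 0 ≤ β t x := bell_nonneg hpq (Fpos ht x) (Gpos ht x)
  have cN {c t} (ht : t ∈ Set.Icc a b) (x) (hc : c ≤ 20 * q ^ 3) :
      c * N t x ≤ 20 * q ^ 3 * (ρ * (1 + ‖x‖)) ^ 2 * N t x := by
    have := (Npos ht x).le
    gcongr
    exact hc.trans (le_mul_of_one_le_right (by positivity)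
      (one_le_pow₀ (one_le_mul_of_one_le_of_one_le hρ (by simp))))
  have aN : adm N := ⟨by simp only [N, bellN]; fun_prop, fun t ht x => by
    rw [abs_of_pos (Npos ht x), ← one_mul (N t x)]
    exact (cN ht x (by nlinarith [mul_nonneg (sub_nonneg.2 hq) (sq_nonneg q)])).trans
      (by rw [one_mul])⟩
  have aβ : adm β := ⟨by simp only [β, bell, bellN]; fun_prop, fun t ht x => by
    rw [abs_of_nonneg (hβ0 ht x)]
    exact (hβN ht x).trans (cN ht x (by nlinarith [mul_nonneg (sub_nonneg.2 hq) (sq_nonneg q)]))⟩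
  -- integration by parts in space
  have ibp (k) {t} (ht : t ∈ Set.Icc a b) : ∫ x, Q k t x + H k t x = 0 := by
    have ht0 := ha.trans_le ht.1
    refine integral_lineDeriv_eq_zero (g := P k t) (v := single k (1 : ℝ)) (intx (aP k) ht)
      ((intx (aQ k) ht).add (intx (aH k) ht)) fun x => ?_
    refine hasLineDerivAt_of_line (g := P k t) (g' := fun x => Q k t x + H k t x) (k := k)
      (fun x => ?_) x
    have := hasDerivAt_bellDeriv (p := p) (q := q) (f := fun s : ℝ => F t (x + s • single k (1 : ℝ)))
      (g := fun s : ℝ => G t (x + s • single k (1 : ℝ)))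
      (hasDerivAt_conv_heat_line hf.integrable ht0 k x 0)
      (hasDerivAt_conv_heat_line hg.integrable ht0 k x 0)
      (hasDerivAt_conv_heatGrad_line hf.integrable ht0 k k x 0)
      (hasDerivAt_conv_heatGrad_line hg.integrable ht0 k k x 0) (Fpos ht _) (Gpos ht _)
    simpa using this
  -- the evolution in time
  have evo {t} (ht : t ∈ Set.Icc a b) (x) : HasDerivAt (fun t => β t x) (∑ k, Q k t x) t := by
    have ht0 := ha.trans_le ht.1
    refine (hasDerivAt_bell (p := p) (q := q) (hasDerivAt_conv_heat_time hf.integrable ht0 x)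
      (hasDerivAt_conv_heat_time hg.integrable ht0 x) (Fpos ht x) (Gpos ht x)).congr_deriv ?_
    rw [conv_heatLap_eq_sum hf.integrable ht0, conv_heatLap_eq_sum hg.integrable ht0]
    simp only [Q, bellDeriv, bellD, Finset.sum_add_distrib, ← mul_sum, ← sum_mul, F2, G2, F, G]
  have ftc (x) : β b x - β a x = ∫ t, ∑ k, Q k t x ∂μ := by
    rw [← integral_of_le hab, intervalIntegral.integral_eq_sub_of_hasDerivAt (f := fun t => β t x)
      (fun t ht => evo (Set.uIcc_of_le hab ▸ ht) x)]
    rw [intervalIntegrable_iff_integrableOn_Ioc_of_le hab]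
    refine integrable_finsetSum _ fun k _ => (integrable_const (Φ x)).mono'
      ((aQ k).1.comp measurable_prodMk_right).aestronglyMeasurable ?_
    filter_upwards [aeμ] with t ht
    exact dom (aQ k) ht x
  have ia : a ∈ Set.Icc a b := ⟨le_rfl, hab⟩
  have ib : b ∈ Set.Icc a b := ⟨hab, le_rfl⟩
  have total : ∫ t, (∫ x, ∑ k, H k t x) ∂μ = (∫ x, β a x) - ∫ x, β b x := by
    rw [← neg_sub, ← integral_sub (intx aβ ib) (intx aβ ia), integral_congr_all ftc,
      ← integral_integral_swap (f := fun t x => ∑ k, Q k t x)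
        (integrable_finsetSum _ fun k _ => intz (aQ k)), ← integral_neg]
    refine integral_congr_ae ?_
    filter_upwards [aeμ] with t ht
    rw [integral_finsetSum _ fun k _ => intx (aH k) ht,
      integral_finsetSum _ fun k _ => intx (aQ k) ht, ← Finset.sum_neg_distrib]
    refine sum_congr rfl fun k _ => ?_
    have := ibp k ht
    rw [integral_add (intx (aQ k) ht) (intx (aH k) ht)] at this; linarith
  have lower {t} (ht : t ∈ Set.Icc a b) (x) :
      2 * (p - 1) * (|F1 i t x| * |G1 j t x|) ≤ ∑ k, H k t x := by
    refine (two_mul_le_bellHess_add hpq hp (Fpos ht x) (Gpos ht x) (F1 i t x) (G1 i t x)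
      (G1 j t x)).trans (le_trans ?_ (Finset.sum_le_sum fun k _ =>
        bellHess_ge hpq hp (Fpos ht x) (Gpos ht x) _ _))
    rw [Finset.sum_add_distrib]
    have := Npos ht x
    exact add_le_add (Finset.single_le_sum (f := fun k => N t x ^ (2 / p - 1) * G1 k t x ^ 2)
        (fun k _ => by positivity) (Finset.mem_univ j))
      (Finset.single_le_sum (f := fun k => bellE p q (F t x) (G t x) (F1 k t x) (G1 k t x))
        (fun k _ => bellE_nonneg hpq (Fpos ht x) (Gpos ht x) _ _) (Finset.mem_univ i))
  have hHz : Integrable (fun z : ℝ × Vec n => ∑ k, H k z.1 z.2) (μ.prod volume) :=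
    integrable_finsetSum _ fun k _ => intz (aH k)
  have hprod : Integrable (fun z : ℝ × Vec n => |F1 i z.1 z.2| * |G1 j z.1 z.2|)
      (μ.prod volume) := by
    refine (hHz.const_mul ((2 * (p - 1))⁻¹)).mono'
      (((mF1 i).abs).mul ((mG1 j).abs)).aestronglyMeasurable ?_
    filter_upwards [aez] with z hz
    rw [norm_of_nonneg (by positivity), ← div_eq_inv_mul, le_div_iff₀' (by linarith)]
    exact lower hz z.2
  have hset : μ.prod (volume : Measure (Vec n)) =
      (volume : Measure (ℝ × Vec n)).restrict (Ioc a b ×ˢ Set.univ) := by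
    rw [Measure.volume_eq_prod, ← Measure.prod_restrict, Measure.restrict_univ]
  refine ⟨by rw [IntegrableOn, ← hset]; exact hprod, ?_⟩
  calc 2 * (p - 1) * ∫ t, (∫ x, |F1 i t x| * |G1 j t x|) ∂μ
      = ∫ t, (∫ x, 2 * (p - 1) * (|F1 i t x| * |G1 j t x|)) ∂μ := by simp_rw [integral_const_mul]
    _ ≤ ∫ t, (∫ x, ∑ k, H k t x) ∂μ := by
        refine integral_mono_ae (hprod.const_mul (2 * (p - 1))).integral_prod_left
          hHz.integral_prod_left ?_
        filter_upwards [aeμ] with t ht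
        exact integral_mono_of_nonneg (ae_of_all _ fun x => by simp only [Pi.zero_apply]; positivity)
          (integrable_finsetSum _ fun k _ => intx (aH k) ht) (ae_of_all _ fun x => lower ht x)
    _ ≤ ∫ x, β a x := by rw [total]; linarith [integral_nonneg (μ := volume) (f := β b) (hβ0 ib)]
    _ ≤ ∫ x, (16 * q + 2) * N a x :=
        integral_mono (intx aβ ia) ((intx aN ia).const_mul _) fun x => hβN ia x
    _ = _ := by rw [integral_const_mul]

end Flow

end

section

/-! ### Kernels averaged over a parameter -/

section TimeAverage

variable {μ : Measure ℝ} {k : ℝ → Vec n → ℝ}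

lemma measurable_comp_sub_param (hkm : Measurable fun w : ℝ × Vec n => k w.1 w.2) :
    Measurable (fun w : ℝ × (Vec n × Vec n) => k w.1 (w.2.1 - w.2.2)) :=
  hkm.comp (by fun_prop : Measurable fun w : ℝ × (Vec n × Vec n) => (w.1, w.2.1 - w.2.2))

/-- Young's inequality for a family of kernels with integrable `L¹` norms. -/
lemma integrable_kernel_param [HolderConjugate P Q]
    (hkm : Measurable fun w : ℝ × Vec n => k w.1 w.2)
    (hk : Integrable (fun w : ℝ × Vec n => k w.1 w.2) (μ.prod volume))
    (hf : MemLp f P) (hg : MemLp g Q) :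
    Integrable (fun w : ℝ × (Vec n × Vec n) => k w.1 (w.2.1 - w.2.2) * f w.2.2 * g w.2.1)
      (μ.prod volume) := by
  have hm : AEStronglyMeasurable (fun w : ℝ × (Vec n × Vec n) =>
      k w.1 (w.2.1 - w.2.2) * f w.2.2 * g w.2.1) (μ.prod volume) :=
    ((measurable_comp_sub_param hkm).aestronglyMeasurable.mul hf.1.comp_snd.comp_snd).mul
        (hg.1.comp_fst (ν := volume)).comp_snd
  refine ⟨hm, ?_⟩
  have hfin : eLpNorm f P volume * eLpNorm g Q volume < ∞ := mul_lt_top hf.2 hg.2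
  rw [HasFiniteIntegral, lintegral_prod _ hm.enorm]
  calc ∫⁻ t, (∫⁻ z : Vec n × Vec n, ‖k t (z.1 - z.2) * f z.2 * g z.1‖ₑ) ∂μ
      ≤ ∫⁻ t, (∫⁻ x, ‖k t x‖ₑ) * (eLpNorm f P volume * eLpNorm g Q volume) ∂μ := by
        refine lintegral_mono fun t => ?_
        have hkt : AEStronglyMeasurable (k t) :=
          (hkm.comp measurable_prodMk_left).aestronglyMeasurable
        have h := lintegral_kernel_le hkt hf.1 hg.1 P Q
        rw [eLpNorm_one_eq_lintegral_enorm, mul_assoc] at h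
        exact (lintegral_enorm_kernel hkt hf.1 hg.1).trans_le h
    _ = (∫⁻ t, (∫⁻ x, ‖k t x‖ₑ) ∂μ) * (eLpNorm f P volume * eLpNorm g Q volume) :=
        lintegral_mul_const' _ _ hfin.ne
    _ < ∞ := by
        refine mul_lt_top ?_ hfin
        have := hk.2
        rwa [HasFiniteIntegral, lintegral_prod _ hk.1.enorm] at this

lemma integral_conv_param_mul [SFinite μ] [HolderConjugate P Q]
    (hkm : Measurable fun w : ℝ × Vec n => k w.1 w.2)
    (hk : Integrable (fun w : ℝ × Vec n => k w.1 w.2) (μ.prod volume))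
    (hf : MemLp f P) (hg : MemLp g Q) :
    ∫ x, conv (fun x => ∫ t, k t x ∂μ) f x * g x = ∫ t, (∫ x, conv (k t) f x * g x) ∂μ := by
  have hint := integrable_kernel_param hkm hk hf hg
  rw [integral_conv_mul_eq hk.integral_prod_right hf hg]
  calc _ = ∫ z : Vec n × Vec n, ∫ t, k t (z.1 - z.2) * f z.2 * g z.1 ∂μ := by
        refine integral_congr_all fun z => ?_
        rw [← integral_mul_const, ← integral_mul_const]
    _ = ∫ t, (∫ z : Vec n × Vec n, k t (z.1 - z.2) * f z.2 * g z.1) ∂μ :=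
        (integral_integral_swap hint).symm
    _ = _ := by
        exact integral_congr_ae (hk.prod_right_ae.mono fun t ht =>
          (integral_conv_mul_eq ht hf hg).symm)

end TimeAverage

/-! ### Truncated Riesz transforms -/

/-- The truncated kernel `∫_a^b ∂ᵢ∂ⱼ p_t dt` of the second order Riesz transform. -/
def hessKernel (i j : Fin n) (a b : ℝ) (x : Vec n) : ℝ := ∫ t in Ioc a b, heatHess i j t x

lemma hessKernel_neg (i j : Fin n) (a b : ℝ) (x : Vec n) :
    hessKernel i j a b (-x) = hessKernel i j a b x := by
  simp [hessKernel, heatHess_neg]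

lemma exists_abs_heatHess_le (ha : 0 < a) (n : ℕ) :
    ∃ C : ℝ, 0 < C ∧ ∀ t, a ≤ t → t ≤ b → ∀ (i j : Fin n) (x : Vec n),
      |heatHess i j t x| ≤ C * heat (2 * b) x := by
  obtain ⟨C, hC, h⟩ := abs_heatHess_le n
  rcases lt_or_ge b a with hab | hab
  · exact ⟨1, one_pos, fun t h1 h2 => by linarith⟩
  have hb := ha.trans_le hab
  refine ⟨C * a⁻¹ * (b / a) ^ ((n : ℝ) / 2), by positivity, fun t hat htb i j x => ?_⟩
  have ht := ha.trans_le hat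
  have h2 := heat_le_mul (s := 2 * t) (t := 2 * b) (c := b / a) (by positivity) (by linarith)
    (by rw [div_mul_eq_mul_div, le_div_iff₀ ha]; nlinarith) x
  have := heat_pos (t := 2 * t) (by positivity) x
  calc _ ≤ C * t⁻¹ * heat (2 * t) x := h t ht i j x
    _ ≤ C * a⁻¹ * ((b / a) ^ ((n : ℝ) / 2) * heat (2 * b) x) := by gcongr
    _ = _ := by ring

lemma integrable_heatHess_prod (ha : 0 < a) (i j : Fin n) :
    Integrable (fun w : ℝ × Vec n => heatHess i j w.1 w.2)
      ((volume.restrict (Ioc a b)).prod volume) := by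
  obtain ⟨C, hC, h⟩ := exists_abs_heatHess_le (b := b) ha n
  rcases le_or_gt b a with hab | hab
  · simp [Set.Ioc_eq_empty (not_lt.2 hab)]
  refine ((integrable_const (1 : ℝ)).mul_prod ((integrable_heat (t := 2 * b)
    (by linarith)).const_mul C)).mono' (measurable_heatHess_uncurry i j).aestronglyMeasurable ?_
  filter_upwards [Measure.quasiMeasurePreserving_fst.ae (ae_restrict_mem measurableSet_Ioc)]
    with w hw
  rw [one_mul]
  exact h w.1 hw.1.le hw.2 i j w.2

lemma integrableOn_heatHess_time (ha : 0 < a) (i j : Fin n) (x : Vec n) :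
    IntegrableOn (fun t => heatHess i j t x) (Ioc a b) := by
  obtain ⟨C, hC, h⟩ := exists_abs_heatHess_le (b := b) ha n
  have hm : Measurable (fun t : ℝ => heatHess i j t x) :=
    (measurable_heatHess_uncurry i j).comp measurable_prodMk_right
  refine (integrable_const (C * heat (2 * b) x)).mono' hm.aestronglyMeasurable ?_
  filter_upwards [ae_restrict_mem measurableSet_Ioc] with t ht
  exact h t ht.1.le ht.2 i j x

lemma measurable_hessKernel (i j : Fin n) (a b : ℝ) : Measurable (hessKernel i j a b) := by
  have h1 : Measurable fun q : Vec n × ℝ => heatHess i j q.2 q.1 := by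
    have h2 : Measurable (fun q : Vec n × ℝ => (q.2, q.1)) := by fun_prop
    exact (measurable_heatHess_uncurry i j).comp h2
  exact (h1.stronglyMeasurable.integral_prod_right').measurable

lemma exists_abs_hessKernel_le (ha : 0 < a) (hab : a ≤ b) (n : ℕ) :
    ∃ C : ℝ, 0 < C ∧ ∀ (i j : Fin n) (x : Vec n), |hessKernel i j a b x| ≤ C * heat (2 * b) x := by
  obtain ⟨C, hC, h⟩ := exists_abs_heatHess_le (b := b) ha n
  refine ⟨C * (b - a) + 1, by nlinarith [hC.le], fun i j x => ?_⟩
  have hp := heat_pos (t := 2 * b) (by linarith) x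
  have e : ∫ _t in Ioc a b, C * heat (2 * b) x = (b - a) * (C * heat (2 * b) x) := by simp [hab]
  calc |hessKernel i j a b x| ≤ ∫ _t in Ioc a b, C * heat (2 * b) x := by
        unfold hessKernel; rw [← norm_eq_abs]
        refine norm_integral_le_of_norm_le (integrable_const _) ?_
        filter_upwards [ae_restrict_mem measurableSet_Ioc] with t ht
        exact h t ht.1.le ht.2 i j x
    _ ≤ _ := by rw [e]; nlinarith

lemma integrable_hessKernel (ha : 0 < a) (i j : Fin n) : Integrable (hessKernel i j a b) :=
  (integrable_heatHess_prod ha i j).integral_prod_right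

/-- The pairing `⟨k * f, g⟩`. -/
def convPairing (k f g : Vec n → ℝ) : ℝ := ∫ z : Vec n × Vec n, k (z.1 - z.2) * f z.2 * g z.1

lemma convPairing_swap (hk : ∀ x, k (-x) = k x) (f g : Vec n → ℝ) :
    convPairing k f g = convPairing k g f := by
  unfold convPairing; rw [Measure.volume_eq_prod, ← integral_prod_swap]
  refine integral_congr_all fun z => ?_
  simp only [Prod.fst_swap, Prod.snd_swap]; rw [← hk, neg_sub]; ring

section Pairing

variable [HolderConjugate P Q]

lemma convPairing_hessKernel (hf : MemLp f P) (hg : MemLp g Q) (ha : 0 < a) (i j : Fin n) :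
    convPairing (hessKernel i j a b) f g =
      ∫ t in Ioc a b, ∫ x, conv (heatHess i j t) f x * g x :=
  (integral_conv_mul_eq (integrable_hessKernel ha i j) hf hg).symm.trans
    (integral_conv_param_mul (measurable_heatHess_uncurry i j)
      (integrable_heatHess_prod ha i j) hf hg)

lemma integral_conv_heatHess_mul (hP : 1 < P) (hPt : P ≠ ∞) (hf : MemLp f P) (hg : MemLp g Q)
    (ht : 0 < t) (i j : Fin n) :
    ∫ x, conv (heatHess i j (2 * t)) f x * g x =
      -∫ x, conv (heatGrad j t) f x * conv (heatGrad i t) g x := by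
  have h1 := conv_conv (integrable_heatGrad ht i) (integrable_heatGrad ht j) hP.le hPt hf
  rw [conv_heatGrad_heatGrad ht ht, ← two_mul] at h1
  rw [← integral_neg, integral_congr_ae (g := fun x => conv (heatGrad i t) (conv (heatGrad j t) f) x
    * g x) (by filter_upwards [h1] with x hx; rw [hx]),
    integral_conv_mul (integrable_heatGrad ht i)
      (MemLp.conv (integrable_heatGrad ht j) hP.le hPt hf) hg]
  refine integral_congr_all fun x => ?_
  simp only [heatGrad_neg, conv, neg_mul, integral_neg, mul_neg]

end Pairing

lemma integral_rpow_eq (hP : P ≠ 0) (hPt : P ≠ ∞) (hf : MemLp f P)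
    (h0 : ∀ x, 0 ≤ f x) : ∫ x, f x ^ P.toReal = (eLpNorm f P).toReal ^ P.toReal := by
  have hp : 0 < P.toReal := ENNReal.toReal_pos hP hPt
  have hi : 0 ≤ ∫ x, ‖f x‖ ^ P.toReal := integral_nonneg fun x => by positivity
  rw [hf.eLpNorm_eq_integral_rpow_norm hP hPt, ENNReal.toReal_ofReal (by positivity),
    ← rpow_mul hi, inv_mul_cancel₀ hp.ne', Real.rpow_one]
  simp only [norm_of_nonneg (h0 _)]

section Bump

variable {M R M' R' : ℝ}

lemma IsBump.memLp (hf : IsBump M R f) (hP : 1 ≤ P) : MemLp f P :=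
  memLp_of_integrable_of_bound hf.integrable (C := M)
    (fun x => by rw [abs_of_nonneg (hf.nonneg x)]; exact hf.le x) hP

lemma IsBump.smul (hf : IsBump M R f) {c : ℝ} (hc : 0 < c) : IsBump (c * M) R (fun x => c * f x) where
  meas := hf.meas.const_mul c
  nonneg x := mul_nonneg hc.le (hf.nonneg x)
  le x := mul_le_mul_of_nonneg_left (hf.le x) hc.le
  supp x hx := by rw [hf.supp x hx, mul_zero]
  R_nonneg := hf.R_nonneg
  integral_pos := by rw [integral_const_mul]; exact mul_pos hc hf.integral_pos

variable [hPQ : HolderConjugate P Q]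

lemma abs_convPairing_le_add (hP : 1 < P) (hP2 : P ≤ 2) (hf : IsBump M R f) (hg : IsBump M' R' g)
    (ha : 0 < a) (hab : a ≤ b) (i j : Fin n) :
    |convPairing (hessKernel i j a b) f g| ≤ (16 * Q.toReal + 2) / (P.toReal - 1) *
      ((eLpNorm f P).toReal ^ P.toReal + (eLpNorm g Q).toReal ^ Q.toReal) := by
  have hPt : P ≠ ∞ := (hP2.trans_lt (by simp)).ne
  have hQ : 1 < Q := (HolderConjugate.lt_top_iff_one_lt P Q).1 hPt.lt_top
  have hQt : Q ≠ ∞ := ((HolderConjugate.lt_top_iff_one_lt Q P).2 hP).ne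
  have hr := one_lt_toReal hP hPt
  have hr2 : P.toReal ≤ 2 := by simpa using ENNReal.toReal_mono (by simp) hP2
  have hc : P.toReal.HolderConjugate Q.toReal := HolderConjugate.toReal hr
  have ha2 := half_pos ha
  obtain ⟨hi, hle⟩ := integral_gradients_le hc hr2 hf hg ha2 (show a / 2 ≤ b / 2 by linarith) j i
  have hfP := hf.memLp hP.le
  have hgQ := hg.memLp hQ.le
  set φ : ℝ → ℝ := fun t => ∫ x, conv (heatHess i j t) f x * g x
  have e1 : convPairing (hessKernel i j a b) f g = 2 * ∫ t in Ioc (a / 2) (b / 2), φ (2 * t) := by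
    rw [convPairing_hessKernel hfP hgQ ha, ← integral_of_le hab,
      ← integral_of_le (show a / 2 ≤ b / 2 by linarith),
      intervalIntegral.mul_integral_comp_mul_left]
    congr 1 <;> ring
  have hset : (volume.restrict (Ioc (a / 2) (b / 2))).prod (volume : Measure (Vec n)) =
      (volume : Measure (ℝ × Vec n)).restrict (Ioc (a / 2) (b / 2) ×ˢ Set.univ) := by
    rw [Measure.volume_eq_prod, ← Measure.prod_restrict, Measure.restrict_univ]
  rw [IntegrableOn, ← hset] at hi
  have e2 : |∫ t in Ioc (a / 2) (b / 2), φ (2 * t)| ≤ ∫ t in Ioc (a / 2) (b / 2),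
      ∫ x, |conv (heatGrad j t) f x| * |conv (heatGrad i t) g x| := by
    rw [← norm_eq_abs]
    refine norm_integral_le_of_norm_le hi.integral_prod_left ?_
    filter_upwards [ae_restrict_mem measurableSet_Ioc] with t ht
    simp only [φ]; rw [integral_conv_heatHess_mul hP hPt hfP hgQ (ha2.trans ht.1), norm_neg]
    refine (norm_integral_le_integral_norm _).trans (le_of_eq ?_)
    simp only [norm_mul, norm_eq_abs]
  have e3 : ∫ x, bellN P.toReal Q.toReal (conv (heat (a / 2)) f x) (conv (heat (a / 2)) g x) ≤
      (eLpNorm f P).toReal ^ P.toReal + (eLpNorm g Q).toReal ^ Q.toReal := by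
    have hP0 : P ≠ 0 := (zero_lt_one.trans hP).ne'
    have hQ0 : Q ≠ 0 := (zero_lt_one.trans hQ).ne'
    have m1 := MemLp.conv (integrable_heat ha2) hP.le hPt hfP
    have m2 := MemLp.conv (integrable_heat ha2) hQ.le hQt hgQ
    have p1 := fun x => (hf.conv_heat_pos ha2 x).le
    have p2 := fun x => (hg.conv_heat_pos ha2 x).le
    have i1 := m1.integrable_norm_rpow hP0 hPt
    have i2 := m2.integrable_norm_rpow hQ0 hQt
    simp only [norm_of_nonneg (p1 _)] at i1; simp only [norm_of_nonneg (p2 _)] at i2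
    simp only [bellN]
    rw [integral_add i1 i2, integral_rpow_eq hP0 hPt m1 p1, integral_rpow_eq hQ0 hQt m2 p2]; gcongr
    · exact hfP.2.ne
    · exact eLpNorm_conv_heat_le ha2 hfP.1 hP.le hPt
    · exact hgQ.2.ne
    · exact eLpNorm_conv_heat_le ha2 hgQ.1 hQ.le hQt
  have hr0 : 0 < P.toReal - 1 := by linarith
  rw [e1, abs_mul, abs_two, div_mul_eq_mul_div, le_div_iff₀ hr0]
  have hq0 := hc.symm.pos
  have : (16 * Q.toReal + 2) * ∫ x, bellN P.toReal Q.toReal (conv (heat (a / 2)) f x)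
      (conv (heat (a / 2)) g x) ≤ (16 * Q.toReal + 2) *
      ((eLpNorm f P).toReal ^ P.toReal + (eLpNorm g Q).toReal ^ Q.toReal) := by gcongr
  nlinarith

lemma abs_convPairing_le_mul (hP : 1 < P) (hP2 : P ≤ 2) (hf : IsBump M R f) (hg : IsBump M' R' g)
    (ha : 0 < a) (hab : a ≤ b) (i j : Fin n) :
    |convPairing (hessKernel i j a b) f g| ≤ 2 * ((16 * Q.toReal + 2) / (P.toReal - 1)) *
      ((eLpNorm f P).toReal * (eLpNorm g Q).toReal) := by
  have hPt : P ≠ ∞ := (hP2.trans_lt (by simp)).ne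
  have hQ : 1 < Q := (HolderConjugate.lt_top_iff_one_lt P Q).1 hPt.lt_top
  have hQt : Q ≠ ∞ := ((HolderConjugate.lt_top_iff_one_lt Q P).2 hP).ne
  have pos : ∀ {M R : ℝ} {f : Vec n → ℝ} {P : ℝ≥0∞}, 1 < P → IsBump M R f →
      0 < (eLpNorm f P).toReal := by
    intro M R f P hP hf
    refine ENNReal.toReal_pos (fun h => ?_) (hf.memLp hP.le).2.ne
    rw [eLpNorm_eq_zero_iff hf.meas.aestronglyMeasurable (zero_lt_one.trans hP).ne'] at h
    have := hf.integral_pos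
    rw [integral_congr_ae h] at this; simp at this
  have hF := pos hP hf
  have hG := pos hQ hg
  set F := (eLpNorm f P).toReal with hFd
  set G := (eLpNorm g Q).toReal with hGd
  have h := abs_convPairing_le_add (P := P) (Q := Q) hP hP2 (hf.smul (inv_pos.2 hF))
    (hg.smul (inv_pos.2 hG)) ha hab i j
  have nrm : ∀ (c : ℝ) (f : Vec n → ℝ) (P : ℝ≥0∞), 0 < c →
      (eLpNorm (fun x => c * f x) P volume).toReal = c * (eLpNorm f P).toReal := by
    intro c f P hc
    have := eLpNorm_const_smul c f P (volume : Measure (Vec n))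
    rw [show (fun x => c * f x) = c • f from rfl, this, ENNReal.toReal_mul]; simp [abs_of_pos hc]
  rw [nrm _ _ _ (inv_pos.2 hF), nrm _ _ _ (inv_pos.2 hG), ← hFd, ← hGd, inv_mul_cancel₀ hF.ne',
    inv_mul_cancel₀ hG.ne', Real.one_rpow, Real.one_rpow] at h
  have e : convPairing (hessKernel i j a b) (fun x => F⁻¹ * f x) (fun x => G⁻¹ * g x) =
      F⁻¹ * G⁻¹ * convPairing (hessKernel i j a b) f g := by
    unfold convPairing; rw [← integral_const_mul]
    congr 1; funext z; ring
  rw [e, abs_mul, abs_of_pos (by positivity)] at h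
  calc |convPairing (hessKernel i j a b) f g|
      = (F * G) * (F⁻¹ * G⁻¹ * |convPairing (hessKernel i j a b) f g|) := by field_simp
    _ ≤ (F * G) * _ := mul_le_mul_of_nonneg_left h (by positivity)
    _ = _ := by ring

end Bump

end

section

/-! ### Boundedness of the truncated Riesz transforms -/

section Truncation

/-- A bound for the norms of the truncated second order Riesz transforms on `L^p`. -/
def rieszBound (P Q : ℝ≥0∞) : ℝ :=
  2 * ((16 * Q.toReal + 2) / (P.toReal - 1)) + 2 * ((16 * P.toReal + 2) / (Q.toReal - 1))

lemma rieszBound_nonneg (hP : 1 < P) (hPt : P ≠ ∞) (hQ : 1 < Q) (hQt : Q ≠ ∞) :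
    0 ≤ rieszBound P Q := by
  have hr := one_lt_toReal hP hPt
  have hr' := one_lt_toReal hQ hQt
  have h1 : 0 < P.toReal - 1 := by linarith
  have h2 : 0 < Q.toReal - 1 := by linarith
  unfold rieszBound; positivity

/-- The truncation of `f` in size and in space. -/
def cutoff (k : ℕ) (f : Vec n → ℝ) : Vec n → ℝ :=
  (Metric.closedBall 0 k).indicator fun x => min (f x) k

lemma cutoff_nonneg (h0 : ∀ x, 0 ≤ f x) (k : ℕ) (x : Vec n) : 0 ≤ cutoff k f x :=
  Set.indicator_nonneg (fun x _ => le_min (h0 x) k.cast_nonneg) x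

lemma cutoff_le (h0 : ∀ x, 0 ≤ f x) (k : ℕ) (x : Vec n) : cutoff k f x ≤ f x :=
  Set.indicator_le' (fun _ _ => min_le_left _ _) (fun x _ => h0 x) x

lemma eLpNorm_cutoff_le (h0 : ∀ x, 0 ≤ f x) (k : ℕ) : eLpNorm (cutoff k f) P ≤ eLpNorm f P :=
  eLpNorm_mono fun x => by
    rw [norm_of_nonneg (cutoff_nonneg h0 k x), norm_of_nonneg (h0 x)]
    exact cutoff_le h0 k x

lemma measurable_cutoff (hf : Measurable f) (k : ℕ) : Measurable (cutoff k f) :=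
  (hf.min measurable_const).indicator Metric.isClosed_closedBall.measurableSet

lemma cutoff_bump (hf : Measurable f) (h0 : ∀ x, 0 ≤ f x) (k : ℕ) :
    cutoff k f =ᵐ[volume] 0 ∨ IsBump k k (cutoff k f) := by
  have hle : ∀ x, cutoff k f x ≤ k := fun x =>
    Set.indicator_le' (fun _ _ => min_le_right _ _) (fun _ _ => k.cast_nonneg) x
  have hsupp : ∀ x, (k : ℝ) < ‖x‖ → cutoff k f x = 0 := fun x hx =>
    Set.indicator_of_notMem (by simpa using hx) _
  have hint : Integrable (cutoff k f) := by
    have : IntegrableOn (fun _ => (k : ℝ)) (Metric.closedBall (0 : Vec n) k) :=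
      integrableOn_const (measure_closedBall_lt_top).ne
    refine ((integrable_indicator_iff Metric.isClosed_closedBall.measurableSet).2 this).mono'
      (measurable_cutoff hf k).aestronglyMeasurable (ae_of_all _ fun x => ?_)
    rw [norm_of_nonneg (cutoff_nonneg h0 k x)]
    refine Set.indicator_le_indicator ?_
    exact min_le_right _ _
  have hnn : 0 ≤ ∫ x, cutoff k f x := integral_nonneg (cutoff_nonneg h0 k)
  rcases hnn.eq_or_lt with h | h
  · exact Or.inl ((integral_eq_zero_iff_of_nonneg (cutoff_nonneg h0 k) hint).1 h.symm)
  · exact Or.inr ⟨measurable_cutoff hf k, cutoff_nonneg h0 k, hle, hsupp, k.cast_nonneg, h⟩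

lemma tendsto_cutoff (f : Vec n → ℝ) (x : Vec n) :
    Tendsto (fun k : ℕ => cutoff k f x) atTop (𝓝 (f x)) := by
  obtain ⟨N, hN⟩ := exists_nat_ge (max ‖x‖ (f x))
  refine tendsto_const_nhds.congr' ?_
  filter_upwards [eventually_ge_atTop N] with k hk
  have hk' : (N : ℝ) ≤ k := by exact_mod_cast hk
  rw [cutoff, Set.indicator_of_mem]
  · exact (min_eq_left ((le_max_right _ _).trans (hN.trans hk'))).symm
  · simpa using (le_max_left _ _).trans (hN.trans hk')

lemma convPairing_congr {f' g' : Vec n → ℝ} (hf : f =ᵐ[volume] f') (hg : g =ᵐ[volume] g') :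
    convPairing k f g = convPairing k f' g' := by
  refine integral_congr_ae ?_
  rw [Measure.volume_eq_prod]
  filter_upwards [Measure.quasiMeasurePreserving_snd.ae hf,
    Measure.quasiMeasurePreserving_fst.ae hg] with z h1 h2
  rw [h1, h2]

end Truncation

section

variable [hPQ : HolderConjugate P Q]

lemma lt_top_of_one_lt_conj (hQ : 1 < Q) : P ≠ ∞ :=
  ((HolderConjugate.lt_top_iff_one_lt P Q).2 hQ).ne

lemma one_lt_conj (hPt : P ≠ ∞) : 1 < Q := (HolderConjugate.lt_top_iff_one_lt P Q).1 hPt.lt_top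

lemma exists_holderConjugate (hP : 1 < P) (hPt : P ≠ ∞) :
    ∃ Q : ℝ≥0∞, HolderConjugate P Q ∧ HolderConjugate Q P ∧ 1 < Q ∧ Q ≠ ∞ :=
  have : HolderConjugate P (conjExponent P) := .conjExponent hP.le
  ⟨conjExponent P, this, this.symm, one_lt_conj (P := P) hPt,
    lt_top_of_one_lt_conj (Q := P) hP⟩

lemma le_two_or_le_two (hP : 1 < P) (hPt : P ≠ ∞) : P ≤ 2 ∨ Q ≤ 2 := by
  have hr := one_lt_toReal hP hPt
  have hQt : Q ≠ ∞ := lt_top_of_one_lt_conj (P := Q) (Q := P) hP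
  have hc : P.toReal.HolderConjugate Q.toReal := HolderConjugate.toReal hr
  by_contra! h
  have h1 : 2 < P.toReal := by
    have := (toReal_lt_toReal (by simp) hPt).2 h.1
    simpa using this
  have h2 : 2 < Q.toReal := by
    have := (toReal_lt_toReal (by simp) hQt).2 h.2
    simpa using this
  have := hc.sub_one_mul_conj
  nlinarith

lemma abs_convPairing_bump_le {M R M' R' : ℝ} (hP : 1 < P) (hPt : P ≠ ∞)
    (hf : IsBump M R f) (hg : IsBump M' R' g) (ha : 0 < a) (hab : a ≤ b) (i j : Fin n) :
    |convPairing (hessKernel i j a b) f g| ≤ rieszBound P Q *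
      ((eLpNorm f P).toReal * (eLpNorm g Q).toReal) := by
  have hQ : 1 < Q := one_lt_conj (P := P) hPt
  have hQt : Q ≠ ∞ := lt_top_of_one_lt_conj (P := Q) (Q := P) hP
  have hr := one_lt_toReal hP hPt
  have hr' := one_lt_toReal hQ hQt
  have h1 : 0 < P.toReal - 1 := by linarith
  have h2 : 0 < Q.toReal - 1 := by linarith
  have h3 : 0 ≤ 2 * ((16 * Q.toReal + 2) / (P.toReal - 1)) := by positivity
  have h4 : 0 ≤ 2 * ((16 * P.toReal + 2) / (Q.toReal - 1)) := by positivity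
  rcases le_two_or_le_two (Q := Q) hP hPt with h | h
  · refine (abs_convPairing_le_mul (Q := Q) hP h hf hg ha hab i j).trans ?_
    unfold rieszBound; gcongr; linarith
  · rw [convPairing_swap (hessKernel_neg i j a b)]
    refine (abs_convPairing_le_mul (P := Q) (Q := P) hQ h hg hf ha hab i j).trans ?_
    rw [mul_comm (eLpNorm g Q volume).toReal]; unfold rieszBound; gcongr
    linarith

lemma abs_convPairing_le_of_nonneg (hP : 1 < P) (hPt : P ≠ ∞)
    (hfm : Measurable f) (hf0 : ∀ x, 0 ≤ f x) (hf : MemLp f P)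
    (hgm : Measurable g) (hg0 : ∀ x, 0 ≤ g x) (hg : MemLp g Q)
    (ha : 0 < a) (hab : a ≤ b) (i j : Fin n) :
    |convPairing (hessKernel i j a b) f g| ≤ rieszBound P Q *
      ((eLpNorm f P).toReal * (eLpNorm g Q).toReal) := by
  have hQ : 1 < Q := one_lt_conj (P := P) hPt
  have hQt : Q ≠ ∞ := lt_top_of_one_lt_conj (P := Q) (Q := P) hP
  have hC := rieszBound_nonneg hP hPt hQ hQt
  have hK := integrable_hessKernel (b := b) ha i j
  have lim : Tendsto (fun k : ℕ => convPairing (hessKernel i j a b) (cutoff k f) (cutoff k g)) atTop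
      (𝓝 (convPairing (hessKernel i j a b) f g)) := by
    refine tendsto_integral_of_dominated_convergence
      (fun z => ‖hessKernel i j a b (z.1 - z.2) * f z.2 * g z.1‖) (fun k => ?_)
      (integrable_kernel hK hf hg).norm (fun k => ae_of_all _ fun z => ?_) (ae_of_all _ fun z => ?_)
    · exact (aestronglyMeasurable_kernel hK.1 (measurable_cutoff hfm k).aestronglyMeasurable).mul
        ((measurable_cutoff hgm k).comp measurable_fst).aestronglyMeasurable
    · rw [norm_mul, norm_mul, norm_mul, norm_mul, norm_of_nonneg (cutoff_nonneg hf0 k _),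
        norm_of_nonneg (cutoff_nonneg hg0 k _), norm_of_nonneg (hf0 _),
        norm_of_nonneg (hg0 _)]
      exact mul_le_mul (mul_le_mul_of_nonneg_left (cutoff_le hf0 k _) (norm_nonneg _))
        (cutoff_le hg0 k _) (cutoff_nonneg hg0 k _) (mul_nonneg (norm_nonneg _) (hf0 _))
    · exact ((tendsto_cutoff f z.2).const_mul _).mul (tendsto_cutoff g z.1)
  refine le_of_tendsto lim.abs (Eventually.of_forall fun k => ?_)
  have hnn : 0 ≤ rieszBound P Q * ((eLpNorm f P).toReal * (eLpNorm g Q).toReal) := by positivity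
  rcases cutoff_bump hfm hf0 k with h1 | h1
  · rw [convPairing_congr h1 (EventuallyEq.refl _ _)]
    simpa [convPairing] using hnn
  rcases cutoff_bump hgm hg0 k with h2 | h2
  · rw [convPairing_congr (EventuallyEq.refl _ _) h2]
    simpa [convPairing] using hnn
  refine (abs_convPairing_bump_le (P := P) (Q := Q) hP hPt h1 h2 ha hab i j).trans ?_
  gcongr
  · exact hf.2.ne
  · exact eLpNorm_cutoff_le hf0 k
  · exact hg.2.ne
  · exact eLpNorm_cutoff_le hg0 k

lemma abs_convPairing_le (hP : 1 < P) (hPt : P ≠ ∞) (hf : MemLp f P) (hg : MemLp g Q)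
    (ha : 0 < a) (hab : a ≤ b) (i j : Fin n) :
    |convPairing (hessKernel i j a b) f g| ≤ 4 * rieszBound P Q *
      ((eLpNorm f P).toReal * (eLpNorm g Q).toReal) := by
  have hQ : 1 < Q := one_lt_conj (P := P) hPt
  have hQt : Q ≠ ∞ := lt_top_of_one_lt_conj (P := Q) (Q := P) hP
  have hC := rieszBound_nonneg hP hPt hQ hQt
  have hK := integrable_hessKernel (b := b) ha i j
  wlog hfm : Measurable f ∧ Measurable g generalizing f g
  · obtain ⟨f', mf', e1⟩ := hf.1.aemeasurable
    obtain ⟨g', mg', e2⟩ := hg.1.aemeasurable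
    rw [convPairing_congr e1 e2, eLpNorm_congr_ae e1, eLpNorm_congr_ae e2]
    exact this ((memLp_congr_ae e1).1 hf) ((memLp_congr_ae e2).1 hg) ⟨mf', mg'⟩
  obtain ⟨hfm, hgm⟩ := hfm
  have l (r : ℝ) : ‖max r 0‖ ≤ ‖r‖ := by
    rw [norm_of_nonneg (le_max_right _ _)]
    exact max_le (le_abs_self r) (abs_nonneg r)
  have key (F G : Vec n → ℝ) (m1 : Measurable F) (l1 : ∀ x, ‖F x‖ ≤ ‖f x‖) (m2 : Measurable G)
      (l2 : ∀ x, ‖G x‖ ≤ ‖g x‖) : Integrable (fun z : Vec n × Vec n =>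
        hessKernel i j a b (z.1 - z.2) * max (F z.2) 0 * max (G z.1) 0) ∧
      |convPairing (hessKernel i j a b) (fun x => max (F x) 0) fun x => max (G x) 0| ≤
        rieszBound P Q * ((eLpNorm f P).toReal * (eLpNorm g Q).toReal) := by
    have k1 (x) := (l _).trans (l1 x)
    have k2 (x) := (l _).trans (l2 x)
    have m1 := m1.max (measurable_const (a := (0 : ℝ)))
    have m2 := m2.max (measurable_const (a := (0 : ℝ)))
    have L1 := hf.mono m1.aestronglyMeasurable (ae_of_all _ k1)
    have L2 := hg.mono m2.aestronglyMeasurable (ae_of_all _ k2)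
    refine ⟨integrable_kernel hK L1 L2, (abs_convPairing_le_of_nonneg hP hPt m1
      (fun x => le_max_right _ _) L1 m2 (fun x => le_max_right _ _) L2 ha hab i j).trans ?_⟩
    gcongr
    · exact hf.2.ne
    · exact eLpNorm_mono k1
    · exact hg.2.ne
    · exact eLpNorm_mono k2
  obtain ⟨i11, b11⟩ := key f g hfm (fun _ => le_rfl) hgm fun _ => le_rfl
  obtain ⟨i12, b12⟩ := key f (-g) hfm (fun _ => le_rfl) hgm.neg fun _ => (norm_neg _).le
  obtain ⟨i21, b21⟩ := key (-f) g hfm.neg (fun _ => (norm_neg _).le) hgm fun _ => le_rfl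
  obtain ⟨i22, b22⟩ := key (-f) (-g) hfm.neg (fun _ => (norm_neg _).le) hgm.neg
    fun _ => (norm_neg _).le
  have e := integral_sub (i11.sub i12) (i21.sub i22)
  simp only [Pi.sub_apply] at e; rw [integral_sub i11 i12, integral_sub i21 i22] at e
  have e : convPairing (hessKernel i j a b) f g = _ := Eq.trans (integral_congr_all fun z => by
    have e1 := max_zero_sub_eq_self (f z.2)
    have e2 := max_zero_sub_eq_self (g z.1)
    simp only [Pi.neg_apply]; linear_combination -hessKernel i j a b (z.1 - z.2) * (g z.1 * e1 +
      (max (f z.2) 0 - max (-f z.2) 0) * e2)) e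
  rw [e]
  refine (abs_sub _ _).trans ((add_le_add (abs_sub _ _) (abs_sub _ _)).trans ?_)
  exact (add_le_add (add_le_add b11 b12) (add_le_add b21 b22)).trans_eq (by ring)

/-- The truncated second order Riesz transforms are bounded on `L^p`, `1 < p < ∞`, uniformly in the
truncation. -/
theorem eLpNorm_conv_hessKernel_le (hP : 1 < P) (hPt : P ≠ ∞) (hf : MemLp f P)
    (ha : 0 < a) (hab : a ≤ b) (i j : Fin n) :
    eLpNorm (conv (hessKernel i j a b) f) P ≤ ofReal (4 * rieszBound P Q) * eLpNorm f P := by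
  have hQ : 1 < Q := one_lt_conj (P := P) hPt
  have hQt : Q ≠ ∞ := lt_top_of_one_lt_conj (P := Q) (Q := P) hP
  have hC := rieszBound_nonneg hP hPt hQ hQt
  have hK := integrable_hessKernel (b := b) ha i j
  refine eLpNorm_le_of_pairing (q := Q) hP hPt (MemLp.conv hK hP.le hPt hf) fun g hg => ?_
  rw [integral_conv_mul_eq hK hf hg]
  have h := abs_convPairing_le hP hPt hf hg ha hab i j
  rw [← ofReal_norm, norm_eq_abs]
  refine (ofReal_le_ofReal h).trans (le_of_eq ?_)
  rw [ofReal_mul (by positivity), ofReal_mul ENNReal.toReal_nonneg,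
    ENNReal.ofReal_toReal hf.2.ne, ENNReal.ofReal_toReal hg.2.ne, mul_assoc]

end

end

section

/-! ### Convergence of the truncated Riesz transforms -/

lemma hessKernel_add {c : ℝ} (ha : 0 < a) (hab : a ≤ b) (hbc : b ≤ c) (i j : Fin n) (x : Vec n) :
    hessKernel i j a b x + hessKernel i j b c x = hessKernel i j a c x := by
  unfold hessKernel
  rw [← setIntegral_union (Set.Ioc_disjoint_Ioc_of_le le_rfl) measurableSet_Ioc
    (integrableOn_heatHess_time ha i j x) (integrableOn_heatHess_time (ha.trans_le hab) i j x),
    Set.Ioc_union_Ioc_eq_Ioc hab hbc]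

lemma eLpNorm_one_hessKernel_le (n : ℕ) : ∃ C : ℝ, 0 < C ∧ ∀ a b : ℝ, 0 < a → a ≤ b →
    ∀ i j : Fin n, eLpNorm (hessKernel i j a b) 1 ≤ ofReal (C * ((b - a) / a)) := by
  obtain ⟨C, hC, h⟩ := integral_abs_heatHess_le n
  refine ⟨C, hC, fun a b ha hab i j => ?_⟩
  have hm : Measurable (fun q : Vec n × ℝ => ‖heatHess i j q.2 q.1‖ₑ) := by
    have h2 : Measurable (fun q : Vec n × ℝ => (q.2, q.1)) := by fun_prop
    exact ((measurable_heatHess_uncurry i j).comp h2).enorm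
  rw [eLpNorm_one_eq_lintegral_enorm]
  calc _ ≤ ∫⁻ x : Vec n, ∫⁻ t in Ioc a b, ‖heatHess i j t x‖ₑ :=
        lintegral_mono fun x => enorm_integral_le_lintegral_enorm _
    _ = ∫⁻ t in Ioc a b, ∫⁻ x : Vec n, ‖heatHess i j t x‖ₑ :=
        lintegral_lintegral_swap hm.aemeasurable
    _ ≤ ∫⁻ _t in Ioc a b, ofReal (C * a⁻¹) := by
        refine setLIntegral_mono measurable_const fun t ht => ?_
        have ht0 := ha.trans ht.1
        rw [← ofReal_integral_norm_eq_lintegral_enorm (integrable_heatHess ht0 i j)]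
        refine ofReal_le_ofReal ((h t ht0 i j).trans ?_)
        have := ht.1.le
        gcongr
    _ = _ := by
        rw [setLIntegral_const, Real.volume_Ioc, ← ofReal_mul (by positivity)]; congr 1; field_simp

lemma conv_hessKernel_heat {c : ℝ} (ha : 0 < a) (hab : a ≤ b) (hc : 0 < c) (i j : Fin n) :
    conv (hessKernel i j a b) (heat c) = hessKernel i j (a + c) (b + c) := by
  funext x
  obtain ⟨C, hC, h⟩ := exists_abs_heatHess_le (b := b) ha n
  have hb := ha.trans_le hab
  set μ := (volume : Measure ℝ).restrict (Ioc a b)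
  have hi : Integrable fun y => heat (2 * b) (x - y) * heat c y :=
    ((integrable_heat (by positivity)).comp_sub_left x).mul_bdd
      (c := (4 * π * c) ^ (-(n : ℝ) / 2)) (by fun_prop) (ae_of_all _ fun y => by
        rw [norm_of_nonneg (heat_pos hc y).le]; exact heat_le_const hc y)
  have hm : Measurable (fun w : Vec n × ℝ => heatHess i j w.2 (x - w.1)) := by
    have h2 : Measurable (fun w : Vec n × ℝ => (w.2, x - w.1)) := by fun_prop
    exact (measurable_heatHess_uncurry i j).comp h2
  have hint : Integrable (fun w : Vec n × ℝ => heatHess i j w.2 (x - w.1) * heat c w.1)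
      (volume.prod μ) := by
    refine ((hi.const_mul C).mul_prod (integrable_const (1 : ℝ)) (ν := μ)).mono' ?_ ?_
    · exact (hm.mul ((continuous_heat c).measurable.comp measurable_fst)).aestronglyMeasurable
    · have h3 : ∀ᵐ w ∂((volume : Measure (Vec n)).prod μ), w.2 ∈ Ioc a b :=
        Measure.quasiMeasurePreserving_snd.ae (ae_restrict_mem measurableSet_Ioc)
      filter_upwards [h3] with w hw
      rw [mul_one, norm_mul, norm_of_nonneg (heat_pos hc _).le, ← mul_assoc]
      exact mul_le_mul_of_nonneg_right (h w.2 hw.1.le hw.2 i j _) (heat_pos hc _).le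
  calc conv (hessKernel i j a b) (heat c) x = ∫ y, ∫ t, heatHess i j t (x - y) * heat c y ∂μ := by
        simp only [conv, hessKernel]
        refine integral_congr_all fun y => ?_
        rw [← integral_mul_const]
    _ = ∫ t, (∫ y, heatHess i j t (x - y) * heat c y) ∂μ := integral_integral_swap hint
    _ = ∫ t, heatHess i j (t + c) x ∂μ := by
        refine integral_congr_ae ?_
        filter_upwards [ae_restrict_mem measurableSet_Ioc] with t ht
        rw [← conv_heatHess_heat (ha.trans ht.1) hc]; rfl
    _ = hessKernel i j (a + c) (b + c) x := by
        simp only [hessKernel, μ]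
        rw [← integral_of_le hab, ← integral_of_le (by linarith : a + c ≤ b + c),
          intervalIntegral.integral_comp_add_right (fun t => heatHess i j t x)]

/-- The truncations, over the times between `1/(k+1)` and `k+1`, of `RᵢRⱼ f`. -/
def rieszTrunc (i j : Fin n) (k : ℕ) (f : Vec n → ℝ) : Vec n → ℝ :=
  conv (hessKernel i j (1 / (k + 1)) (k + 1)) f

lemma trunc_pos (k : ℕ) : (0 : ℝ) < 1 / (k + 1) := by positivity

lemma trunc_le (k : ℕ) : (1 : ℝ) / (k + 1) ≤ k + 1 := by
  rw [div_le_iff₀ (by positivity)]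
  nlinarith [(k.cast_nonneg : (0 : ℝ) ≤ k)]

lemma memLp_rieszTrunc (hP : 1 ≤ P) (hPt : P ≠ ∞) (hf : MemLp f P)
    (i j : Fin n) (k : ℕ) : MemLp (rieszTrunc i j k f) P :=
  MemLp.conv (integrable_hessKernel (trunc_pos k) i j) hP hPt hf

lemma hessKernel_telescope {c d : ℝ} (ha : 0 < a) (hab : a ≤ b) (hc : 0 < c) (hcd : c ≤ d)
    (i j : Fin n) (x : Vec n) :
    hessKernel i j (a + c) (b + c) x - hessKernel i j (a + d) (b + d) x - hessKernel i j c d x =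
    hessKernel i j d (a + d) x - hessKernel i j c (a + c) x - hessKernel i j (b + c) (b + d) x := by
  have h1 := hessKernel_add hc (show c ≤ a + c by linarith) (show a + c ≤ b + c by linarith) i j x
  have h2 := hessKernel_add hc (show c ≤ b + c by linarith) (show b + c ≤ b + d by linarith) i j x
  have h3 := hessKernel_add hc hcd (show d ≤ b + d by linarith) i j x
  have h4 := hessKernel_add (hc.trans_le hcd) (show d ≤ a + d by linarith)
    (show a + d ≤ b + d by linarith) i j x
  linarith

lemma tendsto_rieszTrunc_of_heat (hP : 1 ≤ P) (hPt : P ≠ ∞) {h : Vec n → ℝ}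
    (hh : MemLp h P) {c d : ℝ} (hc : 0 < c) (hcd : c ≤ d) (i j : Fin n) :
    Tendsto (fun k : ℕ => eLpNorm (rieszTrunc i j k (conv (heat c) h - conv (heat d) h) -
      conv (hessKernel i j c d) h) P) atTop (𝓝 0) := by
  obtain ⟨C, hC, hK⟩ := eLpNorm_one_hessKernel_le n
  have hd := hc.trans_le hcd
  have hb : ∀ᶠ k : ℕ in atTop, eLpNorm (rieszTrunc i j k (conv (heat c) h - conv (heat d) h) -
      conv (hessKernel i j c d) h) P ≤ (ofReal (C * ((1 / (k + 1) : ℝ) / d)) +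
      ofReal (C * ((1 / (k + 1) : ℝ) / c)) + ofReal (C * ((d - c) / (k + 1 + c))))
      * eLpNorm h P := by
    obtain ⟨N, hN⟩ := exists_nat_ge d
    filter_upwards [eventually_ge_atTop N] with k hk
    have hk' : d ≤ (k : ℝ) + 1 := by
      have : (N : ℝ) ≤ k := by exact_mod_cast hk
      linarith
    have ha := trunc_pos k
    have hab := trunc_le k
    set a : ℝ := 1 / (k + 1)
    set b : ℝ := k + 1
    have iab := integrable_hessKernel (n := n) (b := b) ha i j
    have icd := integrable_hessKernel (n := n) (b := d) hc i j
    have i1 := integrable_hessKernel (n := n) (b := b + c) (add_pos ha hc) i j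
    have i2 := integrable_hessKernel (n := n) (b := b + d) (add_pos ha hd) i j
    have j1 := integrable_hessKernel (n := n) (b := a + d) hd i j
    have j2 := integrable_hessKernel (n := n) (b := a + c) hc i j
    have j3 := integrable_hessKernel (n := n) (a := b + c) (b := b + d) (by linarith) i j
    have e : rieszTrunc i j k (conv (heat c) h - conv (heat d) h) - conv (hessKernel i j c d) h
        =ᵐ[volume] conv (fun x => hessKernel i j d (a + d) x - hessKernel i j c (a + c) x -
          hessKernel i j (b + c) (b + d) x) h := by
      have e1 := conv_sub_right iab hP hPt (MemLp.conv (integrable_heat hc) hP hPt hh)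
        (MemLp.conv (integrable_heat hd) hP hPt hh)
      have e2 := conv_conv iab (integrable_heat hc) hP hPt hh
      have e3 := conv_conv iab (integrable_heat hd) hP hPt hh
      rw [conv_hessKernel_heat ha hab hc] at e2; rw [conv_hessKernel_heat ha hab hd] at e3
      filter_upwards [e1, e2, e3, ae_integrable_conv i1 hP hPt hh, ae_integrable_conv i2 hP hPt hh,
        ae_integrable_conv icd hP hPt hh] with x h1 h2 h3 h4 h5 h6
      simp only [Pi.sub_apply, rieszTrunc] at h1 ⊢
      rw [h1, h2, h3]; simp only [conv]
      rw [← integral_sub h4 h5, ← integral_sub (by exact h4.sub h5) h6]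
      refine integral_congr_all fun y => ?_
      rw [← hessKernel_telescope ha hab hc hcd]; ring
    rw [eLpNorm_congr_ae e]
    refine (eLpNorm_conv_le ((j1.sub j2).sub j3).1 hh.1 hP hPt).trans ?_
    gcongr
    refine (eLpNorm_sub_le (j1.sub j2).1 j3.1 le_rfl).trans ?_
    gcongr
    · refine (eLpNorm_sub_le j1.1 j2.1 le_rfl).trans ?_
      gcongr
      · exact (hK d (a + d) hd (by linarith) i j).trans (by rw [add_sub_cancel_right])
      · exact (hK c (a + c) hc (by linarith) i j).trans (by rw [add_sub_cancel_right])
    · exact (hK (b + c) (b + d) (by linarith) (by linarith) i j).trans (le_of_eq (by congr 3; ring))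
  refine tendsto_of_tendsto_of_tendsto_of_le_of_le' tendsto_const_nhds ?_
    (Eventually.of_forall fun _ => zero_le) hb
  have l1 : Tendsto (fun k : ℕ => (1 / (k + 1) : ℝ)) atTop (𝓝 0) :=
    tendsto_one_div_add_atTop_nhds_zero_nat
  have l2 : ∀ r : ℝ, Tendsto (fun k : ℕ => ofReal (C * ((1 / (k + 1) : ℝ) / r))) atTop
      (𝓝 0) := fun r => by
    have := ENNReal.tendsto_ofReal ((l1.div_const r).const_mul C)
    simpa using this
  have l3 : Tendsto (fun k : ℕ => ofReal (C * ((d - c) / (k + 1 + c)))) atTop (𝓝 0) := by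
    have h1 : Tendsto (fun k : ℕ => ((k : ℝ) + 1 + c)) atTop atTop :=
      tendsto_atTop_add_const_right _ _ (tendsto_atTop_add_const_right _ _
        tendsto_natCast_atTop_atTop)
    have := ENNReal.tendsto_ofReal ((h1.const_div_atTop (d - c)).const_mul C)
    simpa using this
  have l4 := ENNReal.Tendsto.mul_const (b := eLpNorm h P volume) (((l2 d).add (l2 c)).add l3)
    (Or.inr hh.2.ne)
  simpa using l4

/-- The heat semigroup approximates: `P_c f - P_d f` is close to `f` for small `c` and large `d`. -/
lemma exists_heat_sub_heat_le (hn : 0 < n) (hP : 1 < P) (hPt : P ≠ ∞)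
    (hf : MemLp f P) {B : ℝ≥0∞} (hB : B ≠ ∞) {ε : ℝ≥0∞} (hε : 0 < ε) :
    ∃ c d : ℝ, 0 < c ∧ c ≤ d ∧ B * eLpNorm (f - (conv (heat c) f - conv (heat d) f)) P ≤ ε := by
  have l1 := ENNReal.Tendsto.const_mul (a := B) (tendsto_conv_heat hP.le hPt hf) (Or.inr hB)
  have l2 := ENNReal.Tendsto.const_mul (a := B) (tendsto_conv_heat_atTop hn hP hPt hf) (Or.inr hB)
  rw [mul_zero] at l1 l2
  have hε2 : 0 < ε / 2 := ENNReal.div_pos hε.ne' (by norm_num)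
  have t1 : ∀ᶠ c in 𝓝[>] (0 : ℝ), B * eLpNorm (conv (heat c) f - f) P ≤ ε / 2 :=
    ENNReal.tendsto_nhds_zero.1 l1 _ hε2
  have t2 : ∀ᶠ d in atTop, B * eLpNorm (conv (heat d) f) P ≤ ε / 2 :=
    ENNReal.tendsto_nhds_zero.1 l2 _ hε2
  have t3 : ∀ᶠ c in 𝓝[>] (0 : ℝ), 0 < c := eventually_mem_nhdsWithin
  obtain ⟨c, h1, hc⟩ := (t1.and t3).exists
  obtain ⟨d, h3, h4⟩ := (t2.and (eventually_ge_atTop c)).exists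
  refine ⟨c, d, hc, h4, ?_⟩
  have m1 := MemLp.conv (integrable_heat (n := n) hc) hP.le hPt hf
  have m2 := MemLp.conv (integrable_heat (n := n) (hc.trans_le h4)) hP.le hPt hf
  have e : f - (conv (heat c) f - conv (heat d) f) = (f - conv (heat c) f) + conv (heat d) f := by
    abel
  have h5 := eLpNorm_add_le (hf.sub m1).1 m2.1 hP.le
  rw [e]
  refine (mul_le_mul_right h5 B).trans ?_
  rw [mul_add, eLpNorm_sub_comm f]
  exact (add_le_add h1 h3).trans (ENNReal.add_halves ε).le

/-- The truncated second order Riesz transforms converge strongly on `L^p`, `1 < p < ∞`. -/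
theorem exists_tendsto_rieszTrunc (hn : 0 < n) (hP : 1 < P) (hPt : P ≠ ∞)
    (hf : MemLp f P) (i j : Fin n) :
    ∃ G : Vec n → ℝ, MemLp G P ∧
      Tendsto (fun k => eLpNorm (rieszTrunc i j k f - G) P) atTop (𝓝 0) := by
  have : HolderConjugate P (conjExponent P) := .conjExponent hP.le
  have : Fact (1 ≤ P) := ⟨hP.le⟩
  set B : ℝ≥0∞ := ofReal (4 * rieszBound P (conjExponent P))
  have hB : ∀ k (f : Vec n → ℝ), MemLp f P → eLpNorm (rieszTrunc i j k f) P ≤ B * eLpNorm f P :=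
    fun k f hf => eLpNorm_conv_hessKernel_le hP hPt hf (trunc_pos k) (trunc_le k) i j
  have hT : ∀ k, MemLp (rieszTrunc i j k f) P := memLp_rieszTrunc hP.le hPt hf i j
  set u : ℕ → Lp ℝ P (volume : Measure (Vec n)) := fun k => (hT k).toLp
  have hc : CauchySeq u := by
    rw [EMetric.cauchySeq_iff]; intro ε hε
    have hε5 : 0 < ε / 5 := ENNReal.div_pos hε.ne' (by norm_num)
    rcases eq_or_ne ε ∞ with rfl | hεt
    · refine ⟨0, fun m _ l _ => edist_lt_top _ _⟩
    -- approximate `f` by a difference of heat evolutions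
    obtain ⟨c, d, hc, hcd, hcd'⟩ := exists_heat_sub_heat_le hn hP hPt hf (B := B) ofReal_ne_top hε5
    have hd := hc.trans_le hcd
    set f' := conv (heat c) f - conv (heat d) f with hf'
    have mf' : MemLp f' P := (MemLp.conv (integrable_heat hc) hP.le hPt hf).sub
      (MemLp.conv (integrable_heat hd) hP.le hPt hf)
    set X := conv (hessKernel i j c d) f
    have mX : MemLp X P := MemLp.conv (integrable_hessKernel hc i j) hP.le hPt hf
    obtain ⟨N, hN⟩ := eventually_atTop.1
      (ENNReal.tendsto_nhds_zero.1 (tendsto_rieszTrunc_of_heat hP.le hPt hf hc hcd i j) _ hε5)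
    have hd2 : ∀ k, N ≤ k → eLpNorm (rieszTrunc i j k f - X) P ≤ ε / 5 + ε / 5 := by
      intro k hk
      have e : rieszTrunc i j k f - X =ᵐ[volume]
          rieszTrunc i j k (f - f') + (rieszTrunc i j k f' - X) := by
        filter_upwards [conv_sub_right (integrable_hessKernel (trunc_pos k) i j) hP.le
          hPt hf mf'] with x hx
        simp only [Pi.sub_apply, Pi.add_apply, rieszTrunc] at hx ⊢
        rw [hx]; ring
      rw [eLpNorm_congr_ae e]
      refine (eLpNorm_add_le (memLp_rieszTrunc hP.le hPt (hf.sub mf') i j k).1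
        ((memLp_rieszTrunc hP.le hPt mf' i j k).sub mX).1 hP.le).trans ?_
      exact add_le_add ((hB k _ (hf.sub mf')).trans hcd') (hN k hk)
    refine ⟨N, fun m hm l hl => ?_⟩
    rw [Lp.edist_toLp_toLp]
    have e : rieszTrunc i j m f - rieszTrunc i j l f =
        (rieszTrunc i j m f - X) - (rieszTrunc i j l f - X) := by abel
    rw [e]
    calc _ ≤ _ := eLpNorm_sub_le ((hT m).sub mX).1 ((hT l).sub mX).1 hP.le
      _ ≤ (ε / 5 + ε / 5) + (ε / 5 + ε / 5) := add_le_add (hd2 m hm) (hd2 l hl)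
      _ = 4 * (ε / 5) := by ring
      _ < 5 * (ε / 5) := by
          exact ENNReal.mul_lt_mul_left hε5.ne' (ENNReal.div_lt_top hεt (by norm_num)).ne
            (by norm_num)
      _ = ε := ENNReal.mul_div_cancel (by norm_num) (by norm_num)
  obtain ⟨G, hG⟩ := cauchySeq_tendsto_of_complete hc
  refine ⟨G, Lp.memLp G, ?_⟩
  rw [← Lp.tendsto_Lp_iff_tendsto_eLpNorm'' (fun k => rieszTrunc i j k f) hT G (Lp.memLp G)]
  rwa [Lp.toLp_coeFn]

end

section

/-! ### Fourier multipliers -/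

/-- The character `x ↦ exp (2πi x·ξ)`. -/
def wave (x ξ : Vec n) : ℂ := Complex.exp ((2 * π * inner ℝ x ξ : ℝ) * Complex.I)

lemma norm_wave (x ξ : Vec n) : ‖wave x ξ‖ = 1 := Complex.norm_exp_ofReal_mul_I _

lemma wave_add (x y ξ : Vec n) : wave (x + y) ξ = wave x ξ * wave y ξ := by
  simp only [wave, ← Complex.exp_add, inner_add_left]
  congr 1; push_cast; ring

lemma wave_comm (x ξ : Vec n) : wave x ξ = wave ξ x := by simp only [wave, real_inner_comm]

lemma wave_neg (x ξ : Vec n) : wave (-x) ξ = wave x (-ξ) := by simp [wave]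

lemma wave_re (x ξ : Vec n) : (wave x ξ).re = Real.cos (2 * π * inner ℝ x ξ) :=
  Complex.exp_ofReal_mul_I_re _

@[fun_prop]
lemma continuous_wave : Continuous (fun q : Vec n × Vec n => wave q.1 q.2) := by
  unfold wave; fun_prop

lemma continuous_wave_right (x : Vec n) : Continuous (wave x) := by unfold wave; fun_prop

lemma continuous_wave_left (ξ : Vec n) : Continuous (fun x => wave x ξ) := by unfold wave; fun_prop

lemma fourier_eq_wave (f : Vec n → ℂ) (ξ : Vec n) : 𝓕 f ξ = ∫ x, wave (-x) ξ * f x := by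
  rw [Real.fourier_eq']
  refine integral_congr_all fun x => ?_
  simp only [wave, inner_neg_left, smul_eq_mul]
  congr 3; ring_nf

lemma fourierInv_eq_wave (f : Vec n → ℂ) (x : Vec n) : 𝓕⁻ f x = ∫ ξ, wave x ξ * f ξ := by
  rw [Real.fourierInv_eq']
  refine integral_congr_all fun x => ?_
  simp only [wave, smul_eq_mul, real_inner_comm]

/-- The Fourier transform of a real-valued function. -/
abbrev ft (f : Vec n → ℝ) : Vec n → ℂ := 𝓕 (fun y : Vec n => (f y : ℂ))

lemma multiplierOp_eq (m : Vec n → ℂ) (f : Vec n → ℝ) (x : Vec n) :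
    multiplierOp m f x = (∫ ξ, wave x ξ * (m ξ * ft f ξ)).re := by
  rw [multiplierOp, fourierInv_eq_wave]

lemma integrable_wave_mul {g : Vec n → ℂ} (hg : Integrable g) (x : Vec n) :
    Integrable (fun ξ => wave x ξ * g ξ) :=
  hg.bdd_mul (continuous_wave_right x).aestronglyMeasurable
    (ae_of_all _ fun ξ => (norm_wave x ξ).le)

lemma continuous_multiplierOp
    (hm : Integrable fun ξ => m ξ * ft f ξ) : Continuous (multiplierOp m f) := by
  have h : Continuous (fun x => ∫ ξ, wave x ξ * (m ξ * ft f ξ)) := by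
    refine continuous_of_dominated (bound := fun ξ => ‖m ξ * ft f ξ‖)
      (fun x => (integrable_wave_mul hm x).1) (fun x => ae_of_all _ fun ξ => ?_) hm.norm
      (ae_of_all _ fun ξ => (continuous_wave_left ξ).mul continuous_const)
    rw [norm_mul, norm_wave, one_mul]
  simp_rw [funext (multiplierOp_eq m f)]
  exact Complex.continuous_re.comp h

/-- Convolution with an integrable kernel multiplies the symbol by its Fourier transform. -/
lemma conv_multiplierOp {K : Vec n → ℝ} (hK : Integrable K)
    (hm : Integrable fun ξ => m ξ * ft f ξ) :
    conv K (multiplierOp m f) = multiplierOp (fun ξ => ft K ξ * m ξ) f := by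
  funext x
  have hKx : Integrable (fun y => (K (x - y) : ℂ)) := (integrable_comp_sub_left hK x).ofReal
  have hint : Integrable (fun q : Vec n × Vec n =>
      (K (x - q.1) : ℂ) * (wave q.1 q.2 * (m q.2 * ft f q.2))) (volume.prod volume) := by
    have h1 := hKx.mul_prod hm
    refine (h1.bdd_mul (c := 1) (f := fun q : Vec n × Vec n => wave q.1 q.2)
      continuous_wave.aestronglyMeasurable (ae_of_all _ fun q => (norm_wave _ _).le)).congr
      (ae_of_all _ fun q => ?_)
    simp only; ring
  have e1 : conv K (multiplierOp m f) x =
      (∫ y, ∫ ξ, (K (x - y) : ℂ) * (wave y ξ * (m ξ * ft f ξ))).re := by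
    rw [← RCLike.re_eq_complex_re, ← integral_re hint.integral_prod_left]
    refine integral_congr_all fun y => ?_
    simp only [RCLike.re_eq_complex_re]
    rw [integral_const_mul, Complex.re_ofReal_mul, multiplierOp_eq]
  rw [e1, integral_integral_swap hint, multiplierOp_eq]; congr 1
  refine integral_congr_all fun ξ => ?_
  have e2 : ∫ y, (K (x - y) : ℂ) * wave y ξ = wave x ξ * ft K ξ := by
    rw [ft, fourier_eq_wave, ← integral_const_mul, ← integral_sub_left_eq_self _ volume x]
    refine integral_congr_all fun y => ?_
    simp only [sub_sub_cancel]; rw [sub_eq_add_neg, wave_add]; ring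
  calc ∫ y, (K (x - y) : ℂ) * (wave y ξ * (m ξ * ft f ξ))
      = ∫ y, (K (x - y) : ℂ) * wave y ξ * (m ξ * ft f ξ) := by simp only [mul_assoc]
    _ = wave x ξ * ft K ξ * (m ξ * ft f ξ) := by rw [integral_mul_const, e2]
    _ = _ := by ring

lemma multiplierOp_one (hc : Continuous f) (hf : Integrable f)
    (hF : Integrable (ft f)) : multiplierOp (fun _ => 1) f = f := by
  funext x; simp only [multiplierOp, one_mul]
  have := (Complex.continuous_ofReal.comp hc).fourierInv_fourier_eq hf.ofReal hF
  rw [show (𝓕⁻ (fun ξ => 𝓕 (fun y => (f y : ℂ)) ξ)) = _ from this]; simp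

lemma conv_eq_multiplierOp {K : Vec n → ℝ} (hK : Integrable K) (hc : Continuous f)
    (hf : Integrable f) (hF : Integrable (ft f)) : conv K f = multiplierOp (ft K) f := by
  have h := conv_multiplierOp hK (m := fun _ => 1) (f := f) (by simpa using hF)
  rw [multiplierOp_one hc hf hF] at h; simpa using h

/-! ### The Gaussian and its Fourier transform -/

/-- The Fourier transform `exp (-t (2π|ξ|)²)` of the heat kernel. -/
def gauss (t : ℝ) (ξ : Vec n) : ℝ := exp (-(t * (2 * π * ‖ξ‖) ^ 2))

lemma gauss_pos (t : ℝ) (ξ : Vec n) : 0 < gauss t ξ := Real.exp_pos _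

lemma gauss_le_one (ht : 0 ≤ t) (ξ : Vec n) : gauss t ξ ≤ 1 :=
  Real.exp_le_one_iff.2 (neg_nonpos.2 (by positivity))

lemma gauss_add (s t : ℝ) (ξ : Vec n) : gauss (s + t) ξ = gauss s ξ * gauss t ξ := by
  simp only [gauss, ← Real.exp_add]; congr 1; ring

@[fun_prop]
lemma continuous_gauss (t : ℝ) : Continuous (gauss t : Vec n → ℝ) := by unfold gauss; fun_prop

@[fun_prop]
lemma measurable_gauss_uncurry : Measurable (fun q : ℝ × Vec n => gauss q.1 q.2) := by
  unfold gauss; fun_prop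

lemma ft_heat (ht : 0 < t) (ξ : Vec n) : ft (heat t) ξ = (gauss t ξ : ℂ) := by
  have h := fourier_gaussian_innerProductSpace (V := Vec n) (b := ((1 / (4 * t) : ℝ) : ℂ))
    (by rw [Complex.ofReal_re]; positivity) ξ
  have e : (fun y : Vec n => ((heat t y : ℝ) : ℂ)) = fun y =>
      (((4 * π * t) ^ (-(n : ℝ) / 2) : ℝ) : ℂ) •
        Complex.exp (-((1 / (4 * t) : ℝ) : ℂ) * ‖y‖ ^ 2) := by
    funext y; rw [heat_eq]; simp only [smul_eq_mul]
    push_cast; rfl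
  have e3 : 𝓕 (fun y : Vec n => (((4 * π * t) ^ (-(n : ℝ) / 2) : ℝ) : ℂ) •
        Complex.exp (-((1 / (4 * t) : ℝ) : ℂ) * ‖y‖ ^ 2)) ξ =
      (((4 * π * t) ^ (-(n : ℝ) / 2) : ℝ) : ℂ) *
      𝓕 (fun y : Vec n => Complex.exp (-((1 / (4 * t) : ℝ) : ℂ) * ‖y‖ ^ 2)) ξ := by
    rw [fourier_eq_wave, fourier_eq_wave, ← integral_const_mul]
    congr 1; funext y; simp only [smul_eq_mul]; ring
  rw [ft, e, e3, h, finrank_euclideanSpace_fin]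
  have e1 : (π / ((1 / (4 * t) : ℝ) : ℂ)) ^ ((n : ℂ) / 2) =
      (((4 * π * t) ^ ((n : ℝ) / 2) : ℝ) : ℂ) := by
    rw [Complex.ofReal_cpow (by positivity)]; push_cast; congr 1
    have : (t : ℂ) ≠ 0 := by exact_mod_cast ht.ne'
    field_simp
  have e2 : Complex.exp (-(π : ℂ) ^ 2 * (‖ξ‖ : ℂ) ^ 2 / ((1 / (4 * t) : ℝ) : ℂ)) =
      (gauss t ξ : ℂ) := by
    rw [gauss, Complex.ofReal_exp]; congr 1; push_cast
    have : (t : ℂ) ≠ 0 := by exact_mod_cast ht.ne'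
    field_simp; ring
  rw [e1, e2, ← mul_assoc, ← Complex.ofReal_mul, neg_div, rpow_neg (by positivity),
    inv_mul_cancel₀ (by positivity), Complex.ofReal_one, one_mul]

lemma integrable_rpow_mul_gauss (hn : 0 < n) (hr : -(n : ℝ) < r) (ht : 0 < t) :
    Integrable (fun ξ : Vec n => (2 * π * ‖ξ‖) ^ r * gauss t ξ) := by
  have : Nonempty (Fin n) := ⟨⟨0, hn⟩⟩
  have h := (integrable_fun_norm_addHaar (volume : Measure (Vec n))
    (f := fun y => (2 * π * y) ^ r * exp (-(t * (2 * π * y) ^ 2)))).2 ?_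
  · exact h
  have h1 := integrableOn_rpow_mul_exp_neg_mul_sq (b := t * (2 * π) ^ 2) (by positivity)
    (s := r + n - 1) (by linarith)
  refine IntegrableOn.congr_fun (h1.const_mul ((2 * π) ^ r)) (fun y hy => ?_) measurableSet_Ioi
  have hy : 0 < y := hy
  simp only [smul_eq_mul, finrank_euclideanSpace_fin]
  rw [mul_rpow (by positivity) hy.le, show r + n - 1 = (n - 1 : ℕ) + r by
    rw [Nat.cast_sub hn]; push_cast; ring, rpow_add hy, Real.rpow_natCast]
  have : -(t * (2 * π * y) ^ 2) = -(t * (2 * π) ^ 2) * y ^ 2 := by ring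
  rw [this]; ring

lemma hasDerivAt_wave_line (x ξ : Vec n) (k : Fin n) :
    HasLineDerivAt ℝ (fun x => wave (-x) ξ) (-(2 * π * ξ k : ℝ) * Complex.I * wave (-x) ξ) x
      (single k (1 : ℝ)) := by
  unfold HasLineDerivAt wave
  have h1 : HasDerivAt (fun s : ℝ => 2 * π *
      inner ℝ (-(x + s • single k (1 : ℝ))) ξ) (-(2 * π * ξ k)) 0 := by
    have : (fun s : ℝ => 2 * π * inner ℝ (-(x + s • single k (1 : ℝ))) ξ) =
        fun s => s * (-(2 * π * ξ k)) + -(2 * π * inner ℝ x ξ) := by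
      funext s
      rw [inner_neg_left, inner_add_left, real_inner_smul_left, EuclideanSpace.inner_single_left]
      simp; ring
    rw [this]
    simpa using ((hasDerivAt_id (0 : ℝ)).mul_const (-(2 * π * ξ k))).add_const
      (-(2 * π * inner ℝ x ξ))
  have h2 := ((h1.ofReal_comp).mul_const Complex.I).cexp
  refine h2.congr_deriv ?_
  simp only [zero_smul, add_zero, Complex.ofReal_neg]; ring

lemma ft_lineDeriv {g' : Vec n → ℝ} {k : Fin n} (hg : Integrable g) (hg' : Integrable g')
    (h : ∀ x, HasLineDerivAt ℝ g (g' x) x (single k (1 : ℝ))) (ξ : Vec n) :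
    ft g' ξ = (2 * π * ξ k : ℝ) * Complex.I * ft g ξ := by
  have hw : Continuous (fun x => wave (-x) ξ) := (continuous_wave_left ξ).comp continuous_neg
  have hb : ∀ {f : Vec n → ℂ}, Integrable f → Integrable (fun x => wave (-x) ξ * f x) := fun hf =>
    hf.bdd_mul hw.aestronglyMeasurable (ae_of_all _ fun x => (norm_wave _ _).le)
  have := integral_bilinear_hasLineDerivAt_right_eq_neg_left_of_integrable (μ := volume)
    (f := fun x => wave (-x) ξ) (f' := fun x => -(2 * π * ξ k : ℝ) * Complex.I * wave (-x) ξ)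
    (g := fun x => (g x : ℂ)) (g' := fun x => (g' x : ℂ)) (v := single k (1 : ℝ))
    (B := ContinuousLinearMap.mul ℝ ℂ) ?_ (hb hg'.ofReal) (hb hg.ofReal)
    (fun x _ => hasDerivAt_wave_line x ξ k) (fun x _ => (h x).ofReal_comp)
  · simp only [ContinuousLinearMap.mul_apply'] at this
    rw [ft, fourier_eq_wave, this, ft, fourier_eq_wave, ← integral_const_mul, ← integral_neg]
    refine integral_congr_all fun x => ?_
    ring
  · refine ((hb hg.ofReal).const_mul (-(2 * π * ξ k : ℝ) * Complex.I)).congr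
      (ae_of_all _ fun x => ?_)
    change -(2 * π * ξ k : ℝ) * Complex.I * (wave (-x) ξ * (g x : ℂ)) =
      -(2 * π * ξ k : ℝ) * Complex.I * wave (-x) ξ * (g x : ℂ)
    ring

lemma ft_heatHess (ht : 0 < t) (i j : Fin n) (ξ : Vec n) :
    ft (heatHess i j t) ξ = ((-((2 * π) ^ 2 * (ξ i * ξ j)) * gauss t ξ : ℝ) : ℂ) := by
  have h1 : ft (heatGrad i t) ξ = (2 * π * ξ i : ℝ) * Complex.I * ft (heat t) ξ :=
    ft_lineDeriv (integrable_heat ht) (integrable_heatGrad ht i) (fun x =>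
      hasLineDerivAt_of_line (fun x => by simpa using hasDerivAt_heat_line (t := t) i x 0) x) ξ
  have h2 : ft (heatHess i j t) ξ = (2 * π * ξ j : ℝ) * Complex.I * ft (heatGrad i t) ξ :=
    ft_lineDeriv (integrable_heatGrad ht i) (integrable_heatHess ht i j) (fun x =>
      hasLineDerivAt_of_line (fun x => by simpa using hasDerivAt_heatGrad_line (t := t) i j x 0) x) ξ
  rw [h2, h1, ft_heat ht]; push_cast
  linear_combination (2 * π * ξ j) * (2 * π * ξ i) * (gauss t ξ : ℂ) * Complex.I_sq

lemma ft_heatLap (ht : 0 < t) (ξ : Vec n) :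
    ft (heatLap t) ξ = ((-(2 * π * ‖ξ‖) ^ 2 * gauss t ξ : ℝ) : ℂ) := by
  have h : ft (heatLap t) ξ = ∑ k, ft (heatHess k k t) ξ := by
    simp only [ft, fourier_eq_wave, heatLap, Complex.ofReal_sum, mul_sum]
    refine integral_finsetSum _ fun k _ => ?_
    exact (integrable_heatHess ht k k).ofReal.bdd_mul
      ((continuous_wave_left ξ).comp continuous_neg).aestronglyMeasurable
      (ae_of_all _ fun x => (norm_wave _ _).le)
  simp only [h, ft_heatHess ht]
  rw [← Complex.ofReal_sum, ← sum_mul, Finset.sum_neg_distrib, ← mul_sum,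
    mul_pow _ ‖ξ‖, EuclideanSpace.norm_sq_eq]
  simp only [norm_eq_abs, pow_two, abs_mul_abs_self]

end

section

/-! ### Fractional Laplacians of the heat kernel -/

/-- The symbol `(2π|ξ|)^r` of `(-Δ)^{r/2}`. -/
def fracSymbol (r : ℝ) (ξ : Vec n) : ℝ := (2 * π * ‖ξ‖) ^ r

lemma fracSymbol_nonneg (r : ℝ) (ξ : Vec n) : 0 ≤ fracSymbol r ξ := by unfold fracSymbol; positivity

@[fun_prop]
lemma measurable_fracSymbol (r : ℝ) : Measurable (fracSymbol r : Vec n → ℝ) := by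
  unfold fracSymbol; fun_prop

lemma continuous_fracSymbol (hr : 0 ≤ r) : Continuous (fracSymbol r : Vec n → ℝ) := by
  unfold fracSymbol
  exact (by fun_prop : Continuous fun ξ : Vec n => 2 * π * ‖ξ‖).rpow_const fun _ => Or.inr hr

lemma fracSymbol_two (ξ : Vec n) : fracSymbol 2 ξ = (2 * π * ‖ξ‖) ^ 2 := by
  unfold fracSymbol; exact Real.rpow_two _

lemma fracSymbol_zero (ξ : Vec n) : fracSymbol 0 ξ = 1 := Real.rpow_zero _

lemma fracSymbol_neg (r : ℝ) (ξ : Vec n) : fracSymbol r (-ξ) = fracSymbol r ξ := by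
  simp [fracSymbol]

lemma fracSymbol_add {r' : ℝ} (hξ : ξ ≠ 0) :
    fracSymbol (r + r') ξ = fracSymbol r ξ * fracSymbol r' ξ :=
  rpow_add (by positivity) _ _

lemma ae_ne_zero (hn : 0 < n) : ∀ᵐ ξ : Vec n, ξ ≠ 0 := by
  have : Nonempty (Fin n) := ⟨⟨0, hn⟩⟩
  have : Nontrivial (Vec n) := inferInstance
  exact (Set.countable_singleton (0 : Vec n)).ae_notMem volume

/-- The convolution kernel `(-Δ)^{r/2} p_t` of `(-Δ)^{r/2} e^{tΔ}`. -/
def fracHeat (r t : ℝ) : Vec n → ℝ := fracLap r (heat t)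

lemma fracLap_eq (r : ℝ) (f : Vec n → ℝ) :
    fracLap r f = multiplierOp (fun ξ => (fracSymbol r ξ : ℂ)) f := rfl

lemma integrable_fracSymbol_mul_gauss (hn : 0 < n) (hr : -(n : ℝ) < r) (ht : 0 < t) :
    Integrable (fun ξ : Vec n => fracSymbol r ξ * gauss t ξ) :=
  integrable_rpow_mul_gauss hn hr ht

lemma integrable_fracSymbol_mul_ft_heat (hn : 0 < n) (hr : -(n : ℝ) < r) (ht : 0 < t) :
    Integrable (fun ξ : Vec n => (fracSymbol r ξ : ℂ) * ft (heat t) ξ) := by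
  refine (integrable_fracSymbol_mul_gauss hn hr ht).ofReal.congr (ae_of_all _ fun ξ => ?_)
  simp only [ft_heat ht]
  exact Complex.ofReal_mul _ _

lemma fracHeat_eq_re (ht : 0 < t) (x : Vec n) :
    fracHeat r t x = (∫ ξ, wave x ξ * ((fracSymbol r ξ * gauss t ξ : ℝ) : ℂ)).re := by
  rw [fracHeat, fracLap_eq, multiplierOp_eq]; simp only [ft_heat ht, Complex.ofReal_mul]

lemma fracHeat_eq (hn : 0 < n) (hr : -(n : ℝ) < r) (ht : 0 < t) (x : Vec n) :
    fracHeat r t x = ∫ ξ, fracSymbol r ξ * gauss t ξ * Real.cos (2 * π * inner ℝ x ξ) := by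
  have hi : Integrable (fun ξ => wave x ξ * ((fracSymbol r ξ * gauss t ξ : ℝ) : ℂ)) :=
    integrable_wave_mul (integrable_fracSymbol_mul_gauss hn hr ht).ofReal x
  rw [fracHeat_eq_re ht, ← RCLike.re_eq_complex_re, ← integral_re hi]
  refine integral_congr_all fun ξ => ?_
  simp only [RCLike.re_eq_complex_re]; rw [mul_comm, Complex.re_ofReal_mul, wave_re]

lemma fracHeat_neg (r : ℝ) (ht : 0 < t) (x : Vec n) : fracHeat r t (-x) = fracHeat r t x := by
  rw [fracHeat_eq_re ht, fracHeat_eq_re ht, ← integral_neg_eq_self]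
  simp only [wave_neg, neg_neg, fracSymbol_neg, gauss, norm_neg]

/-- A continuous integrable kernel is recovered from its Fourier transform. -/
lemma multiplierOp_heat_eq {K : Vec n → ℝ} (hc : Continuous K)
    (hK : Integrable K) (hF : Integrable (ft K)) (h : ∀ ξ, ft K ξ = m ξ * ft (heat t) ξ) :
    multiplierOp m (heat t) = K := by
  rw [← multiplierOp_one hc hK hF]; funext x; rw [multiplierOp_eq, multiplierOp_eq]
  simp only [one_mul, h]

lemma fracHeat_two (hn : 0 < n) (ht : 0 < t) (x : Vec n) : fracHeat 2 t x = -heatLap t x := by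
  have h : ∀ ξ : Vec n, ft (fun x => -heatLap t x) ξ = (fracSymbol 2 ξ : ℂ) * ft (heat t) ξ := by
    intro ξ
    have h1 : ft (fun x => -heatLap t x) ξ = -ft (heatLap t) ξ := by
      rw [ft, ft, fourier_eq_wave, fourier_eq_wave, ← integral_neg]
      simp only [Complex.ofReal_neg, mul_neg]
    rw [h1, ft_heatLap ht, ft_heat ht, fracSymbol_two]
    push_cast; ring
  have h2 : Integrable (ft (fun x : Vec n => -heatLap t x)) :=
    (integrable_fracSymbol_mul_ft_heat hn (r := 2) (by
      have : (0 : ℝ) ≤ n := n.cast_nonneg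
      linarith) ht).congr (ae_of_all _ fun ξ => (h ξ).symm)
  exact congrFun (multiplierOp_heat_eq (continuous_heatLap t).neg (integrable_heatLap ht).neg h2 h) x

lemma fracHeat_zero (hn : 0 < n) (ht : 0 < t) (x : Vec n) : fracHeat 0 t x = heat t x := by
  have h2 : Integrable (ft (heat t : Vec n → ℝ)) :=
    (integrable_fracSymbol_mul_ft_heat hn (r := 0) (by simpa using hn) ht).congr
      (ae_of_all _ fun ξ => by simp [fracSymbol_zero])
  exact congrFun (multiplierOp_heat_eq (continuous_heat t) (integrable_heat ht) h2 fun ξ => by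
    simp) x

lemma integral_rpow_mul_gauss {ε : ℝ} (hε : ε < 2) (hξ : ξ ≠ 0) :
    IntegrableOn (fun τ : ℝ => τ ^ (-(ε / 2)) * gauss τ ξ) (Ioi 0) ∧
    ∫ τ in Ioi 0, τ ^ (-(ε / 2)) * gauss τ ξ = Gamma (1 - ε / 2) * fracSymbol (ε - 2) ξ := by
  have hpos : 0 < (2 * π * ‖ξ‖) ^ 2 := by positivity
  have e : ∀ τ : ℝ, τ ^ (-(ε / 2)) * gauss τ ξ =
      τ ^ ((1 - ε / 2) - 1) * exp (-((2 * π * ‖ξ‖) ^ 2 * τ)) := fun τ => by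
    rw [gauss, mul_comm τ]; congr 2; ring
  have h2 : ∫ τ in Ioi 0, τ ^ (-(ε / 2)) * gauss τ ξ =
      Gamma (1 - ε / 2) * fracSymbol (ε - 2) ξ := by
    simp_rw [e]
    rw [Real.integral_rpow_mul_exp_neg_mul_Ioi (by linarith) hpos, mul_comm, one_div,
      ← Real.rpow_natCast, ← rpow_neg (by positivity), ← rpow_mul (by positivity),
      fracSymbol]
    congr 2
    push_cast; ring
  refine ⟨?_, h2⟩
  by_contra hc
  rw [integral_undef hc] at h2
  have h3 : 0 < Gamma (1 - ε / 2) := Real.Gamma_pos_of_pos (by linarith)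
  have h4 : 0 < fracSymbol (ε - 2) ξ := by unfold fracSymbol; positivity
  have := mul_pos h3 h4
  linarith

/-- `∫₀^∞ τ^{-ε/2} e^{τΔ} dτ = Γ(1-ε/2) (-Δ)^{ε/2-1}` on the Fourier side. -/
lemma integral_rpow_mul_integral_gauss (hn : 0 < n) {ε : ℝ} (hε : ε < 2) (hf : Measurable f)
    (hi : Integrable fun ξ => fracSymbol (ε - 2) ξ * f ξ) :
    IntegrableOn (fun τ => ∫ ξ, f ξ * (τ ^ (-(ε / 2)) * gauss τ ξ)) (Ioi 0) ∧
    ∫ τ in Ioi 0, ∫ ξ, f ξ * (τ ^ (-(ε / 2)) * gauss τ ξ) =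
      Gamma (1 - ε / 2) * ∫ ξ, fracSymbol (ε - 2) ξ * f ξ := by
  have hm : Measurable fun q : Vec n × ℝ => f q.1 * (q.2 ^ (-(ε / 2)) * gauss q.2 q.1) :=
    (hf.comp measurable_fst).mul ((measurable_snd.pow_const _).mul
      (measurable_gauss_uncurry.comp measurable_swap))
  have hint : Integrable (fun q : Vec n × ℝ => f q.1 * (q.2 ^ (-(ε / 2)) * gauss q.2 q.1))
      (volume.prod (volume.restrict (Ioi 0))) := by
    rw [integrable_prod_iff hm.aestronglyMeasurable]; constructor
    · filter_upwards [ae_ne_zero hn] with ξ hξ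
      exact Integrable.const_mul (integral_rpow_mul_gauss hε hξ).1 (f ξ)
    · refine (hi.norm.const_mul (Gamma (1 - ε / 2))).congr ?_
      filter_upwards [ae_ne_zero hn] with ξ hξ
      rw [norm_mul, norm_of_nonneg (fracSymbol_nonneg _ _), ← mul_assoc,
        ← (integral_rpow_mul_gauss hε hξ).2, ← integral_mul_const]
      refine setIntegral_congr_fun measurableSet_Ioi fun τ (hτ : 0 < τ) => ?_
      have := gauss_pos τ ξ
      simp only [norm_mul, norm_of_nonneg this.le,
        norm_of_nonneg (by positivity : 0 ≤ τ ^ (-(ε / 2)))]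
      ring
  refine ⟨hint.integral_prod_right, ?_⟩
  rw [← integral_integral_swap hint, ← integral_const_mul]
  refine integral_congr_ae ?_
  filter_upwards [ae_ne_zero hn] with ξ hξ
  rw [integral_const_mul, (integral_rpow_mul_gauss hε hξ).2]; ring

/-- The subordination formula
`(-Δ)^{r/2} p_δ = Γ(1-ε/2)⁻¹ ∫₀^∞ τ^{-ε/2} (-Δ)^{(r+2-ε)/2} p_{δ+τ} dτ`. -/
lemma integral_rpow_mul_fracHeat (hn : 0 < n) {ε δ : ℝ} (hr : -(n : ℝ) < r) (hε : ε < 2)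
    (hδ : 0 < δ) (x : Vec n) :
    IntegrableOn (fun τ : ℝ => τ ^ (-(ε / 2)) * fracHeat (r + 2 - ε) (δ + τ) x) (Ioi 0) ∧
    ∫ τ in Ioi 0, τ ^ (-(ε / 2)) * fracHeat (r + 2 - ε) (δ + τ) x =
      Gamma (1 - ε / 2) * fracHeat r δ x := by
  set c : Vec n → ℝ := fun ξ => Real.cos (2 * π * inner ℝ x ξ)
  have hcm : Measurable c := by fun_prop
  have e : (fun ξ => fracSymbol r ξ * gauss δ ξ * c ξ) =ᵐ[volume] fun ξ =>
      fracSymbol (ε - 2) ξ * (fracSymbol (r + 2 - ε) ξ * gauss δ ξ * c ξ) := by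
    filter_upwards [ae_ne_zero hn] with ξ hξ
    rw [← mul_assoc, ← mul_assoc, ← fracSymbol_add hξ, show ε - 2 + (r + 2 - ε) = r by ring]
  have h := integral_rpow_mul_integral_gauss hn hε
    (f := fun ξ => fracSymbol (r + 2 - ε) ξ * gauss δ ξ * c ξ) (by fun_prop)
    (((integrable_fracSymbol_mul_gauss hn hr hδ).mul_bdd (c := 1) (by fun_prop)
      (ae_of_all _ fun ξ => Real.abs_cos_le_one _)).congr e)
  have e2 : Set.EqOn (fun τ => ∫ ξ, fracSymbol (r + 2 - ε) ξ * gauss δ ξ * c ξ *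
      (τ ^ (-(ε / 2)) * gauss τ ξ)) (fun τ => τ ^ (-(ε / 2)) * fracHeat (r + 2 - ε) (δ + τ) x)
      (Ioi 0) := fun τ (hτ : 0 < τ) => by
    simp only [gauss_add, fracHeat_eq hn (by linarith : -(n : ℝ) < r + 2 - ε) (add_pos hδ hτ),
      ← integral_const_mul]
    exact integral_congr_all fun ξ => by ring
  rw [← setIntegral_congr_fun measurableSet_Ioi e2, h.2, ← integral_congr_ae e, fracHeat_eq hn hr hδ]
  exact ⟨h.1.congr_fun e2 measurableSet_Ioi, rfl⟩

/-- `∫₀^∞ τ^{-a} (δ+τ)^{-b} dτ` is finite and scales like `δ^{1-a-b}`. -/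
lemma exists_integral_rpow_mul_rpow_le (ha : a < 1) (hb : 0 ≤ b) (hab : 1 < a + b) :
    ∃ C : ℝ, 0 < C ∧ ∀ δ : ℝ, 0 < δ →
      IntegrableOn (fun τ : ℝ => τ ^ (-a) * (δ + τ) ^ (-b)) (Ioi 0) ∧
      ∫ τ in Ioi 0, τ ^ (-a) * (δ + τ) ^ (-b) ≤ C * δ ^ (1 - a - b) := by
  have hint : ∀ δ : ℝ, 0 < δ → IntegrableOn (fun τ : ℝ => τ ^ (-a) * (δ + τ) ^ (-b)) (Ioi 0) := by
    intro δ hδ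
    have hm : Measurable (fun τ : ℝ => τ ^ (-a) * (δ + τ) ^ (-b)) := by fun_prop
    rw [← Set.Ioc_union_Ioi_eq_Ioi zero_le_one]
    refine IntegrableOn.union ?_ ?_
    · have h1 : IntegrableOn (fun τ : ℝ => τ ^ (-a)) (Ioc 0 1) := by
        rw [← intervalIntegrable_iff_integrableOn_Ioc_of_le zero_le_one]
        exact intervalIntegral.intervalIntegrable_rpow' (by linarith)
      refine (Integrable.mul_const h1 (δ ^ (-b))).mono' hm.aestronglyMeasurable ?_
      filter_upwards [ae_restrict_mem measurableSet_Ioc] with τ hτ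
      have h0 := hτ.1
      rw [norm_of_nonneg (by positivity)]
      gcongr ?_ * ?_
      exact Real.rpow_le_rpow_of_nonpos hδ (by linarith) (by linarith)
    · refine (integrableOn_Ioi_rpow_of_lt (a := -a + -b) (by linarith) one_pos).mono'
        hm.aestronglyMeasurable ?_
      filter_upwards [ae_restrict_mem measurableSet_Ioi] with τ hτ
      have h0 : 0 < τ := one_pos.trans hτ
      rw [norm_of_nonneg (by positivity), rpow_add h0]
      gcongr ?_ * ?_
      exact Real.rpow_le_rpow_of_nonpos h0 (by linarith) (by linarith)
  refine ⟨|∫ τ in Ioi 0, τ ^ (-a) * (1 + τ) ^ (-b)| + 1, by positivity, fun δ hδ => ⟨hint δ hδ, ?_⟩⟩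
  have h := integral_comp_mul_left_Ioi (fun τ : ℝ => τ ^ (-a) * (δ + τ) ^ (-b)) 0 hδ
  rw [mul_zero, smul_eq_mul] at h
  have e : ∫ τ in Ioi 0, (δ * τ) ^ (-a) * (δ + δ * τ) ^ (-b) =
      δ ^ (-a - b) * ∫ τ in Ioi 0, τ ^ (-a) * (1 + τ) ^ (-b) := by
    rw [← integral_const_mul]
    refine setIntegral_congr_fun measurableSet_Ioi fun τ hτ => ?_
    have hτ : 0 < τ := hτ
    rw [show δ + δ * τ = δ * (1 + τ) by ring, mul_rpow hδ.le hτ.le,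
      mul_rpow hδ.le (by positivity), sub_eq_add_neg, rpow_add hδ]
    ring
  rw [e, eq_inv_mul_iff_mul_eq₀ hδ.ne', ← mul_assoc] at h
  rw [← h, show 1 - a - b = 1 + (-a - b) by ring, rpow_add hδ, Real.rpow_one]
  have := le_abs_self (∫ τ : ℝ in Ioi 0, τ ^ (-a) * (1 + τ) ^ (-b))
  have h2 : 0 < δ * δ ^ (-a - b) := by positivity
  nlinarith

end

section

/-! ### Bounds for fractional Laplacians of the heat kernel -/

section Param

variable {k : ℝ → Vec n → ℝ} {β : ℝ} {μ : Measure ℝ} [SFinite μ] {ω θ : ℝ → ℝ}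
  (hk : Measurable fun w : ℝ × Vec n => k w.1 w.2)
  (h : ∀ t : ℝ, 0 < t → Integrable (k t) ∧ ∫ x, |k t x| ≤ C * t ^ (-β))
  (hω : Measurable ω) (hθ : Measurable θ) (hpos : ∀ᵐ t ∂μ, 0 < θ t)
  (hi : Integrable (fun t => ω t * θ t ^ (-β)) μ)

include hk h hω hθ hpos hi

/-- Averaging a family of kernels `k (θ t)` with `L¹` norm at most `C (θ t)^{-β}` gives a kernel in
`L¹`. -/
lemma integrable_mul_param :
    Measurable (fun w : ℝ × Vec n => ω w.1 * k (θ w.1) w.2) ∧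
    Integrable (fun w : ℝ × Vec n => ω w.1 * k (θ w.1) w.2) (μ.prod volume) ∧
    ∫ x, |∫ t, ω t * k (θ t) x ∂μ| ≤ C * ∫ t, |ω t * θ t ^ (-β)| ∂μ := by
  have hm : Measurable (fun w : ℝ × Vec n => ω w.1 * k (θ w.1) w.2) :=
    (hω.comp measurable_fst).mul (hk.comp (by fun_prop : Measurable fun w : ℝ × Vec n =>
      (θ w.1, w.2)))
  have hle : ∀ᵐ t ∂μ, ∫ x, ‖ω t * k (θ t) x‖ ≤ C * |ω t * θ t ^ (-β)| := by
    filter_upwards [hpos] with t ht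
    simp only [norm_mul, norm_eq_abs]
    rw [integral_const_mul, abs_mul, abs_of_pos (Real.rpow_pos_of_pos ht _), mul_left_comm]; gcongr
    exact (h _ ht).2
  have hint : Integrable (fun w : ℝ × Vec n => ω w.1 * k (θ w.1) w.2) (μ.prod volume) := by
    rw [integrable_prod_iff hm.aestronglyMeasurable]
    refine ⟨hpos.mono fun t ht => (h _ ht).1.const_mul (ω t), (hi.norm.const_mul C).mono'
      (hm.norm.stronglyMeasurable.integral_prod_right' (ν := volume)).aestronglyMeasurable ?_⟩
    filter_upwards [hle] with t ht
    rwa [norm_of_nonneg (integral_nonneg fun _ => norm_nonneg _)]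
  refine ⟨hm, hint, ?_⟩
  calc _ ≤ ∫ x, ∫ t, ‖ω t * k (θ t) x‖ ∂μ :=
        integral_mono_of_nonneg (ae_of_all _ fun x => abs_nonneg _)
          hint.norm.integral_prod_right (ae_of_all _ fun x =>
            norm_integral_le_integral_norm fun t => ω t * k (θ t) x)
    _ = ∫ t, (∫ x, ‖ω t * k (θ t) x‖) ∂μ :=
        (integral_integral_swap (f := fun t x => ‖ω t * k (θ t) x‖) hint.norm).symm
    _ ≤ ∫ t, C * |ω t * θ t ^ (-β)| ∂μ :=
        integral_mono_ae hint.norm.integral_prod_left (hi.norm.const_mul C) hle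
    _ = _ := integral_const_mul ..

end Param

lemma exists_integral_fracHeat_le_of_lt_two (hn : 0 < n) (hr0 : 0 < r) (hr2 : r < 2) :
    ∃ C : ℝ, 0 < C ∧ ∀ σ : ℝ, 0 < σ → Integrable (fracHeat r σ : Vec n → ℝ) ∧
      ∫ x : Vec n, |fracHeat r σ x| ≤ C * σ ^ (-(r / 2)) := by
  obtain ⟨C₁, hC₁, h₁⟩ := abs_heatLap_le n
  obtain ⟨C₂, hC₂, h₂⟩ := exists_integral_rpow_mul_rpow_le (a := r / 2) (b := 1) (by linarith)
    zero_le_one (by linarith)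
  have hΓ : 0 < Gamma (1 - r / 2) := Real.Gamma_pos_of_pos (by linarith)
  refine ⟨(Gamma (1 - r / 2))⁻¹ * (C₁ * C₂), by positivity, fun σ hσ => ?_⟩
  obtain ⟨i₂, b₂⟩ := h₂ σ hσ
  have hb (t : ℝ) (ht : 0 < t) : Integrable (heatLap t : Vec n → ℝ) ∧
      ∫ x : Vec n, |heatLap t x| ≤ C₁ * t ^ (-1 : ℝ) :=
    ⟨integrable_heatLap ht, by
      refine (integral_mono_of_nonneg (ae_of_all _ fun x => abs_nonneg _)
        ((integrable_heat (by positivity)).const_mul _) (ae_of_all _ (h₁ t ht))).trans_eq ?_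
      rw [integral_const_mul, integral_heat (by positivity), mul_one, Real.rpow_neg_one]⟩
  obtain ⟨-, hint, hle⟩ := integrable_mul_param measurable_heatLap_uncurry hb
    (ω := fun τ => τ ^ (-(r / 2))) (θ := fun τ => σ + τ) (by fun_prop) (by fun_prop)
    ((ae_restrict_mem measurableSet_Ioi).mono fun τ hτ => add_pos hσ hτ) i₂
  have e (x : Vec n) : fracHeat r σ x = -(Gamma (1 - r / 2))⁻¹ *
      ∫ τ in Ioi 0, τ ^ (-(r / 2)) * heatLap (σ + τ) x := by
    rw [neg_mul, ← mul_neg, eq_inv_mul_iff_mul_eq₀ hΓ.ne', ← integral_neg,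
      ← (integral_rpow_mul_fracHeat hn (r := r) (ε := r) (by
        linarith [n.cast_nonneg (α := ℝ)]) hr2 hσ x).2]
    refine setIntegral_congr_fun measurableSet_Ioi fun τ (hτ : 0 < τ) => ?_
    simp only [show r + 2 - r = 2 by ring, fracHeat_two hn (add_pos hσ hτ), mul_neg]
  refine ⟨funext e ▸ hint.integral_prod_right.const_mul _, ?_⟩
  simp only [e, abs_mul, abs_neg, abs_of_pos (inv_pos.2 hΓ)]
  rw [integral_const_mul, mul_assoc, mul_assoc]; gcongr
  refine hle.trans ?_
  gcongr
  refine Eq.trans_le (setIntegral_congr_fun measurableSet_Ioi fun τ (hτ : 0 < τ) => ?_)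
    (b₂.trans_eq (by ring_nf))
  exact abs_of_nonneg (by positivity)

/-- The kernel `(-Δ)^{r/2} p_t` as a complex Fourier integral. -/
lemma fracHeat_eq_fourierInv (ht : 0 < t) (x : Vec n) :
    (fracHeat r t x : ℂ) = ∫ ξ, wave x ξ * ((fracSymbol r ξ * gauss t ξ : ℝ) : ℂ) := by
  rw [fracHeat_eq_re ht]
  refine Complex.conj_eq_iff_re.1 ?_
  rw [← integral_conj, ← integral_neg_eq_self]
  refine integral_congr_all fun ξ => ?_
  simp only [map_mul, Complex.conj_ofReal, fracSymbol_neg, gauss, norm_neg]; congr 1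
  simp only [wave, ← Complex.exp_conj, map_mul, Complex.conj_ofReal, Complex.conj_I,
    inner_neg_right]
  congr 1; push_cast; ring

lemma ft_fracHeat (hn : 0 < n) (hr : 0 ≤ r) (ht : 0 < t)
    (hi : Integrable (fracHeat r t : Vec n → ℝ)) (ξ : Vec n) :
    ft (fracHeat r t) ξ = ((fracSymbol r ξ * gauss t ξ : ℝ) : ℂ) := by
  set m : Vec n → ℂ := fun ξ => ((fracSymbol r ξ * gauss t ξ : ℝ) : ℂ) with hm
  have hr' : -(n : ℝ) < r := by
    have : (0 : ℝ) < n := by exact_mod_cast hn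
    linarith
  have hmc : Continuous m :=
    Complex.continuous_ofReal.comp ((continuous_fracSymbol hr).mul (continuous_gauss t))
  have hmi : Integrable m := (integrable_fracSymbol_mul_gauss hn hr' ht).ofReal
  have e1 : (fun x => (fracHeat r t x : ℂ)) = 𝓕⁻ m := by
    funext x; rw [fourierInv_eq_wave, fracHeat_eq_fourierInv ht]
  have e2 : 𝓕 m = fun x => (fracHeat r t x : ℂ) := by
    funext x; rw [← fracHeat_neg r ht, fracHeat_eq_fourierInv ht, fourier_eq_wave]
    refine integral_congr_all fun y => ?_
    simp only [hm]; rw [wave_neg, wave_comm]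
  rw [ft, e1, hmc.fourier_fourierInv_eq hmi (by rw [e2]; exact hi.ofReal)]

lemma conv_fracHeat (hn : 0 < n) {r' t' : ℝ} (hr : 0 ≤ r) (ht : 0 < t) (hr' : -(n : ℝ) < r')
    (ht' : 0 < t') (hi : Integrable (fracHeat r t : Vec n → ℝ)) :
    conv (fracHeat r t) (fracHeat r' t') = (fracHeat (r + r') (t + t') : Vec n → ℝ) := by
  rw [show (fracHeat r' t' : Vec n → ℝ) = fracLap r' (heat t') from rfl, fracLap_eq r',
    conv_multiplierOp hi (integrable_fracSymbol_mul_ft_heat hn hr' ht')]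
  funext x; rw [multiplierOp_eq, fracHeat_eq_re (by positivity)]; congr 1
  refine integral_congr_ae ?_
  filter_upwards [ae_ne_zero hn] with ξ hξ
  rw [ft_fracHeat hn hr ht hi, ft_heat ht', fracSymbol_add hξ, gauss_add]; push_cast; ring

/-- The kernels `(-Δ)^{r/2} p_σ` are integrable, with norm of order `σ^{-r/2}`. -/
lemma exists_integral_fracHeat_le (hn : 0 < n) (hr0 : 0 < r) (hr4 : r < 4) :
    ∃ C : ℝ, 0 < C ∧ ∀ σ : ℝ, 0 < σ → Integrable (fracHeat r σ : Vec n → ℝ) ∧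
      ∫ x : Vec n, |fracHeat r σ x| ≤ C * σ ^ (-(r / 2)) := by
  obtain ⟨C, hC, h⟩ := exists_integral_fracHeat_le_of_lt_two hn (r := r / 2) (by linarith)
    (by linarith)
  refine ⟨C ^ 2 * 2 ^ (r / 2), by positivity, fun σ hσ => ?_⟩
  obtain ⟨hi, hb⟩ := h (σ / 2) (by positivity)
  have hn' : (0 : ℝ) < n := by exact_mod_cast hn
  have e := conv_fracHeat hn (r := r / 2) (r' := r / 2) (t := σ / 2) (t' := σ / 2) (by linarith)
    (by positivity) (by linarith) (by positivity) hi
  rw [add_halves, add_halves] at e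
  have hint : Integrable (fracHeat r σ : Vec n → ℝ) := e ▸ integrable_conv hi hi
  refine ⟨hint, ?_⟩
  have h1 := eLpNorm_conv_le hi.1 hi.1 le_rfl one_ne_top
  have nrm : ∀ {f : Vec n → ℝ}, Integrable f → eLpNorm f 1 = ofReal (∫ x, |f x|) := by
    intro f hf; rw [eLpNorm_one_eq_lintegral_enorm, ← ofReal_integral_norm_eq_lintegral_enorm hf]
    rfl
  rw [e, nrm hint, nrm hi, ← ofReal_mul (by positivity)] at h1
  have h2 := (ENNReal.ofReal_le_ofReal_iff (by positivity)).1 h1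
  have h3 : ((σ / 2) ^ (-(r / 2 / 2))) ^ 2 = 2 ^ (r / 2) * σ ^ (-(r / 2)) := by
    rw [← Real.rpow_natCast, ← rpow_mul (by positivity), Real.div_rpow hσ.le two_pos.le,
      div_eq_mul_inv, ← rpow_neg two_pos.le, mul_comm]
    congr 2 <;> push_cast <;> ring
  calc _ ≤ _ := h2
    _ ≤ (C * (σ / 2) ^ (-(r / 2 / 2))) * (C * (σ / 2) ^ (-(r / 2 / 2))) := by gcongr
    _ = C ^ 2 * ((σ / 2) ^ (-(r / 2 / 2))) ^ 2 := by ring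
    _ = _ := by rw [h3]; ring

end

section

/-! ### Heat kernels as test functions -/

open Function in
lemma exists_one_add_norm_pow_mul_heat_le (ht : 0 < t) (N : ℕ) (a : Vec n) :
    ∃ C : ℝ, ∀ x : Vec n, (1 + ‖x‖) ^ N * heat t (a - x) ≤ C := by
  obtain ⟨C, hC, h⟩ := rpow_norm_mul_heat_le n (m := N) (by positivity)
  set c := (4 * π * t) ^ (-(n : ℝ) / 2)
  set c' := (4 * π * (2 * t)) ^ (-(n : ℝ) / 2)
  refine ⟨(1 + ‖a‖) ^ N * (2 ^ N * (c + C * t ^ ((N : ℝ) / 2) * c')), fun x => ?_⟩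
  have hp := heat_pos ht (a - x)
  have h1 : 1 + ‖x‖ ≤ (1 + ‖a‖) * (1 + ‖a - x‖) := by
    have : ‖x‖ ≤ ‖a‖ + ‖a - x‖ := by
      have := norm_sub_le a (a - x)
      rwa [sub_sub_cancel] at this
    nlinarith [norm_nonneg a, norm_nonneg (a - x), mul_nonneg (norm_nonneg a) (norm_nonneg (a - x))]
  have h2 : (1 + ‖a - x‖) ^ N ≤ 2 ^ N * (1 + ‖a - x‖ ^ N) := by
    rcases le_total ‖a - x‖ 1 with h | h
    · calc (1 + ‖a - x‖) ^ N ≤ 2 ^ N := by gcongr; linarith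
        _ ≤ _ := le_mul_of_one_le_right (by positivity) (by
            have : 0 ≤ ‖a - x‖ ^ N := by positivity
            linarith)
    · calc (1 + ‖a - x‖) ^ N ≤ (2 * ‖a - x‖) ^ N := by gcongr; linarith
        _ = 2 ^ N * ‖a - x‖ ^ N := mul_pow _ _ _
        _ ≤ _ := by gcongr; linarith
  have h3 := h t ht (a - x)
  rw [Real.rpow_natCast] at h3
  have h4 := heat_le_const ht (a - x)
  have h5 := heat_le_const (t := 2 * t) (by positivity) (a - x)
  have h6 : ‖a - x‖ ^ N * heat t (a - x) ≤ C * t ^ ((N : ℝ) / 2) * c' := h3.trans (by gcongr)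
  calc (1 + ‖x‖) ^ N * heat t (a - x)
      ≤ ((1 + ‖a‖) * (1 + ‖a - x‖)) ^ N * heat t (a - x) := by gcongr
    _ = (1 + ‖a‖) ^ N * ((1 + ‖a - x‖) ^ N * heat t (a - x)) := by rw [mul_pow]; ring
    _ ≤ (1 + ‖a‖) ^ N * (2 ^ N * (1 + ‖a - x‖ ^ N) * heat t (a - x)) := by gcongr
    _ = (1 + ‖a‖) ^ N * (2 ^ N * (heat t (a - x) + ‖a - x‖ ^ N * heat t (a - x))) := by ring
    _ ≤ (1 + ‖a‖) ^ N * (2 ^ N * (c + C * t ^ ((N : ℝ) / 2) * c')) := by gcongr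

/-- The reflected and translated heat kernel `x ↦ p_t (a - x)` as a Schwartz function. -/
def heatTest (ht : 0 < t) (a : Vec n) : 𝓢(Vec n, ℝ) where
  toFun x := heat t (a - x)
  smooth' := by
    unfold heat
    have : ContDiff ℝ (⊤ : ℕ∞) fun x : Vec n => ‖a - x‖ ^ 2 :=
      (contDiff_const.sub contDiff_id).norm_sq ℝ
    fun_prop
  decay' k m := by
    set c := (4 * π * t) ^ (-(n : ℝ) / 2)
    have hc : 0 < c := by positivity
    set f : Vec n → ℝ := fun x => -(‖a - x‖ ^ 2 / (4 * t)) with hf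
    set g : ℝ → ℝ := fun y => c * exp y with hg
    have hft : f.HasTemperateGrowth := by
      have h1 : (fun x : Vec n => ‖a - x‖ ^ 2).HasTemperateGrowth :=
        (Function.hasTemperateGrowth_norm_sq (H := Vec n)).comp
          ((Function.HasTemperateGrowth.const a).sub Function.HasTemperateGrowth.id)
      have h2 : f = (fun _ : Vec n => -(1 / (4 * t))) * fun x : Vec n => ‖a - x‖ ^ 2 := by
        funext x; simp only [hf, Pi.mul_apply]; ring
      rw [h2]
      exact (Function.HasTemperateGrowth.const _).mul h1
    obtain ⟨l, C, hC, hD⟩ := hft.norm_iteratedFDeriv_le_uniform m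
    obtain ⟨B, hB⟩ := exists_one_add_norm_pow_mul_heat_le ht (k + l * m) a
    refine ⟨m.factorial * (C + 1) ^ m * B, fun x => ?_⟩
    have hgd : ∀ i y, ‖iteratedFDeriv ℝ i g y‖ = c * exp y := by
      intro i y; rw [norm_iteratedFDeriv_eq_norm_iteratedDeriv]
      have : iteratedDeriv i g y = c * exp y := by
        rw [hg, iteratedDeriv_const_mul_field, iteratedDeriv_eq_iterate, Real.iter_deriv_exp]
      rw [this, norm_of_nonneg (by positivity)]
    have hgc : ContDiff ℝ (⊤ : ℕ∞) g := by fun_prop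
    have hone : 1 ≤ (C + 1) * (1 + ‖x‖) ^ l :=
      one_le_mul_of_one_le_of_one_le (by linarith) (one_le_pow₀ (by linarith [norm_nonneg x]))
    have key := norm_iteratedFDeriv_comp_le hgc hft.1 (n := m) (by exact_mod_cast le_top) x
      (C := c * exp (f x)) (D := (C + 1) * (1 + ‖x‖) ^ l) (fun i _ => (hgd i _).le)
      (fun i hi him => by
        refine (hD i him x).trans (le_trans ?_ (le_self_pow₀ hone (by omega)))
        gcongr; linarith)
    have e : (fun x => heat t (a - x)) = g ∘ f := rfl
    rw [e]
    have hp := heat_pos ht (a - x)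
    have hx : ‖x‖ ≤ 1 + ‖x‖ := by linarith
    calc ‖x‖ ^ k * ‖iteratedFDeriv ℝ m (g ∘ f) x‖
        ≤ (1 + ‖x‖) ^ k * (m.factorial * heat t (a - x) * ((C + 1) * (1 + ‖x‖) ^ l) ^ m) := by
          gcongr; exact key
      _ = m.factorial * (C + 1) ^ m * ((1 + ‖x‖) ^ (k + l * m) * heat t (a - x)) := by
          rw [mul_pow, ← pow_mul, pow_add]; ring
      _ ≤ _ := by gcongr; exact hB x

@[simp] lemma heatTest_apply {t : ℝ} (ht : 0 < t) (a x : Vec n) :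
    heatTest ht a x = heat t (a - x) := rfl

/-- The function `x ↦ (Δ p_t) (a - x)` as a Schwartz function. -/
lemma exists_heatLap_test (ht : 0 < t) (a : Vec n) :
    ∃ ψ : 𝓢(Vec n, ℝ), ∀ x, ψ x = heatLap t (a - x) := by
  have h : ∀ k : Fin n, (fun x : Vec n => (a - x) k * (a - x) k / (4 * t ^ 2) - 1 / (2 * t)
      ).HasTemperateGrowth := by
    intro k
    have h1 : (fun x : Vec n => (a - x) k).HasTemperateGrowth :=
      (ContinuousLinearMap.hasTemperateGrowth (EuclideanSpace.proj k : Vec n →L[ℝ] ℝ)).comp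
        ((Function.HasTemperateGrowth.const a).sub Function.HasTemperateGrowth.id)
    have h2 : (fun x : Vec n => (a - x) k * (a - x) k / (4 * t ^ 2) - 1 / (2 * t)) =
        (fun x : Vec n => (a - x) k) * (fun x : Vec n => (a - x) k) *
          (fun _ => 1 / (4 * t ^ 2)) - fun _ => 1 / (2 * t) := by
      funext x; simp only [Pi.mul_apply, Pi.sub_apply]; ring
    rw [h2]
    exact ((h1.mul h1).mul (Function.HasTemperateGrowth.const _)).sub
      (Function.HasTemperateGrowth.const _)
  refine ⟨∑ k, SchwartzMap.smulLeftCLM ℝ (fun x : Vec n => (a - x) k * (a - x) k / (4 * t ^ 2) -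
    1 / (2 * t)) (heatTest ht a), fun x => ?_⟩
  rw [sum_apply, heatLap]
  refine sum_congr rfl fun k _ => ?_
  rw [SchwartzMap.smulLeftCLM_apply_apply (h k)]; simp [heatHess]

lemma ft_comp_sub_left (f : Vec n → ℝ) (a ξ : Vec n) :
    ft (fun y => f (a - y)) ξ = wave (-a) ξ * ft f (-ξ) := by
  rw [ft, ft, fourier_eq_wave, fourier_eq_wave, ← integral_const_mul,
    ← integral_sub_left_eq_self _ volume a]
  refine integral_congr_all fun y => ?_
  simp only [sub_sub_cancel]; rw [← wave_neg, neg_neg, ← mul_assoc, ← wave_add]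
  congr 2
  abel

lemma multiplierOp_comp_sub_left (hm : ∀ ξ, m (-ξ) = m ξ) (f : Vec n → ℝ)
    (a x : Vec n) : multiplierOp m (fun y => f (a - y)) x = multiplierOp m f (a - x) := by
  rw [multiplierOp_eq, multiplierOp_eq, ← integral_neg_eq_self]; congr 1
  refine integral_congr_all fun ξ => ?_
  simp only [ft_comp_sub_left, neg_neg, hm]
  rw [← wave_neg, ← wave_neg, neg_neg, sub_eq_add_neg, wave_add]; ring

lemma fracLap_comp_sub_left (r : ℝ) (f : Vec n → ℝ) (a x : Vec n) :
    fracLap r (fun y => f (a - y)) x = fracLap r f (a - x) :=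
  multiplierOp_comp_sub_left (fun ξ => by simp) f a x

lemma fracLap_heatLap (hn : 0 < n) (r : ℝ) (ht : 0 < t) (x : Vec n) :
    fracLap r (heatLap t) x = -fracHeat (r + 2) t x := by
  rw [fracLap_eq, multiplierOp_eq, fracHeat_eq_re ht, ← Complex.neg_re, ← integral_neg]; congr 1
  refine integral_congr_ae ?_
  filter_upwards [ae_ne_zero hn] with ξ hξ
  rw [ft_heatLap ht, fracSymbol_add hξ, fracSymbol_two]; push_cast; ring

section Consequences

variable {g : Vec n → Vec n}

/-- `e^{tΔ} (-Δ)^{r/2} u` is the convolution of `u` with `(-Δ)^{r/2} p_t`. -/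
lemma IsFracLap.conv_heat (h : IsFracLap r u g) (ht : 0 < t) (i : Fin n) (x : Vec n) :
    Integrable (fun y => heat t (x - y) * g y i) ∧
    conv (heat t) (fun y => g y i) x = conv (fracHeat r t) (fun y => u y i) x := by
  obtain ⟨-, h2, h3⟩ := h (heatTest ht x) i
  have e : ∀ y, fracLap r (heatTest ht x) y = fracHeat r t (x - y) := fun y =>
    fracLap_comp_sub_left r (heat t) x y
  refine ⟨h2.congr (ae_of_all _ fun y => by simp [mul_comm]), ?_⟩
  simp only [heatTest_apply, e] at h3
  simp only [conv, mul_comm (heat t _), mul_comm (fracHeat r t _)]; exact h3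

lemma IsFracLap.conv_heatLap (hn : 0 < n) (h : IsFracLap r u g) (ht : 0 < t) (i : Fin n)
    (x : Vec n) :
    -conv (heatLap t) (fun y => g y i) x = conv (fracHeat (r + 2) t) (fun y => u y i) x := by
  obtain ⟨ψ, hψ⟩ := exists_heatLap_test ht x
  obtain ⟨-, -, h3⟩ := h ψ i
  have e : ∀ y, fracLap r ψ y = -fracHeat (r + 2) t (x - y) := fun y => by
    rw [funext hψ, fracLap_comp_sub_left r (heatLap t) x y, fracLap_heatLap hn r ht]
  simp only [hψ, e] at h3; simp only [conv, mul_comm (heatLap t _), mul_comm (fracHeat (r + 2) t _)]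
  rw [h3, ← integral_neg]; simp

lemma IsFracLap.aestronglyMeasurable (h : IsFracLap r u g) (i : Fin n) :
    AEStronglyMeasurable (fun y => g y i) := by
  have h1 := (h.conv_heat one_pos i 0).1.1
  have h2 : Continuous fun y : Vec n => (heat 1 (0 - y))⁻¹ :=
    ((continuous_heat 1).comp (continuous_const.sub continuous_id)).inv₀ fun y =>
      (heat_pos one_pos _).ne'
  refine (h2.aestronglyMeasurable.mul h1).congr (ae_of_all _ fun y => ?_)
  simp only [Pi.mul_apply]; rw [inv_mul_cancel_left₀ (heat_pos one_pos _).ne']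

end Consequences

end

section

/-! ### Fourier transforms of Schwartz functions -/

/-- The Fourier transform of a real Schwartz function is a Schwartz function. -/
lemma exists_schwartz_ft (ψ : 𝓢(Vec n, ℝ)) : ∃ Ψ : 𝓢(Vec n, ℂ), ft ψ = Ψ := by
  refine ⟨𝓕 (SchwartzMap.postcompCLM Complex.ofRealCLM ψ), ?_⟩
  rw [SchwartzMap.fourier_coe]; rfl

lemma integrable_ft_schwartz (ψ : 𝓢(Vec n, ℝ)) : Integrable (ft ψ) := by
  obtain ⟨Ψ, h⟩ := exists_schwartz_ft ψ
  rw [h]; exact Ψ.integrable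

lemma integrable_fracSymbol_mul_ft (hn : 0 < n) (hr : -(n : ℝ) < r) (ψ : 𝓢(Vec n, ℝ)) :
    Integrable (fun ξ => (fracSymbol r ξ : ℂ) * ft ψ ξ) := by
  obtain ⟨Ψ, h⟩ := exists_schwartz_ft ψ
  rw [h]
  obtain ⟨k, hk⟩ := exists_nat_ge r
  obtain ⟨B, hB⟩ := Ψ.decay 0 0
  obtain ⟨hB0, hB⟩ := hB
  simp only [pow_zero, one_mul, norm_iteratedFDeriv_zero] at hB
  have hg := integrable_fracSymbol_mul_gauss hn hr one_pos
  have h0 := Ψ.integrable_pow_mul volume 0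
  have hk' := Ψ.integrable_pow_mul volume k
  set c := exp ((2 * π) ^ 2)
  refine Integrable.mono' ((hg.const_mul (B * c)).add
    ((h0.add hk').const_mul ((2 * π) ^ r))) ?_ (ae_of_all _ fun ξ => ?_)
  · exact ((Complex.measurable_ofReal.comp (measurable_fracSymbol r)).aestronglyMeasurable).mul
      Ψ.continuous.aestronglyMeasurable
  have hf := fracSymbol_nonneg r ξ
  have hgp := gauss_pos 1 ξ
  rw [norm_mul, Complex.norm_real, norm_of_nonneg hf]; simp only [Pi.add_apply, pow_zero, one_mul]
  rcases le_total ‖ξ‖ 1 with h1 | h1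
  · have h2 : 1 ≤ c * gauss 1 ξ := by
      rw [gauss, ← Real.exp_add]
      refine Real.one_le_exp ?_
      have : ‖ξ‖ ^ 2 ≤ 1 := pow_le_one₀ (norm_nonneg _) h1
      rw [one_mul, mul_pow]
      nlinarith [Real.pi_pos, sq_nonneg (2 * π)]
    have h3 : fracSymbol r ξ * ‖Ψ ξ‖ ≤ B * c * (fracSymbol r ξ * gauss 1 ξ) := by
      calc fracSymbol r ξ * ‖Ψ ξ‖ ≤ fracSymbol r ξ * (B * 1) := by rw [mul_one]; gcongr; exact hB ξ
        _ ≤ fracSymbol r ξ * (B * (c * gauss 1 ξ)) := by gcongr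
        _ = _ := by ring
    have h4 : 0 ≤ (2 * π) ^ r * (‖Ψ ξ‖ + ‖ξ‖ ^ k * ‖Ψ ξ‖) := by positivity
    linarith
  · have h2 : fracSymbol r ξ ≤ (2 * π) ^ r * ‖ξ‖ ^ k := by
      rw [fracSymbol, mul_rpow (by positivity) (norm_nonneg _)]; gcongr; rw [← Real.rpow_natCast]
      exact Real.rpow_le_rpow_of_exponent_le h1 hk
    have h3 : fracSymbol r ξ * ‖Ψ ξ‖ ≤ (2 * π) ^ r * (‖ξ‖ ^ k * ‖Ψ ξ‖) := by
      rw [← mul_assoc]; gcongr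
    have h4 : 0 ≤ (2 * π) ^ r * ‖Ψ ξ‖ := by positivity
    have h5 : 0 ≤ B * c * (fracSymbol r ξ * gauss 1 ξ) := by positivity
    rw [mul_add]; linarith

/-! ### Riesz transforms of order two -/

lemma ft_integral_param {μ : Measure ℝ} [SFinite μ] {k : ℝ → Vec n → ℝ}
    (hk : Integrable (fun w : ℝ × Vec n => k w.1 w.2) (μ.prod volume)) (ξ : Vec n) :
    ft (fun x => ∫ t, k t x ∂μ) ξ = ∫ t, ft (k t) ξ ∂μ := by
  have h1 : Integrable (fun q : Vec n × ℝ => wave (-q.1) ξ * ((k q.2 q.1 : ℝ) : ℂ))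
      (volume.prod μ) := by
    have hi : Integrable (fun q : Vec n × ℝ => ((k q.2 q.1 : ℝ) : ℂ)) (volume.prod μ) :=
      hk.swap.ofReal
    refine hi.bdd_mul (c := 1) ?_ (ae_of_all _ fun q => (norm_wave _ _).le)
    exact ((continuous_wave_left ξ).comp continuous_fst.neg).aestronglyMeasurable
  simp only [ft, fourier_eq_wave]; rw [← integral_integral_swap h1]
  simp only [integral_const_mul, integral_complex_ofReal]

lemma integral_gauss_time (hab : a ≤ b) (hξ : ξ ≠ 0) :
    ∫ t in Ioc a b, gauss t ξ = (gauss a ξ - gauss b ξ) / (2 * π * ‖ξ‖) ^ 2 := by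
  have hc : (2 * π * ‖ξ‖) ^ 2 ≠ 0 := by
    have := norm_pos_iff.2 hξ
    positivity
  set c := (2 * π * ‖ξ‖) ^ 2
  have hd : ∀ t ∈ Set.uIcc a b, HasDerivAt (fun t => -(gauss t ξ / c)) (gauss t ξ) t := by
    intro t _
    have h1 : HasDerivAt (fun t : ℝ => -(t * c)) (-(1 * c)) t := ((hasDerivAt_id t).mul_const c).neg
    refine ((h1.exp).div_const c).neg.congr_deriv ?_
    change -(gauss t ξ * -(1 * c) / c) = _
    field_simp
  rw [← integral_of_le hab, intervalIntegral.integral_eq_sub_of_hasDerivAt hd]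
  · field_simp; ring
  · refine Continuous.intervalIntegrable ?_ a b
    unfold gauss; fun_prop

lemma rieszSymbol_mul (i j : Fin n) (hξ : ξ ≠ 0) :
    rieszSymbol i ξ * rieszSymbol j ξ = ((-(ξ i * ξ j / ‖ξ‖ ^ 2) : ℝ) : ℂ) := by
  have : ‖ξ‖ ≠ 0 := norm_ne_zero_iff.2 hξ
  rw [rieszSymbol, rieszSymbol]
  calc _ = Complex.I * Complex.I * (((ξ i / ‖ξ‖ : ℝ) : ℂ) * ((ξ j / ‖ξ‖ : ℝ) : ℂ)) := by ring
    _ = _ := by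
      rw [Complex.I_mul_I, ← Complex.ofReal_mul, div_mul_div_comm, ← sq]; push_cast; ring

lemma norm_rieszSymbol_mul_le (i j : Fin n) (ξ : Vec n) :
    ‖rieszSymbol i ξ * rieszSymbol j ξ‖ ≤ 1 := by
  have h : ∀ i : Fin n, ‖rieszSymbol i ξ‖ ≤ 1 := fun i => by
    rw [rieszSymbol, norm_mul, Complex.norm_I, one_mul, Complex.norm_real, norm_eq_abs,
      abs_div, abs_norm]
    exact div_le_one_of_le₀ (abs_coord_le_norm ξ i) (norm_nonneg _)
  rw [norm_mul]
  exact mul_le_one₀ (h i) (norm_nonneg _) (h j)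

lemma measurable_rieszSymbol (i : Fin n) : Measurable (rieszSymbol i : Vec n → ℂ) := by
  unfold rieszSymbol
  have : Measurable fun ξ : Vec n => ξ i / ‖ξ‖ :=
    ((EuclideanSpace.proj i : Vec n →L[ℝ] ℝ).continuous.measurable).div measurable_norm
  exact measurable_const.mul (Complex.measurable_ofReal.comp this)

lemma ft_hessKernel (ha : 0 < a) (hab : a ≤ b) (i j : Fin n) (hξ : ξ ≠ 0) :
    ft (hessKernel i j a b) ξ =
      ((gauss a ξ - gauss b ξ : ℝ) : ℂ) * (rieszSymbol i ξ * rieszSymbol j ξ) := by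
  have hn0 : ‖ξ‖ ≠ 0 := norm_ne_zero_iff.2 hξ
  unfold hessKernel
  rw [ft_integral_param (integrable_heatHess_prod ha i j), setIntegral_congr_fun
    measurableSet_Ioc fun t ht => ft_heatHess (ha.trans ht.1) i j ξ, integral_complex_ofReal,
    integral_const_mul, integral_gauss_time hab hξ, rieszSymbol_mul i j hξ, ← Complex.ofReal_mul]
  congr 1; field_simp

lemma tendsto_gauss_trunc (hξ : ξ ≠ 0) :
    Tendsto (fun k : ℕ => gauss (1 / ((k : ℝ) + 1)) ξ - gauss ((k : ℝ) + 1) ξ) atTop (𝓝 1) := by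
  have hc : 0 < (2 * π * ‖ξ‖) ^ 2 := by
    have := norm_pos_iff.2 hξ
    positivity
  have h1 : Tendsto (fun k : ℕ => gauss (1 / ((k : ℝ) + 1)) ξ) atTop (𝓝 1) := by
    have h := (tendsto_one_div_add_atTop_nhds_zero_nat (𝕜 := ℝ)).mul_const ((2 * π * ‖ξ‖) ^ 2)
    rw [zero_mul] at h
    have := (Real.continuous_exp.tendsto _).comp h.neg
    simpa [gauss, Function.comp_def] using this
  have h2 : Tendsto (fun k : ℕ => gauss ((k : ℝ) + 1) ξ) atTop (𝓝 0) := by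
    have h : Tendsto (fun k : ℕ => ((k : ℝ) + 1) * (2 * π * ‖ξ‖) ^ 2) atTop atTop :=
      (tendsto_atTop_add_const_right _ 1 tendsto_natCast_atTop_atTop).atTop_mul_const hc
    exact Real.tendsto_exp_neg_atTop_nhds_zero.comp h
  simpa using h1.sub h2

lemma continuous_ft (hf : Integrable f) : Continuous (ft f) :=
  VectorFourier.fourierIntegral_continuous Real.continuous_fourierChar
    (by exact continuous_inner) hf.ofReal

lemma tendsto_rieszTrunc_multiplierOp (hn : 0 < n) (i j : Fin n)
    (hm : Integrable fun ξ => m ξ * ft f ξ) (x : Vec n) :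
    Tendsto (fun k => rieszTrunc i j k (multiplierOp m f) x) atTop
      (𝓝 (multiplierOp (fun ξ => rieszSymbol i ξ * rieszSymbol j ξ * m ξ) f x)) := by
  have h1 : ∀ k, rieszTrunc i j k (multiplierOp m f) x = (∫ ξ, wave x ξ *
      (ft (hessKernel i j (1 / ((k : ℝ) + 1)) (k + 1)) ξ * (m ξ * ft f ξ))).re := fun k => by
    rw [rieszTrunc, conv_multiplierOp (integrable_hessKernel (trunc_pos k) i j) hm,
      multiplierOp_eq]
    simp only [mul_assoc]
  simp only [h1]; rw [multiplierOp_eq]; simp only [mul_assoc _ (m _) (ft f _)]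
  refine (Complex.continuous_re.tendsto _).comp ?_
  refine tendsto_integral_of_dominated_convergence (fun ξ => ‖m ξ * ft f ξ‖) (fun k => ?_)
    hm.norm (fun k => ?_) ?_
  · refine (continuous_wave_right x).aestronglyMeasurable.mul (AEStronglyMeasurable.mul ?_ hm.1)
    exact (continuous_ft (integrable_hessKernel (trunc_pos k) i
      j)).aestronglyMeasurable
  · filter_upwards [ae_ne_zero hn] with ξ hξ
    rw [ft_hessKernel (trunc_pos k) (trunc_le k) i j hξ, norm_mul, norm_mul _ (m ξ * _), norm_mul,
      norm_wave, one_mul]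
    refine mul_le_of_le_one_left (norm_nonneg _)
      (mul_le_one₀ ?_ (norm_nonneg _) (norm_rieszSymbol_mul_le i j ξ))
    rw [Complex.norm_real, norm_eq_abs, abs_le]
    have e1 := gauss_pos (1 / ((k : ℝ) + 1)) ξ
    have e2 := gauss_pos ((k : ℝ) + 1) ξ
    have e3 := gauss_le_one (t := 1 / ((k : ℝ) + 1)) (by positivity) ξ
    have e4 := gauss_le_one (t := (k : ℝ) + 1) (by positivity) ξ
    constructor <;> linarith
  · filter_upwards [ae_ne_zero hn] with ξ hξ
    simp only [fun k : ℕ => ft_hessKernel (trunc_pos k) (trunc_le k) i j hξ]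
    refine Tendsto.const_mul _ (Tendsto.mul_const _ ?_)
    have := ((Complex.continuous_ofReal.tendsto _).comp (tendsto_gauss_trunc hξ)).mul_const
      (rieszSymbol i ξ * rieszSymbol j ξ)
    simpa [Function.comp_def] using this

lemma ae_eq_of_tendsto_eLpNorm {F : ℕ → Vec n → ℝ} (hP : P ≠ 0)
    (hF : ∀ k, AEStronglyMeasurable (F k)) (hg : AEStronglyMeasurable g)
    (h : Tendsto (fun k => eLpNorm (F k - g) P) atTop (𝓝 0))
    (hf : ∀ x, Tendsto (fun k => F k x) atTop (𝓝 (f x))) : f =ᵐ[volume] g := by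
  obtain ⟨ns, hns, h'⟩ := (tendstoInMeasure_of_tendsto_eLpNorm hP hF hg h).exists_seq_tendsto_ae
  filter_upwards [h'] with x hx
  exact tendsto_nhds_unique ((hf x).comp hns.tendsto_atTop) hx

/-- On `L^P` functions that are Fourier multipliers, the `L^P` limit of the truncated Riesz
transforms is again a Fourier multiplier. -/
lemma tendsto_eLpNorm_rieszTrunc_multiplierOp (hn : 0 < n) (hP : 1 < P) (hPt : P ≠ ∞)
    (i j : Fin n) (hm : Integrable fun ξ => m ξ * ft f ξ)
    (hf : MemLp (multiplierOp m f) P) :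
    MemLp (multiplierOp (fun ξ => rieszSymbol i ξ * rieszSymbol j ξ * m ξ) f) P ∧
      Tendsto (fun k => eLpNorm (rieszTrunc i j k (multiplierOp m f) -
        multiplierOp (fun ξ => rieszSymbol i ξ * rieszSymbol j ξ * m ξ) f) P) atTop (𝓝 0) := by
  obtain ⟨G, hG, h⟩ := exists_tendsto_rieszTrunc hn hP hPt hf i j
  have e := ae_eq_of_tendsto_eLpNorm (zero_lt_one.trans hP).ne'
    (fun k => (memLp_rieszTrunc hP.le hPt hf i j k).1) hG.1 h
    (tendsto_rieszTrunc_multiplierOp hn i j hm)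
  refine ⟨hG.ae_eq e.symm, h.congr fun k => eLpNorm_congr_ae ?_⟩
  filter_upwards [e] with x hx
  simp [hx]

lemma tendsto_eLpNorm_rieszTrunc_schwartz (hn : 0 < n) (hP : 1 < P) (hPt : P ≠ ∞)
    (i j : Fin n) (ψ : 𝓢(Vec n, ℝ)) : MemLp (rieszRiesz i j ψ) P ∧
      Tendsto (fun k => eLpNorm (rieszTrunc i j k ψ - rieszRiesz i j ψ) P) atTop (𝓝 0) := by
  have e := multiplierOp_one ψ.continuous ψ.integrable (integrable_ft_schwartz ψ)
  have := tendsto_eLpNorm_rieszTrunc_multiplierOp hn hP hPt i j (m := fun _ => 1) (f := ψ)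
    (by simpa using integrable_ft_schwartz ψ) (by rw [e]; exact ψ.memLp P volume)
  simpa only [e, mul_one, rieszRiesz] using this

lemma integral_rieszTrunc_mul [HolderConjugate P Q]
    (hf : MemLp f P) (hg : MemLp g Q) (i j : Fin n) (k : ℕ) :
    ∫ x, rieszTrunc i j k f x * g x = ∫ x, f x * rieszTrunc i j k g x := by
  rw [rieszTrunc, integral_conv_mul (integrable_hessKernel (trunc_pos k) i j) hf hg]
  simp only [hessKernel_neg]; rfl

lemma ae_eq_of_integral_schwartz (hP : 1 ≤ P) (hf : MemLp f P)
    (hg : MemLp g P) (h : ∀ ψ : 𝓢(Vec n, ℝ), ∫ x, f x * ψ x = ∫ x, g x * ψ x) :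
    f =ᵐ[volume] g := by
  have h0 : f - g =ᵐ[volume] 0 := by
    refine ae_eq_zero_of_integral_contDiff_smul_eq_zero
      ((hf.sub hg).locallyIntegrable hP) fun ψ hψ hc => ?_
    have hl : ∀ {f : Vec n → ℝ}, MemLp f P → Integrable fun x => f x * ψ x := fun {f} hf => by
      have := (hf.locallyIntegrable hP).integrable_smul_right_of_hasCompactSupport hψ.continuous hc
      simpa using this
    have e : ∫ x, f x * ψ x = ∫ x, g x * ψ x := h (hc.toSchwartzMap hψ)
    calc ∫ x, ψ x • (f - g) x = ∫ x, (f x * ψ x - g x * ψ x) := by congr 1; funext x; simp; ring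
      _ = 0 := by rw [integral_sub (hl hf) (hl hg), e, sub_self]
  filter_upwards [h0] with x hx
  exact sub_eq_zero.1 hx

/-- The limit of the truncated operators `∑ⱼ K_{ij} * fⱼ` is `R ⊗ R f`; in particular `R ⊗ R f`
exists, it is unique up to null sets, and it is approximated by the truncations. -/
lemma exists_isRieszRiesz (hn : 0 < n) (hP : 1 < P) (hPt : P ≠ ∞) {f : Vec n → Vec n}
    (hf : MemLp f P) : ∃ G, IsRieszRiesz P f G ∧ ∀ i,
      Tendsto (fun k => eLpNorm ((fun x => ∑ j, rieszTrunc i j k (fun y => f y j) x) -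
        fun x => G x i) P) atTop (𝓝 0) := by
  have hfj : ∀ j, MemLp (fun x => f x j) P := fun j => hf.eval_piLp j
  choose G hG hT using fun i j => exists_tendsto_rieszTrunc hn hP hPt (hfj j) i j
  let G' : Vec n → Vec n := fun x => WithLp.toLp 2 fun i => ∑ j, G i j x
  have hG' : MemLp G' P := MemLp.of_eval_piLp fun i => by
    simpa [G'] using memLp_finsetSum (μ := volume) Finset.univ fun j _ => hG i j
  refine ⟨G', ⟨hG', fun ψ i => ?_⟩, fun i => ?_⟩
  · obtain ⟨Q, _, _, hQ, hQt⟩ := exists_holderConjugate hP hPt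
    have hψ : MemLp ψ Q := ψ.memLp Q volume
    have h1 : ∀ j, ∫ x, G i j x * ψ x = ∫ x, f x j * rieszRiesz i j ψ x := fun j => by
      have ha := tendsto_integral_mul_of_eLpNorm
        (fun k => memLp_rieszTrunc hP.le hPt (hfj j) i j k) (hG i j) hψ (hT i j)
      obtain ⟨hm, ht⟩ := tendsto_eLpNorm_rieszTrunc_schwartz hn hQ hQt i j ψ
      have hb := tendsto_integral_mul_of_eLpNorm
        (fun k => memLp_rieszTrunc hQ.le hQt hψ i j k) hm (hfj j) ht
      simp only [integral_rieszTrunc_mul (hfj j) hψ, mul_comm (f _ j)] at ha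
      rw [tendsto_nhds_unique ha hb]; simp only [mul_comm]
    calc ∫ x, G' x i * ψ x = ∫ x, ∑ j, G i j x * ψ x := by simp [G', sum_mul]
      _ = ∑ j, ∫ x, G i j x * ψ x :=
        integral_finsetSum _ fun j _ => integrable_mul_of_memLp (hG i j) hψ
      _ = _ := sum_congr rfl fun j _ => h1 j
  · have h2 : Tendsto (fun k => ∑ j, eLpNorm (rieszTrunc i j k (fun y => f y j) - G i j) P)
        atTop (𝓝 0) := by
      simpa using tendsto_finsetSum Finset.univ fun j _ => hT i j
    refine tendsto_of_tendsto_of_tendsto_of_le_of_le tendsto_const_nhds h2 (fun _ => zero_le)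
      fun k => ?_
    have e : ((fun x => ∑ j, rieszTrunc i j k (fun y => f y j) x) - fun x => G' x i) =
        ∑ j, (rieszTrunc i j k (fun y => f y j) - G i j) := by
      funext x; simp [G', Finset.sum_apply, Finset.sum_sub_distrib]
    rw [e]
    exact eLpNorm_sum_le (fun j _ =>
      ((memLp_rieszTrunc hP.le hPt (hfj j) i j k).sub (hG i j)).1) hP.le

lemma IsRieszRiesz.ae_eq (hP : 1 ≤ P) {f G' : Vec n → Vec n}
    (h : IsRieszRiesz P f G) (h' : IsRieszRiesz P f G') (i : Fin n) :
    (fun x => G x i) =ᵐ[volume] fun x => G' x i :=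
  ae_eq_of_integral_schwartz hP (h.1.eval_piLp i) (h'.1.eval_piLp i) fun ψ => by
    rw [h.2 ψ i, h'.2 ψ i]

lemma IsRieszRiesz.tendsto (hn : 0 < n) (hP : 1 < P) (hPt : P ≠ ∞)
    {f : Vec n → Vec n} (hf : MemLp f P) (h : IsRieszRiesz P f G) (i : Fin n) :
    Tendsto (fun k => eLpNorm ((fun x => ∑ j, rieszTrunc i j k (fun y => f y j) x) -
        fun x => G x i) P) atTop (𝓝 0) := by
  obtain ⟨G', hG', ht⟩ := exists_isRieszRiesz hn hP hPt hf
  refine (ht i).congr fun k => eLpNorm_congr_ae ?_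
  filter_upwards [h.ae_eq hP.le hG' i] with x hx
  simp only [Pi.sub_apply, hx]

end

section

/-! ### Averages of the kernels of the fractional Laplacian -/

lemma measurable_fracHeat_uncurry (r : ℝ) : Measurable fun w : ℝ × Vec n => fracHeat r w.1 w.2 := by
  have hw : Measurable fun q : Vec n × Vec n => wave q.1 q.2 := continuous_wave.measurable
  have h1 : Measurable fun q : ℝ × Vec n => ft (heat q.1) q.2 := by
    simp only [ft, fourier_eq_wave]
    have h2 : Measurable fun q : (ℝ × Vec n) × Vec n =>
        wave (-q.2) q.1.2 * ((heat q.1.1 q.2 : ℝ) : ℂ) := by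
      have h3 : Measurable fun q : (ℝ × Vec n) × Vec n => (-q.2, q.1.2) := by fun_prop
      have h4 : Measurable fun q : (ℝ × Vec n) × Vec n => (q.1.1, q.2) := by fun_prop
      have h5 := (measurable_heat_uncurry (n := n)).comp h4
      exact (hw.comp h3).mul (Complex.measurable_ofReal.comp h5)
    exact (h2.stronglyMeasurable.integral_prod_right' (ν := volume)).measurable
  simp only [fracHeat, fracLap_eq, multiplierOp_eq]
  refine Complex.measurable_re.comp ?_
  have h2 : Measurable fun q : (ℝ × Vec n) × Vec n =>
      wave q.1.2 q.2 * (((fracSymbol r q.2 : ℝ) : ℂ) * ft (heat q.1.1) q.2) := by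
    have h3 : Measurable fun q : (ℝ × Vec n) × Vec n => (q.1.2, q.2) := by fun_prop
    have h4 : Measurable fun q : (ℝ × Vec n) × Vec n => (q.1.1, q.2) := by fun_prop
    have h5 := (measurable_fracSymbol (n := n) r).comp
      (measurable_snd : Measurable fun q : (ℝ × Vec n) × Vec n => q.2)
    have h6 := hw.comp h3
    have h7 := h1.comp h4
    have h8 := Complex.measurable_ofReal.comp h5
    exact h6.mul (h8.mul h7)
  exact (h2.stronglyMeasurable.integral_prod_right' (ν := volume)).measurable

lemma integrable_mul_fracHeat_param (hn : 0 < n) (hr0 : 0 < r) (hr4 : r < 4)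
    {μ : Measure ℝ} [SFinite μ] {ω θ : ℝ → ℝ} (hω : Measurable ω) (hθ : Measurable θ)
    (hpos : ∀ᵐ t ∂μ, 0 < θ t) (hi : Integrable (fun t => ω t * θ t ^ (-(r / 2))) μ) :
    Measurable (fun w : ℝ × Vec n => ω w.1 * fracHeat r (θ w.1) w.2) ∧
    Integrable (fun w : ℝ × Vec n => ω w.1 * fracHeat r (θ w.1) w.2) (μ.prod volume) := by
  obtain ⟨C, hC, h⟩ := exists_integral_fracHeat_le hn hr0 hr4
  obtain ⟨hm, hi, -⟩ := integrable_mul_param (measurable_fracHeat_uncurry r) h hω hθ hpos hi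
  exact ⟨hm, hi⟩

/-- The kernel `∫₀¹ (-Δ)^{r/2} p_σ dσ`, with symbol `(2π|ξ|)^{r-2} (1 - exp(-(2π|ξ|)²))`. -/
def smallKernel (r : ℝ) (x : Vec n) : ℝ := ∫ σ in Ioc (0 : ℝ) 1, fracHeat r σ x

lemma integrable_fracHeat_small (hn : 0 < n) (hr0 : 0 < r) (hr2 : r < 2) :
    Integrable (fun w : ℝ × Vec n => fracHeat r w.1 w.2)
      ((volume.restrict (Ioc (0 : ℝ) 1)).prod volume) := by
  have hi : Integrable (fun t : ℝ => (1 : ℝ) * t ^ (-(r / 2)))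
      (volume.restrict (Ioc (0 : ℝ) 1)) := by
    have := (intervalIntegral.intervalIntegrable_rpow' (a := 0) (b := 1) (r := -(r / 2))
      (by linarith)).1
    simp only [one_mul]; exact this
  have := (integrable_mul_fracHeat_param (n := n) hn hr0 (by linarith) (ω := fun _ => 1)
    (θ := fun t => t) measurable_const measurable_id
    ((ae_restrict_mem measurableSet_Ioc).mono fun t ht => ht.1) hi).2
  simpa using this

lemma integrable_smallKernel (hn : 0 < n) (hr0 : 0 < r) (hr2 : r < 2) :
    Integrable (smallKernel r : Vec n → ℝ) :=
  (integrable_fracHeat_small hn hr0 hr2).integral_prod_right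

lemma ft_smallKernel (hn : 0 < n) (hr0 : 0 < r) (hr2 : r < 2) (hξ : ξ ≠ 0) :
    ft (smallKernel r) ξ = ((fracSymbol (r - 2) ξ * (1 - gauss 1 ξ) : ℝ) : ℂ) := by
  have hi0 := integrable_fracHeat_small hn hr0 hr2
  have h3 : (fun t => ft (fracHeat r t : Vec n → ℝ) ξ) =ᵐ[volume.restrict (Ioc (0 : ℝ) 1)]
      fun t => ((fracSymbol r ξ * gauss t ξ : ℝ) : ℂ) := by
    filter_upwards [ae_restrict_mem measurableSet_Ioc, hi0.prod_right_ae] with t ht hit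
    exact ft_fracHeat hn hr0.le ht.1 hit ξ
  unfold smallKernel
  rw [ft_integral_param hi0, integral_congr_ae h3, integral_complex_ofReal, integral_const_mul,
    integral_gauss_time zero_le_one hξ]
  have e : fracSymbol r ξ = fracSymbol (r - 2) ξ * (2 * π * ‖ξ‖) ^ 2 := by
    rw [← fracSymbol_two, ← fracSymbol_add hξ]; congr 1; ring
  have hc : (2 * π * ‖ξ‖) ^ 2 ≠ 0 := by
    have := norm_pos_iff.2 hξ
    positivity
  have e0 : gauss 0 ξ = 1 := by simp [gauss]
  rw [e, e0]; congr 1; field_simp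

/-! ### The fractional Laplacian of test functions -/

lemma integrable_wave_neg_mul (hf : Integrable f) (ξ : Vec n) :
    Integrable fun x => wave (-x) ξ * ((f x : ℝ) : ℂ) := by
  have hi : Integrable fun x => ((f x : ℝ) : ℂ) := hf.ofReal
  refine hi.bdd_mul (c := 1) ?_ (ae_of_all _ fun q => (norm_wave _ _).le)
  exact ((continuous_wave_left ξ).comp continuous_neg).aestronglyMeasurable

lemma norm_ft_le (f : Vec n → ℝ) (ξ : Vec n) : ‖ft f ξ‖ ≤ ∫ x, ‖f x‖ := by
  rw [ft, fourier_eq_wave]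
  refine (norm_integral_le_integral_norm _).trans (le_of_eq ?_)
  simp only [norm_mul, norm_wave, one_mul, Complex.norm_real]

open LineDeriv in
lemma exists_schwartz_fracLap_two (ψ : 𝓢(Vec n, ℝ)) : ∃ χ : 𝓢(Vec n, ℝ), fracLap 2 ψ = χ := by
  have h1 : ∀ (ψ : 𝓢(Vec n, ℝ)) (k : Fin n) (ξ : Vec n),
      ft (∂_{single k (1 : ℝ)} ψ : 𝓢(Vec n, ℝ)) ξ =
        (2 * π * ξ k : ℝ) * Complex.I * ft ψ ξ := fun ψ k ξ =>
    ft_lineDeriv ψ.integrable (SchwartzMap.integrable _) (fun x => by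
      rw [SchwartzMap.lineDerivOp_apply]
      exact ψ.differentiableAt.lineDifferentiableAt.hasLineDerivAt) ξ
  set χ : 𝓢(Vec n, ℝ) := -∑ k : Fin n, ∂_{single k (1 : ℝ)}
    (∂_{single k (1 : ℝ)} ψ : 𝓢(Vec n, ℝ)) with hχ
  refine ⟨χ, ?_⟩
  have h2 : ∀ ξ, ft χ ξ = (fracSymbol 2 ξ : ℂ) * ft ψ ξ := fun ξ => by
    have e : ft χ ξ = -∑ k : Fin n, ft (∂_{single k (1 : ℝ)}
        (∂_{single k (1 : ℝ)} ψ : 𝓢(Vec n, ℝ)) : 𝓢(Vec n, ℝ)) ξ := by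
      simp only [ft, fourier_eq_wave]; rw [← integral_finsetSum Finset.univ, ← integral_neg]
      · refine integral_congr_all fun x => ?_
        simp only [hχ, neg_apply, sum_apply]; push_cast; rw [← mul_sum, mul_neg]
      · exact fun k _ => integrable_wave_neg_mul (SchwartzMap.integrable _) ξ
    rw [e, fracSymbol_two, mul_pow, EuclideanSpace.real_norm_sq_eq]; simp only [h1]; push_cast
    rw [mul_sum, sum_mul, ← Finset.sum_neg_distrib]
    refine sum_congr rfl fun k _ => ?_
    ring_nf; rw [Complex.I_sq]; ring
  funext x
  rw [← multiplierOp_one χ.continuous χ.integrable (integrable_ft_schwartz χ), fracLap_eq,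
    multiplierOp_eq, multiplierOp_eq]
  simp only [one_mul, h2]

lemma fracLap_zero (ψ : 𝓢(Vec n, ℝ)) : fracLap 0 ψ = ψ := by
  rw [← multiplierOp_one ψ.continuous ψ.integrable (integrable_ft_schwartz ψ), fracLap_eq]
  simp only [fracSymbol_zero, multiplierOp_one ψ.continuous ψ.integrable
    (integrable_ft_schwartz ψ), Complex.ofReal_one]

lemma continuous_fracLap (hn : 0 < n) (hr : -(n : ℝ) < r) (ψ : 𝓢(Vec n, ℝ)) :
    Continuous (fracLap r ψ) := continuous_multiplierOp (integrable_fracSymbol_mul_ft hn hr ψ)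

/-- Splitting `(-Δ)^{r/2}` at unit scale into a smoothing part and `∫₀¹ e^{σΔ} dσ (-Δ)^{1+r/2}`. -/
lemma fracLap_eq_conv_add (hn : 0 < n) (hr0 : 0 < r) (hr2 : r < 2) (ψ : 𝓢(Vec n, ℝ)) :
    fracLap r ψ = conv (fracHeat r 1) ψ + conv (smallKernel r) (fracLap 2 ψ) := by
  have hn' : (0 : ℝ) < n := Nat.cast_pos.2 hn
  have hi : Integrable (fracHeat r 1 : Vec n → ℝ) := by
    obtain ⟨C, hC, h⟩ := exists_integral_fracHeat_le (n := n) hn hr0 (by linarith)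
    exact (h 1 one_pos).1
  have i1 : Integrable fun ξ => (fracSymbol r ξ : ℂ) * ft ψ ξ :=
    integrable_fracSymbol_mul_ft hn (by linarith) ψ
  have i2 : Integrable fun ξ => (fracSymbol 2 ξ : ℂ) * ft ψ ξ :=
    integrable_fracSymbol_mul_ft hn (by linarith) ψ
  funext x
  rw [Pi.add_apply, conv_eq_multiplierOp hi ψ.continuous ψ.integrable (integrable_ft_schwartz ψ),
    fracLap_eq, fracLap_eq, conv_multiplierOp (integrable_smallKernel hn hr0 hr2) i2,
    multiplierOp_eq, multiplierOp_eq, multiplierOp_eq, ← Complex.add_re, ← integral_add]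
  · congr 1
    refine integral_congr_ae ?_
    filter_upwards [ae_ne_zero hn] with ξ hξ
    rw [ft_fracHeat hn hr0.le one_pos hi, ft_smallKernel hn hr0 hr2 hξ]
    have e : fracSymbol r ξ = fracSymbol (r - 2) ξ * fracSymbol 2 ξ := by
      rw [← fracSymbol_add hξ]; congr 1; ring
    rw [e]; push_cast; ring
  · exact integrable_wave_mul ((integrable_ft_schwartz ψ).bdd_mul (c := ∫ x, ‖fracHeat r 1 x‖)
      (continuous_ft hi).aestronglyMeasurable (ae_of_all _ fun ξ => norm_ft_le _ _)) x
  · refine integrable_wave_mul ?_ x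
    simp only [mul_assoc]
    exact i2.bdd_mul (c := ∫ x, ‖smallKernel r x‖)
      (continuous_ft (integrable_smallKernel hn hr0 hr2)).aestronglyMeasurable
      (ae_of_all _ fun ξ => norm_ft_le _ _)

lemma memLp_fracLap (hn : 0 < n) (hr0 : 0 < r) (hr2 : r < 2) (ψ : 𝓢(Vec n, ℝ))
    (hP : 1 ≤ P) (hPt : P ≠ ∞) : MemLp (fracLap r ψ) P := by
  obtain ⟨χ, hχ⟩ := exists_schwartz_fracLap_two ψ
  obtain ⟨C, hC, h⟩ := exists_integral_fracHeat_le (n := n) hn hr0 (by linarith)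
  rw [fracLap_eq_conv_add hn hr0 hr2, hχ]
  exact (MemLp.conv (h 1 one_pos).1 hP hPt (ψ.memLp P volume)).add
    (MemLp.conv (integrable_smallKernel hn hr0 hr2) hP hPt (χ.memLp P volume))

end

section

/-! ### Existence of fractional Laplacians of order less than `s₁` -/

lemma conv_congr_ft {K L : Vec n → ℝ} (hK : Integrable K) (hL : Integrable L)
    (hfc : Continuous f) (hf : Integrable f) (hf' : Integrable (ft f))
    (hgc : Continuous g) (hg : Integrable g) (hg' : Integrable (ft g))
    (h : ∀ᵐ ξ, ft K ξ * ft f ξ = ft L ξ * ft g ξ) : conv K f = conv L g := by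
  rw [conv_eq_multiplierOp hK hfc hf hf', conv_eq_multiplierOp hL hgc hg hg']; funext x
  rw [multiplierOp_eq, multiplierOp_eq]; congr 1
  refine integral_congr_ae ?_
  filter_upwards [h] with ξ hξ
  rw [hξ]

lemma integrable_fracHeat (hn : 0 < n) (hr0 : 0 < r) (hr4 : r < 4) (hσ : 0 < σ) :
    Integrable (fracHeat r σ : Vec n → ℝ) := by
  obtain ⟨C, hC, h⟩ := exists_integral_fracHeat_le (n := n) hn hr0 hr4
  exact (h σ hσ).1

lemma smallKernel_neg (r : ℝ) (x : Vec n) : smallKernel r (-x) = smallKernel r x :=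
  setIntegral_congr_fun measurableSet_Ioc fun _ ht => fracHeat_neg r ht.1 x

lemma integral_conv_mul_of_even (hk : Integrable k) (he : ∀ x, k (-x) = k x)
    [HolderConjugate P Q] (hf : MemLp f P) (hg : MemLp g Q) :
    ∫ x, conv k f x * g x = ∫ x, f x * conv k g x := by
  rw [integral_conv_mul hk hf hg, funext he]

/-- `(-Δ)^{ρ/2} e^{σΔ} (-Δ)^{r/2} u = (-Δ)^{(ρ+r)/2} e^{σΔ} u`. -/
lemma IsFracLap.conv_fracHeat_ae (hn : 0 < n) {ρ : ℝ}
    (h : IsFracLap r u U) (hr0 : 0 < r) (hr4 : r < 4) (hρ0 : 0 < ρ) (hρ4 : ρ < 4)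
    (hP : 1 ≤ P) (hPt : P ≠ ∞) (hu : MemLp u P) (hU : MemLp U P) (hσ : 0 < σ)
    (i : Fin n) : conv (fracHeat ρ σ) (fun y => U y i) =ᵐ[volume]
      conv (fracHeat (ρ + r) σ) (fun y => u y i) := by
  have hn' : (0 : ℝ) < n := Nat.cast_pos.2 hn
  have h2 : 0 < σ / 2 := half_pos hσ
  have iρ := integrable_fracHeat hn hρ0 hρ4 h2
  have e1 : (fracHeat ρ σ : Vec n → ℝ) = conv (fracHeat ρ (σ / 2)) (heat (σ / 2)) := by
    have := conv_fracHeat hn hρ0.le h2 (r' := 0) (by linarith) h2 iρ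
    rw [add_zero, add_halves] at this; rw [← this]; congr 1
    funext x
    exact fracHeat_zero hn h2 x
  have e2 : (fracHeat (ρ + r) σ : Vec n → ℝ) = conv (fracHeat ρ (σ / 2)) (fracHeat r (σ / 2)) := by
    have := conv_fracHeat hn hρ0.le h2 (r' := r) (by linarith) h2 iρ
    rw [add_halves] at this; exact this.symm
  have h3 : conv (heat (σ / 2)) (fun y => U y i) = conv (fracHeat r (σ / 2)) (fun y => u y i) :=
    funext fun x => (h.conv_heat h2 i x).2
  rw [e1, e2]
  refine (conv_conv iρ (integrable_heat h2) hP hPt (hU.eval_piLp i)).symm.trans ?_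
  rw [h3]
  exact conv_conv iρ (integrable_fracHeat hn hr0 hr4 h2) hP hPt (hu.eval_piLp i)

lemma conv_fracHeat_schwartz (hn : 0 < n) (hr0 : 0 < r) (hr2 : r < 2)
    (hσ : 0 < σ) (ψ : 𝓢(Vec n, ℝ)) :
    conv (fracHeat (r + 2) σ) ψ = conv (fracHeat r σ) (fracLap 2 ψ) := by
  have hn' : (0 : ℝ) < n := Nat.cast_pos.2 hn
  rw [conv_eq_multiplierOp (integrable_fracHeat hn (by linarith) (by linarith) hσ) ψ.continuous
    ψ.integrable (integrable_ft_schwartz ψ), fracLap_eq,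
    conv_multiplierOp (integrable_fracHeat hn hr0 (by linarith) hσ)
    (integrable_fracSymbol_mul_ft hn (by linarith) ψ)]
  funext x; rw [multiplierOp_eq, multiplierOp_eq]; congr 1
  refine integral_congr_ae ?_
  filter_upwards [ae_ne_zero hn] with ξ hξ
  rw [ft_fracHeat hn (by linarith) hσ (integrable_fracHeat hn (by linarith) (by linarith) hσ),
    ft_fracHeat hn hr0.le hσ (integrable_fracHeat hn hr0 (by linarith) hσ), fracSymbol_add hξ]
  push_cast; ring

lemma integrable_mul_schwartz (hP : 1 ≤ P) (hf : MemLp f P)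
    (ψ : 𝓢(Vec n, ℝ)) : Integrable fun x => f x * ψ x := by
  have : HolderConjugate P (conjExponent P) := .conjExponent hP
  exact integrable_mul_of_memLp hf (ψ.memLp (conjExponent P) volume)

lemma IsFracLap.zero (hP : 1 ≤ P) (hu : MemLp u P) : IsFracLap 0 u u := fun ψ i => by
  have h := integrable_mul_schwartz hP (hu.eval_piLp i) ψ
  rw [fracLap_zero]
  exact ⟨h, h, rfl⟩

lemma exists_isFracLap_of_pos (hn : 0 < n) {ε : ℝ} (hε : 0 < ε) (hεs : ε < s) (hs : s < 2)
    (hP : 1 < P) (hPt : P ≠ ∞) (h : IsSobolevPair s P u U) :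
    ∃ g, IsFracLap (s - ε) u g := by
  obtain ⟨hu, hU, hF⟩ := h
  obtain ⟨Q, _, _, hQ, hQt⟩ := exists_holderConjugate hP hPt
  set r := s - ε with hr
  have hr0 : 0 < r := by linarith
  have hr2 : r < 2 := by linarith
  have i1 : Integrable (fracHeat r 1 : Vec n → ℝ) :=
    integrable_fracHeat hn hr0 (by linarith) one_pos
  have i2 : Integrable (smallKernel (2 - ε) : Vec n → ℝ) :=
    integrable_smallKernel hn (by linarith) (by linarith)
  have i3 : Integrable (smallKernel r : Vec n → ℝ) := integrable_smallKernel hn hr0 hr2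
  have m1 : ∀ i, MemLp (conv (fracHeat r 1) fun y => u y i) P := fun i =>
    MemLp.conv i1 hP.le hPt (hu.eval_piLp i)
  have m2 : ∀ i, MemLp (conv (smallKernel (2 - ε)) fun y => U y i) P := fun i =>
    MemLp.conv i2 hP.le hPt (hU.eval_piLp i)
  refine ⟨fun x => WithLp.toLp 2 fun i => conv (fracHeat r 1) (fun y => u y i) x +
    conv (smallKernel (2 - ε)) (fun y => U y i) x, fun ψ i => ⟨?_, ?_, ?_⟩⟩
  · exact integrable_mul_of_memLp (hu.eval_piLp i) (memLp_fracLap hn hr0 hr2 ψ hQ.le hQt)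
  · exact integrable_mul_schwartz hP.le ((m1 i).add (m2 i)) ψ
  obtain ⟨χ, hχ⟩ := exists_schwartz_fracLap_two ψ
  have hψ : MemLp ψ Q := ψ.memLp Q volume
  have hχm : MemLp χ Q := χ.memLp Q volume
  have hui := hu.eval_piLp i
  have hUi := hU.eval_piLp i
  have a1 : ∫ x, conv (fracHeat r 1) (fun y => u y i) x * ψ x =
      ∫ x, u x i * conv (fracHeat r 1) ψ x :=
    integral_conv_mul_of_even i1 (fracHeat_neg r one_pos) hui hψ
  have a2 : ∫ x, conv (smallKernel (2 - ε)) (fun y => U y i) x * ψ x =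
      ∫ x, u x i * conv (smallKernel r) χ x := by
    rw [← integral_conv_mul_of_even i3 (smallKernel_neg r) hui hχm]
    have b1 := integral_conv_param_mul (μ := volume.restrict (Ioc (0 : ℝ) 1))
      (measurable_fracHeat_uncurry (2 - ε))
      (integrable_fracHeat_small hn (by linarith) (by linarith)) hUi hψ
    have b2 := integral_conv_param_mul (μ := volume.restrict (Ioc (0 : ℝ) 1))
      (measurable_fracHeat_uncurry r) (integrable_fracHeat_small hn hr0 hr2) hui hχm
    refine b1.trans (Eq.trans ?_ b2.symm)
    refine setIntegral_congr_fun measurableSet_Ioc fun σ hσ => ?_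
    have c1 : ∫ x, conv (fracHeat (2 - ε) σ) (fun y => U y i) x * ψ x =
        ∫ x, conv (fracHeat (r + 2) σ) (fun y => u y i) x * ψ x := by
      refine integral_congr_ae ?_
      have := hF.conv_fracHeat_ae hn (ρ := 2 - ε) (by linarith) (by linarith) (by linarith)
        (by linarith) hP.le hPt hu hU hσ.1 i
      rw [show 2 - ε + s = r + 2 by ring] at this
      filter_upwards [this] with x hx
      rw [hx]
    rw [c1, integral_conv_mul_of_even (integrable_fracHeat hn (by linarith) (by linarith) hσ.1)
      (fracHeat_neg _ hσ.1) hui hψ, conv_fracHeat_schwartz hn hr0 hr2 hσ.1, hχ,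
      integral_conv_mul_of_even (integrable_fracHeat hn (by linarith) (by linarith) hσ.1)
      (fracHeat_neg _ hσ.1) hui hχm]
  have hc1 : MemLp (conv (fracHeat r 1) ψ) Q := MemLp.conv i1 hQ.le hQt hψ
  have hc2 : MemLp (conv (smallKernel r) χ) Q := MemLp.conv i3 hQ.le hQt hχm
  calc _ = ∫ x, (conv (fracHeat r 1) (fun y => u y i) x * ψ x +
        conv (smallKernel (2 - ε)) (fun y => U y i) x * ψ x) := by simp only [add_mul]
    _ = ∫ x, (u x i * conv (fracHeat r 1) ψ x + u x i * conv (smallKernel r) χ x) := by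
        rw [integral_add (integrable_mul_schwartz hP.le (m1 i) ψ)
          (integrable_mul_schwartz hP.le (m2 i) ψ), a1, a2, integral_add
          (integrable_mul_of_memLp hui hc1) (integrable_mul_of_memLp hui hc2)]
    _ = _ := by
        rw [fracLap_eq_conv_add hn hr0 hr2, hχ]; simp only [Pi.add_apply, mul_add]

lemma conv_heat_schwartz (ht : 0 < t) (ψ : 𝓢(Vec n, ℝ)) (x : Vec n) :
    conv (heat t) ψ x = ∫ ξ, gauss t ξ * (wave x ξ * ft ψ ξ).re := by
  rw [conv_eq_multiplierOp (integrable_heat ht) ψ.continuous ψ.integrable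
    (integrable_ft_schwartz ψ), multiplierOp_eq]
  have hi : Integrable fun ξ => wave x ξ * (ft (heat t) ξ * ft ψ ξ) :=
    integrable_wave_mul ((integrable_ft_schwartz ψ).bdd_mul (c := ∫ x : Vec n, ‖heat t x‖)
      (continuous_ft (integrable_heat ht)).aestronglyMeasurable
      (ae_of_all _ fun ξ => norm_ft_le _ _)) x
  calc _ = ∫ ξ, (wave x ξ * (ft (heat t) ξ * ft ψ ξ)).re := (integral_re hi).symm
    _ = _ := by
      refine integral_congr_all fun ξ => ?_
      simp only [ft_heat ht]; rw [mul_left_comm, Complex.re_ofReal_mul]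

/-- Subordination: `∫₀^∞ τ^{-ε/2} e^{τΔ} ψ dτ = Γ(1-ε/2) (-Δ)^{ε/2-1} ψ`. -/
lemma integral_rpow_mul_conv_heat (hn : 0 < n) {ε : ℝ} (hε : ε < 2) (hε' : -(n : ℝ) < ε - 2)
    (ψ : 𝓢(Vec n, ℝ)) (x : Vec n) :
    ∫ τ in Ioi 0, τ ^ (-(ε / 2)) * conv (heat τ) ψ x = Gamma (1 - ε / 2) * fracLap (ε - 2) ψ x := by
  have e (ξ : Vec n) : fracSymbol (ε - 2) ξ * (wave x ξ * ft ψ ξ).re =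
      (wave x ξ * ((fracSymbol (ε - 2) ξ : ℂ) * ft ψ ξ)).re := by
    rw [mul_left_comm, Complex.re_ofReal_mul]
  have hi := integrable_wave_mul (integrable_fracSymbol_mul_ft hn hε' ψ) x
  have h := (integral_rpow_mul_integral_gauss hn hε (f := fun ξ => (wave x ξ * ft ψ ξ).re)
    (Complex.continuous_re.comp ((continuous_wave_right x).mul
      (continuous_ft ψ.integrable))).measurable (by simp only [e]; exact hi.re)).2
  simp only [e] at h; rw [fracLap_eq, multiplierOp_eq]
  refine (setIntegral_congr_fun measurableSet_Ioi fun τ hτ => ?_).trans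
    (h.trans (congrArg _ (integral_re hi)))
  simp only [conv_heat_schwartz hτ, ← integral_const_mul]
  exact integral_congr_all fun ξ => by ring

end

section

/-! ### Existence of Riesz potentials -/

lemma lintegral_kernel_le' (hk : AEStronglyMeasurable k)
    (hke : ∀ x, k (-x) = k x) (hf : AEStronglyMeasurable f) (hg : AEStronglyMeasurable g)
    (P Q : ℝ≥0∞) [HolderConjugate P Q] :
    ∫⁻ x, ∫⁻ y, ‖k (x - y)‖ₑ * ‖f y‖ₑ * ‖g x‖ₑ ≤ eLpNorm g 1 * eLpNorm k Q * eLpNorm f P := by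
  have : HolderConjugate Q P := .symm
  have hm : AEMeasurable (Function.uncurry fun x y : Vec n => ‖k (x - y)‖ₑ * ‖f y‖ₑ * ‖g x‖ₑ)
      (volume.prod volume) :=
    (((aestronglyMeasurable_kernel hk hf).mul hg.comp_fst).enorm).congr
      (ae_of_all _ fun z => by simp [Function.uncurry, enorm_mul])
  rw [lintegral_lintegral_swap hm]
  refine le_trans (le_of_eq ?_) (lintegral_kernel_le hg hk hf Q P)
  refine lintegral_congr fun y => ?_
  rw [← lintegral_sub_left_eq_self _ y]
  refine lintegral_congr fun w => ?_
  rw [sub_sub_cancel_left, hke]; ring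

lemma eLpNorm_heat_le (ht : 0 < t) (hQ : 1 ≤ Q) (hQt : Q ≠ ∞)
    [HolderConjugate P Q] : eLpNorm (heat t : Vec n → ℝ) Q volume ≤
      ofReal ((4 * π * t) ^ (-((n : ℝ) / P.toReal / 2))) := by
  have hc : 0 < 4 * π * t := by positivity
  have h := eLpNorm_le_of_bound (n := n) (f := heat t) (C := (4 * π * t) ^ (-(n : ℝ) / 2))
    (fun x => by rw [abs_of_pos (heat_pos ht x)]; exact heat_le_const ht x) hQ hQt
  rw [eLpNorm_one_heat ht, ENNReal.one_rpow, mul_one] at h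
  refine h.trans (le_of_eq ?_)
  have h1 : 1 - 1 / Q.toReal = 1 / P.toReal := by
    have h2 := HolderConjugate.inv_add_inv_eq_one P Q
    have h3 : (P⁻¹ + Q⁻¹).toReal = 1 := by rw [h2]; simp
    have hQ0 : Q⁻¹ ≠ ∞ := ENNReal.inv_ne_top.2 (zero_lt_one.trans_le hQ).ne'
    have hP0 : P⁻¹ ≠ ∞ := ENNReal.inv_ne_top.2 (HolderConjugate.ne_zero P Q)
    rw [ENNReal.toReal_add hP0 hQ0, ENNReal.toReal_inv, ENNReal.toReal_inv] at h3
    rw [one_div, one_div]; linarith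
  have h4 : 0 ≤ 1 - 1 / Q.toReal := by rw [h1]; positivity
  rw [ENNReal.ofReal_rpow_of_nonneg (by positivity) h4, ← rpow_mul hc.le, h1]
  congr 2
  ring

/-- The kernel `t^{σ/2-1} p_t`, whose time integral is a multiple of the Riesz kernel `|x|^{σ-n}`,
pairs absolutely convergently with `L^P` functions and test functions if `σ < n/P`. -/
lemma integrable_heat_potential [HolderConjugate P Q] (hP : 1 < P)
    (hPt : P ≠ ∞) (hσ : 0 < σ) (hσn : σ < (n : ℝ) / P.toReal)
    (hf : MemLp f P) (hg : MemLp g Q) (hg1 : Integrable g) :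
    Integrable (fun w : ℝ × (Vec n × Vec n) =>
      w.1 ^ (σ / 2 - 1) * heat w.1 (w.2.1 - w.2.2) * f w.2.2 * g w.2.1)
      ((volume.restrict (Ioi 0)).prod volume) := by
  have hQ : 1 < Q := one_lt_conj (P := P) hPt
  have : HolderConjugate Q P := .symm
  have hQt : Q ≠ ∞ := lt_top_of_one_lt_conj (P := Q) (Q := P) hP
  have hkm : Measurable fun w : ℝ × Vec n => w.1 ^ (σ / 2 - 1) * heat w.1 w.2 :=
    (by fun_prop : Measurable fun w : ℝ × Vec n => w.1 ^ (σ / 2 - 1)).mul measurable_heat_uncurry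
  have hm : AEStronglyMeasurable (fun w : ℝ × (Vec n × Vec n) =>
      w.1 ^ (σ / 2 - 1) * heat w.1 (w.2.1 - w.2.2) * f w.2.2 * g w.2.1)
      ((volume.restrict (Ioi 0)).prod volume) :=
    ((measurable_comp_sub_param (k := fun t x => t ^ (σ / 2 - 1) * heat t x)
      hkm).aestronglyMeasurable.mul hf.1.comp_snd.comp_snd).mul
        (hg.1.comp_fst (ν := volume)).comp_snd
  refine ⟨hm, ?_⟩
  rw [HasFiniteIntegral, lintegral_prod _ hm.enorm]
  set B : ℝ → ℝ≥0∞ := fun t => ∫⁻ z : Vec n × Vec n,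
    ‖t ^ (σ / 2 - 1) * heat t (z.1 - z.2) * f z.2 * g z.1‖ₑ with hB
  have hBe : ∀ t : ℝ, B t = ‖t ^ (σ / 2 - 1)‖ₑ *
      ∫⁻ x, ∫⁻ y, ‖heat t (x - y)‖ₑ * ‖f y‖ₑ * ‖g x‖ₑ := fun t => by
    have hkt : AEStronglyMeasurable (heat t : Vec n → ℝ) := (continuous_heat t).aestronglyMeasurable
    simp only [hB, mul_assoc, enorm_mul (t ^ (σ / 2 - 1))]
    rw [lintegral_const_mul' _ _ enorm_ne_top]; congr 1
    simpa only [mul_assoc] using lintegral_enorm_kernel hkt hf.1 hg.1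
  have hn : ∀ t : ℝ, 0 < t → ‖t ^ (σ / 2 - 1)‖ₑ = ofReal (t ^ (σ / 2 - 1)) :=
    fun t ht => Real.enorm_of_nonneg (by positivity)
  have hlow : ∫⁻ t in Ioc (0 : ℝ) 1, B t < ∞ := by
    calc ∫⁻ t in Ioc (0 : ℝ) 1, B t
        ≤ ∫⁻ t in Ioc (0 : ℝ) 1, ‖t ^ (σ / 2 - 1)‖ₑ *
          (eLpNorm f P volume * eLpNorm g Q volume) := by
          refine setLIntegral_mono' measurableSet_Ioc fun t ht => ?_
          rw [hBe]
          refine mul_le_mul_right ?_ _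
          have := lintegral_kernel_le (continuous_heat (n := n) t).aestronglyMeasurable
            hf.1 hg.1 P Q
          rwa [eLpNorm_one_heat ht.1, one_mul] at this
      _ = (∫⁻ t in Ioc (0 : ℝ) 1, ‖t ^ (σ / 2 - 1)‖ₑ) * (eLpNorm f P volume * eLpNorm g Q volume) :=
          lintegral_mul_const' _ _ (mul_lt_top hf.2 hg.2).ne
      _ < ∞ := mul_lt_top ((intervalIntegral.intervalIntegrable_rpow' (a := 0) (b := 1)
          (r := σ / 2 - 1) (by linarith)).1.2) (mul_lt_top hf.2 hg.2)
  set c := (4 * π) ^ (-((n : ℝ) / P.toReal / 2)) with hc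
  have hhigh : ∫⁻ t in Ioi (1 : ℝ), B t < ∞ := by
    have hfin : ofReal c * (eLpNorm g 1 volume * eLpNorm f P volume) < ∞ :=
      mul_lt_top ENNReal.ofReal_lt_top (mul_lt_top (memLp_one_iff_integrable.2 hg1).2 hf.2)
    calc ∫⁻ t in Ioi (1 : ℝ), B t
        ≤ ∫⁻ t in Ioi (1 : ℝ), ‖t ^ (σ / 2 - 1 - (n : ℝ) / P.toReal / 2)‖ₑ *
          (ofReal c * (eLpNorm g 1 volume * eLpNorm f P volume)) := by
          refine setLIntegral_mono' measurableSet_Ioi fun t ht => ?_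
          have ht0 : 0 < t := zero_lt_one.trans ht
          rw [hBe, sub_eq_add_neg (σ / 2 - 1), rpow_add ht0, enorm_mul, mul_assoc]
          refine mul_le_mul_right ?_ _
          refine (lintegral_kernel_le' (continuous_heat (n := n) t).aestronglyMeasurable
            (heat_neg t) hf.1 hg.1 P Q).trans ?_
          have h1 := eLpNorm_heat_le (n := n) ht0 (P := P) hQ.le hQt
          rw [mul_rpow (by positivity) ht0.le, ofReal_mul (by positivity)] at h1
          rw [Real.enorm_of_nonneg (by positivity)]
          calc _ ≤ eLpNorm g 1 volume * (ofReal c *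
                ofReal (t ^ (-((n : ℝ) / P.toReal / 2)))) * eLpNorm f P volume := by
                gcongr
            _ = _ := by ring
      _ = (∫⁻ t in Ioi (1 : ℝ), ‖t ^ (σ / 2 - 1 - (n : ℝ) / P.toReal / 2)‖ₑ) *
          (ofReal c * (eLpNorm g 1 volume * eLpNorm f P volume)) :=
          lintegral_mul_const' _ _ hfin.ne
      _ < ∞ := mul_lt_top (integrableOn_Ioi_rpow_of_lt (by linarith) one_pos).2 hfin
  have hun : Ioi (0 : ℝ) = Ioc 0 1 ∪ Ioi 1 := (Set.Ioc_union_Ioi_eq_Ioi zero_le_one).symm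
  calc ∫⁻ t in Ioi (0 : ℝ), B t ≤ (∫⁻ t in Ioc (0 : ℝ) 1, B t) +
        ∫⁻ t in Ioi (1 : ℝ), B t := by
        rw [hun]
        exact lintegral_union_le _ _ _
    _ < ∞ := ENNReal.add_lt_top.2 ⟨hlow, hhigh⟩

/-- Fubini's theorem for a kernel depending on a parameter. -/
lemma integrable_param_mul {μ : Measure ℝ} [SFinite μ] {k : ℝ → Vec n → ℝ}
    (h : Integrable (fun w : ℝ × (Vec n × Vec n) => k w.1 (w.2.1 - w.2.2) * f w.2.2 * g w.2.1)
      (μ.prod volume)) :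
    (∀ᵐ x, Integrable (fun q : Vec n × ℝ => k q.2 (x - q.1) * f q.1 * g x) (volume.prod μ)) ∧
    Integrable (fun x => (∫ q : Vec n × ℝ, k q.2 (x - q.1) * f q.1 ∂(volume.prod μ)) * g x) ∧
    ∫ x, (∫ q : Vec n × ℝ, k q.2 (x - q.1) * f q.1 ∂(volume.prod μ)) * g x =
      ∫ w : ℝ × (Vec n × Vec n), k w.1 (w.2.1 - w.2.2) * f w.2.2 * g w.2.1 ∂(μ.prod volume) := by
  have hmp := (measurePreserving_prodAssoc (volume : Measure (Vec n)) (volume : Measure (Vec n))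
    μ).symm MeasurableEquiv.prodAssoc
  have h2 := hmp.integrable_comp_of_integrable h.swap
  have e : ∀ x, ∫ q : Vec n × ℝ, k q.2 (x - q.1) * f q.1 * g x ∂(volume.prod μ) =
      (∫ q : Vec n × ℝ, k q.2 (x - q.1) * f q.1 ∂(volume.prod μ)) * g x := fun x =>
    integral_mul_const _ _
  refine ⟨h2.prod_right_ae, h2.integral_prod_left.congr (ae_of_all _ e), ?_⟩
  have e1 := integral_prod _ h2
  have e2 := hmp.integral_comp' ((fun w : ℝ × (Vec n × Vec n) =>
    k w.1 (w.2.1 - w.2.2) * f w.2.2 * g w.2.1) ∘ Prod.swap)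
  have e3 := integral_prod_swap (ν := (volume.prod volume : Measure (Vec n × Vec n))) (μ := μ)
    (fun w : ℝ × (Vec n × Vec n) => k w.1 (w.2.1 - w.2.2) * f w.2.2 * g w.2.1)
  refine Eq.trans (integral_congr_all fun x => (e x).symm) (e1.symm.trans ?_)
  exact e2.trans e3

lemma exists_isFracLap_of_neg (hn : 0 < n) (hσ : 0 < σ) (hP : 1 < P)
    (hPt : P ≠ ∞) (hσn : σ < (n : ℝ) / P.toReal) (hu : MemLp u P) :
    ∃ g, IsFracLap (-σ) u g := by
  set μ := (volume : Measure ℝ).restrict (Ioi 0)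
  obtain ⟨Q, _, _, -, -⟩ := exists_holderConjugate hP hPt
  have hΓ : Gamma (σ / 2) ≠ 0 := (Real.Gamma_pos_of_pos (half_pos hσ)).ne'
  have hσn' : σ < n := by
    refine hσn.trans_le (div_le_self n.cast_nonneg ?_)
    have := ENNReal.toReal_mono hPt hP.le
    simpa using this
  set k : ℝ → Vec n → ℝ := fun t x => t ^ (σ / 2 - 1) * heat t x with hk
  refine ⟨fun x => WithLp.toLp 2 fun i => (Gamma (σ / 2))⁻¹ *
    ∫ q : Vec n × ℝ, k q.2 (x - q.1) * u q.1 i ∂(volume.prod μ), fun ψ i => ?_⟩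
  have h1 : Integrable (fun w : ℝ × (Vec n × Vec n) =>
      k w.1 (w.2.1 - w.2.2) * u w.2.2 i * ψ w.2.1) (μ.prod volume) :=
    integrable_heat_potential hP hPt hσ hσn (hu.eval_piLp i) (ψ.memLp Q volume) ψ.integrable
  have hmp : MeasurePreserving (fun w : ℝ × (Vec n × Vec n) => (w.1, w.2.swap))
      (μ.prod volume) (μ.prod volume) := (MeasurePreserving.id μ).prod Measure.measurePreserving_swap
  have h2 : Integrable (fun w : ℝ × (Vec n × Vec n) =>
      k w.1 (w.2.1 - w.2.2) * ψ w.2.2 * u w.2.1 i) (μ.prod volume) := by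
    refine (hmp.integrable_comp_of_integrable h1).congr (ae_of_all _ fun w => ?_)
    simp only [Function.comp_apply, Prod.fst_swap, Prod.snd_swap, hk, heat_sub_comm w.1 w.2.2 w.2.1]
    ring
  have hswap : ∫ w : ℝ × (Vec n × Vec n), k w.1 (w.2.1 - w.2.2) * ψ w.2.2 * u w.2.1 i
      ∂(μ.prod volume) = ∫ w : ℝ × (Vec n × Vec n), k w.1 (w.2.1 - w.2.2) * u w.2.2 i * ψ w.2.1
      ∂(μ.prod volume) := by
    have hme : MeasurableEmbedding fun w : ℝ × (Vec n × Vec n) => (w.1, w.2.swap) :=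
      ((MeasurableEquiv.refl ℝ).prodCongr MeasurableEquiv.prodComm).measurableEmbedding
    rw [← hmp.integral_comp hme]
    refine integral_congr_all fun w => ?_
    simp only [Prod.fst_swap, Prod.snd_swap, hk, heat_sub_comm w.1 w.2.2 w.2.1]; ring
  obtain ⟨-, a2, a3⟩ := integrable_param_mul (k := k) (f := fun y => u y i) (g := ψ) h1
  obtain ⟨b1, b2, b3⟩ := integrable_param_mul (k := k) (f := ψ) (g := fun y => u y i) h2
  have e : ∀ᵐ x, (∫ q : Vec n × ℝ, k q.2 (x - q.1) * ψ q.1 ∂(volume.prod μ)) * u x i =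
      Gamma (σ / 2) * (u x i * fracLap (-σ) ψ x) := by
    filter_upwards [b1] with x hx
    rcases eq_or_ne (u x i) 0 with h0 | h0
    · simp [h0]
    have hx' : Integrable (fun q : Vec n × ℝ => k q.2 (x - q.1) * ψ q.1) (volume.prod μ) := by
      refine (hx.mul_const (u x i)⁻¹).congr (ae_of_all _ fun q => ?_)
      simp only; rw [mul_inv_cancel_right₀ h0]
    have h3 := integral_rpow_mul_conv_heat hn (ε := 2 - σ) (by linarith) (by linarith) ψ x
    rw [show 2 - σ - 2 = -σ by ring, show 1 - (2 - σ) / 2 = σ / 2 by ring,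
      show -((2 - σ) / 2) = σ / 2 - 1 by ring] at h3
    rw [integral_prod_symm _ hx']
    have h4 : ∫ t, (∫ y, k t (x - y) * ψ y) ∂μ = Gamma (σ / 2) * fracLap (-σ) ψ x := by
      rw [← h3]
      refine integral_congr_all fun t => ?_
      simp only [hk, conv, mul_assoc]; rw [integral_const_mul]
    rw [h4]; ring
  have e' : ∀ᵐ x, (Gamma (σ / 2))⁻¹ *
      ((∫ q : Vec n × ℝ, k q.2 (x - q.1) * ψ q.1 ∂(volume.prod μ)) * u x i) =
      u x i * fracLap (-σ) ψ x := e.mono fun x hx => by rw [hx, inv_mul_cancel_left₀ hΓ]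
  refine ⟨(b2.const_mul _).congr e', ?_, ?_⟩
  · refine (a2.const_mul (Gamma (σ / 2))⁻¹).congr (ae_of_all _ fun x => ?_)
    simp only; ring
  · rw [← integral_congr_ae e', integral_const_mul, b3, hswap, ← a3, ← integral_const_mul]
    refine integral_congr_all fun x => ?_
    ring

/-- `(-Δ)^{(s-ε)/2} u` is obtained from `U = (-Δ)^{s/2} u` by splitting the average over heat
scales if `ε < s`, and as a Riesz potential of `u ∈ L^P` if `ε > s`; the latter needs `ε - s < n/P`. -/
theorem exists_isFracLap (hn : 0 < n) {ε : ℝ} (hε : 0 < ε) (hs : s < 2)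
    (hP : 1 < P) (hPt : P ≠ ∞) (hεn : ε - s < (n : ℝ) / P.toReal)
    (h : IsSobolevPair s P u U) : ∃ g, IsFracLap (s - ε) u g := by
  rcases lt_trichotomy ε s with h1 | rfl | h1
  · exact exists_isFracLap_of_pos hn hε h1 hs hP hPt h
  · rw [sub_self]
    exact ⟨u, IsFracLap.zero hP.le h.memLp⟩
  · rw [← neg_sub]
    exact exists_isFracLap_of_neg hn (by linarith) hP hPt hεn h.memLp

end

section

/-! ### The kernel of the commutator at fixed heat scales -/

lemma integral_shift_eq_conv (K L : Vec n → ℝ) (x z : Vec n) :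
    ∫ y, K (x - y) * L (y - z) = conv K L (x - z) := by
  rw [conv, ← integral_sub_right_eq_self (fun y => K (x - z - y) * L y) z]
  refine integral_congr_all fun y => ?_
  simp only [sub_sub_sub_cancel_right]

lemma integrable_heat_mul_heat (hs : 0 < s) (ht : 0 < t) (x z : Vec n) :
    Integrable fun y => heat s (x - y) * heat t (y - z) :=
  ((integrable_heat ht).comp_sub_right z).bdd_mul (c := (4 * π * s) ^ (-(n : ℝ) / 2))
    ((continuous_heat s).comp (continuous_const.sub continuous_id)).aestronglyMeasurable
    (ae_of_all _ fun y => by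
      rw [norm_of_nonneg (heat_pos hs _).le]
      exact heat_le_const hs _)

lemma integral_heat_shift (hs : 0 < s) (ht : 0 < t) (x z : Vec n) :
    ∫ y, heat s (x - y) * heat t (y - z) = heat (s + t) (x - z) := by
  rw [integral_shift_eq_conv, conv_heat_heat hs ht]

lemma abs_integral_le_heat {D : ℝ} (hs : 0 < s) (ht : 0 < t) {x z : Vec n}
    {F : Vec n → ℝ} (h : ∀ y, |F y| ≤ D * (heat s (x - y) * heat t (y - z))) :
    |∫ y, F y| ≤ D * heat (s + t) (x - z) := by
  rw [← integral_heat_shift hs ht, ← integral_const_mul]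
  exact abs_integral_le_of_abs_le ((integrable_heat_mul_heat hs ht x z).const_mul D) h

lemma abs_mul_le_mul_mul {u v A B p q : ℝ} (hu : |u| ≤ A * p) (hv : |v| ≤ B * q) :
    |u * v| ≤ A * B * (p * q) := by
  rw [abs_mul, mul_mul_mul_comm]
  exact mul_le_mul hu hv (abs_nonneg _) ((abs_nonneg _).trans hu)

lemma abs_mul_le_mul_of_mul_le {u v L w D : ℝ} (hL : 0 ≤ L) (hu : |u| ≤ L * w) (hv : w * |v| ≤ D) :
    |u * v| ≤ L * D := by
  rw [abs_mul]
  calc _ ≤ L * w * |v| := by gcongr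
    _ ≤ _ := by rw [mul_assoc]; gcongr

lemma integrable_ft_heatLap (hn : 0 < n) (ht : 0 < t) :
    Integrable (ft (heatLap t : Vec n → ℝ)) := by
  have hi : Integrable fun ξ : Vec n => ((-(fracSymbol 2 ξ * gauss t ξ) : ℝ) : ℂ) :=
    (integrable_fracSymbol_mul_gauss hn (r := 2) (by
      have : (0 : ℝ) ≤ n := n.cast_nonneg
      linarith) ht).neg.ofReal
  refine hi.congr (ae_of_all _ fun ξ => ?_)
  simp only [ft_heatLap ht, fracSymbol_two, neg_mul]

/-- `∂ᵢ∂ⱼ p_t * Δ p_σ` depends only on `t + σ`, so that it can be estimated with `t = σ`. -/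
lemma exists_abs_conv_heatHess_heatLap_le (hn : 0 < n) : ∃ C : ℝ, 0 < C ∧ ∀ t σ : ℝ, 0 < t →
    0 < σ → ∀ (i j : Fin n) (x : Vec n),
      |conv (heatHess i j t) (heatLap σ) x| ≤ C * (t + σ) ^ (-2 : ℝ) * heat (2 * (t + σ)) x := by
  obtain ⟨C₁, hC₁, h₁⟩ := abs_heatHess_le n
  obtain ⟨C₂, hC₂, h₂⟩ := abs_heatLap_le n
  refine ⟨4 * (C₁ * C₂), by positivity, fun t σ ht hσ i j x => ?_⟩
  set τ := (t + σ) / 2 with hτ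
  have hτ0 : 0 < τ := by positivity
  have e : conv (heatHess i j t) (heatLap σ) = conv (heatHess i j τ) (heatLap τ) := by
    refine conv_congr_ft (integrable_heatHess ht i j) (integrable_heatHess hτ0 i j)
      (continuous_heatLap σ) (integrable_heatLap hσ) (integrable_ft_heatLap hn hσ)
      (continuous_heatLap τ) (integrable_heatLap hτ0) (integrable_ft_heatLap hn hτ0)
      (ae_of_all _ fun ξ => ?_)
    rw [ft_heatHess ht, ft_heatHess hτ0, ft_heatLap hσ, ft_heatLap hτ0, ← Complex.ofReal_mul,
      ← Complex.ofReal_mul]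
    congr 1
    have hg : gauss t ξ * gauss σ ξ = gauss τ ξ * gauss τ ξ := by
      rw [← gauss_add, ← gauss_add, hτ, add_halves]
    linear_combination (2 * π) ^ 2 * (ξ i * ξ j) * (2 * π * ‖ξ‖) ^ 2 * hg
  have h := abs_integral_le_heat (x := x) (z := 0) (F := fun y => heatHess i j τ (x - y) * heatLap τ y)
    (by positivity : 0 < 2 * τ) (by positivity : 0 < 2 * τ) fun y =>
      abs_mul_le_mul_mul (h₁ τ hτ0 i j _) (by rw [sub_zero]; exact h₂ τ hτ0 _)
  rw [sub_zero, show 2 * τ + 2 * τ = 2 * (t + σ) by rw [hτ]; ring] at h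
  rw [e]
  refine h.trans (le_of_eq ?_)
  have hts : t + σ = 2 * τ := by rw [hτ]; ring
  rw [hts, rpow_neg (by positivity), Real.rpow_two]; field_simp; ring_nf

/-- The size of the commutator kernel at heat scales `t` and `σ`. -/
def commMajorant (α t σ : ℝ) (x : Vec n) : ℝ :=
  min t σ ^ (α / 2 - 1) * (max t σ)⁻¹ * heat (8 * max t σ) x

/-- The smaller of the two scales profits from the Hölder continuity of `a`. For `σ < t` this
requires to split `a(y) - a(x) = (a(y) - a(z)) + (a(z) - a(x))`; the second part leads to the
fourth order kernel `∂ᵢ∂ⱼΔ p_{t+σ}`. -/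
lemma exists_abs_commKernel_le (hn : 0 < n) {α : ℝ} (hα : 0 < α) (hα1 : α ≤ 1) :
    ∃ C : ℝ, 0 < C ∧ ∀ (L : ℝ) (a : Vec n → ℝ), 0 ≤ L → Measurable a →
      (∀ x y, |a x - a y| ≤ L * ‖x - y‖ ^ α) → ∀ t σ : ℝ, 0 < t → 0 < σ →
      ∀ (i j : Fin n) (x z : Vec n),
      |∫ y, heatHess i j t (x - y) * (a y - a x) * heatLap σ (y - z)| ≤
        C * L * commMajorant α t σ (x - z) := by
  obtain ⟨C₁, hC₁, h₁⟩ := abs_heatHess_le n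
  obtain ⟨C₂, hC₂, h₂⟩ := abs_heatLap_le n
  obtain ⟨C₃, hC₃, h₃⟩ := rpow_norm_mul_heatHess_le n hα.le
  obtain ⟨C₄, hC₄, h₄⟩ := rpow_norm_mul_heatLap_le n hα.le
  obtain ⟨C₅, hC₅, h₅⟩ := exists_abs_conv_heatHess_heatLap_le hn
  obtain ⟨C₆, hC₆, h₆⟩ := rpow_norm_mul_heat_le n hα.le
  set K : ℝ := 4 ^ ((n : ℝ) / 2)
  have hK : 0 < K := by positivity
  refine ⟨C₃ * C₂ * K + (C₁ * C₄ * K + C₅ * (C₆ * 2 ^ (α / 2)) * K), by positivity,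
    fun L a hL ham ha t σ ht hσ i j x z => ?_⟩
  have hmax : 0 < max t σ := lt_max_of_lt_left ht
  set M := heat (8 * max t σ) (x - z) with hM
  have hM0 : 0 < M := heat_pos (by positivity) _
  have hle1 : t ≤ max t σ := le_max_left _ _
  have hle2 : σ ≤ max t σ := le_max_right _ _
  have hle3 : max t σ ≤ t + σ := max_le (by linarith) (by linarith)
  have k1 : heat (2 * t + 2 * σ) (x - z) ≤ K * M :=
    heat_le_mul (by positivity) (by linarith) (by linarith) _
  have k2 : heat (2 * (2 * (t + σ))) (x - z) ≤ K * M :=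
    heat_le_mul (by positivity) (by linarith) (by linarith) _
  have ha' (y) : |a y - a x| ≤ L * ‖x - y‖ ^ α := norm_sub_rev x y ▸ ha y x
  have h2t : 0 < 2 * t := by positivity
  have h2σ : 0 < 2 * σ := by positivity
  have hm : 0 ≤ L * commMajorant α t σ (x - z) := by unfold commMajorant; positivity
  rw [mul_assoc _ L, add_mul]
  rcases le_or_gt t σ with hts | hts
  · refine le_add_of_le_of_nonneg ?_ (by positivity)
    calc _ ≤ L * (C₃ * t ^ (α / 2 - 1)) * (C₂ * σ⁻¹) * heat (2 * t + 2 * σ) (x - z) :=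
          abs_integral_le_heat h2t h2σ fun y => abs_mul_le_mul_mul (by
            rw [mul_comm (heatHess ..), mul_assoc L]
            exact abs_mul_le_mul_of_mul_le hL (ha' y) (h₃ t ht i j _)) (h₂ σ hσ _)
      _ ≤ L * (C₃ * t ^ (α / 2 - 1)) * (C₂ * σ⁻¹) * (K * M) := by gcongr
      _ = _ := by rw [commMajorant, min_eq_left hts, ← hM, max_eq_right hts]; ring
  · refine le_add_of_nonneg_of_le (by positivity) ?_
    set D₁ := (C₁ * t⁻¹) * (L * (C₄ * σ ^ (α / 2 - 1))) with hD₁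
    have q1 (y) : |heatHess i j t (x - y) * (a y - a z) * heatLap σ (y - z)| ≤
        D₁ * (heat (2 * t) (x - y) * heat (2 * σ) (y - z)) := by
      rw [mul_assoc]
      refine abs_mul_le_mul_mul (h₁ t ht i j _) ?_
      rw [mul_assoc L]
      exact abs_mul_le_mul_of_mul_le hL (ha y z) (h₄ σ hσ _)
    have hdom := integrable_heat_mul_heat h2t h2σ x z
    have mH : Measurable fun y => heatHess i j t (x - y) :=
      ((continuous_heatHess i j t).comp (continuous_const.sub continuous_id)).measurable
    have mL : Measurable fun y => heatLap σ (y - z) :=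
      ((continuous_heatLap σ).comp (continuous_id.sub continuous_const)).measurable
    have I1 : Integrable fun y => heatHess i j t (x - y) * (a y - a z) * heatLap σ (y - z) :=
      (hdom.const_mul D₁).mono' ((mH.mul (ham.sub_const _)).mul mL).aestronglyMeasurable
        (ae_of_all _ q1)
    have I2 : Integrable fun y => heatHess i j t (x - y) * heatLap σ (y - z) :=
      (hdom.const_mul _).mono' (mH.mul mL).aestronglyMeasurable
        (ae_of_all _ fun y => abs_mul_le_mul_mul (h₁ t ht i j _) (h₂ σ hσ _))
    have e : ∫ y, heatHess i j t (x - y) * (a y - a x) * heatLap σ (y - z) =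
        (∫ y, heatHess i j t (x - y) * (a y - a z) * heatLap σ (y - z)) +
          (a z - a x) * conv (heatHess i j t) (heatLap σ) (x - z) := by
      rw [← integral_shift_eq_conv, ← integral_const_mul, ← integral_add I1 (I2.const_mul _)]
      refine integral_congr_all fun y => ?_
      ring
    have b2 : |(a z - a x) * conv (heatHess i j t) (heatLap σ) (x - z)| ≤
        L * (C₅ * (t + σ) ^ (-2 : ℝ) * (C₆ * (2 * (t + σ)) ^ (α / 2) * (K * M))) :=
      abs_mul_le_mul_of_mul_le hL (ha' z) <| by
        calc _ ≤ ‖x - z‖ ^ α * (C₅ * (t + σ) ^ (-2 : ℝ) * heat (2 * (t + σ)) (x - z)) := by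
              gcongr; exact h₅ t σ ht hσ i j _
          _ = C₅ * (t + σ) ^ (-2 : ℝ) * (‖x - z‖ ^ α * heat (2 * (t + σ)) (x - z)) := by ring
          _ ≤ _ := mul_le_mul_of_nonneg_left
            ((h₆ _ (by positivity) _).trans (by gcongr)) (by positivity)
    have b3 : (t + σ) ^ (-2 : ℝ) * (t + σ) ^ (α / 2) ≤ σ ^ (α / 2 - 1) * t⁻¹ := by
      have hts0 : 0 < t + σ := by positivity
      rw [← rpow_add hts0, show -2 + α / 2 = α / 2 - 1 + -1 by ring, rpow_add hts0,
        Real.rpow_neg_one]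
      exact mul_le_mul (Real.rpow_le_rpow_of_nonpos hσ (by linarith) (by linarith))
        (inv_anti₀ ht (by linarith)) (by positivity) (by positivity)
    rw [e]
    calc _ ≤ D₁ * (K * M) +
          L * (C₅ * (t + σ) ^ (-2 : ℝ) * (C₆ * (2 * (t + σ)) ^ (α / 2) * (K * M))) := by
          refine (abs_add_le _ _).trans
            (add_le_add ((abs_integral_le_heat h2t h2σ q1).trans ?_) b2)
          have : 0 ≤ D₁ := by positivity
          gcongr
      _ = C₁ * C₄ * K * (L * (σ ^ (α / 2 - 1) * t⁻¹ * M)) + C₅ * (C₆ * 2 ^ (α / 2)) * K *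
          (L * ((t + σ) ^ (-2 : ℝ) * (t + σ) ^ (α / 2) * M)) := by
          rw [mul_rpow zero_le_two (by positivity), hD₁]; ring
      _ ≤ C₁ * C₄ * K * (L * (σ ^ (α / 2 - 1) * t⁻¹ * M)) + C₅ * (C₆ * 2 ^ (α / 2)) * K *
          (L * (σ ^ (α / 2 - 1) * t⁻¹ * M)) := by gcongr
      _ = _ := by rw [commMajorant, min_eq_right hts.le, ← hM, max_eq_left hts.le]; ring

lemma exists_heat_le_rpow (n : ℕ) {β : ℝ} (hβ : -(n : ℝ) / 2 ≤ β) : ∃ C : ℝ, 0 < C ∧ ∀ t : ℝ,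
    0 < t → ∀ x : Vec n, x ≠ 0 → heat t x ≤ C * t ^ β * ‖x‖ ^ (-(n : ℝ) - 2 * β) := by
  obtain ⟨C, hC, h⟩ := rpow_norm_mul_heat_le n (m := n + 2 * β) (by linarith)
  refine ⟨C * (8 * π) ^ (-(n : ℝ) / 2), by positivity, fun t ht x hx => ?_⟩
  have hx0 : 0 < ‖x‖ := norm_pos_iff.2 hx
  have h1 := heat_le_const (n := n) (t := 2 * t) (by positivity) x
  have h2 : ‖x‖ ^ ((n : ℝ) + 2 * β) * heat t x ≤ C * t ^ (((n : ℝ) + 2 * β) / 2) *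
      (4 * π * (2 * t)) ^ (-(n : ℝ) / 2) := (h t ht x).trans (by gcongr)
  have e : heat t x = ‖x‖ ^ (-(n : ℝ) - 2 * β) * (‖x‖ ^ ((n : ℝ) + 2 * β) * heat t x) := by
    rw [← mul_assoc, ← rpow_add hx0, show -(n : ℝ) - 2 * β + (n + 2 * β) = 0 by ring,
      Real.rpow_zero, one_mul]
  rw [e]
  calc _ ≤ ‖x‖ ^ (-(n : ℝ) - 2 * β) * (C * t ^ (((n : ℝ) + 2 * β) / 2) *
        (4 * π * (2 * t)) ^ (-(n : ℝ) / 2)) := by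
        gcongr
    _ = _ := by
        rw [show 4 * π * (2 * t) = (8 * π) * t by ring, mul_rpow (by positivity) ht.le,
          show β = ((n : ℝ) + 2 * β) / 2 + -(n : ℝ) / 2 by ring, rpow_add ht]
        ring_nf

lemma lintegral_Ioc_rpow {p R : ℝ} (hp : -1 < p) (hR : 0 < R) :
    ∫⁻ t in Ioc 0 R, ofReal (t ^ p) = ofReal (R ^ (p + 1) / (p + 1)) := by
  have hi := (intervalIntegral.intervalIntegrable_rpow' (a := 0) (b := R) hp).1
  rw [← ofReal_integral_eq_lintegral_ofReal hi, ← integral_of_le hR.le,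
    integral_rpow (Or.inl hp), Real.zero_rpow (by linarith), sub_zero]
  filter_upwards [ae_restrict_mem measurableSet_Ioc] with t ht
  exact Real.rpow_nonneg ht.1.le _

lemma lintegral_Ioi_rpow {p R : ℝ} (hp : p < -1) (hR : 0 < R) :
    ∫⁻ t in Ioi R, ofReal (t ^ p) = ofReal (-R ^ (p + 1) / (p + 1)) := by
  rw [← ofReal_integral_eq_lintegral_ofReal (integrableOn_Ioi_rpow_of_lt hp hR),
    integral_Ioi_rpow_of_lt hp hR]
  filter_upwards [ae_restrict_mem measurableSet_Ioi] with t ht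
  exact Real.rpow_nonneg (hR.trans ht).le _

lemma exists_lintegral_commMajorant_le (n : ℕ) {α β : ℝ} (hα : 0 < α)
    (hβ : -(n : ℝ) / 2 ≤ β) (hβ0 : β < 0) : ∃ C : ℝ, 0 < C ∧ ∀ σ : ℝ, 0 < σ → ∀ x : Vec n, x ≠ 0 →
      ∫⁻ t in Ioi 0, ofReal (commMajorant α t σ x) ≤
        ofReal (C * σ ^ (α / 2 - 1 + β) * ‖x‖ ^ (-(n : ℝ) - 2 * β)) := by
  obtain ⟨C, hC, h⟩ := exists_heat_le_rpow n hβ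
  have hβ' : 0 < -β := neg_pos.2 hβ0
  refine ⟨C * 8 ^ β * ((α / 2)⁻¹ + (-β)⁻¹), by positivity, fun σ hσ x hx => ?_⟩
  set X := C * 8 ^ β * ‖x‖ ^ (-(n : ℝ) - 2 * β) with hX
  have hX0 : 0 ≤ X := by positivity
  have key : ∀ t, 0 < t → commMajorant α t σ x ≤
      X * (min t σ ^ (α / 2 - 1) * max t σ ^ (β - 1)) := fun t ht => by
    have hmax : 0 < max t σ := lt_max_of_lt_left ht
    have hmin : 0 < min t σ := lt_min ht hσ
    rw [commMajorant]
    calc _ ≤ min t σ ^ (α / 2 - 1) * (max t σ)⁻¹ *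
          (C * (8 * max t σ) ^ β * ‖x‖ ^ (-(n : ℝ) - 2 * β)) := by
          gcongr
          exact h _ (by positivity) x hx
      _ = _ := by
          rw [mul_rpow (by norm_num) hmax.le, Real.rpow_sub hmax, Real.rpow_one, hX]; ring
  have l1 : ∫⁻ t in Ioc 0 σ, ofReal (commMajorant α t σ x) ≤
      ofReal (X * σ ^ (β - 1)) * ofReal (σ ^ (α / 2 - 1 + 1) / (α / 2 - 1 + 1)) := by
    rw [← lintegral_Ioc_rpow (by linarith) hσ, ← lintegral_const_mul' _ _ ofReal_ne_top]
    refine setLIntegral_mono' measurableSet_Ioc fun t ht => ?_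
    rw [← ofReal_mul (by positivity)]
    refine ofReal_le_ofReal ((key t ht.1).trans (le_of_eq ?_))
    rw [min_eq_left ht.2, max_eq_right ht.2]; ring
  have l2 : ∫⁻ t in Ioi σ, ofReal (commMajorant α t σ x) ≤ ofReal (X * σ ^ (α / 2 - 1)) *
        ofReal (-σ ^ (β - 1 + 1) / (β - 1 + 1)) := by
    rw [← lintegral_Ioi_rpow (by linarith) hσ, ← lintegral_const_mul' _ _ ofReal_ne_top]
    refine setLIntegral_mono' measurableSet_Ioi fun t ht => ?_
    have ht : σ < t := ht
    rw [← ofReal_mul (by positivity)]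
    refine ofReal_le_ofReal ((key t (hσ.trans ht)).trans (le_of_eq ?_))
    rw [min_eq_right ht.le, max_eq_left ht.le]; ring
  have r1 : X * σ ^ (β - 1) * (σ ^ (α / 2 - 1 + 1) / (α / 2 - 1 + 1)) =
      X * σ ^ (α / 2 - 1 + β) * (α / 2)⁻¹ := by
    rw [sub_add_cancel, show α / 2 - 1 + β = (β - 1) + α / 2 by ring, rpow_add hσ]
    ring
  have r2 : X * σ ^ (α / 2 - 1) * (-σ ^ (β - 1 + 1) / (β - 1 + 1)) =
      X * σ ^ (α / 2 - 1 + β) * (-β)⁻¹ := by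
    rw [sub_add_cancel, rpow_add hσ, neg_div, ← div_neg]; ring
  rw [← Set.Ioc_union_Ioi_eq_Ioi hσ.le]
  refine (lintegral_union_le _ _ _).trans ((add_le_add l1 l2).trans (le_of_eq ?_))
  rw [← ofReal_mul (by positivity), ← ofReal_mul (by positivity), r1, r2,
    ← ENNReal.ofReal_add (by positivity) (by positivity)]
  congr 1; rw [hX]; ring

/-- Integrated over both scales, the majorants add up to the kernel of the Riesz potential of
order `α - ε`. The shift `δ` of the scale `τ` only helps. -/
lemma exists_lintegral_lintegral_commMajorant_le (hn : 0 < n) {α ε : ℝ} (hε : 0 < ε) (hεα : ε < α)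
    (hα1 : α ≤ 1) : ∃ C : ℝ, 0 < C ∧ ∀ δ : ℝ, 0 < δ → ∀ x : Vec n, x ≠ 0 →
      ∫⁻ τ in Ioi 0, ofReal (τ ^ (-(ε / 2))) * ∫⁻ t in Ioi 0, ofReal (commMajorant α t (δ + τ) x) ≤
        ofReal (C * ‖x‖ ^ (α - ε - n)) := by
  have hn1 : (1 : ℝ) ≤ n := by exact_mod_cast hn
  set κ := α - ε with hκ
  have hκ0 : 0 < κ := by linarith
  set β := -κ / 4 with hβ
  have hα0 : 0 < α := hε.trans hεα
  obtain ⟨C₁, hC₁, h₁⟩ := exists_lintegral_commMajorant_le n hα0 (β := β) (by linarith)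
    (by linarith)
  obtain ⟨C₂, hC₂, h₂⟩ := exists_lintegral_commMajorant_le n hα0 (β := -(n : ℝ) / 2) le_rfl
    (by linarith)
  have d1 : 0 < κ / 2 - 1 + β + 1 := by linarith
  have d2 : 0 < -(κ / 2 - 1 + -(n : ℝ) / 2 + 1) := by linarith
  refine ⟨C₁ / (κ / 2 - 1 + β + 1) + C₂ / -(κ / 2 - 1 + -(n : ℝ) / 2 + 1), by positivity,
    fun δ hδ x hx => ?_⟩
  have hx0 : 0 < ‖x‖ := norm_pos_iff.2 hx
  set R := ‖x‖ ^ (2 : ℝ) with hR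
  have hR0 : 0 < R := by positivity
  have step : ∀ {C b : ℝ}, 0 < C → b < 0 → (∀ σ : ℝ, 0 < σ → ∀ x : Vec n, x ≠ 0 →
      ∫⁻ t in Ioi 0, ofReal (commMajorant α t σ x) ≤
        ofReal (C * σ ^ (α / 2 - 1 + b) * ‖x‖ ^ (-(n : ℝ) - 2 * b))) →
      ∀ τ, 0 < τ → ofReal (τ ^ (-(ε / 2))) * ∫⁻ t in Ioi 0, ofReal (commMajorant α t (δ + τ) x) ≤
        ofReal (C * ‖x‖ ^ (-(n : ℝ) - 2 * b)) * ofReal (τ ^ (κ / 2 - 1 + b)) := by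
    intro C b hC hb h τ hτ
    calc _ ≤ ofReal (τ ^ (-(ε / 2))) *
          ofReal (C * τ ^ (α / 2 - 1 + b) * ‖x‖ ^ (-(n : ℝ) - 2 * b)) := by
          gcongr
          refine (h _ (by positivity) x hx).trans (ofReal_le_ofReal ?_)
          have := Real.rpow_le_rpow_of_nonpos (z := α / 2 - 1 + b) hτ
            (by linarith : τ ≤ δ + τ) (by linarith)
          gcongr
      _ = _ := by
          rw [← ofReal_mul (by positivity), ← ofReal_mul (by positivity),
            show κ / 2 - 1 + b = -(ε / 2) + (α / 2 - 1 + b) by rw [hκ]; ring,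
            rpow_add hτ (-(ε / 2))]
          congr 1; ring
  have l1 := setLIntegral_mono' (μ := volume) (measurableSet_Ioc (a := (0 : ℝ)) (b := R))
    fun τ hτ => step hC₁ (by linarith) h₁ τ hτ.1
  have l2 := setLIntegral_mono' (μ := volume) (measurableSet_Ioi (a := R))
    fun τ (hτ : R < τ) => step hC₂ (by linarith) h₂ τ (hR0.trans hτ)
  rw [lintegral_const_mul' _ _ ofReal_ne_top, lintegral_Ioc_rpow (by linarith) hR0] at l1
  rw [lintegral_const_mul' _ _ ofReal_ne_top, lintegral_Ioi_rpow (by linarith) hR0,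
    neg_div (κ / 2 - 1 + -(n : ℝ) / 2 + 1), ← div_neg (R ^ (κ / 2 - 1 + -(n : ℝ) / 2 + 1))] at l2
  have h0 := lintegral_union_le (μ := volume) (fun τ : ℝ => ofReal (τ ^ (-(ε / 2))) *
    ∫⁻ t in Ioi 0, ofReal (commMajorant α t (δ + τ) x)) (Ioc 0 R) (Ioi R)
  rw [Set.Ioc_union_Ioi_eq_Ioi hR0.le] at h0
  refine h0.trans ((add_le_add l1 l2).trans (le_of_eq ?_))
  rw [← ofReal_mul (by positivity),
    ← ofReal_mul (by positivity), ← ENNReal.ofReal_add (by positivity) (by positivity)]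
  congr 1
  have e : ∀ b : ℝ, ‖x‖ ^ (-(n : ℝ) - 2 * b) * R ^ (κ / 2 - 1 + b + 1) = ‖x‖ ^ (κ - n) := by
    intro b; rw [hR, ← rpow_mul hx0.le, ← rpow_add hx0]; congr 1
    ring
  rw [add_mul, ← e β]
  nth_rewrite 2 [e β]
  rw [← e (-(n : ℝ) / 2)]; ring

end

section

/-! ### The commutator estimate -/

/-- The commutator `[a, K] g` of a multiplication operator and a convolution operator. -/
def commConv (K a g : Vec n → ℝ) (y : Vec n) : ℝ := a y * conv K g y - conv K (fun x => a x * g x) y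

lemma memLp_mul_bdd {a : Vec n → ℝ} (ham : Measurable a)
    (hab : ∀ x, |a x| ≤ Λ) (hf : MemLp f P) : MemLp (fun x => a x * f x) P :=
  (hf.const_mul Λ).mono (ham.aestronglyMeasurable.mul hf.1) (ae_of_all _ fun x => by
    rw [norm_mul, norm_mul, norm_eq_abs]
    exact mul_le_mul_of_nonneg_right ((hab x).trans (le_abs_self Λ)) (norm_nonneg _))

lemma memLp_commConv (hP : 1 ≤ P) (hPt : P ≠ ∞) {K a : Vec n → ℝ}
    (hK : Integrable K) (ham : Measurable a) (hab : ∀ x, |a x| ≤ Λ) (hf : MemLp f P) :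
    MemLp (commConv K a f) P :=
  (memLp_mul_bdd ham hab (MemLp.conv hK hP hPt hf)).sub
    (MemLp.conv hK hP hPt (memLp_mul_bdd ham hab hf))

lemma commConv_eq_integral {K a : Vec n → ℝ} (ham : Measurable a)
    (hab : ∀ x, |a x| ≤ Λ) {y : Vec n} (h : Integrable fun x => K (y - x) * g x) :
    commConv K a g y = ∫ x, K (y - x) * (a y - a x) * g x := by
  have h2 : Integrable fun x => K (y - x) * (a x * g x) :=
    (h.bdd_mul (c := Λ) ham.aestronglyMeasurable
      (ae_of_all _ fun x => by simpa using hab x)).congr (ae_of_all _ fun x => by simp only; ring)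
  rw [commConv, conv, conv, ← integral_const_mul, ← integral_sub (h.const_mul _) h2]
  exact integral_congr_all fun x => by ring

lemma integral_commConv_mul [HolderConjugate P Q] (hP : 1 ≤ P)
    (hPt : P ≠ ∞) (hQ : 1 ≤ Q) (hQt : Q ≠ ∞) {K a : Vec n → ℝ} (hK : Integrable K)
    (hKe : ∀ x, K (-x) = K x) (ham : Measurable a) (hab : ∀ x, |a x| ≤ Λ) (hf : MemLp f P)
    (hg : MemLp g Q) : ∫ x, commConv K a f x * g x = -∫ y, f y * commConv K a g y := by
  have haf := memLp_mul_bdd ham hab hf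
  have hag := memLp_mul_bdd ham hab hg
  have i1 := integrable_mul_of_memLp (MemLp.conv hK hP hPt hf) hag
  have i2 := integrable_mul_of_memLp (MemLp.conv hK hP hPt haf) hg
  have i3 := integrable_mul_of_memLp hf (MemLp.conv hK hQ hQt hag)
  have i4 := integrable_mul_of_memLp haf (MemLp.conv hK hQ hQt hg)
  calc _ = ∫ x, (conv K f x * (a x * g x) - conv K (fun x => a x * f x) x * g x) := by
        refine integral_congr_all fun x => ?_
        simp only [commConv]; ring
    _ = (∫ x, f x * conv K (fun x => a x * g x) x) - ∫ x, a x * f x * conv K g x := by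
        rw [integral_sub i1 i2, integral_conv_mul_of_even hK hKe hf hag,
          integral_conv_mul_of_even hK hKe haf hg]
    _ = _ := by
        rw [← integral_sub i3 i4, ← integral_neg]
        refine integral_congr_all fun x => ?_
        simp only [commConv]; ring

section Estimate

variable {a w E : Vec n → ℝ} {α ε L : ℝ}

variable {c : ℝ} (hC : 0 < C)
  (hC' : ∀ t σ : ℝ, 0 < t → 0 < σ → ∀ (i j : Fin n) (x z : Vec n),
    |∫ y, heatHess i j t (x - y) * (a y - a x) * heatLap σ (y - z)| ≤ C * commMajorant α t σ (x - z))
  (ham : Measurable a) (hab : ∀ x, |a x| ≤ Λ) (hb : 0 < b) (hbc : b ≤ c) (hσ : 0 < σ) (i j : Fin n)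

include hab in
lemma abs_sub_le_of_abs_le (x y : Vec n) : |a y - a x| ≤ 2 * Λ :=
  (abs_sub _ _).trans (by linarith [hab y, hab x])

include hC hC' ham hab hb hbc hσ

/-- The kernel of `[R ⊗ R, a]` composed with `Δp_σ` is bounded by `commMajorant` integrated over the
scales `t`, uniformly in the truncation. -/
lemma enorm_commKernel_le (x z : Vec n) :
    ‖∫ y, hessKernel i j b c (x - y) * (a y - a x) * heatLap σ (y - z)‖ₑ ≤
      ofReal C * ∫⁻ t in Ioi 0, ofReal (commMajorant α t σ (x - z)) := by
  obtain ⟨C₁, hC₁, h₁⟩ := exists_abs_heatHess_le (b := c) hb n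
  set μ := (volume : Measure ℝ).restrict (Ioc b c)
  have hc := hb.trans_le hbc
  have hLi : Integrable fun y => heatLap σ (y - z) := (integrable_heatLap hσ).comp_sub_right z
  set D := C₁ * (4 * π * (2 * c)) ^ (-(n : ℝ) / 2) * (2 * Λ) with hD
  have hdom : Integrable (fun q : Vec n × ℝ => D * heatLap σ (q.1 - z) * 1) (volume.prod μ) :=
    (hLi.const_mul D).mul_prod (integrable_const (1 : ℝ))
  have hint : Integrable (fun q : Vec n × ℝ =>
      heatHess i j q.2 (x - q.1) * (a q.1 - a x) * heatLap σ (q.1 - z)) (volume.prod μ) := by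
    refine hdom.mono ?_ ?_
    · have h2 : Measurable (fun q : Vec n × ℝ => (q.2, x - q.1)) := by fun_prop
      have h3 := (measurable_heatHess_uncurry i j).comp h2
      have h4 : Measurable fun q : Vec n × ℝ => heatLap σ (q.1 - z) :=
        (continuous_heatLap σ).measurable.comp (measurable_fst.sub_const z)
      exact ((h3.mul ((ham.comp measurable_fst).sub_const (a x))).mul h4).aestronglyMeasurable
    · have h3 : ∀ᵐ w ∂((volume : Measure (Vec n)).prod μ), w.2 ∈ Ioc b c :=
        Measure.quasiMeasurePreserving_snd.ae (ae_restrict_mem measurableSet_Ioc)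
      filter_upwards [h3] with q hq
      have e1 := h₁ q.2 hq.1.le hq.2 i j (x - q.1)
      have e2 := heat_le_const (n := n) (t := 2 * c) (by positivity) (x - q.1)
      have e3 := abs_sub_le_of_abs_le hab x q.1
      have e4 : 0 ≤ 2 * Λ := (abs_nonneg _).trans e3
      rw [mul_one, norm_mul, norm_mul, norm_mul, norm_of_nonneg (show 0 ≤ D by positivity)]
      refine mul_le_mul_of_nonneg_right ?_ (norm_nonneg _)
      refine mul_le_mul (e1.trans ?_) e3 (norm_nonneg _) (by positivity)
      gcongr
  have e : ∫ y, hessKernel i j b c (x - y) * (a y - a x) * heatLap σ (y - z) =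
      ∫ t, (∫ y, heatHess i j t (x - y) * (a y - a x) * heatLap σ (y - z)) ∂μ := by
    rw [← integral_integral_swap hint]
    refine integral_congr_all fun y => ?_
    simp only [hessKernel, mul_assoc]; rw [integral_mul_const]
  rw [e, ← lintegral_const_mul' _ _ ofReal_ne_top]
  refine (enorm_integral_le_lintegral_enorm _).trans ?_
  calc _ ≤ ∫⁻ t in Ioc b c, ofReal C * ofReal (commMajorant α t σ (x - z)) := by
        refine setLIntegral_mono' measurableSet_Ioc fun t ht => ?_
        rw [← ofReal_mul hC.le, ← ofReal_norm]
        exact ofReal_le_ofReal (hC' t σ (hb.trans ht.1) hσ i j x z)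
    _ ≤ _ := lintegral_mono_set fun t ht => hb.trans ht.1

lemma enorm_integral_heatLap_commConv_le
    (hn : 0 < n) (hα1 : α ≤ 1) (hε : 0 < ε)
    (hQ : 1 ≤ Q) (hQt : Q ≠ ∞) (hE : MemLp E Q) (hw : AEStronglyMeasurable w)
    (hfin : ∫⁻ q : Vec n × Vec n, ofReal (‖q.1 - q.2‖ ^ (α - ε - n)) * (‖w q.2‖ₑ * ‖E q.1‖ₑ) < ∞) :
    ‖∫ y, conv (heatLap σ) w y * commConv (hessKernel i j b c) a E y‖ₑ ≤
      ∫⁻ q : Vec n × Vec n, ofReal C * (∫⁻ t in Ioi 0, ofReal (commMajorant α t σ (q.1 - q.2))) *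
          (‖w q.2‖ₑ * ‖E q.1‖ₑ) := by
  have hn1 : (1 : ℝ) ≤ n := by exact_mod_cast hn
  have hc := hb.trans_le hbc
  set K := hessKernel i j b c with hKdef
  have hK := integrable_hessKernel (b := c) hb i j
  have hKm := measurable_hessKernel i j b c
  obtain ⟨C₁, hC₁, h₁⟩ := exists_abs_hessKernel_le hb hbc n
  obtain ⟨C₂, hC₂, h₂⟩ := abs_heatLap_le n
  obtain ⟨C₃, hC₃, h₃⟩ := exists_heat_le_rpow n (β := -(α - ε) / 2) (by linarith)
  set Θ : Vec n × (Vec n × Vec n) → ℝ := fun q =>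
    K (q.1 - q.2.1) * (a q.1 - a q.2.1) * E q.2.1 * (heatLap σ (q.1 - q.2.2) * w q.2.2) with hΘ
  have hΛ : 0 ≤ Λ := (abs_nonneg _).trans (hab 0)
  have hΘm : AEStronglyMeasurable Θ (volume.prod (volume.prod volume)) := by
    have m1 : Measurable fun q : Vec n × (Vec n × Vec n) =>
        K (q.1 - q.2.1) * (a q.1 - a q.2.1) := (hKm.comp (by fun_prop)).mul
      ((ham.comp measurable_fst).sub (ham.comp (measurable_fst.comp measurable_snd)))
    have m3 : Measurable fun q : Vec n × (Vec n × Vec n) => heatLap σ (q.1 - q.2.2) :=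
      (continuous_heatLap σ).measurable.comp (by fun_prop)
    exact (m1.aestronglyMeasurable.mul (hE.1.comp_fst (ν := volume)).comp_snd).mul
      (m3.aestronglyMeasurable.mul hw.comp_snd.comp_snd)
  set D := C₁ * (2 * Λ) * (C₂ * σ⁻¹) with hD
  have hD0 : 0 ≤ D := by positivity
  -- the triple integral is absolutely convergent since `p_τ ≤ c |x|^{α-ε-n}` for a fixed `τ`
  have hptw : ∀ q : Vec n × Vec n, q.1 - q.2 ≠ 0 → ∫⁻ y, ‖Θ (y, q)‖ₑ ≤
      ofReal (D * (C₃ * (2 * c + 2 * σ) ^ (-(α - ε) / 2))) *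
      (ofReal (‖q.1 - q.2‖ ^ (α - ε - n)) * (‖w q.2‖ₑ * ‖E q.1‖ₑ)) := by
    intro q hq
    have hh := integrable_heat_mul_heat (by positivity : 0 < 2 * c) (by positivity : 0 < 2 * σ)
      q.1 q.2
    calc ∫⁻ y, ‖Θ (y, q)‖ₑ ≤ ∫⁻ y, ofReal (heat (2 * c) (q.1 - y) *
          heat (2 * σ) (y - q.2)) * (ofReal D * (‖w q.2‖ₑ * ‖E q.1‖ₑ)) := by
          refine lintegral_mono fun y => ?_
          have e1 := h₁ i j (y - q.1)
          have e3 := abs_sub_le_of_abs_le hab q.1 y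
          have e4 := h₂ σ hσ (y - q.2)
          have p1 := heat_pos (by positivity : 0 < 2 * c) (q.1 - y)
          have p2 := heat_pos (by positivity : 0 < 2 * σ) (y - q.2)
          rw [heat_sub_comm] at e1; simp only [hΘ, enorm_mul]
          calc _ = ‖K (y - q.1) * (a y - a q.1) * heatLap σ (y - q.2)‖ₑ *
                (‖w q.2‖ₑ * ‖E q.1‖ₑ) := by simp only [enorm_mul]; ring
            _ ≤ ofReal ((C₁ * heat (2 * c) (q.1 - y)) * (2 * Λ) *
                (C₂ * σ⁻¹ * heat (2 * σ) (y - q.2))) * (‖w q.2‖ₑ * ‖E q.1‖ₑ) := by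
                gcongr; rw [← ofReal_norm]
                refine ofReal_le_ofReal ?_
                rw [norm_mul, norm_mul]
                exact mul_le_mul (mul_le_mul e1 e3 (norm_nonneg _) (by positivity)) e4
                  (norm_nonneg _) (by positivity)
            _ = _ := by
                rw [← mul_assoc _ (ofReal D), ← ofReal_mul (by positivity)]
                congr 2
                rw [hD]; ring
      _ = ofReal (heat (2 * c + 2 * σ) (q.1 - q.2)) * (ofReal D * (‖w q.2‖ₑ * ‖E q.1‖ₑ)) := by
          rw [lintegral_mul_const' _ _ (by finiteness),
            ← ofReal_integral_eq_lintegral_ofReal hh (ae_of_all _ fun y =>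
              mul_nonneg (heat_pos (by positivity) _).le (heat_pos (by positivity) _).le),
            integral_heat_shift (by positivity) (by positivity)]
      _ ≤ ofReal (C₃ * (2 * c + 2 * σ) ^ (-(α - ε) / 2) * ‖q.1 - q.2‖ ^ (α - ε - n)) *
          (ofReal D * (‖w q.2‖ₑ * ‖E q.1‖ₑ)) := by
          gcongr
          refine (h₃ _ (by positivity) _ hq).trans (le_of_eq ?_)
          congr 2
          ring
      _ = _ := by
          rw [← mul_assoc, ← mul_assoc (ofReal _) (ofReal _),
            ← ofReal_mul (by positivity), ← ofReal_mul (by positivity)]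
          congr 2
          ring
  have hne : ∀ᵐ q : Vec n × Vec n ∂(volume.prod volume), q.1 - q.2 ≠ 0 :=
    (quasiMeasurePreserving_sub (volume : Measure (Vec n)) volume).ae (ae_ne_zero hn)
  have hint : Integrable Θ (volume.prod (volume.prod volume)) := by
    refine ⟨hΘm, ?_⟩
    rw [HasFiniteIntegral, lintegral_prod_symm _ hΘm.enorm]
    refine (lintegral_mono_ae (hne.mono hptw)).trans_lt ?_
    rw [lintegral_const_mul' _ _ ofReal_ne_top]
    exact mul_lt_top ENNReal.ofReal_lt_top hfin
  have e1 : ∫ y, conv (heatLap σ) w y * commConv K a E y = ∫ y, (∫ q : Vec n × Vec n, Θ (y, q)) := by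
    refine integral_congr_ae ?_
    filter_upwards [ae_integrable_conv hK hQ hQt hE] with y hy
    rw [commConv_eq_integral ham hab hy, mul_comm, conv]
    exact (integral_prod_mul (fun x => K (y - x) * (a y - a x) * E x)
      (fun z => heatLap σ (y - z) * w z)).symm
  rw [e1, show ∫ y, (∫ q : Vec n × Vec n, Θ (y, q)) = ∫ q : Vec n × Vec n, ∫ y, Θ (y, q) from
    integral_integral_swap (f := fun y q => Θ (y, q)) hint]
  refine (enorm_integral_le_lintegral_enorm _).trans (lintegral_mono fun q => ?_)
  have e3 : ∫ y, Θ (y, q) = (∫ y, K (q.1 - y) * (a y - a q.1) * heatLap σ (y - q.2)) *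
      (w q.2 * E q.1) := by
    rw [← integral_mul_const]
    refine integral_congr_all fun y => ?_
    simp only [hΘ]; rw [← neg_sub q.1 y, hKdef, hessKernel_neg]; ring
  rw [e3, enorm_mul, enorm_mul]; gcongr
  exact enorm_commKernel_le hC hC' ham hab hb hbc hσ i j q.1 q.2

end Estimate

end

section

/-! ### Integration over the scales -/

lemma measurable_commMajorant (α : ℝ) :
    Measurable fun q : ℝ × ℝ × Vec n => commMajorant α q.1 q.2.1 q.2.2 := by
  have h : Measurable fun q : ℝ × ℝ × Vec n =>
      min q.1 q.2.1 ^ (α / 2 - 1) * (max q.1 q.2.1)⁻¹ := by fun_prop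
  have h' : Measurable fun q : ℝ × ℝ × Vec n => (8 * max q.1 q.2.1, q.2.2) := by fun_prop
  exact h.mul (measurable_heat_uncurry.comp h')

/-- The commutator estimate for truncated kernels: if `F = (-Δ)^{s/2} f` and
`w = (-Δ)^{(s-ε)/2} f`, then `ε` derivatives can be moved from `F` to the kernel. This rests on
`e^{δΔ} F = Γ(1-ε/2)⁻¹ ∫₀^∞ τ^{-ε/2} (-Δ) e^{(δ+τ)Δ} w dτ`; the bound is uniform in `δ` and in the
truncation. -/
theorem exists_enorm_integral_commConv_le (hn : 0 < n) {α ε : ℝ} (hs0 : 0 < s) (hs2 : s < 2)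
    (hε : 0 < ε) (hεα : ε < α) (hα1 : α ≤ 1) : ∃ C : ℝ, 0 < C ∧
    ∀ (L Λ : ℝ) (a : Vec n → ℝ), 0 < L → Measurable a → (∀ x, |a x| ≤ Λ) →
      (∀ x y, |a x - a y| ≤ L * ‖x - y‖ ^ α) →
    ∀ (P Q : ℝ≥0∞) [HolderConjugate P Q], 1 < P → P ≠ ∞ →
    ∀ f F w E : Vec n → ℝ, MemLp f P → MemLp F P → MemLp E Q → AEStronglyMeasurable w →
      (∀ δ, 0 < δ → ∀ x, conv (heat δ) F x = conv (fracHeat s δ) f x) →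
      (∀ σ, 0 < σ → ∀ x, -conv (heatLap σ) w x = conv (fracHeat (s + 2 - ε) σ) f x) →
    ∀ (b c : ℝ), 0 < b → b ≤ c → ∀ i j : Fin n,
      ‖∫ y, F y * commConv (hessKernel i j b c) a E y‖ₑ ≤ ofReal (C * L) * ∫⁻ q : Vec n × Vec n,
          ofReal (‖q.1 - q.2‖ ^ (α - ε - n)) * (‖w q.2‖ₑ * ‖E q.1‖ₑ) := by
  have hα0 := hε.trans hεα
  obtain ⟨C₁, hC₁, h₁⟩ := exists_abs_commKernel_le hn hα0 hα1
  obtain ⟨C₂, hC₂, h₂⟩ := exists_lintegral_lintegral_commMajorant_le hn hε hεα hα1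
  obtain ⟨C₃, hC₃, h₃⟩ := exists_integral_rpow_mul_rpow_le (a := ε / 2) (b := (s + 2 - ε) / 2)
    (by linarith) (by linarith) (by linarith)
  have hΓ : 0 < Gamma (1 - ε / 2) := Real.Gamma_pos_of_pos (by linarith)
  set γ := Gamma (1 - ε / 2) with hγ
  refine ⟨γ⁻¹ * (C₁ * C₂), by positivity, fun L Λ a hL ham hab ha P Q _ hP hPt f F w E hf hF hE hw
    hFf hwf b c hb hbc i j => ?_⟩
  set I₀ := ∫⁻ q : Vec n × Vec n,
    ofReal (‖q.1 - q.2‖ ^ (α - ε - n)) * (‖w q.2‖ₑ * ‖E q.1‖ₑ) with hI₀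
  rcases eq_or_ne I₀ ∞ with htop | hfin
  · rw [htop, ENNReal.mul_top (by simpa using by positivity)]
    exact le_top
  have hfin := hfin.lt_top
  have hQ : 1 < Q := one_lt_conj (P := P) hPt
  have : HolderConjugate Q P := .symm
  have hQt : Q ≠ ∞ := lt_top_of_one_lt_conj (P := Q) (Q := P) hP
  set K := hessKernel i j b c
  have hK := integrable_hessKernel (b := c) hb i j
  set S := commConv K a E
  have hS : MemLp S Q := memLp_commConv hQ.le hQt hK ham hab hE
  have hδ : ∀ δ : ℝ, 0 < δ → ‖∫ y, conv (heat δ) F y * S y‖ₑ ≤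
      ofReal (γ⁻¹ * (C₁ * C₂) * L) * I₀ := by
    intro δ hδ
    set μ := (volume : Measure ℝ).restrict (Ioi 0)
    have hpos : ∀ᵐ t ∂μ, 0 < t := ae_restrict_mem measurableSet_Ioi
    obtain ⟨hkm, hk⟩ := integrable_mul_fracHeat_param (n := n) hn (r := s + 2 - ε) (by linarith)
      (by linarith) (μ := μ) (ω := fun τ => τ ^ (-(ε / 2))) (θ := fun τ => δ + τ) (by fun_prop)
      (by fun_prop) (hpos.mono fun t ht => by positivity) (h₃ δ hδ).1
    have e1 : conv (heat δ) F = fun x => γ⁻¹ *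
        conv (fun x => ∫ τ, τ ^ (-(ε / 2)) * fracHeat (s + 2 - ε) (δ + τ) x ∂μ) f x := by
      funext x
      have e2 : ∀ x : Vec n, ∫ τ, τ ^ (-(ε / 2)) * fracHeat (s + 2 - ε) (δ + τ) x ∂μ =
          γ * fracHeat s δ x := fun x =>
        (integral_rpow_mul_fracHeat hn (by linarith [n.cast_nonneg (α := ℝ)]) (by linarith) hδ x).2
      rw [hFf δ hδ x]; simp only [e2, conv, mul_assoc]
      rw [integral_const_mul, inv_mul_cancel_left₀ hΓ.ne']
    have e3 : ∫ y, conv (heat δ) F y * S y = γ⁻¹ * ∫ τ, (∫ y,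
        conv (fun x => τ ^ (-(ε / 2)) * fracHeat (s + 2 - ε) (δ + τ) x) f y * S y) ∂μ := by
      rw [← integral_conv_param_mul hkm hk hf hS, e1, ← integral_const_mul]; simp only [mul_assoc]
    have e4 : ∀ τ : ℝ, 0 < τ →
        ∫ y, conv (fun x => τ ^ (-(ε / 2)) * fracHeat (s + 2 - ε) (δ + τ) x) f y * S y =
        -(τ ^ (-(ε / 2)) * ∫ y, conv (heatLap (δ + τ)) w y * S y) := fun τ hτ => by
      rw [← integral_const_mul, ← integral_neg]
      refine integral_congr_all fun y => ?_
      have e5 : conv (fun x => τ ^ (-(ε / 2)) * fracHeat (s + 2 - ε) (δ + τ) x) f y =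
          τ ^ (-(ε / 2)) * conv (fracHeat (s + 2 - ε) (δ + τ)) f y := by
        simp only [conv, mul_assoc]; rw [integral_const_mul]
      rw [e5, ← hwf (δ + τ) (by positivity) y]; ring
    have mM : Measurable fun q : ℝ × (Vec n × Vec n) =>
        ∫⁻ t in Ioi 0, ofReal (commMajorant α t (δ + q.1) (q.2.1 - q.2.2)) := by
      have m : Measurable fun p : (ℝ × (Vec n × Vec n)) × ℝ =>
          (p.2, δ + p.1.1, p.1.2.1 - p.1.2.2) := by fun_prop
      exact ((measurable_commMajorant α).comp m).ennreal_ofReal.lintegral_prod_right' (ν := μ)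
    have mwE : AEMeasurable (fun q : Vec n × Vec n => ‖w q.2‖ₑ * ‖E q.1‖ₑ)
        (volume.prod volume) := hw.comp_snd.enorm.mul hE.1.comp_fst.enorm
    have hne : ∀ᵐ q : Vec n × Vec n ∂(volume.prod volume), q.1 - q.2 ≠ 0 :=
      (quasiMeasurePreserving_sub (volume : Measure (Vec n)) volume).ae (ae_ne_zero hn)
    rw [e3, enorm_mul, Real.enorm_of_nonneg (by positivity)]
    calc _ ≤ ofReal γ⁻¹ * ∫⁻ τ, (∫⁻ q : Vec n × Vec n, ofReal (τ ^ (-(ε / 2))) *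
          (ofReal (C₁ * L) *
          (∫⁻ t in Ioi 0, ofReal (commMajorant α t (δ + τ) (q.1 - q.2))) *
            (‖w q.2‖ₑ * ‖E q.1‖ₑ))) ∂μ := by
          gcongr
          refine (enorm_integral_le_lintegral_enorm _).trans (lintegral_mono_ae ?_)
          filter_upwards [hpos] with τ hτ
          rw [e4 τ hτ, enorm_neg, enorm_mul, Real.enorm_of_nonneg (by positivity),
            lintegral_const_mul' _ _ ofReal_ne_top]
          gcongr
          exact enorm_integral_heatLap_commConv_le (by positivity) (h₁ L a hL.le ham ha) ham hab hb
            hbc (by positivity) i j hn hα1 hε hQ.le hQt hE hw hfin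
      _ = ofReal γ⁻¹ * ∫⁻ q : Vec n × Vec n, ofReal (C₁ * L) *
          ((∫⁻ τ, (ofReal (τ ^ (-(ε / 2))) * ∫⁻ t in Ioi 0,
            ofReal (commMajorant α t (δ + τ) (q.1 - q.2))) ∂μ) * (‖w q.2‖ₑ * ‖E q.1‖ₑ)) := by
          have mτ : Measurable fun q : ℝ × (Vec n × Vec n) =>
              ofReal (q.1 ^ (-(ε / 2))) := by fun_prop
          rw [lintegral_lintegral_swap]
          · congr 1
            refine lintegral_congr fun q => ?_
            have m3 : Measurable fun τ : ℝ => ofReal (τ ^ (-(ε / 2))) *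
                ∫⁻ t in Ioi 0, ofReal (commMajorant α t (δ + τ) (q.1 - q.2)) :=
              (mτ.mul mM).comp (measurable_prodMk_right (y := q))
            rw [← lintegral_mul_const _ m3, ← lintegral_const_mul _ (m3.mul_const _)]
            refine lintegral_congr fun τ => ?_
            ring
          · exact mτ.aemeasurable.mul ((mM.const_mul _).aemeasurable.mul mwE.comp_snd)
      _ ≤ ofReal γ⁻¹ * ∫⁻ q : Vec n × Vec n, ofReal (C₁ * L) *
          (ofReal (C₂ * ‖q.1 - q.2‖ ^ (α - ε - n)) * (‖w q.2‖ₑ * ‖E q.1‖ₑ)) := by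
          refine mul_le_mul_right (lintegral_mono_ae (hne.mono fun q hq => ?_)) _
          gcongr
          exact h₂ δ hδ _ hq
      _ = _ := by
          rw [← lintegral_const_mul' _ _ ofReal_ne_top, hI₀,
            ← lintegral_const_mul' _ _ ofReal_ne_top]
          refine lintegral_congr fun q => ?_
          rw [ofReal_mul hC₂.le, show γ⁻¹ * (C₁ * C₂) * L = γ⁻¹ * (C₁ * L * C₂) by ring,
            ofReal_mul (by positivity : 0 ≤ γ⁻¹), ofReal_mul (q := C₂) (by positivity)]
          ring
  have hlim : Tendsto (fun k : ℕ => ∫ y, conv (heat (1 / ((k : ℝ) + 1))) F y * S y) atTop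
      (𝓝 (∫ y, F y * S y)) := by
    refine tendsto_integral_mul_of_eLpNorm (p := P) (q := Q)
      (fun k => MemLp.conv (integrable_heat (trunc_pos k)) hP.le hPt hF) hF hS ?_
    refine (tendsto_conv_heat hP.le hPt hF).comp ?_
    exact tendsto_nhdsWithin_iff.2 ⟨tendsto_one_div_add_atTop_nhds_zero_nat,
      Eventually.of_forall fun k => trunc_pos k⟩
  exact le_of_tendsto ((continuous_enorm.tendsto _).comp hlim)
    (Eventually.of_forall fun k => hδ _ (trunc_pos k))

end

section

/-! ### The form `𝓓₂` -/

lemma tendsto_mul_norm_sub_rpow {β : ℝ} (hβ : 0 < β) (L : ℝ) (x : Vec n) :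
    Tendsto (fun y => L * ‖y - x‖ ^ β) (𝓝 x) (𝓝 0) := by
  have h : Continuous fun y : Vec n => ‖y - x‖ := by fun_prop
  simpa [Real.zero_rpow hβ.ne'] using
    (continuous_const.mul (h.rpow_const fun _ => .inr hβ.le)).tendsto' (f := fun y => L * _) x _ rfl

/-- The derivative of a function that is Hölder continuous of exponent `α > 1` vanishes. -/
lemma eq_of_holder_one_lt {a : Vec n → ℝ} {L α : ℝ} (hα : 1 < α)
    (ha : ∀ x y, |a x - a y| ≤ L * ‖x - y‖ ^ α) (x y : Vec n) : a x = a y := by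
  have h : ∀ x, HasFDerivAt a (0 : Vec n →L[ℝ] ℝ) x := fun x => by
    refine hasFDerivAt_iff_tendsto.2 (squeeze_zero (fun _ => by positivity) (fun y => ?_)
      (tendsto_mul_norm_sub_rpow (sub_pos.2 hα) L x))
    rcases (norm_nonneg (y - x)).eq_or_lt with h | h
    · simp [← h, Real.zero_rpow (sub_pos.2 hα).ne']
    · rw [Real.rpow_sub_one h.ne', inv_mul_le_iff₀ h, mul_div_assoc', mul_div_cancel₀ _ h.ne']
      simpa using ha y x
  exact is_const_of_fderiv_eq_zero (fun x => (h x).differentiableAt) (fun x => (h x).fderiv) x y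

lemma IsCoefficient.diag_holder {α : ℝ} (hA : IsCoefficient α Λ A)
    (x y : Vec n) : |A x x - A y y| ≤ 2 * Λ * ‖x - y‖ ^ α := by
  have h1 := hA.holder x x y
  have h2 := hA.holder y x y
  rw [hA.symm y x] at h2
  have := abs_sub_le (A x x) (A x y) (A y y)
  linarith

lemma continuous_of_holder {a : Vec n → ℝ} {L α : ℝ} (hα : 0 < α)
    (ha : ∀ x y, |a x - a y| ≤ L * ‖x - y‖ ^ α) : Continuous a := by
  refine continuous_iff_continuousAt.2 fun x => tendsto_iff_norm_sub_tendsto_zero.2 ?_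
  exact squeeze_zero (fun _ => norm_nonneg _) (fun y => ha y x) (tendsto_mul_norm_sub_rpow hα L x)

lemma IsCoefficient.measurable_diag {α : ℝ} (hα : 0 < α)
    (hA : IsCoefficient α Λ A) : Measurable fun x => A x x :=
  (continuous_of_holder hα hA.diag_holder).measurable

lemma IsCoefficient.measurable {α : ℝ} (hα : 0 < α)
    (hA : IsCoefficient α Λ A) : Measurable fun q : Vec n × Vec n => A q.1 q.2 :=
  measurable_uncurry_of_continuous_of_measurable
    (fun y => continuous_of_holder (L := Λ) hα fun x x' => by
      rw [hA.symm x, hA.symm x']; exact hA.holder y x x')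
    fun x => (continuous_of_holder hα (hA.holder x)).measurable

lemma memLp_smul_bdd {a : Vec n → ℝ} (ham : Measurable a)
    (hab : ∀ x, |a x| ≤ Λ) (hU : MemLp U P) : MemLp (fun z => a z • U z) P :=
  MemLp.of_eval_piLp fun i => by simpa using memLp_mul_bdd ham hab (hU.eval_piLp i)

lemma inner_eq_sum (x y : Vec n) : inner ℝ x y = ∑ i, x i * y i := by
  rw [PiLp.inner_apply]
  exact sum_congr rfl fun i _ => by simp [mul_comm]

section

variable [HolderConjugate P Q] {a : Vec n → ℝ}

lemma integrable_inner_of_memLp (hU : MemLp U P) (hV : MemLp V Q) :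
    Integrable fun z => inner ℝ (U z) (V z) := by
  simp only [inner_eq_sum]
  exact integrable_finsetSum _ fun i _ => integrable_mul_of_memLp (hU.eval_piLp i) (hV.eval_piLp i)

/-- `𝓓₂` is the limit of the forms of the commutators with the truncated Riesz transforms. -/
lemma tendsto_sum_integral_commConv (hn : 0 < n) (hP : 1 < P) (hPt : P ≠ ∞)
    (ham : Measurable a) (hab : ∀ x, |a x| ≤ Λ) (hU : MemLp U P)
    (hV : MemLp V Q) (hG : IsRieszRiesz P U G) (hH : IsRieszRiesz P (fun z => a z • U z) H) :
    Tendsto (fun k : ℕ => ∑ i, ∑ j, ∫ x,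
        commConv (hessKernel i j (1 / ((k : ℝ) + 1)) (k + 1)) a (fun y => U y j) x * V x i)
      atTop (𝓝 (-∫ z, inner ℝ (H z - a z • G z) (V z))) := by
  have haU := memLp_smul_bdd ham hab hU
  have hUj : ∀ j, MemLp (fun x => U x j) P := fun j => hU.eval_piLp j
  have haUj : ∀ j, MemLp (fun x => a x * U x j) P := fun j => by simpa using haU.eval_piLp j
  have hVi : ∀ i, MemLp (fun x => V x i) Q := fun i => hV.eval_piLp i
  have haVi : ∀ i, MemLp (fun x => a x * V x i) Q := fun i => memLp_mul_bdd ham hab (hVi i)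
  have hT : ∀ {f : Vec n → ℝ}, MemLp f P → ∀ i j k, MemLp (rieszTrunc i j k f) P :=
    fun hf i j k => memLp_rieszTrunc hP.le hPt hf i j k
  have hi : ∀ i, Tendsto (fun k : ℕ => ∑ j, ∫ x,
      commConv (hessKernel i j (1 / ((k : ℝ) + 1)) (k + 1)) a (fun y => U y j) x * V x i)
      atTop (𝓝 (∫ z, (a z * G z i - H z i) * V z i)) := by
    intro i
    have t1 := tendsto_integral_mul_of_eLpNorm (F := fun k x => ∑ j,
      rieszTrunc i j k (fun y => U y j) x) (fun k => memLp_finsetSum _ fun j _ => hT (hUj j) i j k)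
      (hG.1.eval_piLp i) (haVi i) (hG.tendsto hn hP hPt hU i)
    have t2 := tendsto_integral_mul_of_eLpNorm (F := fun k x => ∑ j,
      rieszTrunc i j k (fun y => (a y • U y) j) x)
      (fun k => memLp_finsetSum _ fun j _ => hT (haU.eval_piLp j) i j k)
      (hH.1.eval_piLp i) (hVi i) (hH.tendsto hn hP hPt haU i)
    have e : ∫ z, (a z * G z i - H z i) * V z i =
        (∫ z, G z i * (a z * V z i)) - ∫ z, H z i * V z i := by
      rw [← integral_sub (integrable_mul_of_memLp (hG.1.eval_piLp i) (haVi i))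
        (integrable_mul_of_memLp (hH.1.eval_piLp i) (hVi i))]
      exact integral_congr_all fun z => by ring
    rw [e]
    refine (t1.sub t2).congr fun k => ?_
    have i3 : ∀ j, Integrable fun x => rieszTrunc i j k (fun y => U y j) x * (a x * V x i) :=
      fun j => integrable_mul_of_memLp (hT (hUj j) i j k) (haVi i)
    have i4 : ∀ j, Integrable fun x => rieszTrunc i j k (fun y => a y * U y j) x * V x i :=
      fun j => integrable_mul_of_memLp (hT (haUj j) i j k) (hVi i)
    simp only [sum_mul, PiLp.smul_apply, smul_eq_mul]
    rw [integral_finsetSum _ fun j _ => i3 j, integral_finsetSum _ fun j _ => i4 j,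
      ← Finset.sum_sub_distrib]
    refine sum_congr rfl fun j _ => ?_
    rw [← integral_sub (i3 j) (i4 j)]
    refine integral_congr_all fun z => ?_
    simp only [commConv, rieszTrunc]; ring
  have e : -∫ z, inner ℝ (H z - a z • G z) (V z) = ∑ i, ∫ z, (a z * G z i - H z i) * V z i := by
    rw [← integral_neg, ← integral_finsetSum]
    · refine integral_congr_all fun z => ?_
      simp only [inner_eq_sum, PiLp.sub_apply, PiLp.smul_apply, smul_eq_mul]
      rw [← Finset.sum_neg_distrib]
      exact sum_congr rfl fun i _ => by ring
    · exact fun i _ => integrable_mul_of_memLp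
        ((memLp_mul_bdd ham hab (hG.1.eval_piLp i)).sub (hH.1.eval_piLp i)) (hVi i)
  rw [e]
  exact tendsto_finsetSum _ fun i _ => hi i

lemma enorm_integral_D2_le (hn : 0 < n) (hP : 1 < P) (hPt : P ≠ ∞)
    (ham : Measurable a) (hab : ∀ x, |a x| ≤ Λ) (hU : MemLp U P)
    (hV : MemLp V Q) (hG : IsRieszRiesz P U G) (hH : IsRieszRiesz P (fun z => a z • U z) H)
    {B : ℝ≥0∞} (hB : ∀ (b c : ℝ), 0 < b → b ≤ c → ∀ i j : Fin n,
      ‖∫ x, commConv (hessKernel i j b c) a (fun y => U y j) x * V x i‖ₑ ≤ B) :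
    ofReal |∫ z, inner ℝ (H z - a z • G z) (V z)| ≤ (n : ℝ≥0∞) ^ 2 * B := by
  have h := tendsto_sum_integral_commConv hn hP hPt ham hab hU hV hG hH
  rw [← norm_eq_abs, ofReal_norm, ← enorm_neg]
  refine le_of_tendsto ((continuous_enorm.tendsto _).comp h) (Eventually.of_forall fun k => ?_)
  refine (enorm_sum_le _ _).trans ?_
  calc _ ≤ ∑ i : Fin n, ∑ j : Fin n, B := Finset.sum_le_sum fun i _ =>
        (enorm_sum_le _ _).trans (Finset.sum_le_sum fun j _ => hB _ _ (trunc_pos k) (trunc_le k) i j)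
    _ = _ := by
        simp only [Finset.sum_const, Finset.card_univ, Fintype.card_fin, nsmul_eq_mul]; ring

end

lemma commConv_const (K : Vec n → ℝ) (c : ℝ) (f : Vec n → ℝ) (x : Vec n) :
    commConv K (fun _ => c) f x = 0 := by
  simp only [commConv, conv, mul_left_comm _ c]; rw [integral_const_mul, sub_self]

lemma rieszConst_pos (hσ : 0 < σ) (hσn : σ < n) : 0 < rieszConst n σ := by
  have h1 := Real.Gamma_pos_of_pos (by linarith : 0 < ((n : ℝ) - σ) / 2)
  have h2 := Real.Gamma_pos_of_pos (by linarith : 0 < σ / 2)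
  unfold rieszConst; positivity

lemma enorm_coord_le (x : Vec n) (i : Fin n) : ‖x i‖ₑ ≤ ‖x‖ₑ := by
  rw [← ofReal_norm, ← ofReal_norm]
  exact ofReal_le_ofReal (abs_coord_le_norm x i)

lemma lintegral_coord_le_rieszPotential {κ : ℝ} (hκ : 0 < κ) (hκn : κ < n) (f h : Vec n → Vec n)
    (i j : Fin n) : ∫⁻ q : Vec n × Vec n,
        ofReal (‖q.1 - q.2‖ ^ (κ - n)) * (‖f q.2 j‖ₑ * ‖h q.1 i‖ₑ) ≤
      ofReal (rieszConst n κ)⁻¹ * ∫⁻ z, rieszPotential κ f z * ‖h z‖ₑ := by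
  have hc := rieszConst_pos hκ hκn
  rw [← lintegral_const_mul' _ _ ofReal_ne_top]
  refine (lintegral_prod_le _).trans (lintegral_mono fun x => ?_)
  rw [rieszPotential, ← mul_assoc, ← mul_assoc, ← ofReal_mul (by positivity),
    inv_mul_cancel₀ hc.ne', ENNReal.ofReal_one, one_mul, ← lintegral_mul_const' _ _ enorm_ne_top]
  refine lintegral_mono fun y => ?_
  calc _ ≤ ofReal (‖x - y‖ ^ (κ - n)) * (‖f y‖ₑ * ‖h x‖ₑ) := by gcongr <;> exact enorm_coord_le _ _
    _ = _ := by ring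

lemma lintegral_coord_le_rieszPotential' {κ : ℝ} (hκ : 0 < κ) (hκn : κ < n) (f h : Vec n → Vec n)
    (hf : AEStronglyMeasurable f) (hh : AEStronglyMeasurable h)
    (i j : Fin n) : ∫⁻ q : Vec n × Vec n,
        ofReal (‖q.1 - q.2‖ ^ (κ - n)) * (‖h q.2 i‖ₑ * ‖f q.1 j‖ₑ) ≤
      ofReal (rieszConst n κ)⁻¹ * ∫⁻ z, rieszPotential κ f z * ‖h z‖ₑ := by
  refine le_trans (le_of_eq ?_) (lintegral_coord_le_rieszPotential hκ hκn f h i j)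
  have hm : AEMeasurable (fun q : Vec n × Vec n => ofReal (‖q.1 - q.2‖ ^ (κ - n)) *
      (‖f q.2 j‖ₑ * ‖h q.1 i‖ₑ)) (volume.prod volume) := by
    have hp : ∀ (i : Fin n) {f : Vec n → Vec n}, AEStronglyMeasurable f →
      AEStronglyMeasurable fun x => f x i := fun i f hf =>
      (EuclideanSpace.proj i : Vec n →L[ℝ] ℝ).continuous.comp_aestronglyMeasurable hf
    have h1 : Measurable fun q : Vec n × Vec n => ‖q.1 - q.2‖ ^ (κ - n) := by fun_prop
    exact h1.ennreal_ofReal.aemeasurable.mul ((hp j hf).comp_snd.enorm.mul (hp i hh).comp_fst.enorm)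
  rw [Measure.volume_eq_prod, ← lintegral_prod_swap _]
  refine lintegral_congr fun q => ?_
  simp only [Prod.fst_swap, Prod.snd_swap, norm_sub_rev q.2 q.1]; ring

section TestFields

variable {φ : Vec n → Vec n}

lemma exists_schwartz_coord (hφ : ContDiff ℝ (⊤ : ℕ∞) φ) (hc : HasCompactSupport φ) (i : Fin n) :
    ∃ ψ : 𝓢(Vec n, ℝ), (fun y => φ y i) = ψ :=
  ⟨(hc.comp_left (g := fun v : Vec n => v i) rfl).toSchwartzMap
    ((EuclideanSpace.proj i : Vec n →L[ℝ] ℝ).contDiff.comp hφ), rfl⟩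

lemma memLp_fracLapVec (hn : 0 < n) (hφ : ContDiff ℝ (⊤ : ℕ∞) φ) (hc : HasCompactSupport φ)
    (hr0 : 0 < r) (hr2 : r < 2) (hQ : 1 ≤ Q) (hQt : Q ≠ ∞) :
    MemLp (fracLapVec r φ) Q := MemLp.of_eval_piLp fun i => by
  obtain ⟨ψ, hψ⟩ := exists_schwartz_coord hφ hc i
  simpa [fracLapVec, hψ] using memLp_fracLap hn hr0 hr2 ψ hQ hQt

lemma conv_heat_fracLap (hn : 0 < n) (hr0 : 0 < r) (hr4 : r < 4) (ψ : 𝓢(Vec n, ℝ)) {δ : ℝ}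
    (hδ : 0 < δ) : conv (heat δ) (fracLap r ψ) = conv (fracHeat r δ) ψ := by
  have hn' : (0 : ℝ) < n := Nat.cast_pos.2 hn
  have hi := integrable_fracHeat hn hr0 hr4 hδ
  rw [fracLap_eq, conv_multiplierOp (integrable_heat hδ)
    (integrable_fracSymbol_mul_ft hn (by linarith) ψ),
    conv_eq_multiplierOp hi ψ.continuous ψ.integrable (integrable_ft_schwartz ψ)]
  congr 1; funext ξ; rw [ft_heat hδ, ft_fracHeat hn hr0.le hδ hi]
  push_cast; ring

lemma conv_heatLap_fracLap (hn : 0 < n) (hr : -(n : ℝ) < r) (hr0 : 0 < r + 2)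
    (hr2 : r < 2) (ψ : 𝓢(Vec n, ℝ)) (hσ : 0 < σ) (x : Vec n) :
    -conv (heatLap σ) (fracLap r ψ) x = conv (fracHeat (r + 2) σ) ψ x := by
  have hi := integrable_fracHeat (n := n) hn hr0 (by linarith) hσ
  rw [fracLap_eq, conv_multiplierOp (integrable_heatLap hσ) (integrable_fracSymbol_mul_ft hn hr ψ),
    conv_eq_multiplierOp hi ψ.continuous ψ.integrable (integrable_ft_schwartz ψ),
    multiplierOp_eq, multiplierOp_eq, ← Complex.neg_re, ← integral_neg]
  congr 1
  refine integral_congr_ae ?_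
  filter_upwards [ae_ne_zero hn] with ξ hξ
  rw [ft_heatLap hσ, ft_fracHeat hn hr0.le hσ hi, fracSymbol_add hξ, fracSymbol_two]; push_cast
  ring

end TestFields

/-- The two estimates of `𝓓₂`. In the first one the commutator kernel is smoothed by moving `ε`
derivatives from `U = (-Δ)^{s₁/2} u`, in the second one by moving them from
`V = (-Δ)^{s₂/2} φ`. -/
theorem exists_formD2_le (hn : 1 ≤ n) {s₁ s₂ α ε : ℝ} (hs₁ : 0 < s₁) (hs₂ : 0 < s₂)
    (hs : s₁ + s₂ < 2) (hΛ : 0 < Λ) (hε : 0 < ε) (hεα : ε < α) : ∃ C : ℝ, 0 < C ∧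
    ∀ p : ℝ≥0∞, 1 < p → p < ∞ → ∀ A : Vec n → Vec n → ℝ, IsCoefficient α Λ A →
    ∀ u U : Vec n → Vec n, IsSobolevPair s₁ p u U →
    ∀ φ : Vec n → Vec n, ContDiff ℝ (⊤ : ℕ∞) φ → HasCompactSupport φ →
    ∀ G H, IsRieszRiesz p U G → IsRieszRiesz p (fun z => A z z • U z) H →
      (∀ g, IsFracLap (s₁ - ε) u g → ofReal |∫ z, integrandD2 A H G (fracLapVec s₂ φ) z| ≤
          ofReal C * ∫⁻ z, rieszPotential (α - ε) g z * ‖fracLapVec s₂ φ z‖ₑ) ∧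
      ofReal |∫ z, integrandD2 A H G (fracLapVec s₂ φ) z| ≤
        ofReal C * ∫⁻ z, rieszPotential (α - ε) U z * ‖fracLapVec (s₂ - ε) φ z‖ₑ := by
  have hn0 : 0 < n := hn
  have hn1 : (1 : ℝ) ≤ n := by exact_mod_cast hn
  have hα0 := hε.trans hεα
  have hV : ∀ {Q} φ, ContDiff ℝ (⊤ : ℕ∞) φ → HasCompactSupport φ → 1 < Q → Q ≠ ∞ →
      MemLp (fracLapVec s₂ φ : Vec n → Vec n) Q := fun φ hφ hc hQ =>
    memLp_fracLapVec hn0 hφ hc hs₂ (by linarith) hQ.le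
  rcases lt_or_ge 1 α with hα | hα
  · -- for `α > 1` the coefficient is constant on the diagonal and the commutator vanishes
    refine ⟨1, one_pos, fun p hp hpt A hA u U hu φ hφ hc G H hG hH => ?_⟩
    obtain ⟨Q, _, _, hQ, hQt⟩ := exists_holderConjugate hp hpt.ne
    have hA0 : (fun z => A z z) = fun _ => A 0 0 :=
      funext fun z => eq_of_holder_one_lt hα hA.diag_holder z 0
    have h := enorm_integral_D2_le hn0 hp hpt.ne (hA.measurable_diag hα0) (fun x => hA.bound x x)
      hu.memLp_fracLap (hV φ hφ hc hQ hQt) hG hH (B := 0) fun b c _ _ i j => by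
        rw [hA0]; simp [commConv_const]
    rw [mul_zero] at h
    exact ⟨fun g _ => h.trans zero_le, h.trans zero_le⟩
  have hκ : 0 < α - ε := by linarith
  have hκn : α - ε < n := by linarith
  have hc := rieszConst_pos hκ hκn
  obtain ⟨C₁, hC₁, h₁⟩ := exists_enorm_integral_commConv_le hn0 (s := s₁) hs₁ (by linarith) hε hεα hα
  obtain ⟨C₂, hC₂, h₂⟩ := exists_enorm_integral_commConv_le hn0 (s := s₂) hs₂ (by linarith) hε hεα hα
  set D := (n : ℝ) ^ 2 * ((C₁ + C₂) * (2 * Λ) * (rieszConst n (α - ε))⁻¹) with hD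
  refine ⟨D, by positivity, fun p hp hpt A hA u U hu φ hφ hcs G H hG hH =>
    ?_⟩
  obtain ⟨Q, _, _, hQ, hQt⟩ := exists_holderConjugate hp hpt.ne
  set V := fracLapVec s₂ φ
  have hV : MemLp V Q := hV φ hφ hcs hQ hQt
  have ham := hA.measurable_diag hα0
  have hab : ∀ x, |A x x| ≤ Λ := fun x => hA.bound x x
  have hU := hu.memLp_fracLap
  have key : ∀ {C : ℝ} {I : ℝ≥0∞}, 0 < C → C ≤ C₁ + C₂ → (∀ (b c : ℝ), 0 < b → b ≤ c →
      ∀ i j : Fin n, ‖∫ x, commConv (hessKernel i j b c) (fun z => A z z) (fun y => U y j) x *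
        V x i‖ₑ ≤ ofReal (C * (2 * Λ)) * (ofReal (rieszConst n (α - ε))⁻¹ * I)) →
      ofReal |∫ z, integrandD2 A H G V z| ≤ ofReal D * I := by
    intro C I hC hC' h
    refine (enorm_integral_D2_le hn0 hp hpt.ne ham hab hU hV hG hH h).trans ?_
    rw [hD, ofReal_mul (p := (n : ℝ) ^ 2) (by positivity), ENNReal.ofReal_pow (by positivity),
      ENNReal.ofReal_natCast, ofReal_mul (p := (C₁ + C₂) * (2 * Λ)) (by positivity), mul_assoc,
      mul_assoc]
    gcongr
  refine ⟨fun g hg => key hC₁ (by linarith) fun b c hb hbc i j => ?_,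
    key hC₂ (by linarith) fun b c hb hbc i j => ?_⟩
  · rw [integral_commConv_mul hp.le hpt.ne hQ.le hQt (integrable_hessKernel hb i j)
      (hessKernel_neg i j b c) ham hab (hU.eval_piLp j) (hV.eval_piLp i), enorm_neg]
    refine (h₁ (2 * Λ) Λ _ (by positivity) ham hab hA.diag_holder p Q hp hpt.ne
      (fun x => u x j) (fun x => U x j) (fun x => g x j) (fun x => V x i) (hu.memLp.eval_piLp j)
      (hU.eval_piLp j) (hV.eval_piLp i) (hg.aestronglyMeasurable j)
      (fun δ hδ x => (hu.isFracLap.conv_heat hδ j x).2)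
      (fun σ hσ x => ?_) b c hb hbc i j).trans ?_
    · rw [hg.conv_heatLap hn0 hσ j x, show s₁ - ε + 2 = s₁ + 2 - ε by ring]
    · gcongr
      exact lintegral_coord_le_rieszPotential hκ hκn g V i j
  · obtain ⟨ψ, hψ⟩ := exists_schwartz_coord hφ hcs i
    have hr : -(n : ℝ) < s₂ - ε := by linarith
    have hVi : (fun x => V x i) = fracLap s₂ ψ := by funext x; simp [V, fracLapVec, hψ]
    have hW : ∀ k, Continuous fun x => fracLapVec (s₂ - ε) φ x k := fun k => by
      obtain ⟨χ, hχ⟩ := exists_schwartz_coord hφ hcs k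
      simpa [fracLapVec, hχ] using continuous_fracLap hn0 hr χ
    have hWm : AEStronglyMeasurable (fracLapVec (s₂ - ε) φ) :=
      ((PiLp.continuous_toLp 2 _).comp (continuous_pi hW)).aestronglyMeasurable
    have hWi : (fun x => fracLapVec (s₂ - ε) φ x i) = fracLap (s₂ - ε) ψ := by
      funext x; simp [fracLapVec, hψ]
    simp only [mul_comm _ (V _ i)]
    refine (h₂ (2 * Λ) Λ _ (by positivity) ham hab hA.diag_holder Q p hQ hQt
      ψ (fun x => V x i) (fun x => fracLapVec (s₂ - ε) φ x i) (fun x => U x j) (ψ.memLp Q volume)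
      (hV.eval_piLp i) (hU.eval_piLp j) (hW i).aestronglyMeasurable
      (fun δ hδ x => ?_) (fun σ hσ x => ?_) b c hb hbc i j).trans ?_
    · rw [hVi, conv_heat_fracLap hn0 hs₂ (by linarith) ψ hδ]
    · rw [hWi, conv_heatLap_fracLap hn0 hr (by linarith) (by linarith) ψ hσ,
        show s₂ - ε + 2 = s₂ + 2 - ε by ring]
    · gcongr
      exact lintegral_coord_le_rieszPotential' hκ hκn U _ hU.1 hWm i j

end

section

/-! ### Differences of Riesz kernels -/

lemma integral_rpow_mul_heat {m : ℝ} (hm : 0 < m) {x : Vec n} (hx : x ≠ 0) :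
    IntegrableOn (fun t : ℝ => t ^ ((n : ℝ) / 2 - m - 1) * heat t x) (Ioi 0) ∧
    ∫ t in Ioi 0, t ^ ((n : ℝ) / 2 - m - 1) * heat t x =
      (4 * π) ^ (-(n : ℝ) / 2) * 4 ^ m * Gamma m * ‖x‖ ^ (-(2 * m)) := by
  have hx0 := norm_pos_iff.2 hx
  set b := ‖x‖ ^ 2 / 4 with hb
  have hb0 : 0 < b := by positivity
  set c := (4 * π) ^ (-(n : ℝ) / 2)
  have hg : IntegrableOn (fun y : ℝ => c * (y ^ (m - 1) * exp (-(b * y)))) (Ioi 0) := by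
    have := integrableOn_rpow_mul_exp_neg_mul_rpow (s := m - 1) (p := 1) (by linarith) one_pos hb0
    simp only [Real.rpow_one, ← neg_mul] at this ⊢
    exact this.const_mul _
  have e : ∀ t ∈ Ioi (0 : ℝ), (|(-1 : ℝ)| * t ^ ((-1 : ℝ) - 1)) •
      (fun y : ℝ => c * (y ^ (m - 1) * exp (-(b * y)))) (t ^ (-1 : ℝ)) =
      t ^ ((n : ℝ) / 2 - m - 1) * heat t x := fun t ht => by
    have ht0 : 0 < t := ht
    have h1 : (4 * π * t) ^ (-(n : ℝ) / 2) = c * t ^ (-(n : ℝ) / 2) :=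
      mul_rpow (by positivity) ht0.le
    have h2 : b * t ^ (-1 : ℝ) = ‖x‖ ^ 2 / (4 * t) := by rw [Real.rpow_neg_one, hb]; field_simp
    have h3 : t ^ ((n : ℝ) / 2 - m - 1) * t ^ (-(n : ℝ) / 2) =
        t ^ ((-1 : ℝ) - 1) * (t ^ (-1 : ℝ)) ^ (m - 1) := by
      rw [← rpow_mul ht0.le, ← rpow_add ht0, ← rpow_add ht0]
      congr 1; ring
    simp only [smul_eq_mul, heat]; rw [h1, h2, abs_neg, abs_one]
    linear_combination -c * exp (-(‖x‖ ^ 2 / (4 * t))) * h3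
  constructor
  · exact ((integrableOn_Ioi_comp_rpow_iff _ (by norm_num : (-1 : ℝ) ≠ 0)).2 hg).congr_fun e
      measurableSet_Ioi
  · rw [← setIntegral_congr_fun measurableSet_Ioi e,
      integral_comp_rpow_Ioi (fun y : ℝ => c * (y ^ (m - 1) * exp (-(b * y))))
        (by norm_num : (-1 : ℝ) ≠ 0), integral_const_mul, Real.integral_rpow_mul_exp_neg_mul_Ioi hm hb0, hb,
      one_div, inv_div,
      Real.div_rpow (by norm_num) (by positivity), ← Real.rpow_natCast, ← rpow_mul hx0.le,
      rpow_neg hx0.le]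
    push_cast; ring

/-- The bound comes from `√(p_t(x) p_t(x-h)) = exp(-|h|²/16t) p_t(x - h/2)`, that is from the
Hellinger distance between a Gaussian and its translate. -/
lemma integral_abs_heat_sub_le (ht : 0 < t) {h : Vec n} (hh : h ≠ 0) :
    ∫ x, |heat t x - heat t (x - h)| ≤ 3 * ‖h‖ * t ^ (-(1 / 2) : ℝ) := by
  have hh0 := norm_pos_iff.2 hh
  have hs : t ^ (-(1 / 2) : ℝ) = (√t)⁻¹ := by rw [rpow_neg ht.le, Real.sqrt_eq_rpow]
  have hst := Real.sqrt_pos.2 ht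
  rw [hs]
  set l := ‖h‖ * (√t)⁻¹ with hl
  have hl0 : 0 < l := by positivity
  set ρ := exp (-(‖h‖ ^ 2 / (16 * t)))
  have hi := integrable_heat (n := n) ht
  have key : ∀ x, |heat t x - heat t (x - h)| ≤ (2 * l)⁻¹ * (heat t x + heat t (x - h) -
      2 * (ρ * heat t (x - (1 / 2 : ℝ) • h))) + l * (heat t x + heat t (x - h)) := fun x => by
    have hp := heat_pos ht x
    have hq := heat_pos ht (x - h)
    have hg := mul_pos (Real.exp_pos (-(‖h‖ ^ 2 / (16 * t)))) (heat_pos ht (x - (1 / 2 : ℝ) • h))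
    have e : (ρ * heat t (x - (1 / 2 : ℝ) • h)) ^ 2 = heat t x * heat t (x - h) := by
      have h1 : ‖x - (1 / 2 : ℝ) • h‖ ^ 2 = (‖x‖ ^ 2 + ‖x - h‖ ^ 2) / 2 - ‖h‖ ^ 2 / 4 := by
        rw [norm_sub_sq_real, norm_sub_sq_real, inner_smul_right, norm_smul]; norm_num; ring
      have h2 : exp (-(‖h‖ ^ 2 / (16 * t))) ^ 2 * exp (-(‖x - (1 / 2 : ℝ) • h‖ ^ 2 / (4 * t))) ^ 2 =
          exp (-(‖x‖ ^ 2 / (4 * t))) * exp (-(‖x - h‖ ^ 2 / (4 * t))) := by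
        rw [← Real.exp_nat_mul, ← Real.exp_nat_mul, ← Real.exp_add, ← Real.exp_add, h1]; congr 1
        push_cast; field_simp; ring
      unfold heat; linear_combination ((4 * π * t) ^ (-(n : ℝ) / 2)) ^ 2 * h2
    change |_| ≤ (2 * l)⁻¹ * (_ - 2 * (ρ * _)) + _
    obtain ⟨a, ha, ha'⟩ : ∃ a, 0 < a ∧ heat t x = a ^ 2 :=
      ⟨_, Real.sqrt_pos.2 hp, (Real.sq_sqrt hp.le).symm⟩
    obtain ⟨b, hb, hb'⟩ : ∃ b, 0 < b ∧ heat t (x - h) = b ^ 2 :=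
      ⟨_, Real.sqrt_pos.2 hq, (Real.sq_sqrt hq.le).symm⟩
    have e' : ρ * heat t (x - (1 / 2 : ℝ) • h) = a * b := by
      rw [ha', hb', ← mul_pow] at e
      exact (pow_left_inj₀ hg.le (by positivity) two_ne_zero).1 e
    rw [e', ha', hb', show a ^ 2 - b ^ 2 = (a - b) * (a + b) by ring, abs_mul,
      abs_of_pos (by positivity : 0 < a + b),
      show a ^ 2 + b ^ 2 - 2 * (a * b) = |a - b| ^ 2 by rw [sq_abs]; ring]
    have h3 : (a + b) ^ 2 ≤ 2 * (a ^ 2 + b ^ 2) := by nlinarith [sq_nonneg (a - b)]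
    have h4 : |a - b| * (a + b) = (2 * l)⁻¹ * (2 * |a - b| * (l * (a + b))) := by field_simp
    have h5 : 2 * |a - b| * (l * (a + b)) ≤ |a - b| ^ 2 + (l * (a + b)) ^ 2 := two_mul_le_add_sq _ _
    calc |a - b| * (a + b) ≤ (2 * l)⁻¹ * (|a - b| ^ 2 + (l * (a + b)) ^ 2) := by rw [h4]; gcongr
      _ = (2 * l)⁻¹ * |a - b| ^ 2 + l * ((a + b) ^ 2 / 2) := by field_simp
      _ ≤ _ := by gcongr; linarith
  have i1 := hi.comp_sub_right h
  have i2 := hi.comp_sub_right ((1 / 2 : ℝ) • h)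
  have i3 : Integrable fun x => heat t x + heat t (x - h) := hi.add i1
  have i4 : Integrable fun x => heat t x + heat t (x - h) -
      2 * (ρ * heat t (x - (1 / 2 : ℝ) • h)) := i3.sub ((i2.const_mul ρ).const_mul 2)
  have i5 : Integrable fun x => heat t x - heat t (x - h) := hi.sub i1
  refine (integral_mono i5.abs ((i4.const_mul _).add (i3.const_mul _)) key).trans ?_
  rw [integral_add' (i4.const_mul _) (i3.const_mul _), integral_const_mul, integral_const_mul,
    integral_sub i3 ((i2.const_mul ρ).const_mul 2), integral_const_mul, integral_const_mul]
  have e1 : ∫ x, (heat t x + heat t (x - h)) = 2 := by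
    rw [integral_add hi i1, integral_sub_right_eq_self (heat t), integral_heat ht]; norm_num
  have e2 : ∫ x, heat t (x - (1 / 2 : ℝ) • h) = 1 := by
    rw [integral_sub_right_eq_self (heat t), integral_heat ht]
  rw [e1, e2]
  have h6 : 1 - l ^ 2 / 16 ≤ ρ := by
    have := Real.add_one_le_exp (-(‖h‖ ^ 2 / (16 * t)))
    have e3 : ‖h‖ ^ 2 / (16 * t) = l ^ 2 / 16 := by
      rw [hl, mul_pow, inv_pow, Real.sq_sqrt ht.le]; field_simp
    rw [e3] at this
    change _ ≤ exp _
    rw [e3]; linarith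
  have h7 : (2 * l)⁻¹ * (2 - 2 * (ρ * 1)) ≤ (2 * l)⁻¹ * (l ^ 2 / 8) := by gcongr; linarith
  have h8 : (2 * l)⁻¹ * (l ^ 2 / 8) = l / 16 := by field_simp; norm_num
  rw [mul_assoc 3]; linarith

lemma exists_lintegral_heat_sub_le (n : ℕ) (hσ : 0 < σ) (hσ1 : σ < 1) :
    ∃ C : ℝ, 0 < C ∧ ∀ h : Vec n, h ≠ 0 → ∫⁻ t in Ioi 0, ofReal (t ^ (σ / 2 - 1)) *
      ∫⁻ x : Vec n, ‖heat t x - heat t (x - h)‖ₑ ≤ ofReal (C * ‖h‖ ^ σ) := by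
  refine ⟨2 * (σ / 2)⁻¹ + 3 * ((1 - σ) / 2)⁻¹, by
    have : 0 < 1 - σ := by linarith
    positivity, fun h hh => ?_⟩
  have hh0 := norm_pos_iff.2 hh
  have hR : 0 < ‖h‖ ^ 2 := by positivity
  have hb : ∀ t : ℝ, 0 < t → ∫⁻ x : Vec n, ‖heat t x - heat t (x - h)‖ₑ ≤ ofReal 2 ∧
      ∫⁻ x : Vec n, ‖heat t x - heat t (x - h)‖ₑ ≤
        ofReal (3 * ‖h‖ * t ^ (-(1 / 2) : ℝ)) := fun t ht => by
    have hi := integrable_heat (n := n) ht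
    have i1 := hi.comp_sub_right h
    have i5 : Integrable fun x => heat t x - heat t (x - h) := hi.sub i1
    rw [← ofReal_integral_norm_eq_lintegral_enorm i5]
    refine ⟨ofReal_le_ofReal ?_, ofReal_le_ofReal (integral_abs_heat_sub_le ht hh)⟩
    refine (integral_mono i5.norm (hi.add i1) fun x => ?_).trans_eq ?_
    · have := heat_pos ht x
      have := heat_pos ht (x - h)
      simp only [Pi.add_apply, norm_eq_abs, abs_le]
      constructor <;> linarith
    · rw [integral_add' hi i1, integral_sub_right_eq_self (heat t), integral_heat ht]; norm_num
  rw [← Set.Ioc_union_Ioi_eq_Ioi hR.le,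
    lintegral_union measurableSet_Ioi (Set.Ioc_disjoint_Ioi le_rfl)]
  have e1 : ∫⁻ t in Ioc 0 (‖h‖ ^ 2), ofReal (t ^ (σ / 2 - 1)) *
      ∫⁻ x : Vec n, ‖heat t x - heat t (x - h)‖ₑ ≤ ofReal (2 * (σ / 2)⁻¹ * ‖h‖ ^ σ) := by
    calc _ ≤ ∫⁻ t in Ioc 0 (‖h‖ ^ 2), ofReal (t ^ (σ / 2 - 1)) * ofReal 2 :=
          setLIntegral_mono' measurableSet_Ioc fun t ht => by gcongr; exact (hb t ht.1).1
      _ = _ := by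
        rw [lintegral_mul_const' _ _ ofReal_ne_top, lintegral_Ioc_rpow (by linarith) hR,
          ← ENNReal.ofReal_mul' (by norm_num), sub_add_cancel, ← Real.rpow_natCast,
          ← rpow_mul hh0.le, Nat.cast_ofNat, mul_div_cancel₀ _ two_ne_zero]
        congr 1; ring
  have e2 : ∫⁻ t in Ioi (‖h‖ ^ 2), ofReal (t ^ (σ / 2 - 1)) *
      ∫⁻ x : Vec n, ‖heat t x - heat t (x - h)‖ₑ ≤
      ofReal (3 * ((1 - σ) / 2)⁻¹ * ‖h‖ ^ σ) := by
    calc _ ≤ ∫⁻ t in Ioi (‖h‖ ^ 2), ofReal (t ^ ((σ - 1) / 2 - 1)) *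
          ofReal (3 * ‖h‖) := setLIntegral_mono' measurableSet_Ioi fun t ht => by
            have ht0 : 0 < t := hR.trans ht
            refine (mul_le_mul_right (hb t ht0).2 _).trans_eq ?_
            rw [← ofReal_mul (by positivity), ← ofReal_mul (by positivity),
              show (σ - 1) / 2 - 1 = σ / 2 - 1 + -(1 / 2) by ring, rpow_add ht0]
            congr 1; ring
      _ = _ := by
        rw [lintegral_mul_const' _ _ ofReal_ne_top, lintegral_Ioi_rpow (by linarith) hR,
          ← ENNReal.ofReal_mul' (by positivity), sub_add_cancel, ← Real.rpow_natCast,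
          ← rpow_mul hh0.le, Nat.cast_ofNat, mul_div_cancel₀ _ two_ne_zero,
          Real.rpow_sub_one hh0.ne']
        congr 1
        have : 1 - σ ≠ 0 := by linarith
        have : σ - 1 ≠ 0 := by linarith
        field_simp; ring
  refine (add_le_add e1 e2).trans_eq ?_
  have : 0 < 1 - σ := by linarith
  rw [← ENNReal.ofReal_add (by positivity) (by positivity), add_mul]

end

section

/-! ### The Riesz kernel as an average of heat kernels -/

/-- The kernel of `f ↦ I^σ f - (I^σ f)(· - h)`. -/
def rieszDiff (σ : ℝ) (h x : Vec n) : ℝ :=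
  rieszConst n σ * (‖x‖ ^ (σ - (n : ℝ)) - ‖x - h‖ ^ (σ - (n : ℝ)))

@[fun_prop]
lemma measurable_rieszDiff (σ : ℝ) : Measurable fun w : Vec n × Vec n => rieszDiff σ w.1 w.2 := by
  unfold rieszDiff; fun_prop

lemma rieszDiff_neg (σ : ℝ) (h x : Vec n) : rieszDiff σ h (-x) = rieszDiff σ (-h) x := by
  simp only [rieszDiff, norm_neg, sub_neg_eq_add]; rw [show -x - h = -(x + h) by abel, norm_neg]

lemma rieszConst_mul_rpow (hσ : 0 < σ) (hσn : σ < n) {x : Vec n} (hx : x ≠ 0) :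
    IntegrableOn (fun t : ℝ => t ^ (σ / 2 - 1) * heat t x) (Ioi 0) ∧
    rieszConst n σ * ‖x‖ ^ (σ - (n : ℝ)) =
      (Gamma (σ / 2))⁻¹ * ∫ t in Ioi 0, t ^ (σ / 2 - 1) * heat t x := by
  have h := integral_rpow_mul_heat (n := n) (m := (n - σ) / 2) (by linarith) hx
  rw [show (n : ℝ) / 2 - (n - σ) / 2 - 1 = σ / 2 - 1 by ring] at h
  refine ⟨h.1, ?_⟩
  rw [h.2, rieszConst, show -(2 * ((n - σ) / 2)) = σ - (n : ℝ) by ring]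
  have h4 : (4 : ℝ) ^ ((n - σ) / 2) = 2 ^ (n : ℝ) * (2 ^ σ)⁻¹ := by
    rw [show (4 : ℝ) = 2 ^ (2 : ℝ) by norm_num, ← rpow_mul (by norm_num),
      ← rpow_neg (by norm_num), ← rpow_add (by norm_num)]
    congr 1; ring
  have h5 : (4 * π) ^ (-(n : ℝ) / 2) = (2 ^ (n : ℝ))⁻¹ * (π ^ ((n : ℝ) / 2))⁻¹ := by
    rw [mul_rpow (by norm_num) Real.pi_pos.le, show (4 : ℝ) = 2 ^ (2 : ℝ) by norm_num,
      ← rpow_mul (by norm_num), ← rpow_neg (by norm_num),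
      ← rpow_neg Real.pi_pos.le]
    congr 2 <;> ring
  have : (2 : ℝ) ^ (n : ℝ) ≠ 0 := by positivity
  rw [h4, h5]; field_simp

/-- For `σ < 1` the difference of two translates of the Riesz kernel is an integrable average of
differences of heat kernels, although the Riesz kernel itself is not integrable. -/
lemma exists_rieszDiff (hn : 0 < n) (hσ : 0 < σ) (hσ1 : σ < 1) :
    ∃ C : ℝ, 0 < C ∧ ∀ h : Vec n, h ≠ 0 →
      Integrable (fun w : ℝ × Vec n => w.1 ^ (σ / 2 - 1) * (heat w.1 w.2 - heat w.1 (w.2 - h)))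
        ((volume.restrict (Ioi 0)).prod volume) ∧
      (rieszDiff σ h =ᵐ[volume] fun x => (Gamma (σ / 2))⁻¹ *
        ∫ t in Ioi 0, t ^ (σ / 2 - 1) * (heat t x - heat t (x - h))) ∧
      eLpNorm (rieszDiff σ h) 1 volume ≤ ofReal (C * ‖h‖ ^ σ) := by
  obtain ⟨C, hC, H⟩ := exists_lintegral_heat_sub_le n hσ hσ1
  have hσn : σ < n := hσ1.trans_le (by exact_mod_cast hn)
  have hΓ := Real.Gamma_pos_of_pos (half_pos hσ)
  refine ⟨(Gamma (σ / 2))⁻¹ * C, by positivity, fun h hh => ?_⟩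
  have hm : Measurable (fun w : ℝ × Vec n =>
      w.1 ^ (σ / 2 - 1) * (heat w.1 w.2 - heat w.1 (w.2 - h))) := by
    have h1 : Measurable fun w : ℝ × Vec n => (w.1, w.2 - h) := by fun_prop
    have h2 := measurable_heat_uncurry.comp h1
    exact (measurable_fst.pow_const _).mul (measurable_heat_uncurry.sub h2)
  have hle : ∫⁻ w : ℝ × Vec n, ‖w.1 ^ (σ / 2 - 1) * (heat w.1 w.2 - heat w.1 (w.2 - h))‖ₑ
      ∂((volume.restrict (Ioi 0)).prod volume) ≤ ofReal (C * ‖h‖ ^ σ) := by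
    rw [lintegral_prod _ hm.enorm.aemeasurable]
    refine (setLIntegral_mono' measurableSet_Ioi fun t ht => ?_).trans (H h hh)
    have ht0 : 0 < t := ht
    simp only [enorm_mul]
    rw [lintegral_const_mul' _ _ enorm_ne_top, Real.enorm_of_nonneg (by positivity)]
  have hi : Integrable (fun w : ℝ × Vec n =>
      w.1 ^ (σ / 2 - 1) * (heat w.1 w.2 - heat w.1 (w.2 - h)))
      ((volume.restrict (Ioi 0)).prod volume) :=
    ⟨hm.aestronglyMeasurable, hle.trans_lt ENNReal.ofReal_lt_top⟩
  have e : rieszDiff σ h =ᵐ[volume] fun x => (Gamma (σ / 2))⁻¹ *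
      ∫ t in Ioi 0, t ^ (σ / 2 - 1) * (heat t x - heat t (x - h)) := by
    have hsub := (measurePreserving_sub_right volume h).quasiMeasurePreserving.ae (ae_ne_zero hn)
    filter_upwards [ae_ne_zero hn, hsub] with x hx hx'
    obtain ⟨i1, e1⟩ := rieszConst_mul_rpow hσ hσn hx
    obtain ⟨i2, e2⟩ := rieszConst_mul_rpow hσ hσn hx'
    rw [rieszDiff, mul_sub, e1, e2, ← mul_sub, ← integral_sub i1 i2]; simp only [mul_sub]
  refine ⟨hi, e, ?_⟩
  rw [eLpNorm_congr_ae e, eLpNorm_one_eq_lintegral_enorm]; simp only [enorm_mul]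
  rw [lintegral_const_mul' _ _ enorm_ne_top, Real.enorm_of_nonneg (by positivity), mul_assoc,
    ofReal_mul (by positivity)]
  gcongr
  refine (lintegral_mono fun x => enorm_integral_le_lintegral_enorm _).trans ?_
  rw [lintegral_lintegral_swap (by
    have := hm.comp measurable_swap
    exact this.enorm.aemeasurable), ← lintegral_prod _ hm.enorm.aemeasurable]
  exact hle

lemma integrable_rieszDiff (hn : 0 < n) (hσ : 0 < σ) (hσ1 : σ < 1) (h : Vec n) :
    Integrable (rieszDiff σ h) := by
  obtain ⟨C, hC, H⟩ := exists_rieszDiff hn hσ hσ1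
  by_cases hh : h = 0
  · have : rieszDiff σ h = 0 := by ext x; simp [rieszDiff, hh]
    rw [this]
    exact integrable_zero _ _ _
  · have hm : Measurable fun x => rieszDiff σ h x := by unfold rieszDiff; fun_prop
    exact memLp_one_iff_integrable.1
      ⟨hm.aestronglyMeasurable, (H h hh).2.2.trans_lt ENNReal.ofReal_lt_top⟩

lemma exists_eLpNorm_rieszDiff_le (hn : 0 < n) (hσ : 0 < σ) (hσ1 : σ < 1) :
    ∃ C : ℝ, 0 < C ∧ ∀ h : Vec n, eLpNorm (rieszDiff σ h) 1 volume ≤ ofReal (C * ‖h‖ ^ σ) := by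
  obtain ⟨C, hC, H⟩ := exists_rieszDiff hn hσ hσ1
  refine ⟨C, hC, fun h => ?_⟩
  by_cases hh : h = 0
  · have : rieszDiff σ h = 0 := by ext x; simp [rieszDiff, hh]
    rw [this]; simp
  · exact (H h hh).2.2

lemma ft_comp_sub (f : Vec n → ℝ) (h ξ : Vec n) :
    ft (fun x => f (x - h)) ξ = wave (-h) ξ * ft f ξ := by
  rw [ft, ft, fourier_eq_wave, fourier_eq_wave, ← integral_const_mul,
    ← integral_sub_right_eq_self (fun x => wave (-h) ξ * (wave (-x) ξ * (f x : ℂ))) h]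
  refine integral_congr_all fun x => ?_
  rw [← mul_assoc, ← wave_add]
  congr 2; abel

lemma ft_rieszDiff (hn : 0 < n) (hσ : 0 < σ) (hσ1 : σ < 1) (h : Vec n)
    (hξ : ξ ≠ 0) : ft (rieszDiff σ h) ξ = fracSymbol (-σ) ξ * (1 - wave (-h) ξ) := by
  by_cases hh : h = 0
  · simp [rieszDiff, hh, fourier_eq_wave, wave]
  obtain ⟨C, hC, H⟩ := exists_rieszDiff hn hσ hσ1
  obtain ⟨hi, e, -⟩ := H h hh
  have hΓ := Real.Gamma_pos_of_pos (half_pos hσ)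
  have e1 : ft (rieszDiff σ h) ξ = ((Gamma (σ / 2))⁻¹ : ℝ) * ft (fun x =>
      ∫ t in Ioi 0, t ^ (σ / 2 - 1) * (heat t x - heat t (x - h))) ξ := by
    rw [ft, ft, fourier_eq_wave, fourier_eq_wave, ← integral_const_mul]
    refine integral_congr_ae ?_
    filter_upwards [e] with x hx
    rw [hx]; push_cast; ring
  have e2 : ∀ t ∈ Ioi (0 : ℝ), ft (fun x => t ^ (σ / 2 - 1) * (heat t x - heat t (x - h))) ξ =
      (1 - wave (-h) ξ) * ((t ^ (-((2 - σ) / 2)) * gauss t ξ : ℝ) : ℂ) := fun t ht => by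
    have i0 := integrable_wave_neg_mul (integrable_heat (n := n) ht) ξ
    have i1 := integrable_wave_neg_mul ((integrable_heat (n := n) ht).comp_sub_right h) ξ
    have e3 := ft_comp_sub (heat t) h ξ
    rw [ft_heat ht, ft, fourier_eq_wave] at e3
    have e4 := ft_heat ht ξ
    rw [ft, fourier_eq_wave] at e4
    calc _ = ((t ^ (σ / 2 - 1) : ℝ) : ℂ) * ((∫ x, wave (-x) ξ * ((heat t x : ℝ) : ℂ)) -
          ∫ x, wave (-x) ξ * ((heat t (x - h) : ℝ) : ℂ)) := by
          rw [ft, fourier_eq_wave, ← integral_sub i0 i1, ← integral_const_mul]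
          congr 1; ext x; push_cast; ring
      _ = _ := by
        rw [e3, e4, show -((2 - σ) / 2) = σ / 2 - 1 by ring]
        push_cast; ring
  rw [e1, ft_integral_param hi, setIntegral_congr_fun measurableSet_Ioi e2, integral_const_mul,
    integral_complex_ofReal, (integral_rpow_mul_gauss (by linarith) hξ).2,
    show 1 - (2 - σ) / 2 = σ / 2 by ring, show 2 - σ - 2 = -σ by ring]
  push_cast
  have : (Gamma (σ / 2) : ℂ) ≠ 0 := by exact_mod_cast hΓ.ne'
  field_simp

lemma sub_shift_eq_multiplierOp (ψ : 𝓢(Vec n, ℝ)) (h : Vec n) :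
    (fun x => ψ x - ψ (x - h)) = multiplierOp (fun ξ => 1 - wave (-h) ξ) ψ := by
  have hi := integrable_ft_schwartz ψ
  ext x
  nth_rw 1 [← multiplierOp_one ψ.continuous ψ.integrable hi]
  nth_rw 2 [← multiplierOp_one ψ.continuous ψ.integrable hi]
  simp only [multiplierOp_eq, one_mul]
  rw [← Complex.sub_re, ← integral_sub (integrable_wave_mul hi x) (integrable_wave_mul hi _)]
  congr 2; ext ξ
  rw [sub_eq_add_neg x h, wave_add]; ring

lemma norm_one_sub_wave_le (h ξ : Vec n) : ‖1 - wave h ξ‖ ≤ 2 :=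
  (norm_sub_le _ _).trans (by rw [norm_wave, norm_one]; norm_num)

lemma conv_rieszDiff_fracLap (hn : 0 < n) (hσ : 0 < σ) (hσ1 : σ < 1) (ψ : 𝓢(Vec n, ℝ))
    (h : Vec n) : conv (rieszDiff σ h) (fracLap σ ψ) = fun x => ψ x - ψ (x - h) := by
  have hr : -(n : ℝ) < σ := by linarith [(Nat.cast_nonneg n : (0 : ℝ) ≤ n)]
  rw [fracLap_eq, conv_multiplierOp (integrable_rieszDiff hn hσ hσ1 h)
    (integrable_fracSymbol_mul_ft hn hr ψ), sub_shift_eq_multiplierOp]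
  ext x; simp only [multiplierOp_eq]; congr 1
  refine integral_congr_ae ?_
  filter_upwards [ae_ne_zero hn] with ξ hξ
  have e : (fracSymbol (-σ) ξ : ℂ) * fracSymbol σ ξ = 1 := by
    rw [← Complex.ofReal_mul, ← fracSymbol_add hξ, neg_add_cancel, fracSymbol_zero,
      Complex.ofReal_one]
  rw [ft_rieszDiff hn hσ hσ1 h hξ]; linear_combination wave x ξ * (1 - wave (-h) ξ) * ft ψ ξ * e

lemma eLpNorm_comp_sub (hf : AEStronglyMeasurable f) (P : ℝ≥0∞) (h : Vec n) :
    eLpNorm (fun x => f (x - h)) P = eLpNorm f P :=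
  eLpNorm_comp_measurePreserving hf (measurePreserving_sub_right volume h)

lemma eLpNorm_sub_shift_le_add (hP : 1 ≤ P) (hf : MemLp f P)
    (hg : MemLp g P) (h : Vec n) : eLpNorm (fun x => f x - f (x - h)) P ≤
      2 * eLpNorm (g - f) P + eLpNorm (fun x => g x - g (x - h)) P := by
  have hmp := measurePreserving_sub_right (volume : Measure (Vec n)) h
  have hd := hg.sub hf
  have hm : AEStronglyMeasurable fun x => g x - g (x - h) :=
    (hg.sub (hg.comp_measurePreserving hmp)).1
  have hdh : AEStronglyMeasurable fun x => (g - f) (x - h) := (hd.comp_measurePreserving hmp).1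
  have e : (fun x => f x - f (x - h)) = -(g - f) +
      ((fun x => g x - g (x - h)) + fun x => (g - f) (x - h)) := by
    ext x; simp only [Pi.add_apply, Pi.neg_apply, Pi.sub_apply]; ring
  have h1 := eLpNorm_add_le hd.1.neg (hm.add hdh) hP
  have h2 := eLpNorm_add_le hm hdh hP
  rw [eLpNorm_neg] at h1; rw [eLpNorm_comp_sub hd.1] at h2
  calc _ ≤ _ := e ▸ h1
    _ ≤ eLpNorm (g - f) P + (eLpNorm (fun x => g x - g (x - h)) P + eLpNorm (g - f) P) := by gcongr
    _ = _ := by ring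

/-- Differences of `u` are controlled by `(-Δ)^{σ/2} u`: after smoothing by the heat semigroup,
`u - u(· - h)` is the convolution of `(-Δ)^{σ/2} u` with `rieszDiff σ h`. -/
lemma IsSobolevPair.eLpNorm_sub_shift_le (hn : 0 < n) (hσ : 0 < σ) (hσ1 : σ < 1)
    (hP : 1 ≤ P) (hPt : P ≠ ∞) (hu : IsSobolevPair σ P u U)
    (i : Fin n) (h : Vec n) : eLpNorm (fun x => u x i - u (x - h) i) P ≤
      eLpNorm (rieszDiff σ h) 1 * eLpNorm (fun x => U x i) P := by
  set f := fun x => u x i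
  set F := fun x => U x i
  have hf : MemLp f P := hu.memLp.eval_piLp i
  have hF : MemLp F P := hu.memLp_fracLap.eval_piLp i
  have hK := integrable_rieszDiff hn hσ hσ1 h
  have hfh : MemLp (fun x => f (x - h)) P :=
    hf.comp_measurePreserving (measurePreserving_sub_right volume h)
  have key : ∀ δ : ℝ, 0 < δ → eLpNorm (fun x => f x - f (x - h)) P ≤
      2 * eLpNorm (conv (heat δ) f - f) P + eLpNorm (rieszDiff σ h) 1 * eLpNorm F P := by
    intro δ hδ
    have hcf : MemLp (conv (heat δ) f) P := MemLp.conv (integrable_heat hδ) hP hPt hf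
    have e1 : conv (rieszDiff σ h) (conv (heat δ) F) =ᵐ[volume]
        fun x => conv (heat δ) f x - conv (heat δ) f (x - h) := by
      have e2 : conv (heat δ) F = conv (fracHeat σ δ) f :=
        funext fun x => (hu.isFracLap.conv_heat hδ i x).2
      have e3 := conv_rieszDiff_fracLap hn hσ hσ1 (heatTest hδ (0 : Vec n)) h
      have e4 : ((heatTest hδ (0 : Vec n) : 𝓢(Vec n, ℝ)) : Vec n → ℝ) = heat δ := by
        ext x
        change heat δ (0 - x) = _
        rw [zero_sub, heat_neg]
      rw [e4] at e3
      have e5 : conv (rieszDiff σ h) (fracHeat σ δ) = fun x => heat δ x - heat δ (x - h) := e3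
      rw [e2]
      refine (conv_conv hK (integrable_fracHeat hn hσ (by linarith) hδ) hP hPt hf).trans ?_
      rw [e5]
      have hm := integrable_heat (n := n) hδ
      have hsub := (measurePreserving_sub_right volume h).quasiMeasurePreserving.ae
        (ae_integrable_conv hm hP hPt hf)
      filter_upwards [ae_integrable_conv hm hP hPt hf, hsub] with x hx hx'
      simp only [conv]; rw [← integral_sub hx hx']
      congr 1; ext y; rw [sub_right_comm x h y]
      ring
    refine (eLpNorm_sub_shift_le_add hP hf hcf h).trans ?_
    rw [← eLpNorm_congr_ae e1]; gcongr
    refine (eLpNorm_conv_le hK.1 (aestronglyMeasurable_conv (integrable_heat hδ).1 hF.1)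
      hP hPt).trans ?_
    gcongr
    exact eLpNorm_conv_heat_le hδ hF.1 hP hPt
  have ht := ((ENNReal.Tendsto.const_mul (a := 2) (tendsto_conv_heat hP hPt hf)
    (Or.inr (by norm_num))).add_const (eLpNorm (rieszDiff σ h) 1 * eLpNorm F P))
  rw [mul_zero, zero_add] at ht
  exact ge_of_tendsto ht (by filter_upwards [self_mem_nhdsWithin] with δ hδ using key δ hδ)

end

section

/-! ### The singular bond weight -/

lemma integrable_rpow_mul_min (hn : 0 < n) {η : ℝ} (hη : 0 < η) :
    Integrable fun h : Vec n => ‖h‖ ^ (-(n : ℝ)) * min (‖h‖ ^ η) (‖h‖ ^ (-η)) := by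
  have : Nonempty (Fin n) := ⟨⟨0, hn⟩⟩
  have hf : Measurable fun r : ℝ => r ^ (-(n : ℝ)) * min (r ^ η) (r ^ (-η)) := by fun_prop
  rw [integrable_fun_norm_addHaar (volume : Measure (Vec n))
    (f := fun r : ℝ => r ^ (-(n : ℝ)) * min (r ^ η) (r ^ (-η))), finrank_euclideanSpace_fin]
  have e : ∀ r ∈ Ioi (0 : ℝ), r ^ (n - 1) • (r ^ (-(n : ℝ)) * min (r ^ η) (r ^ (-η))) =
      min (r ^ (η - 1)) (r ^ (-η - 1)) := fun r hr => by
    have hr0 : 0 < r := hr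
    have h1 : r ^ (n - 1) * r ^ (-(n : ℝ)) = r⁻¹ := by
      rw [← Real.rpow_natCast, ← rpow_add hr0, ← Real.rpow_neg_one, Nat.cast_sub hn]
      congr 1; push_cast; ring
    rw [smul_eq_mul, ← mul_assoc, h1, Real.rpow_sub_one hr0.ne', Real.rpow_sub_one hr0.ne',
      mul_min_of_nonneg _ _ (inv_nonneg.2 hr0.le), div_eq_inv_mul, div_eq_inv_mul]
  refine IntegrableOn.congr_fun ?_ (fun r hr => (e r hr).symm) measurableSet_Ioi
  have hm : Measurable fun r : ℝ => min (r ^ (η - 1)) (r ^ (-η - 1)) := by fun_prop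
  rw [← Set.Ioc_union_Ioi_eq_Ioi zero_le_one]
  refine IntegrableOn.union ?_ ?_
  · have h1 : IntegrableOn (fun r : ℝ => r ^ (η - 1)) (Ioc 0 1) :=
      (intervalIntegrable_iff_integrableOn_Ioc_of_le zero_le_one).1
        (intervalIntegral.intervalIntegrable_rpow' (by linarith))
    refine h1.mono' hm.aestronglyMeasurable ?_
    filter_upwards [ae_restrict_mem measurableSet_Ioc] with r hr
    have := hr.1
    rw [norm_of_nonneg (by positivity)]
    exact min_le_left _ _
  · refine (integrableOn_Ioi_rpow_of_lt (by linarith : -η - 1 < -1) zero_lt_one).mono'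
      hm.aestronglyMeasurable ?_
    filter_upwards [ae_restrict_mem measurableSet_Ioi] with r hr
    have : (0 : ℝ) < r := zero_lt_one.trans hr
    rw [norm_of_nonneg (by positivity)]
    exact min_le_right _ _

/-- The weight `hᵢ hⱼ / |h|^{n+2s+2}`. -/
def bondWeight (s : ℝ) (i j : Fin n) (h : Vec n) : ℝ := h i * h j * ‖h‖ ^ (-((n : ℝ) + 2 * s + 2))

@[fun_prop]
lemma measurable_bondWeight (s : ℝ) (i j : Fin n) : Measurable (bondWeight s i j : Vec n → ℝ) := by
  unfold bondWeight; fun_prop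

lemma abs_bondWeight_le (s : ℝ) (i j : Fin n) {h : Vec n} (hh : h ≠ 0) :
    |bondWeight s i j h| ≤ ‖h‖ ^ (-(n : ℝ) - 2 * s) := by
  have h0 := norm_pos_iff.2 hh
  rw [bondWeight, abs_mul, abs_mul, abs_of_nonneg (Real.rpow_nonneg h0.le _)]
  calc |h i| * |h j| * ‖h‖ ^ (-((n : ℝ) + 2 * s + 2)) ≤
      ‖h‖ * ‖h‖ * ‖h‖ ^ (-((n : ℝ) + 2 * s + 2)) := by gcongr <;> exact abs_coord_le_norm h _
    _ = _ := by
      rw [← sq, ← Real.rpow_two, ← rpow_add h0]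
      congr 1; ring

lemma lintegral_bondWeight_mul_lt_top (hn : 0 < n) (s : ℝ) (i j : Fin n) {η : ℝ} (hη : 0 < η)
    (hC : 0 ≤ C) {G : Vec n → ℝ≥0∞}
    (h1 : ∀ h, G h ≤ ofReal (C * ‖h‖ ^ (2 * s + η)))
    (h2 : ∀ h, G h ≤ ofReal (C * ‖h‖ ^ (2 * s - η))) :
    ∫⁻ h, ‖bondWeight s i j h‖ₑ * G h < ∞ := by
  refine lt_of_le_of_lt (lintegral_mono_ae ?_)
    ((integrable_rpow_mul_min hn hη).const_mul C).lintegral_lt_top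
  filter_upwards [ae_ne_zero hn] with h hh
  have h0 := norm_pos_iff.2 hh
  have e : ∀ θ : ℝ, ‖h‖ ^ (-(n : ℝ) - 2 * s) * (C * ‖h‖ ^ (2 * s + θ)) =
      C * (‖h‖ ^ (-(n : ℝ)) * ‖h‖ ^ θ) := fun θ => by
    rw [mul_left_comm, ← rpow_add h0, ← rpow_add h0]
    congr 2; ring
  calc ‖bondWeight s i j h‖ₑ * G h ≤ ofReal (‖h‖ ^ (-(n : ℝ) - 2 * s)) *
        ofReal (min (C * ‖h‖ ^ (2 * s + η)) (C * ‖h‖ ^ (2 * s + -η))) := by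
        rw [← ofReal_norm, norm_eq_abs, ENNReal.ofReal_min]; gcongr
        · exact abs_bondWeight_le s i j hh
        · exact le_min (h1 h) (h2 h)
    _ = _ := by
      rw [← ofReal_mul (by positivity), mul_min_of_nonneg _ _ (by positivity), e, e,
        ← mul_min_of_nonneg _ _ hC, ← mul_min_of_nonneg _ _ (by positivity)]

lemma integrable_bondWeight_smul (hn : 0 < n) (s : ℝ) (i j : Fin n) {η : ℝ} (hη : 0 < η)
    (hC : 0 ≤ C) {E : Type*} [NormedAddCommGroup E] [NormedSpace ℝ E]
    {g : Vec n × Vec n → E} (hg : AEStronglyMeasurable g)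
    (h1 : ∀ h, ∫⁻ x, ‖g (h, x)‖ₑ ≤ ofReal (C * ‖h‖ ^ (2 * s + η)))
    (h2 : ∀ h, ∫⁻ x, ‖g (h, x)‖ₑ ≤ ofReal (C * ‖h‖ ^ (2 * s - η))) :
    Integrable fun q => bondWeight s i j q.1 • g q := by
  have hm : AEStronglyMeasurable fun q : Vec n × Vec n => bondWeight s i j q.1 • g q :=
    ((measurable_bondWeight s i j).comp measurable_fst).aestronglyMeasurable.smul hg
  refine ⟨hm, ?_⟩
  rw [hasFiniteIntegral_iff_enorm, Measure.volume_eq_prod, lintegral_prod _ hm.enorm]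
  simp only [enorm_smul]; simp only [lintegral_const_mul' _ _ enorm_ne_top]
  exact lintegral_bondWeight_mul_lt_top hn s i j hη hC h1 h2

lemma measurePreserving_sub_fst :
    MeasurePreserving (fun q : Vec n × Vec n => (q.1 - q.2, q.1)) := by
  have h := ((Measure.measurePreserving_neg (volume : Measure (Vec n))).prod
    (MeasurePreserving.id volume)).comp ((measurePreserving_sub_prod
      (volume : Measure (Vec n)) (volume : Measure (Vec n))).comp Measure.measurePreserving_swap)
  rw [Measure.volume_eq_prod]
  convert h using 2 with q
  simp

lemma bondIntegrand_eq (hs : 0 ≤ s) (B : Vec n → Vec n → ℝ) (δu δφ : Vec n → Vec n → Vec n)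
    (q : Vec n × Vec n) : bondIntegrand s B δu δφ q = B q.1 q.2 *
      ∑ j, ∑ i, bondWeight s i j (q.1 - q.2) * (δu q.1 q.2 j * δφ q.1 q.2 i) := by
  set h := q.1 - q.2 with hh
  have e : (‖h‖ ^ ((n : ℝ) + 2 * s))⁻¹ * (‖h‖⁻¹ * ‖h‖⁻¹) = ‖h‖ ^ (-((n : ℝ) + 2 * s + 2)) := by
    rcases eq_or_ne h 0 with h0 | h0
    · have : -((n : ℝ) + 2 * s + 2) ≠ 0 := by
        have := (Nat.cast_nonneg n : (0 : ℝ) ≤ n)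
        linarith
      rw [h0, norm_zero, Real.zero_rpow this, inv_zero, mul_zero, mul_zero]
    · have h0 := norm_pos_iff.2 h0
      rw [← rpow_neg h0.le, ← mul_inv, ← sq, ← Real.rpow_two, ← rpow_neg h0.le, ← rpow_add h0]
      congr 1; ring
  simp only [bondIntegrand, inner_smul_right, inner_eq_sum, bondWeight, ← hh, ← e]
  rw [show ∀ b c d x y : ℝ, b / d * (c * x * (c * y)) = b * (d⁻¹ * (c * c) * (x * y)) by
    intros; ring, Finset.sum_mul_sum]
  simp only [mul_sum]
  refine sum_congr rfl fun j _ => sum_congr rfl fun i _ => ?_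
  ring

lemma measurable_rieszDiff_kernel (σ : ℝ) (hf : Measurable f) :
    Measurable fun v : (Vec n × Vec n) × Vec n => rieszDiff σ v.1.1 (v.1.2 - v.2) * f v.2 := by
  have h1 : Measurable fun v : (Vec n × Vec n) × Vec n => (v.1.1, v.1.2 - v.2) := by fun_prop
  have h2 := (measurable_rieszDiff (n := n) σ).comp h1
  exact h2.mul (hf.comp measurable_snd)

lemma aestronglyMeasurable_conv_rieszDiff (σ : ℝ) (hf : AEStronglyMeasurable f) :
    AEStronglyMeasurable fun w : Vec n × Vec n => conv (rieszDiff σ w.1) f w.2 := by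
  obtain ⟨f', hf', e⟩ := hf
  have e' : (fun w : Vec n × Vec n => conv (rieszDiff σ w.1) f w.2) =
      fun w => conv (rieszDiff σ w.1) f' w.2 := by
    ext w; exact congrFun (conv_congr_right e) _
  rw [e']
  exact ((measurable_rieszDiff_kernel σ hf'.measurable).stronglyMeasurable.integral_prod_right'
    (ν := volume)).aestronglyMeasurable

lemma ae_integrable_rieszDiff (hn : 0 < n) (hσ : 0 < σ) (hσ1 : σ < 1)
    (hP : 1 ≤ P) (hPt : P ≠ ∞) (hf : MemLp f P) :
    ∀ᵐ w : Vec n × Vec n, Integrable fun z => rieszDiff σ w.1 (w.2 - z) * f z := by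
  obtain ⟨f', hf', e⟩ := hf.1
  have hm := (measurable_rieszDiff_kernel σ hf'.measurable).stronglyMeasurable
  have hs : MeasurableSet {w : Vec n × Vec n |
      Integrable fun z => rieszDiff σ w.1 (w.2 - z) * f' z} := measurableSet_integrable hm
  have h2 : ∀ᵐ w : Vec n × Vec n, w ∈ {w : Vec n × Vec n |
      Integrable fun z => rieszDiff σ w.1 (w.2 - z) * f' z} := by
    rw [Measure.volume_eq_prod, Measure.ae_prod_mem_iff_ae_ae_mem hs]
    refine ae_of_all _ fun h => ?_
    have h3 := ae_integrable_conv (integrable_rieszDiff hn hσ hσ1 h) hP hPt (hf.ae_eq e)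
    filter_upwards [h3] with x hx
    exact hx
  filter_upwards [h2] with w hw
  refine Integrable.congr hw ?_
  filter_upwards [e] with z hz
  rw [hz]

lemma rieszPotentialDiff_ae (hn : 0 < n) (hσ : 0 < σ) (hσ1 : σ < 1)
    (hP : 1 ≤ P) (hPt : P ≠ ∞) {F : Vec n → Vec n} (hF : MemLp F P) :
    ∀ᵐ q : Vec n × Vec n, ∀ j, rieszPotentialDiff σ F q.1 q.2 j =
      conv (rieszDiff σ (q.1 - q.2)) (fun z => F z j) q.1 := by
  have h := ae_all_iff.2 fun j => ae_integrable_rieszDiff hn hσ hσ1 hP hPt (hF.eval_piLp j)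
  have hσn : σ < n := hσ1.trans_le (by exact_mod_cast hn)
  filter_upwards [measurePreserving_sub_fst.quasiMeasurePreserving.ae h] with q hq j
  have e : ∀ z, rieszConst n σ • (‖q.1 - z‖ ^ (σ - (n : ℝ)) - ‖q.2 - z‖ ^ (σ - (n : ℝ))) • F z =
      rieszDiff σ (q.1 - q.2) (q.1 - z) • F z := fun z => by
    rw [smul_smul, rieszDiff, show q.1 - z - (q.1 - q.2) = q.2 - z by abel]
  rw [rieszPotentialDiff, ← integral_smul]; simp only [e]
  have hi : Integrable fun z => rieszDiff σ (q.1 - q.2) (q.1 - z) • F z :=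
    Integrable.of_eval_piLp fun j => by simpa using hq j
  rw [eval_integral_piLp hi.eval_piLp j]; rfl

end

section

/-! ### The Fourier symbol of the bond form -/

/-- `|1 - exp(2πi h·ξ)|²`, the symbol of a second difference. -/
def gap (h ξ : Vec n) : ℝ := 2 - 2 * Real.cos (2 * π * inner ℝ h ξ)

lemma gap_nonneg (h ξ : Vec n) : 0 ≤ gap h ξ := by
  unfold gap
  linarith [Real.cos_le_one (2 * π * inner ℝ h ξ)]

lemma continuous_gap : Continuous fun q : Vec n × Vec n => gap q.1 q.2 := by unfold gap; fun_prop

lemma gap_eq (h ξ : Vec n) : (gap h ξ : ℂ) = (1 - wave h ξ) * (1 - wave (-h) ξ) := by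
  have h1 : wave h ξ * wave (-h) ξ = 1 := by rw [← wave_add, add_neg_cancel]; simp [wave]
  have h2 : wave h ξ + wave (-h) ξ = 2 * (Real.cos (2 * π * inner ℝ h ξ) : ℂ) := by
    simp only [wave, inner_neg_left, mul_neg, Complex.ofReal_neg, Complex.ofReal_cos,
      Complex.two_cos]
  rw [gap]
  push_cast at h2 ⊢
  linear_combination -h1 + h2

lemma gap_le {β : ℝ} (hβ : 0 ≤ β) (hβ2 : β ≤ 2) (h ξ : Vec n) :
    gap h ξ ≤ 4 * (fracSymbol β ξ * ‖h‖ ^ β) := by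
  set y := 2 * π * ‖ξ‖ * ‖h‖ with hy
  have hy0 : 0 ≤ y := by positivity
  have e : fracSymbol β ξ * ‖h‖ ^ β = y ^ β := (mul_rpow (by positivity) (norm_nonneg _)).symm
  rw [e, gap]
  set θ := 2 * π * inner ℝ h ξ
  have hθ : |θ| ≤ y := by
    rw [abs_mul, abs_of_pos Real.two_pi_pos, hy, mul_assoc _ ‖ξ‖, mul_comm ‖ξ‖]; gcongr
    exact abs_real_inner_le_norm h ξ
  rcases le_total y 1 with h1 | h1
  · have h2 := Real.one_sub_sq_div_two_le_cos (x := θ)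
    have h3 : θ ^ 2 ≤ y ^ 2 := by rw [← sq_abs θ]; gcongr
    have h4 : y ^ 2 ≤ y ^ β := by
      rcases eq_or_lt_of_le hy0 with h0 | h0
      · rw [← h0, zero_pow two_ne_zero]; positivity
      · rw [← Real.rpow_two]
        exact Real.rpow_le_rpow_of_exponent_ge h0 h1 hβ2
    have := Real.rpow_nonneg hy0 β
    linarith
  · have h2 := Real.one_le_rpow h1 hβ
    linarith [Real.neg_one_le_cos θ]

lemma integral_mul_gap (hk : Integrable k) (ξ : Vec n) :
    ∫ h, k h * gap h ξ = 2 * (∫ h, k h) - 2 * (ft k ξ).re := by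
  have hi := integrable_wave_neg_mul hk ξ
  have e : (ft k ξ).re = ∫ h, k h * Real.cos (2 * π * inner ℝ h ξ) := by
    rw [ft, fourier_eq_wave]
    refine (integral_re hi).symm.trans (integral_congr_all fun h => ?_)
    simp [wave_re, mul_comm]
  have hc : Integrable fun h => k h * Real.cos (2 * π * inner ℝ h ξ) :=
    hk.mul_bdd (c := 1) (by fun_prop) (ae_of_all _ fun h => by
      rw [norm_eq_abs]; exact Real.abs_cos_le_one _)
  rw [e, ← integral_const_mul, ← integral_const_mul, ← integral_sub (hk.const_mul 2)
    (hc.const_mul 2)]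
  congr 1; ext h; rw [gap]; ring

lemma coord_mul_heat (ht : 0 < t) (i j : Fin n) (h : Vec n) : h i * h j * heat t h =
      2 * t * (if i = j then 1 else 0) * heat t h + 4 * t ^ 2 * heatHess i j t h := by
  unfold heatHess; field_simp; ring

lemma integral_coord_mul_heat_mul_gap (ht : 0 < t) (i j : Fin n) (ξ : Vec n) :
    ∫ h, h i * h j * heat t h * gap h ξ = 4 * t * (if i = j then 1 else 0) * (1 - gauss t ξ) +
      8 * t ^ 2 * ((2 * π) ^ 2 * (ξ i * ξ j)) * gauss t ξ := by
  have hb : ∀ k : Vec n → ℝ, Integrable k → Integrable fun h => k h * gap h ξ := fun k hk =>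
    hk.mul_bdd (c := 4) (by unfold gap; fun_prop) (ae_of_all _ fun h => by
      have := gap_le le_rfl zero_le_two h ξ
      rw [norm_of_nonneg (gap_nonneg _ _)]
      simpa [fracSymbol_zero] using this)
  have h1 := integral_mul_gap (integrable_heat (n := n) ht) ξ
  have h2 := integral_mul_gap (integrable_heatHess (n := n) ht i j) ξ
  rw [ft_heat ht, integral_heat ht, Complex.ofReal_re] at h1
  rw [ft_heatHess ht, integral_heatHess ht, Complex.ofReal_re] at h2
  simp only [coord_mul_heat ht i j, add_mul, mul_assoc _ _ (gap _ ξ)]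
  rw [integral_add ((hb _ (integrable_heat ht)).const_mul _)
    ((hb _ (integrable_heatHess ht i j)).const_mul _), integral_const_mul, integral_const_mul,
    h1, h2]
  ring

/-- The constant by which `|h|^{-n-2s-2}` is the average of the heat kernels `t^{-s-2} p_t(h)`. -/
def bondConst (n : ℕ) (s : ℝ) : ℝ :=
  (4 * π) ^ (-(n : ℝ) / 2) * 4 ^ ((n : ℝ) / 2 + s + 1) * Gamma ((n : ℝ) / 2 + s + 1)

/-- The coefficient of the identity in the symbol of the bond form. -/
def symbolConst (n : ℕ) (s : ℝ) : ℝ :=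
  4 * (∫ t in Ioi 0, t ^ (-s - 1) * (1 - exp (-t))) / bondConst n s

/-- The coefficient of `ξ ⊗ ξ / |ξ|²` in the symbol of the bond form. -/
def symbolConst' (n : ℕ) (s : ℝ) : ℝ := 8 * Gamma (1 - s) / bondConst n s

lemma bondConst_pos (hs : 0 < s) : 0 < bondConst n s := by
  have := Real.Gamma_pos_of_pos (by positivity : 0 < (n : ℝ) / 2 + s + 1)
  unfold bondConst; positivity

lemma integral_rpow_mul_one_sub_gauss (s : ℝ) (hξ : ξ ≠ 0) :
    ∫ t in Ioi 0, t ^ (-s - 1) * (1 - gauss t ξ) =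
      (∫ t in Ioi 0, t ^ (-s - 1) * (1 - exp (-t))) * fracSymbol (2 * s) ξ := by
  have h0 := norm_pos_iff.2 hξ
  set l := (2 * π * ‖ξ‖) ^ 2 with hl
  have hl0 : 0 < l := by positivity
  have e : ∀ t ∈ Ioi (0 : ℝ), t ^ (-s - 1) * (1 - gauss t ξ) = l ^ (s + 1) *
      (fun t : ℝ => t ^ (-s - 1) * (1 - exp (-t))) (l * t) := fun t ht => by
    have ht0 : 0 < t := ht
    simp only [gauss, ← hl]
    rw [mul_rpow hl0.le ht0.le, show -s - 1 = -(s + 1) by ring, rpow_neg hl0.le, mul_comm t l]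
    have : l ^ (s + 1) ≠ 0 := by positivity
    field_simp
  have e2 : fracSymbol (2 * s) ξ = l ^ s := by
    rw [fracSymbol, hl, ← Real.rpow_two, ← rpow_mul (by positivity)]
  rw [setIntegral_congr_fun measurableSet_Ioi e, integral_const_mul,
    integral_comp_mul_left_Ioi (fun t : ℝ => t ^ (-s - 1) * (1 - exp (-t))) 0 hl0,
    mul_zero, smul_eq_mul, e2, Real.rpow_add_one hl0.ne']
  field_simp

/-- The symbol of the bond form, `∫ hᵢhⱼ|h|^{-n-2s-2} |1 - exp(2πi h·ξ)|² dh`, computed by writing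
the weight as an average of Gaussians. -/
lemma integral_bondWeight_mul_gap (hn : 0 < n) (hs0 : 0 < s) (hs1 : s < 1) (i j : Fin n)
    (hξ : ξ ≠ 0) : ∫ h, bondWeight s i j h * gap h ξ =
      (symbolConst n s * (if i = j then 1 else 0) + symbolConst' n s * (ξ i * ξ j / ‖ξ‖ ^ 2)) *
        fracSymbol (2 * s) ξ := by
  have hc := bondConst_pos (n := n) hs0
  set c := bondConst n s with hcd
  have hx0 := norm_pos_iff.2 hξ
  set η := min s (1 - s) with hη
  have hη0 : 0 < η := lt_min hs0 (by linarith)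
  have hη1 : η ≤ s := min_le_left _ _
  have hη2 : η ≤ 1 - s := min_le_right _ _
  have hi : Integrable fun h => bondWeight s i j h * gap h ξ := by
    refine ⟨((measurable_bondWeight s i j).aestronglyMeasurable).mul (by unfold gap; fun_prop), ?_⟩
    rw [hasFiniteIntegral_iff_enorm]; simp only [enorm_mul]
    have hb : ∀ β : ℝ, 0 ≤ β → β ≤ 2 → fracSymbol β ξ ≤
        fracSymbol (2 * s + η) ξ + fracSymbol (2 * s - η) ξ → ∀ h : Vec n, ‖gap h ξ‖ₑ ≤
        ofReal (4 * (fracSymbol (2 * s + η) ξ + fracSymbol (2 * s - η) ξ) * ‖h‖ ^ β) :=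
      fun β h0 h2 hle h => by
        rw [Real.enorm_of_nonneg (gap_nonneg _ _), mul_assoc]
        refine ofReal_le_ofReal ((gap_le h0 h2 h ξ).trans ?_)
        gcongr
    have p1 := fracSymbol_nonneg (2 * s + η) ξ
    have p2 := fracSymbol_nonneg (2 * s - η) ξ
    exact lintegral_bondWeight_mul_lt_top hn s i j hη0 (by positivity)
      (hb _ (by linarith) (by linarith) (by linarith))
      (hb _ (by linarith) (by linarith) (by linarith))
  have hw : ∀ h : Vec n, h ≠ 0 → IntegrableOn (fun t : ℝ => t ^ (-s - 2) * heat t h) (Ioi 0) ∧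
      h i * h j * ∫ t in Ioi 0, t ^ (-s - 2) * heat t h = c * bondWeight s i j h :=
    fun h hh => by
      have := integral_rpow_mul_heat (m := (n : ℝ) / 2 + s + 1) (by positivity) hh
      rw [show (n : ℝ) / 2 - (n / 2 + s + 1) - 1 = -s - 2 by ring,
        show -(2 * ((n : ℝ) / 2 + s + 1)) = -((n : ℝ) + 2 * s + 2) by ring] at this
      refine ⟨this.1, ?_⟩
      rw [this.2, bondWeight, hcd, bondConst]; ring
  have hm : Measurable fun w : Vec n × ℝ =>
      w.1 i * w.1 j * gap w.1 ξ * (w.2 ^ (-s - 2) * heat w.2 w.1) := by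
    have h1 := (measurable_heat_uncurry (n := n)).comp measurable_swap
    have h2 : Measurable fun w : Vec n × ℝ => w.1 i * w.1 j * gap w.1 ξ := by unfold gap; fun_prop
    exact h2.mul ((measurable_snd.pow_const _).mul h1)
  have hI : Integrable (fun w : Vec n × ℝ =>
      w.1 i * w.1 j * gap w.1 ξ * (w.2 ^ (-s - 2) * heat w.2 w.1))
      (volume.prod (volume.restrict (Ioi 0))) := by
    rw [integrable_prod_iff hm.aestronglyMeasurable]; constructor
    · filter_upwards [ae_ne_zero hn] with h hh using (hw h hh).1.const_mul _
    · refine (hi.norm.const_mul c).congr ?_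
      filter_upwards [ae_ne_zero hn] with h hh
      have e : ∀ t ∈ Ioi (0 : ℝ), ‖h i * h j * gap h ξ * (t ^ (-s - 2) * heat t h)‖ =
          |h i * h j * gap h ξ| * (t ^ (-s - 2) * heat t h) := fun t ht => by
        have ht0 : 0 < t := ht
        have := heat_pos ht0 h
        rw [norm_mul, norm_eq_abs, norm_of_nonneg (by positivity)]
      have h3 := (hw h hh).2
      have h4 : 0 ≤ ∫ t in Ioi 0, t ^ (-s - 2) * heat t h :=
        setIntegral_nonneg measurableSet_Ioi fun t ht => by
          have ht0 : 0 < t := ht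
          have := heat_pos ht0 h
          positivity
      rw [setIntegral_congr_fun measurableSet_Ioi e, integral_const_mul, norm_mul, ← mul_assoc,
        ← norm_of_nonneg hc.le, ← norm_mul, ← h3, norm_mul, norm_of_nonneg h4, abs_mul]
      simp only [norm_eq_abs]; ring
  have e1 : c * ∫ h, bondWeight s i j h * gap h ξ =
      ∫ h, ∫ t in Ioi 0, h i * h j * gap h ξ * (t ^ (-s - 2) * heat t h) := by
    rw [← integral_const_mul]
    refine integral_congr_ae ?_
    filter_upwards [ae_ne_zero hn] with h hh
    rw [integral_const_mul, ← mul_assoc, ← (hw h hh).2]; ring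
  set d : ℝ := if i = j then 1 else 0
  set X := (2 * π) ^ 2 * (ξ i * ξ j) with hX
  have e2 : ∀ t ∈ Ioi (0 : ℝ), ∫ h, h i * h j * gap h ξ * (t ^ (-s - 2) * heat t h) =
      4 * d * (t ^ (-s - 1) * (1 - gauss t ξ)) +
        8 * X * (t ^ (-(2 * s / 2)) * gauss t ξ) := fun t ht => by
    have ht0 : 0 < t := ht
    have h1 : t ^ (-s - 1) = t ^ (-s - 2) * t := by rw [← Real.rpow_add_one ht0.ne']; congr 1; ring
    have h2 : t ^ (-(2 * s / 2)) = t ^ (-s - 2) * t ^ 2 := by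
      rw [← Real.rpow_two, ← rpow_add ht0]; congr 1; ring
    rw [h1, h2, show (fun h : Vec n => h i * h j * gap h ξ * (t ^ (-s - 2) * heat t h)) =
      fun h => t ^ (-s - 2) * (h i * h j * heat t h * gap h ξ) by ext h; ring,
      integral_const_mul, integral_coord_mul_heat_mul_gap ht0]
    ring
  obtain ⟨g1, g2⟩ := integral_rpow_mul_gauss (ε := 2 * s) (by linarith) hξ
  have hsum : IntegrableOn (fun t => ∫ h : Vec n, h i * h j * gap h ξ * (t ^ (-s - 2) * heat t h))
      (Ioi 0) := hI.integral_prod_right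
  have h5 := hsum.congr_fun e2 measurableSet_Ioi
  have h6 : IntegrableOn (fun t : ℝ => 4 * d * (t ^ (-s - 1) * (1 - gauss t ξ))) (Ioi 0) := by
    refine (h5.sub (g1.const_mul (8 * X))).congr (ae_of_all _ fun t => ?_)
    simp only [Pi.sub_apply]; ring
  rw [integral_integral_swap hI, setIntegral_congr_fun measurableSet_Ioi e2,
    integral_add h6 (g1.const_mul _), integral_const_mul, integral_const_mul, g2,
    integral_rpow_mul_one_sub_gauss s hξ, mul_div_cancel_left₀ s two_ne_zero] at e1
  have e3 : fracSymbol (2 * s) ξ = fracSymbol (2 * s - 2) ξ * (2 * π * ‖ξ‖) ^ 2 := by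
    rw [← fracSymbol_two, ← fracSymbol_add hξ, sub_add_cancel]
  rw [symbolConst, symbolConst', ← hcd]
  have e4 : fracSymbol (2 * s - 2) ξ * X = fracSymbol (2 * s) ξ * (ξ i * ξ j / ‖ξ‖ ^ 2) := by
    rw [e3, hX]; field_simp
  refine mul_left_cancel₀ hc.ne' (e1.trans ?_)
  generalize fracSymbol (2 * s) ξ = Y, ξ i * ξ j / ‖ξ‖ ^ 2 = Z at e4 ⊢
  rw [show ∀ K Γ : ℝ, c * ((4 * K / c * d + 8 * Γ / c * Z) * Y) = 4 * K * d * Y + 8 * Γ * Z * Y by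
    intros; field_simp]
  linear_combination 8 * Gamma (1 - s) * e4

end

section

/-! ### The bond form of a Riesz potential -/

section

variable {s₁ s₂ : ℝ}

lemma exists_eLpNorm_shift_schwartz_le (hn : 0 < n) (hσ : 0 < σ) (hσ1 : σ < 1)
    (hQ : 1 ≤ Q) (hQt : Q ≠ ∞) (ψ : 𝓢(Vec n, ℝ)) : ∃ C : ℝ, 0 ≤ C ∧ ∀ h,
      eLpNorm (fun x => ψ x - ψ (x - h)) Q ≤ ofReal (C * ‖h‖ ^ σ) := by
  obtain ⟨C, hC, H⟩ := exists_eLpNorm_rieszDiff_le hn hσ hσ1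
  have hm := memLp_fracLap hn hσ (by linarith) ψ hQ hQt
  refine ⟨C * (eLpNorm (fracLap σ ψ) Q).toReal, by positivity, fun h => ?_⟩
  rw [← conv_rieszDiff_fracLap hn hσ hσ1 ψ h]
  refine (eLpNorm_conv_le (integrable_rieszDiff hn hσ hσ1 h).1 hm.1 hQ hQt).trans ?_
  rw [mul_right_comm, ofReal_mul (by positivity), ENNReal.ofReal_toReal hm.eLpNorm_ne_top]; gcongr
  exact H h

lemma exists_margin (hs₂ : 0 < s₂) (hs₂' : s₂ < 1) : ∃ η, 0 < η ∧ η < s₂ ∧ η < 1 - s₂ := by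
  obtain ⟨η, h0, h⟩ := exists_between (lt_min hs₂ (sub_pos.2 hs₂'))
  exact ⟨η, h0, lt_min_iff.1 h⟩

/-- Near the diagonal the differences beat the weight because `σ > s₂` is allowed in the
hypothesis, away from it because `σ < s₂` is. -/
lemma integrable_bondWeight_mul [HolderConjugate P Q] (hn : 0 < n) (hs₂ : 0 < s₂)
    (hs₂' : s₂ < 1) (hs : s₁ + s₂ = 2 * s) (i j : Fin n) {a b : Vec n × Vec n → ℝ}
    (ha : AEStronglyMeasurable a) (hb : AEStronglyMeasurable b)
    (ha' : ∀ h, AEStronglyMeasurable fun x => a (h, x))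
    (hb' : ∀ h, AEStronglyMeasurable fun x => b (h, x))
    (H : ∀ σ, 0 < σ → σ < 1 → ∃ C : ℝ, 0 ≤ C ∧ ∀ h,
      eLpNorm (fun x => a (h, x)) P * eLpNorm (fun x => b (h, x)) Q ≤ ofReal (C * ‖h‖ ^ (s₁ + σ))) :
    Integrable fun q : Vec n × Vec n => bondWeight s i j q.1 * (a q * b q) := by
  obtain ⟨η, h0, h1, h2⟩ := exists_margin hs₂ hs₂'
  obtain ⟨C₁, hC₁, H₁⟩ := H (s₂ + η) (by linarith) (by linarith)
  obtain ⟨C₂, hC₂, H₂⟩ := H (s₂ - η) (by linarith) (by linarith)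
  rw [← add_assoc, hs] at H₁; rw [← add_sub_assoc, hs] at H₂
  have key : ∀ h, ∫⁻ x, ‖a (h, x) * b (h, x)‖ₑ ≤
      eLpNorm (fun x => a (h, x)) P * eLpNorm (fun x => b (h, x)) Q := fun h => by
    simp only [enorm_mul]
    exact lintegral_mul_le_eLpNorm (ha' h) (hb' h) P Q
  refine integrable_bondWeight_smul hn s i j h0 (add_nonneg hC₁ hC₂) (ha.mul hb)
    (fun h => (key h).trans ((H₁ h).trans (ofReal_le_ofReal ?_)))
    (fun h => (key h).trans ((H₂ h).trans (ofReal_le_ofReal ?_)))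
  · gcongr; linarith
  · gcongr; linarith

lemma conv_rieszDiff_shift (hn : 0 < n) (hs₁ : 0 < s₁) (hs₁' : s₁ < 1) (ψ : 𝓢(Vec n, ℝ))
    (h : Vec n) : conv (fun x => rieszDiff s₁ h (-x)) (fun x => ψ x - ψ (x - h)) =
      multiplierOp (fun ξ => ((gap h ξ * fracSymbol (-s₁) ξ : ℝ) : ℂ)) ψ := by
  have e : (fun x => rieszDiff s₁ h (-x)) = rieszDiff s₁ (-h) := funext (rieszDiff_neg s₁ h)
  rw [e, sub_shift_eq_multiplierOp, conv_multiplierOp (integrable_rieszDiff hn hs₁ hs₁' _)]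
  · ext x; simp only [multiplierOp_eq]; congr 1
    refine integral_congr_ae ?_
    filter_upwards [ae_ne_zero hn] with ξ hξ
    rw [ft_rieszDiff hn hs₁ hs₁' _ hξ, neg_neg, Complex.ofReal_mul, gap_eq]; ring
  · exact (integrable_ft_schwartz ψ).bdd_mul (c := 2)
      (continuous_const.sub (continuous_wave_right (-h))).aestronglyMeasurable
      (ae_of_all _ fun ξ => norm_one_sub_wave_le _ _)

/-- Integrating the second differences of `I^{s₁} ψ` against the bond weight gives a multiple of
`(-Δ)^{s₂/2} ψ` and a multiple of its second order Riesz transform. -/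
lemma integral_bondWeight_mul_multiplierOp (hn : 0 < n) (hs₁ : 0 < s₁) (hs₁' : s₁ < 1)
    (hs₂ : 0 < s₂) (hs₂' : s₂ < 1) (hs : s₁ + s₂ = 2 * s) (i j : Fin n) (ψ : 𝓢(Vec n, ℝ))
    (z : Vec n) : ∫ h, bondWeight s i j h *
        multiplierOp (fun ξ => ((gap h ξ * fracSymbol (-s₁) ξ : ℝ) : ℂ)) ψ z =
      symbolConst n s * (if i = j then 1 else 0) * fracLap s₂ ψ z - symbolConst' n s *
        multiplierOp (fun ξ => rieszSymbol i ξ * rieszSymbol j ξ * fracSymbol s₂ ξ) ψ z := by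
  have hn0 : (0 : ℝ) ≤ n := Nat.cast_nonneg n
  set g : Vec n × Vec n → ℂ := fun q =>
    wave z q.2 * (((gap q.1 q.2 * fracSymbol (-s₁) q.2 : ℝ) : ℂ) * ft ψ q.2)
  obtain ⟨η, h0, h1, h2⟩ := exists_margin hs₂ hs₂'
  have hg : Measurable g := by
    have m {E : Type} [MeasurableSpace E] {f : Vec n → E} (hf : Measurable f) :
        Measurable fun q : Vec n × Vec n => f q.2 := hf.comp measurable_snd
    exact (m (continuous_wave_right z).measurable).mul ((Complex.measurable_ofReal.comp
      (continuous_gap.measurable.mul (m (measurable_fracSymbol _)))).mul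
        (m (continuous_ft ψ.integrable).measurable))
  have hbd : ∀ β : ℝ, s₁ ≤ β → β ≤ 2 → ∃ C : ℝ, 0 ≤ C ∧ ∀ h, ∫⁻ ξ, ‖g (h, ξ)‖ₑ ≤
      ofReal (C * ‖h‖ ^ β) := fun β hβ hβ2 => by
    have hi := integrable_fracSymbol_mul_ft hn (r := β - s₁) (by
      have : (1 : ℝ) ≤ n := by exact_mod_cast hn
      linarith) ψ
    refine ⟨4 * ∫ ξ, ‖(fracSymbol (β - s₁) ξ : ℂ) * ft ψ ξ‖, by positivity, fun h => ?_⟩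
    rw [mul_right_comm, ofReal_mul (by positivity),
      ofReal_integral_norm_eq_lintegral_enorm hi, ← lintegral_const_mul' _ _ ofReal_ne_top]
    refine lintegral_mono_ae ?_
    filter_upwards [ae_ne_zero hn] with ξ hξ
    have en : ∀ r : ℝ, 0 ≤ r → ‖(r : ℂ)‖ₑ = ofReal r := fun r hr => by
      rw [← ofReal_norm, Complex.norm_of_nonneg hr]
    have p := fracSymbol_nonneg (-s₁) ξ
    simp only [g, enorm_mul]
    rw [← ofReal_norm (wave z ξ), norm_wave, ENNReal.ofReal_one, one_mul,
      ← mul_assoc (ofReal _), en _ (mul_nonneg (gap_nonneg h ξ) p),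
      en _ (fracSymbol_nonneg _ ξ), ← ofReal_mul (by positivity)]
    refine mul_le_mul' (ofReal_le_ofReal ?_) le_rfl
    rw [sub_eq_add_neg, fracSymbol_add hξ]
    have := gap_le (hs₁.le.trans hβ) hβ2 h ξ
    calc _ ≤ 4 * (fracSymbol β ξ * ‖h‖ ^ β) * fracSymbol (-s₁) ξ := by gcongr
      _ = _ := by ring
  obtain ⟨C₁, hC₁, H₁⟩ := hbd (2 * s + η) (by linarith) (by linarith)
  obtain ⟨C₂, hC₂, H₂⟩ := hbd (2 * s - η) (by linarith) (by linarith)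
  have hI := integrable_bondWeight_smul hn s i j h0 (add_nonneg hC₁ hC₂) hg.aestronglyMeasurable
    (fun h => (H₁ h).trans (ofReal_le_ofReal (by gcongr; linarith)))
    (fun h => (H₂ h).trans (ofReal_le_ofReal (by gcongr; linarith)))
  have e1 : ∀ᵐ h : Vec n, bondWeight s i j h *
      multiplierOp (fun ξ => ((gap h ξ * fracSymbol (-s₁) ξ : ℝ) : ℂ)) ψ z =
      (∫ ξ, bondWeight s i j h • g (h, ξ)).re := ae_of_all _ fun h => by
    rw [multiplierOp_eq, integral_smul, Complex.smul_re, smul_eq_mul]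
  have e2 : ∀ᵐ ξ : Vec n, ∫ h, bondWeight s i j h • g (h, ξ) =
      ((symbolConst n s * (if i = j then 1 else 0) : ℝ) : ℂ) *
        (wave z ξ * (fracSymbol s₂ ξ * ft ψ ξ)) - ((symbolConst' n s : ℝ) : ℂ) *
          (wave z ξ * (rieszSymbol i ξ * rieszSymbol j ξ * fracSymbol s₂ ξ * ft ψ ξ)) := by
    filter_upwards [ae_ne_zero hn] with ξ hξ
    have e3 : ∀ h, bondWeight s i j h • g (h, ξ) = ((bondWeight s i j h * gap h ξ : ℝ) : ℂ) *
        (wave z ξ * ((fracSymbol (-s₁) ξ : ℂ) * ft ψ ξ)) := fun h => by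
      simp only [g, Complex.real_smul]; push_cast; ring
    have e4 : fracSymbol s₂ ξ = fracSymbol (2 * s) ξ * fracSymbol (-s₁) ξ := by
      rw [← fracSymbol_add hξ, ← hs]; congr 1; ring
    simp only [e3]
    rw [integral_mul_const, integral_complex_ofReal,
      integral_bondWeight_mul_gap hn (by linarith) (by linarith) i j hξ, rieszSymbol_mul i j hξ, e4]
    push_cast; ring
  have i1 := integrable_wave_mul (integrable_fracSymbol_mul_ft hn (r := s₂) (by linarith) ψ) z
  have i2 : Integrable fun ξ => wave z ξ *
      (rieszSymbol i ξ * rieszSymbol j ξ * fracSymbol s₂ ξ * ft ψ ξ) := by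
    refine integrable_wave_mul (((integrable_fracSymbol_mul_ft hn (r := s₂)
      (by linarith) ψ).bdd_mul (c := 1) ((measurable_rieszSymbol i).mul
      (measurable_rieszSymbol j)).aestronglyMeasurable (ae_of_all _ fun ξ =>
        norm_rieszSymbol_mul_le i j ξ)).congr (ae_of_all _ fun ξ => ?_)) z
    exact (mul_assoc _ _ _).symm
  rw [integral_congr_ae e1, show ∫ h, (∫ ξ, bondWeight s i j h • g (h, ξ)).re =
    (∫ h, ∫ ξ, bondWeight s i j h • g (h, ξ)).re from
    integral_re hI.integral_prod_left, integral_integral_swap hI,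
    integral_congr_ae e2, fracLap_eq, multiplierOp_eq, multiplierOp_eq,
    integral_sub (i1.const_mul _) (i2.const_mul _), integral_const_mul, integral_const_mul,
    Complex.sub_re, Complex.re_ofReal_mul, Complex.re_ofReal_mul]

end

end

section

/-! ### The bond form of a Sobolev function -/

section

variable {s₁ s₂ : ℝ}

lemma aestronglyMeasurable_shift (hf : AEStronglyMeasurable f) :
    AEStronglyMeasurable fun q : Vec n × Vec n => f q.2 - f (q.2 - q.1) :=
  hf.comp_snd.sub ((aestronglyMeasurable_comp_sub hf).comp_quasiMeasurePreserving
    (Measure.measurePreserving_swap (μ := (volume : Measure (Vec n)))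
      (ν := (volume : Measure (Vec n)))).quasiMeasurePreserving)

lemma eLpNorm_comp_neg (hf : AEStronglyMeasurable f) (P : ℝ≥0∞) :
    eLpNorm (fun x => f (-x)) P = eLpNorm f P :=
  eLpNorm_comp_measurePreserving hf (Measure.measurePreserving_neg volume)

lemma exists_mul_le_rpow {A : Vec n → ℝ≥0∞} {B : Vec n → ℝ≥0∞} {N : ℝ≥0∞} (hN : N ≠ ∞)
    {C' : ℝ} (hC : 0 ≤ C) (hs₁ : 0 < s₁) (hσ : 0 < σ)
    (hA : ∀ h, A h ≤ ofReal (C * ‖h‖ ^ s₁) * N)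
    (hB : ∀ h, B h ≤ ofReal (C' * ‖h‖ ^ σ)) (hC' : 0 ≤ C') :
    ∃ C : ℝ, 0 ≤ C ∧ ∀ h, A h * B h ≤ ofReal (C * ‖h‖ ^ (s₁ + σ)) := by
  refine ⟨C * C' * N.toReal, by positivity, fun h => (mul_le_mul' (hA h) (hB h)).trans_eq ?_⟩
  rw [Real.rpow_add_of_nonneg (norm_nonneg h) hs₁.le hσ.le,
    show C * C' * N.toReal * (‖h‖ ^ s₁ * ‖h‖ ^ σ) = C * ‖h‖ ^ s₁ * N.toReal * (C' * ‖h‖ ^ σ) by ring,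
    ofReal_mul (p := C * ‖h‖ ^ s₁ * N.toReal) (by positivity),
    ofReal_mul (p := C * ‖h‖ ^ s₁) (by positivity),
    ENNReal.ofReal_toReal hN]

section

variable (hn : 0 < n) (hs₁ : 0 < s₁) (hs₁' : s₁ < 1) (hs₂ : 0 < s₂) (hs₂' : s₂ < 1)
  (hs : s₁ + s₂ = 2 * s) (hP : 1 < P) (hPt : P ≠ ∞) (i j : Fin n)

include hn hs₁ hs₁' hs₂ hs₂' hs hP hPt

/-- The differences of `I^{s₁} f` and of `ψ`, paired through the bond weight. -/
lemma integrable_bondWeight_conv (hf : MemLp f P) (ψ : 𝓢(Vec n, ℝ)) :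
    Integrable fun q : Vec n × Vec n => bondWeight s i j q.1 *
      (conv (rieszDiff s₁ q.1) f q.2 * (ψ q.2 - ψ (q.2 - q.1))) := by
  obtain ⟨Q, _, _, hQ, hQt⟩ := exists_holderConjugate hP hPt
  have hK := fun h => integrable_rieszDiff (n := n) hn hs₁ hs₁' h
  obtain ⟨C, hC, H⟩ := exists_eLpNorm_rieszDiff_le hn hs₁ hs₁'
  refine integrable_bondWeight_mul (P := P) (Q := Q) hn hs₂ hs₂' hs i j
    (aestronglyMeasurable_conv_rieszDiff s₁ hf.1)
    (aestronglyMeasurable_shift ψ.continuous.aestronglyMeasurable)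
    (fun h => aestronglyMeasurable_conv (hK h).1 hf.1)
    (fun h => (ψ.continuous.sub (ψ.continuous.comp
      (continuous_id.sub continuous_const))).aestronglyMeasurable) fun σ hσ hσ1 => ?_
  obtain ⟨C', hC', H'⟩ := exists_eLpNorm_shift_schwartz_le hn hσ hσ1 hQ.le hQt ψ
  refine exists_mul_le_rpow hf.eLpNorm_ne_top hC.le hs₁ hσ (fun h => ?_) H' hC'
  refine (eLpNorm_conv_le (hK h).1 hf.1 hP.le hPt).trans ?_
  gcongr
  exact H h

/-- The same for the differences of `u` with `(-Δ)^{s₁/2} u = U`. -/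
lemma integrable_bondWeight_shift (hu : IsSobolevPair s₁ P u U) (ψ : 𝓢(Vec n, ℝ)) :
    Integrable fun q : Vec n × Vec n => bondWeight s i j q.1 *
      ((u q.2 j - u (q.2 - q.1) j) * (ψ q.2 - ψ (q.2 - q.1))) := by
  obtain ⟨Q, _, _, hQ, hQt⟩ := exists_holderConjugate hP hPt
  have hf := hu.memLp.eval_piLp j
  have hU := hu.memLp_fracLap.eval_piLp j
  obtain ⟨C, hC, H⟩ := exists_eLpNorm_rieszDiff_le hn hs₁ hs₁'
  refine integrable_bondWeight_mul (P := P) (Q := Q) hn hs₂ hs₂' hs i j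
    (aestronglyMeasurable_shift hf.1)
    (aestronglyMeasurable_shift ψ.continuous.aestronglyMeasurable)
    (fun h => hf.1.sub (hf.comp_measurePreserving (measurePreserving_sub_right volume h)).1)
    (fun h => (ψ.continuous.sub (ψ.continuous.comp
      (continuous_id.sub continuous_const))).aestronglyMeasurable) fun σ hσ hσ1 => ?_
  obtain ⟨C', hC', H'⟩ := exists_eLpNorm_shift_schwartz_le hn hσ hσ1 hQ.le hQt ψ
  refine exists_mul_le_rpow hU.eLpNorm_ne_top hC.le hs₁ hσ (fun h => ?_) H' hC'
  refine (hu.eLpNorm_sub_shift_le hn hs₁ hs₁' hP.le hPt j h).trans ?_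
  gcongr
  exact H h

/-- The bond form of the `i`-th component of a Riesz potential against the `j`-th component of a
test function, in terms of the symbol `(a δᵢⱼ + b ξᵢξⱼ/|ξ|²) (2π|ξ|)^{2s}`. -/
lemma integral_bondWeight_conv (hf : MemLp f P) (ψ : 𝓢(Vec n, ℝ)) :
    ∫ q : Vec n × Vec n, bondWeight s i j q.1 *
        (conv (rieszDiff s₁ q.1) f q.2 * (ψ q.2 - ψ (q.2 - q.1))) =
      symbolConst n s * (if i = j then 1 else 0) * (∫ z, f z * fracLap s₂ ψ z) -
        symbolConst' n s * ∫ z, f z *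
          multiplierOp (fun ξ => rieszSymbol i ξ * rieszSymbol j ξ * fracSymbol s₂ ξ) ψ z := by
  obtain ⟨Q, _, _, hQ, hQt⟩ := exists_holderConjugate hP hPt
  have hr : -(n : ℝ) < s₂ := by linarith [(Nat.cast_nonneg n : (0 : ℝ) ≤ n)]
  have hK := fun h => integrable_rieszDiff (n := n) hn hs₁ hs₁' h
  have hK' : ∀ h : Vec n, Integrable fun x => rieszDiff s₁ h (-x) := fun h => (hK h).comp_neg
  obtain ⟨C, hC, H⟩ := exists_eLpNorm_rieszDiff_le hn hs₁ hs₁'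
  have hψs : ∀ h, MemLp (fun x => ψ x - ψ (x - h)) Q := fun h =>
    (ψ.memLp Q volume).sub ((ψ.memLp Q volume).comp_measurePreserving
      (measurePreserving_sub_right volume h))
  set E : Vec n × Vec n → ℝ := fun q =>
    conv (fun x => rieszDiff s₁ q.1 (-x)) (fun x => ψ x - ψ (x - q.1)) q.2
  have hE : AEStronglyMeasurable E := by
    have h1 : Measurable fun v : (Vec n × Vec n) × Vec n =>
        rieszDiff s₁ v.1.1 (-(v.1.2 - v.2)) * (ψ v.2 - ψ (v.2 - v.1.1)) := by
      have m1 : Measurable fun v : (Vec n × Vec n) × Vec n => (v.1.1, -(v.1.2 - v.2)) := by fun_prop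
      have m2 := (measurable_rieszDiff (n := n) s₁).comp m1
      have m3 := ψ.continuous.measurable
      exact m2.mul ((m3.comp measurable_snd).sub
        (m3.comp (measurable_snd.sub (measurable_fst.comp measurable_fst))))
    exact (h1.stronglyMeasurable.integral_prod_right' (ν := volume)).aestronglyMeasurable
  have hI : Integrable fun q : Vec n × Vec n => bondWeight s i j q.1 * (f q.2 * E q) := by
    refine integrable_bondWeight_mul (P := P) (Q := Q) hn hs₂ hs₂' hs i j hf.1.comp_snd hE
      (fun h => hf.1) (fun h => aestronglyMeasurable_conv (hK' h).1 (hψs h).1) fun σ hσ hσ1 => ?_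
    obtain ⟨C', hC', H'⟩ := exists_eLpNorm_shift_schwartz_le hn hσ hσ1 hQ.le hQt ψ
    have hA : ∀ h : Vec n, eLpNorm (rieszDiff s₁ h) 1 * eLpNorm f P ≤
        ofReal (C * ‖h‖ ^ s₁) * eLpNorm f P := fun h => by
      gcongr
      exact H h
    obtain ⟨C'', hC'', H''⟩ := exists_mul_le_rpow hf.eLpNorm_ne_top hC.le hs₁ hσ hA H' hC'
    refine ⟨C'', hC'', fun h => le_trans ?_ (H'' h)⟩
    have h2 := eLpNorm_conv_le (hK' h).1 (hψs h).1 hQ.le hQt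
    rw [eLpNorm_comp_neg (hK h).1 1] at h2
    exact (mul_le_mul' le_rfl h2).trans_eq (by ring)
  have hI0 := integrable_bondWeight_conv hn hs₁ hs₁' hs₂ hs₂' hs hP hPt i j hf ψ
  have hVm : MemLp (fracLap s₂ ψ) Q := memLp_fracLap hn hs₂ (by linarith) ψ hQ.le hQt
  have hW := (tendsto_eLpNorm_rieszTrunc_multiplierOp hn hQ hQt i j
    (integrable_fracSymbol_mul_ft hn hr ψ) hVm).1
  calc _ = ∫ h, ∫ x, bondWeight s i j h * (conv (rieszDiff s₁ h) f x * (ψ x - ψ (x - h))) :=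
        integral_prod _ hI0
    _ = ∫ h, ∫ z, bondWeight s i j h * (f z * E (h, z)) := by
      congr 1; ext h
      rw [integral_const_mul, integral_const_mul, integral_conv_mul (hK h) hf (hψs h)]
    _ = ∫ z, f z * ∫ h, bondWeight s i j h *
          multiplierOp (fun ξ => ((gap h ξ * fracSymbol (-s₁) ξ : ℝ) : ℂ)) ψ z := by
      rw [integral_integral_swap hI]
      congr 1; ext z; rw [← integral_const_mul]
      congr 1; ext h; simp only [E, conv_rieszDiff_shift hn hs₁ hs₁' ψ h]
      ring
    _ = _ := by
      simp only [integral_bondWeight_mul_multiplierOp hn hs₁ hs₁' hs₂ hs₂' hs, mul_sub,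
        mul_left_comm (f _)]
      rw [integral_sub ((integrable_mul_of_memLp hf hVm).const_mul _)
        ((integrable_mul_of_memLp hf hW).const_mul _), integral_const_mul, integral_const_mul]

end

/-- `R ⊗ R` is its own transpose, also when it is applied to the fields `(-Δ)^{s₂/2} ψ`, which
need not be rapidly decreasing. -/
lemma IsRieszRiesz.sum_integral_mul_fracLap (hn : 0 < n) (hP : 1 < P) (hPt : P ≠ ∞)
    (hs₂ : 0 < s₂) (hs₂' : s₂ < 2) {F : Vec n → Vec n} (hF : MemLp F P)
    (h : IsRieszRiesz P F H) (i : Fin n) (ψ : 𝓢(Vec n, ℝ)) :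
    ∑ j, ∫ z, F z j *
        multiplierOp (fun ξ => rieszSymbol i ξ * rieszSymbol j ξ * fracSymbol s₂ ξ) ψ z =
      ∫ z, H z i * fracLap s₂ ψ z := by
  obtain ⟨Q, _, _, hQ, hQt⟩ := exists_holderConjugate hP hPt
  have hr : -(n : ℝ) < s₂ := by linarith [(Nat.cast_nonneg n : (0 : ℝ) ≤ n)]
  have hV : MemLp (fracLap s₂ ψ) Q := memLp_fracLap hn hs₂ hs₂' ψ hQ.le hQt
  have hFj := fun j => hF.eval_piLp j
  have hT := fun j k => memLp_rieszTrunc hP.le hPt (hFj j) i j k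
  have h1 := tendsto_integral_mul_of_eLpNorm (g := fracLap s₂ ψ) (q := Q)
    (fun k => memLp_finsetSum Finset.univ fun j _ => hT j k) (h.1.eval_piLp i) hV
    (h.tendsto hn hP hPt hF i)
  have h2 : Tendsto (fun k => ∑ j, ∫ z, F z j * rieszTrunc i j k (fracLap s₂ ψ) z) atTop
      (𝓝 (∑ j, ∫ z, F z j *
        multiplierOp (fun ξ => rieszSymbol i ξ * rieszSymbol j ξ * fracSymbol s₂ ξ) ψ z)) :=
    tendsto_finsetSum _ fun j _ => by
      obtain ⟨hW, ht⟩ := tendsto_eLpNorm_rieszTrunc_multiplierOp hn hQ hQt i j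
        (integrable_fracSymbol_mul_ft hn hr ψ) hV
      have := tendsto_integral_mul_of_eLpNorm (q := P)
        (fun k => memLp_rieszTrunc hQ.le hQt hV i j k) hW (hFj j) ht
      simpa only [mul_comm] using this
  refine tendsto_nhds_unique h2 (h1.congr fun k => ?_)
  simp only [sum_mul]; rw [integral_finsetSum _ fun j _ => integrable_mul_of_memLp (hT j k) hV]
  exact sum_congr rfl fun j _ => integral_rieszTrunc_mul (hFj j) hV i j k

end

end

section

/-! ### The decomposition of the nonlocal form -/

lemma symbolConst'_pos (hs₀ : 0 < s) (hs₁ : s < 1) : 0 < symbolConst' n s := by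
  have := bondConst_pos (n := n) hs₀
  have := Real.Gamma_pos_of_pos (sub_pos.2 hs₁)
  unfold symbolConst'
  positivity

section

variable {s₁ s₂ α : ℝ} {φ : Vec n → Vec n} (hn : 0 < n) (hs₁ : 0 < s₁) (hs₁' : s₁ < 1) (hs₂ : 0 < s₂)
  (hs₂' : s₂ < 1) (hs : s₁ + s₂ = 2 * s) (hP : 1 < P) (hPt : P ≠ ∞)

include hn hs₁ hs₁' hs₂ hs₂' hs hP hPt

lemma integrable_integrandLA (hα : 0 < α)
    (hA : IsCoefficient α Λ A)
    (hu : IsSobolevPair s₁ P u U) (hφ : ContDiff ℝ (⊤ : ℕ∞) φ) (hc : HasCompactSupport φ) :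
    Integrable (integrandLA s A u φ) := by
  choose ψ hψ using exists_schwartz_coord hφ hc
  have hψ' : ∀ i y, ψ i y = φ y i := fun i y => (congrFun (hψ i) y).symm
  have h1 : Integrable fun q : Vec n × Vec n => ∑ j, ∑ i, bondWeight s i j q.1 *
      ((u q.2 j - u (q.2 - q.1) j) * (ψ i q.2 - ψ i (q.2 - q.1))) :=
    integrable_finsetSum _ fun j _ => integrable_finsetSum _ fun i _ =>
      integrable_bondWeight_shift hn hs₁ hs₁' hs₂ hs₂' hs hP hPt i j hu (ψ i)
  have h2 := (measurePreserving_sub_fst.integrable_comp_of_integrable h1).bdd_mul (c := Λ)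
    (hA.measurable hα).aestronglyMeasurable (ae_of_all _ fun q => hA.bound q.1 q.2)
  refine h2.congr (ae_of_all _ fun q => ?_)
  rw [integrandLA, bondIntegrand_eq (by linarith)]; simp [hψ']

/-- For `F ∈ L^p` the bond form of `I^{s₁} F` and `φ` is a combination of `F` and its second order
Riesz transform `H`, tested against `(-Δ)^{s₂/2} φ`. -/
theorem integral_bondIntegrand_rieszPotentialDiff {F : Vec n → Vec n} (hF : MemLp F P)
    (hH : IsRieszRiesz P F H) (hφ : ContDiff ℝ (⊤ : ℕ∞) φ) (hc : HasCompactSupport φ) :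
    Integrable (bondIntegrand s (fun _ _ => 1) (rieszPotentialDiff s₁ F)
      (rieszPotentialDiff s₂ (fracLapVec s₂ φ))) ∧
    ∫ q, bondIntegrand s (fun _ _ => 1) (rieszPotentialDiff s₁ F)
        (rieszPotentialDiff s₂ (fracLapVec s₂ φ)) q =
      symbolConst n s * (∫ z, inner ℝ (F z) (fracLapVec s₂ φ z)) -
        symbolConst' n s * ∫ z, inner ℝ (H z) (fracLapVec s₂ φ z) := by
  obtain ⟨Q, _, _, hQ, hQt⟩ := exists_holderConjugate hP hPt
  choose ψ hψ using exists_schwartz_coord hφ hc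
  have hV : ∀ i z, fracLapVec s₂ φ z i = fracLap s₂ (ψ i) z := fun i z => by rw [← hψ i]; rfl
  have hVm : MemLp (fracLapVec s₂ φ) Q := memLp_fracLapVec hn hφ hc hs₂ (by linarith) hQ.le hQt
  set T : Fin n → Fin n → Vec n × Vec n → ℝ := fun j i q => bondWeight s i j q.1 *
    (conv (rieszDiff s₁ q.1) (fun z => F z j) q.2 * (ψ i q.2 - ψ i (q.2 - q.1))) with hT
  have hTi : ∀ j i, Integrable (T j i) := fun j i =>
    integrable_bondWeight_conv hn hs₁ hs₁' hs₂ hs₂' hs hP hPt i j (hF.eval_piLp j) (ψ i)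
  have hsum : Integrable fun q => ∑ j, ∑ i, T j i q :=
    integrable_finsetSum _ fun j _ => integrable_finsetSum _ fun i _ => hTi j i
  have e : bondIntegrand s (fun _ _ => 1) (rieszPotentialDiff s₁ F)
      (rieszPotentialDiff s₂ (fracLapVec s₂ φ)) =ᵐ[volume]
      fun q => ∑ j, ∑ i, T j i (q.1 - q.2, q.1) := by
    filter_upwards [rieszPotentialDiff_ae hn hs₁ hs₁' hP.le hPt hF,
      rieszPotentialDiff_ae hn hs₂ hs₂' hQ.le hQt hVm] with q h1 h2
    rw [bondIntegrand_eq (by linarith), one_mul]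
    refine sum_congr rfl fun j _ => sum_congr rfl fun i _ => ?_
    have h3 : (fun z => fracLapVec s₂ φ z i) = fracLap s₂ (ψ i) := funext (hV i)
    rw [h1, h2, h3, conv_rieszDiff_fracLap hn hs₂ hs₂']
  refine ⟨(measurePreserving_sub_fst.integrable_comp_of_integrable hsum).congr e.symm, ?_⟩
  have e2 : ∫ q : Vec n × Vec n, ∑ j, ∑ i, T j i (q.1 - q.2, q.1) = ∫ q, ∑ j, ∑ i, T j i q := by
    have hm := measurePreserving_sub_fst (n := n)
    nth_rw 2 [← hm.map_eq]
    exact (integral_map hm.measurable.aemeasurable (by rw [hm.map_eq]; exact hsum.1)).symm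
  rw [integral_congr_ae e, e2, integral_finsetSum _ fun j _ => integrable_finsetSum _
    fun i _ => hTi j i]
  simp only [integral_finsetSum _ fun i _ => hTi _ i]
  have e3 : ∀ j i, ∫ q, T j i q = _ := fun j i =>
    integral_bondWeight_conv hn hs₁ hs₁' hs₂ hs₂' hs hP hPt i j (hF.eval_piLp j) (ψ i)
  have e4 : ∀ G : Vec n → Vec n, MemLp G P → ∫ z, inner ℝ (G z) (fracLapVec s₂ φ z) =
      ∑ i, ∫ z, G z i * fracLap s₂ (ψ i) z := fun G hG => by
    simp only [inner_eq_sum, ← hV]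
    exact integral_finsetSum _ fun i _ => integrable_mul_of_memLp (hG.eval_piLp i) (hVm.eval_piLp i)
  rw [e4 F hF, e4 H hH.1, Finset.sum_comm, mul_sum, mul_sum, ← Finset.sum_sub_distrib]
  refine sum_congr rfl fun i _ => ?_
  simp only [e3]
  rw [Finset.sum_sub_distrib, ← mul_sum,
    hH.sum_integral_mul_fracLap hn hP hPt hs₂ (by linarith) hF i (ψ i)]
  congr 1; simp

/-- The term `⟨A_D 𝓛₁ u, φ⟩` is computed by applying the Fourier symbol of the bond form to `A_D U`;
what is left of `⟨𝓛_A u, φ⟩` is `𝓓₁` by definition. -/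
theorem nonlocal_decomposition (hα : 0 < α) (hA : IsCoefficient α Λ A)
    (hu : IsSobolevPair s₁ P u U)
    (hφ : ContDiff ℝ (⊤ : ℕ∞) φ) (hc : HasCompactSupport φ)
    (hG : IsRieszRiesz P U G) (hH : IsRieszRiesz P (fun z => A z z • U z) H) :
    Integrable (integrandLA s A u φ) ∧
    Integrable (integrandADL1 s s₁ s₂ A U (fracLapVec s₂ φ)) ∧
    Integrable (integrandLame (symbolConst n s) (-symbolConst' n s) A U G (fracLapVec s₂ φ)) ∧
    ∫ q, integrandLA s A u φ q =
      (∫ z, integrandLame (symbolConst n s) (-symbolConst' n s) A U G (fracLapVec s₂ φ) z) +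
      formD1 s s₁ s₂ A u U φ (fracLapVec s₂ φ) +
      -symbolConst' n s * ∫ z, integrandD2 A H G (fracLapVec s₂ φ) z := by
  obtain ⟨Q, _, _, hQ, hQt⟩ := exists_holderConjugate hP hPt
  have hVm : MemLp (fracLapVec s₂ φ) Q := memLp_fracLapVec hn hφ hc hs₂ (by linarith) hQ.le hQt
  have hbd := fun (f : Vec n → Vec n) (hf : MemLp f P) =>
    memLp_smul_bdd (hA.measurable_diag hα) (fun x => hA.bound x x) hf
  have hF := hbd U hu.memLp_fracLap
  have hAG := hbd G hG.1
  obtain ⟨i1, e1⟩ := integral_bondIntegrand_rieszPotentialDiff hn hs₁ hs₁' hs₂ hs₂' hs hP hPt hF hH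
    hφ hc
  have j1 := integrable_inner_of_memLp hF hVm
  have j2 := integrable_inner_of_memLp hAG hVm
  have j3 := integrable_inner_of_memLp hH.1 hVm
  have e2 : integrandLame (symbolConst n s) (-symbolConst' n s) A U G (fracLapVec s₂ φ) =
      fun z => symbolConst n s * inner ℝ (A z z • U z) (fracLapVec s₂ φ z) -
        symbolConst' n s * inner ℝ (A z z • G z) (fracLapVec s₂ φ z) := by
    ext z; simp only [integrandLame, inner_add_left, real_inner_smul_left]; ring
  have e3 : ∫ z, integrandD2 A H G (fracLapVec s₂ φ) z = (∫ z, inner ℝ (H z) (fracLapVec s₂ φ z)) -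
        ∫ z, inner ℝ (A z z • G z) (fracLapVec s₂ φ z) := by
    simp only [integrandD2, inner_sub_left]
    exact integral_sub j3 j2
  refine ⟨integrable_integrandLA hn hs₁ hs₁' hs₂ hs₂' hs hP hPt hα hA hu hφ hc, i1, ?_, ?_⟩
  · rw [e2]
    exact (j1.const_mul _).sub (j2.const_mul _)
  · have e4 : ∫ q, integrandADL1 s s₁ s₂ A U (fracLapVec s₂ φ) q = _ := e1
    rw [formD1, e4, e3, e2, integral_sub (j1.const_mul _) (j2.const_mul _), integral_const_mul,
      integral_const_mul]
    ring

end

end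

end NonlocalCommutator

end

theorem proposition2p2 (n : ℕ) (hn : 1 ≤ n) (s : ℝ) (hs₀ : 0 < s) (hs₁ : s < 1) :
    ∃ c₁ c₂ : ℝ, c₂ ≠ 0 ∧
    ∀ s₁ s₂ : ℝ, 0 < s₁ → 0 < s₂ → s₁ + s₂ = 2 * s →
    ∀ α Λ : ℝ, 0 < α → 0 < Λ →
    -- the terms are well defined and the decomposition holds
    (∀ p : ℝ≥0∞, 1 < p → p < ⊤ →
      ∀ A : Vec n → Vec n → ℝ, IsCoefficient α Λ A →
      ∀ u U : Vec n → Vec n, IsSobolevPair s₁ p u U →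
      ∀ φ : Vec n → Vec n, ContDiff ℝ (⊤ : ℕ∞) φ → HasCompactSupport φ →
      (∃ G, IsRieszRiesz p U G) ∧
      (∃ H, IsRieszRiesz p (fun z => A z z • U z) H) ∧
      ∀ G H, IsRieszRiesz p U G → IsRieszRiesz p (fun z => A z z • U z) H →
        Integrable (integrandD2 A H G (fracLapVec s₂ φ)) ∧
        (s₁ < 1 → s₂ < 1 →
          Integrable (integrandLA s A u φ) ∧
          Integrable (integrandADL1 s s₁ s₂ A U (fracLapVec s₂ φ)) ∧
          Integrable (integrandLame c₁ c₂ A U G (fracLapVec s₂ φ)) ∧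
          ∫ q, integrandLA s A u φ q =
            (∫ z, integrandLame c₁ c₂ A U G (fracLapVec s₂ φ) z) +
            formD1 s s₁ s₂ A u U φ (fracLapVec s₂ φ) +
            c₂ * ∫ z, integrandD2 A H G (fracLapVec s₂ φ) z)) ∧
    -- the two estimates of the commutator term
    (∀ ε : ℝ, 0 < ε → ε < α → ∃ C : ℝ, 0 < C ∧
      ∀ p : ℝ≥0∞, 1 < p → p < ⊤ →
      ∀ A : Vec n → Vec n → ℝ, IsCoefficient α Λ A →
      ∀ u U : Vec n → Vec n, IsSobolevPair s₁ p u U →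
      (ε - s₁ < (n : ℝ) / p.toReal → ∃ g, IsFracLap (s₁ - ε) u g) ∧
      ∀ φ : Vec n → Vec n, ContDiff ℝ (⊤ : ℕ∞) φ → HasCompactSupport φ →
      ∀ G H, IsRieszRiesz p U G → IsRieszRiesz p (fun z => A z z • U z) H →
        (∀ g, IsFracLap (s₁ - ε) u g →
          ENNReal.ofReal |∫ z, integrandD2 A H G (fracLapVec s₂ φ) z| ≤
            ENNReal.ofReal C *
              ∫⁻ z, rieszPotential (α - ε) g z * ‖fracLapVec s₂ φ z‖ₑ) ∧
        ENNReal.ofReal |∫ z, integrandD2 A H G (fracLapVec s₂ φ) z| ≤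
          ENNReal.ofReal C *
            ∫⁻ z, rieszPotential (α - ε) U z * ‖fracLapVec (s₂ - ε) φ z‖ₑ) := by
  have hn0 : 0 < n := hn
  refine ⟨symbolConst n s, -symbolConst' n s, neg_ne_zero.2 (symbolConst'_pos hs₀ hs₁).ne',
    fun s₁ s₂ h₁ h₂ hs α Λ hα hΛ => ⟨fun p hp hpt A hA u U hu φ hφ hc => ?_, fun ε hε hεα => ?_⟩⟩
  · have hF := memLp_smul_bdd (hA.measurable_diag hα) (fun x => hA.bound x x) hu.memLp_fracLap
    obtain ⟨G₀, hG₀, -⟩ := exists_isRieszRiesz hn0 hp hpt.ne hu.memLp_fracLap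
    obtain ⟨H₀, hH₀, -⟩ := exists_isRieszRiesz hn0 hp hpt.ne hF
    refine ⟨⟨G₀, hG₀⟩, ⟨H₀, hH₀⟩, fun G H hG hH => ⟨?_, fun h₁' h₂' =>
      nonlocal_decomposition hn0 h₁ h₁' h₂ h₂' hs hp hpt.ne hα hA hu hφ hc hG hH⟩⟩
    obtain ⟨Q, _, _, hQ, hQt⟩ := exists_holderConjugate hp hpt.ne
    exact integrable_inner_of_memLp
      (hH.1.sub (memLp_smul_bdd (hA.measurable_diag hα) (fun x => hA.bound x x) hG.1))
      (memLp_fracLapVec hn0 hφ hc h₂ (by linarith) hQ.le hQt)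
  · obtain ⟨C, hC, H⟩ := exists_formD2_le hn h₁ h₂ (by linarith) hΛ hε hεα
    exact ⟨C, hC, fun p hp hpt A hA u U hu =>
      ⟨fun hεn => exists_isFracLap hn0 hε (by linarith) hp hpt.ne hεn hu,
        fun φ hφ hc G K hG hK => H p hp hpt A hA u U hu φ hφ hc G K hG hK⟩⟩
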